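/- **Setting.** Let $d\in\mathbb N$. *Hopping.* Let $h:\mathbb Z^d\to\mathbb C$ satisfy $h(\zeta)=\overline{h(-\zeta)}$; $\sum_y e^{m|y|}|h(y)|<\infty$ for some $m>0$; and for every non-zero $k\in\mathbb R^d$ there is $y\in\mathbb Z^d$ with $k\cdot y\ne0$ and $h(y)\neq 0$. Put $K\psi(x)=\sum_y h(x-y)\psi(y)$ on $\ell^2(\mathbb Z^d)$. *Markov process.* Let $\Omega$ be a topological space with a Borel probability measure $\mu$ and $\mu$-preserving maps $\sigma_x:\Omega\to\Omega$ ($x\in\mathbb Z^d$) with $\sigma_0=\mathrm{id}$, $\sigma_x\circ\sigma_y=\sigma_{x+y}$. For each $a\in\Omega$ let $\mathbb P_a$ be a probability measure, depending measurably on $a$, on the right-continuous paths $\omega:[0,\infty)\to\Omega$ with the $\sigma$-algebra generated by Borel cylinder sets, such that (1) $\omega_0=a$ $\mathbb P_a$-almost surely; (2) the law of $(\omega_t)_{t\ge0}$ under $\mathbb P_{\sigma_xa}$ is that of $(\sigma_x\omega_t)_{t\ge0}$ under $\mathbb P_a$; (3) $\mathbb P_a(\mathcal T_s^{-1}\mathcal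 A)=\mathbb E_a(\mathbb P_{\omega_s}(\mathcal A))$ for measurable $\mathcal A$, where $(\mathcal T_s\omega)_t=\omega_{t+s}$; (4) $\int_\Omega\mathbb P_a(\omega_t\in A)\,d\mu(a)=\mu(A)$ for all Borel $A$ and $t>0$. Write $\mathbb E(\cdot)=\int_\Omega\mathbb E_a(\cdot)\,d\mu(a)$. Let $S_t^\dagger$ be the operators on $L^2(\Omega,\mu)$ given by $\langle g,S_t^\dagger f\rangle=\mathbb E(\overline{g(\omega_t)}f(\omega_0))$, and let $Bf=\lim_{t\downarrow0}\frac1t(f-S_t^\dagger f)$ on the domain $\mathcal D(B)$ of those $f$ for which the limit exists in $L^2$. Assume that there are $T>0$ and $b,q\in\mathbb R$ such that for all $f\in\mathcal D(B)$ with $\int f\,d\mu=0$ $$\operatorname{Re}\langle f,Bf\rangle\ge\tfrac1T\|f\|^2,\qquad |\operatorname{Im}\langle f,Bf\rangle|\le q\,\bigl|\operatorname{Re}\langle f,Bf\rangle+b\|f\|^2\bigr| .$$ *Potential.* Let $v_0\in L^\infty(\mu)$ be real valued and $v_x=v_0\circ\sigma_x$, with $(t,\omega)\mapsto v_x(\omega_t)$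 jointly measurable (which is automatic if $\Omega$ is metrizable). Assume that there is $\chi>0$ with $\|B^{-1}(v_x-v_0)\|_{L^2}\ge\chi$ for all $x\ne0$, where $B^{-1}$ is the inverse of $B$ restricted to mean-zero functions. *Characteristic function.* For $\psi_0\in\ell^2(\mathbb Z^d)$ let $\psi_t$ be the solution, continuous in $\ell^2(\mathbb Z^d)$ and understood in time-integrated form, of $$i\partial_t\psi_t(x)=K\psi_t(x)+v_x(\omega_t)\psi_t(x)$$ with initial value $\psi_0$, and let $M_t(z;\psi_0)=\sum_{x\in\mathbb Z^d}e^{iz\cdot x}\,\mathbb E|\psi_t(x)|^2$ for those $z\in\mathbb C^d$ for which the series converges absolutely. **Theorem (diffusive limit for the characteristic function).** There is a (real symmetric) positive definite $d\times d$ matrix $D$ such that for every $\psi_0$ with $\sup_xe^{\nu|x|}|\psi_0(x)|<\infty$ for some $\nu>0$ the following holds. For almost every path $\omega$ the solution $\psi_t$ exists and is unique, $|\psi_t(x)|^2$ is integrable for all $t\ge 0$ and $x$, and for every $t>0$ and every compact $C\subset\mathbb C^d$, $M_{\tau t}(z/\sqrt\tau;\psi_0)$ is defined for all $z\in C$ once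 $\tau$ is large, and $$M_{\tau t}\bigl(z/\sqrt\tau;\psi_0\bigr)\;\longrightarrow\;\|\psi_0\|_{\ell^2}^2\,e^{-\frac t2\,z\cdot Dz}\qquad(\tau\to\infty)$$ uniformly in $z\in C$, where $z\cdot Dz=\sum_{i,j}D_{ij}z_iz_j$. -/

import Mathlib

open MeasureTheory ProbabilityTheory Filter Topology
open scoped NNReal ENNReal

noncomputable section

namespace MarkovAnderson

/-! ### The lattice and the hopping kernel -/

/-- The lattice `ℤ^d`. -/
abbrev Lattice (d : ℕ) : Type := Fin d → ℤ

/-- The Euclidean length `|x|` of a lattice point. -/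
def latticeNorm {d : ℕ} (x : Lattice d) : ℝ := Real.sqrt (∑ i, (x i : ℝ) ^ 2)

/-- The Hilbert space `ℓ²(ℤ^d)`. -/
abbrev EllTwo (d : ℕ) : Type := lp (fun _ : Lattice d => ℂ) 2

/-- The assumptions on the hopping kernel: self-adjointness, exponential boundedness and
non-degeneracy. -/
structure IsHoppingKernel {d : ℕ} (h : Lattice d → ℂ) : Prop where
  selfAdjoint : ∀ ζ, h ζ = star (h (-ζ))
  expBounded : ∃ m : ℝ, 0 < m ∧ Summable fun y => Real.exp (m * latticeNorm y) * ‖h y‖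
  nondegenerate : ∀ k : Fin d → ℝ, k ≠ 0 → ∃ y : Lattice d, ∑ i, k i * (y i : ℝ) ≠ 0 ∧ h y ≠ 0

/-- The hopping operator `(Kψ)(x) = ∑_y h(x - y) ψ(y)`. -/
def hop {d : ℕ} (h : Lattice d → ℂ) (ψ : EllTwo d) (x : Lattice d) : ℂ :=
  ∑' y, h (x - y) * ψ y

/-! ### The probability space, the shifts and the Markov process -/

/-- `σ` is an action of `ℤ^d` on `Ω` by measure preserving maps. -/
structure IsShiftAction {d : ℕ} {Ω : Type*} [MeasurableSpace Ω] (μ : Measure Ω)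
    (σ : Lattice d → Ω → Ω) : Prop where
  measurePreserving : ∀ x, MeasurePreserving (σ x) μ μ
  zero : σ 0 = id
  comp : ∀ x y, σ x ∘ σ y = σ (x + y)

/-- The space of right-continuous paths `[0,∞) → Ω`. As a subtype of the product `Ω^[0,∞)` it
carries the trace of the `σ`-algebra generated by the Borel cylinder sets. A measure on this space
is the same as a measure on the cylinder `σ`-algebra of `Ω^[0,∞)` for which the right-continuous
paths have full outer measure (they are in general not a cylinder measurable set). -/
abbrev RCPath (Ω : Type*) [TopologicalSpace Ω] : Type _ :=
  {ω : ℝ≥0 → Ω // ∀ t, ContinuousWithinAt ω (Set.Ici t) t}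

/-- The time shift `(𝒯_s ω)_t = ω_{t+s}` on right-continuous paths. -/
def timeShift {Ω : Type*} [TopologicalSpace Ω] (s : ℝ≥0) (ω : RCPath Ω) : RCPath Ω :=
  ⟨fun t => ω.1 (t + s), fun t => by
    have h1 := ω.2 (t + s)
    have h2 : ContinuousWithinAt (fun r : ℝ≥0 => r + s) (Set.Ici t) t :=
      (continuous_id.add continuous_const).continuousWithinAt
    exact ContinuousWithinAt.comp (f := fun r : ℝ≥0 => r + s) h1 h2
      (fun r hr => add_le_add_left (Set.mem_Ici.1 hr) s)⟩

/-- `P a` is the law of a time homogeneous right-continuous Markov process started at `a`, which is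
shift invariant in distribution and has the invariant measure `μ`. Since the shifts `σ x` need not
be continuous, shift invariance is stated for measures on all of `Ω^[0,∞)`. -/
structure IsMarkovFamily {d : ℕ} {Ω : Type*} [TopologicalSpace Ω] [MeasurableSpace Ω]
    (μ : Measure Ω) (σ : Lattice d → Ω → Ω) (P : Kernel Ω (RCPath Ω)) : Prop where
  initial : ∀ a, (P a).map (fun ω => ω.1 0) = Measure.dirac a
  shift : ∀ a x, (P (σ x a)).map (fun ω => ω.1) = (P a).map (fun ω t => σ x (ω.1 t))
  markov : ∀ (a : Ω) (s : ℝ≥0) (A : Set (RCPath Ω)), MeasurableSet A →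
    P a (timeShift s ⁻¹' A) = ∫⁻ ω, P (ω.1 s) A ∂(P a)
  invariant : ∀ (t : ℝ≥0), 0 < t → ∀ A : Set Ω, MeasurableSet A →
    ∫⁻ a, P a {ω | ω.1 t ∈ A} ∂μ = μ A

/-- The joint law `∫ P_a dμ(a)` of the process with initial distribution `μ`; the expectation `𝔼`
is integration against this measure. -/
def jointLaw {Ω : Type*} [TopologicalSpace Ω] [MeasurableSpace Ω] (μ : Measure Ω)
    (P : Kernel Ω (RCPath Ω)) : Measure (RCPath Ω) :=
  μ.bind P

theorem measurable_evalPath {Ω : Type*} [TopologicalSpace Ω] [MeasurableSpace Ω] (t : ℝ≥0) :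
    Measurable (fun ω : RCPath Ω => ω.1 t) :=
  (measurable_pi_apply t).comp measurable_subtype_coe

/-- Under the joint law every `ω_t` has distribution `μ`. -/
theorem IsMarkovFamily.measurePreserving_eval {d : ℕ} {Ω : Type*} [TopologicalSpace Ω]
    [MeasurableSpace Ω] {μ : Measure Ω} {σ : Lattice d → Ω → Ω} {P : Kernel Ω (RCPath Ω)}
    (hP : IsMarkovFamily μ σ P) (t : ℝ≥0) :
    MeasurePreserving (fun ω : RCPath Ω => ω.1 t) (jointLaw μ P) μ := by
  refine ⟨measurable_evalPath t, ?_⟩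
  ext A hA
  have hm : MeasurableSet ((fun ω : RCPath Ω => ω.1 t) ⁻¹' A) := measurable_evalPath t hA
  rw [Measure.map_apply (measurable_evalPath t) hA, jointLaw,
    Measure.bind_apply hm P.measurable.aemeasurable]
  rcases eq_or_lt_of_le (show (0 : ℝ≥0) ≤ t from t.2) with ht | ht
  · subst ht
    have h0 : ∀ a, P a ((fun ω : RCPath Ω => ω.1 0) ⁻¹' A) = A.indicator 1 a := fun a => by
      rw [← Measure.map_apply (measurable_evalPath 0) hA, hP.initial a, Measure.dirac_apply' _ hA]
    simp only [h0]
    exact lintegral_indicator_one hA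
  · exact hP.invariant t ht A hA

/-! ### The generator -/

section Generator

variable {d : ℕ} {Ω : Type*} [TopologicalSpace Ω] [MeasurableSpace Ω] {μ : Measure Ω}
  {σ : Lattice d → Ω → Ω} {P : Kernel Ω (RCPath Ω)}

/-- The isometry `f ↦ f(ω_t)` from `L²(Ω, μ)` to `L²` of the path space. -/
def evalL2 (hP : IsMarkovFamily μ σ P) (t : ℝ≥0) :
    Lp ℂ 2 μ →L[ℂ] Lp ℂ 2 (jointLaw μ P) :=
  (Lp.compMeasurePreservingₗᵢ ℂ (fun ω : RCPath Ω => ω.1 t)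
    (hP.measurePreserving_eval t)).toContinuousLinearMap

/-- The semigroup `S_t†` on `L²(Ω, μ)`, given by `⟨g, S_t† f⟩ = 𝔼(conj g(ω_t) f(ω_0))`. -/
def adjSemigroup (hP : IsMarkovFamily μ σ P) (t : ℝ≥0) : Lp ℂ 2 μ →L[ℂ] Lp ℂ 2 μ :=
  (ContinuousLinearMap.adjoint (evalL2 hP t)).comp (evalL2 hP 0)

/-- `f` is in the domain of the generator `B` and `B f = g`, that is,
`g = lim_{t ↓ 0} t⁻¹ (f - S_t† f)` in `L²`. -/
def IsGen (hP : IsMarkovFamily μ σ P) (f g : Lp ℂ 2 μ) : Prop :=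
  Tendsto (fun t : ℝ≥0 => ((t : ℝ) : ℂ)⁻¹ • (f - adjSemigroup hP t f)) (𝓝[>] 0) (𝓝 g)

/-- The gap condition and the sectoriality of `B` on the mean-zero part of its domain. -/
def GapAndSector (hP : IsMarkovFamily μ σ P) : Prop :=
  ∃ T b q : ℝ, 0 < T ∧ ∀ f g : Lp ℂ 2 μ, IsGen hP f g → ∫ a, f a ∂μ = 0 →
    1 / T * ‖f‖ ^ 2 ≤ (inner ℂ f g).re ∧
    |(inner ℂ f g).im| ≤ q * |(inner ℂ f g).re + b * ‖f‖ ^ 2|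

/-- The assumptions on the potential `v_x = v₀ ∘ σ_x`. The field `measurable` says that the
processes `v_x(ω_t)` are jointly measurable in `t` and `ω`; it holds for all measurable `v₀` when
`Ω` is metrizable, and whenever the `v_x` are continuous. In the field `nondegenerate`, `f` is
`B⁻¹(v_x - v₀)`, where `B⁻¹` is the inverse of `B` on the mean-zero functions. -/
structure IsPotential (hP : IsMarkovFamily μ σ P) (v₀ : Ω → ℝ) : Prop where
  memLp : MemLp v₀ ⊤ μ
  measurable : ∀ x, AEMeasurable (fun p : ℝ × RCPath Ω => v₀ (σ x (p.2.1 p.1.toNNReal)))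
    (((volume : Measure ℝ).restrict (Set.Ici 0)).prod (jointLaw μ P))
  nondegenerate : ∃ χ : ℝ, 0 < χ ∧ ∀ x : Lattice d, x ≠ 0 → ∀ f g : Lp ℂ 2 μ,
    (g =ᵐ[μ] fun a => ((v₀ (σ x a) - v₀ a : ℝ) : ℂ)) → ∫ a, f a ∂μ = 0 → IsGen hP f g → χ ≤ ‖f‖

end Generator

/-! ### The Schrödinger equation and the characteristic function -/

/-- `ψ` solves `i ∂_t ψ_t(x) = (K ψ_t)(x) + w_t(x) ψ_t(x)` on `ℓ²(ℤ^d)`, in the time integrated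
sense, with initial value `ψ₀`. -/
structure IsSolution {d : ℕ} (h : Lattice d → ℂ) (w : ℝ≥0 → Lattice d → ℝ) (ψ₀ : EllTwo d)
    (ψ : ℝ≥0 → EllTwo d) : Prop where
  continuous : Continuous ψ
  integrable : ∀ (t : ℝ≥0) (x : Lattice d),
    IntervalIntegrable (fun s : ℝ => hop h (ψ s.toNNReal) x + (w s.toNNReal x : ℂ) * ψ s.toNNReal x)
      volume 0 t
  integral_eq : ∀ (t : ℝ≥0) (x : Lattice d),
    ψ t x = ψ₀ x - Complex.I *
      ∫ s in (0 : ℝ)..t, (hop h (ψ s.toNNReal) x + (w s.toNNReal x : ℂ) * ψ s.toNNReal x)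

open Classical in
/-- The solution of the Schrödinger equation (`0` if there is none). -/
def solution {d : ℕ} (h : Lattice d → ℂ) (w : ℝ≥0 → Lattice d → ℝ) (ψ₀ : EllTwo d) :
    ℝ≥0 → EllTwo d :=
  if H : ∃ ψ, IsSolution h w ψ₀ ψ then H.choose else 0

/-- The time dependent potential `(t, x) ↦ v_x(ω_t) = v₀(σ_x ω_t)` along the path `ω`. -/
def pathPotential {d : ℕ} {Ω : Type*} [TopologicalSpace Ω] (σ : Lattice d → Ω → Ω) (v₀ : Ω → ℝ)
    (ω : RCPath Ω) : ℝ≥0 → Lattice d → ℝ :=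
  fun t x => v₀ (σ x (ω.1 t))

/-- The mean square amplitude `𝔼 |ψ_t(x)|²`. -/
def meanSq {d : ℕ} {Ω : Type*} [TopologicalSpace Ω] [MeasurableSpace Ω] (μ : Measure Ω)
    (σ : Lattice d → Ω → Ω) (P : Kernel Ω (RCPath Ω)) (h : Lattice d → ℂ) (v₀ : Ω → ℝ)
    (ψ₀ : EllTwo d) (t : ℝ≥0) (x : Lattice d) : ℝ :=
  ∫ ω, ‖solution h (pathPotential σ v₀ ω) ψ₀ t x‖ ^ 2 ∂(jointLaw μ P)

/-- The term `e^{i z·x} 𝔼 |ψ_t(x)|²` of the characteristic function. -/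
def cfTerm {d : ℕ} {Ω : Type*} [TopologicalSpace Ω] [MeasurableSpace Ω] (μ : Measure Ω)
    (σ : Lattice d → Ω → Ω) (P : Kernel Ω (RCPath Ω)) (h : Lattice d → ℂ) (v₀ : Ω → ℝ)
    (ψ₀ : EllTwo d) (t : ℝ≥0) (z : Fin d → ℂ) (x : Lattice d) : ℂ :=
  Complex.exp (Complex.I * ∑ i, z i * (x i : ℂ)) * (meanSq μ σ P h v₀ ψ₀ t x : ℂ)

/-- The characteristic function `M_t(z; ψ₀) = ∑_x e^{i z·x} 𝔼 |ψ_t(x)|²`. -/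
def charFn {d : ℕ} {Ω : Type*} [TopologicalSpace Ω] [MeasurableSpace Ω] (μ : Measure Ω)
    (σ : Lattice d → Ω → Ω) (P : Kernel Ω (RCPath Ω)) (h : Lattice d → ℂ) (v₀ : Ω → ℝ)
    (ψ₀ : EllTwo d) (t : ℝ≥0) (z : Fin d → ℂ) : ℂ :=
  ∑' x, cfTerm μ σ P h v₀ ψ₀ t z x

/-- The exponential bound `sup_x e^{ν|x|} |ψ₀(x)| < ∞` for some `ν > 0`. -/
def ExpDecay {d : ℕ} (ψ₀ : EllTwo d) : Prop :=
  ∃ ν : ℝ, 0 < ν ∧ BddAbove (Set.range fun x => Real.exp (ν * latticeNorm x) * ‖ψ₀ x‖)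

end MarkovAnderson

end

/-! The density `𝔼|ψ_t(x)|²` obeys no closed equation, but the conditional correlations `ρ_t(x,y) =
𝔼(ψ_t(x) conj ψ_t(y) | ω_t)`, viewed in `L²(μ)`, do. The solution depends only on the past of the
path and the potential at time `t` only on `ω_t`, so the Markov property yields `∂_t ρ = -Bρ - i[K +
v, ρ]` (`tendsto_corr`, `condL2_pairVelL2`). Shift invariance allows a Fourier transform in the
common translation: `u_k(t) = ∑ e^{ik·y} δ_{x-y} ⊗ (ρ_t(x,y) ∘ σ_{-y})` in `ℓ²(ℤ^d; L²(μ))`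
satisfies the autonomous equation `∂_t u = -(B + iA + iΔ_k)u` with `A` symmetric and `Δ_k = O(|k|)`
(`tendsto_field`), and `M_t(k) = ⟨φ, u_k(t)⟩` for `φ = δ₀ ⊗ 1` (`hasSum_cfTerm`).

At `k = 0` the vector `φ` is stationary and everything orthogonal to it decays. The operator `B` by
itself damps only the mean-zero part. On the range of the projection `Q` onto functions constant in
`Ω`, however, `A` reduces to multiplication by `v_x - v_0`, which leads into the mean-zero part, and
the lower bound on `B⁻¹(v_x - v_0)` gives `Re⟨B⁻¹Aψ, Aψ⟩ ≥ c‖ψ‖²` for `ψ` in that range with `ψ ⟂ φ`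
(`exists_isHypocoercive`). Adding `2ε Im⟨AQw, B⁻¹w⟩` to `‖w‖²` turns this into exponential decay;
this is the hypocoercivity argument of `exists_lyapunov`.

For small `k` the amplitude of `φ` is the only slow quantity. A corrector `η = O(|k|)`, obtained
from the adjoint equation (`exists_adjoint_solution`), removes the first order coupling to the fast
part, so that `p = ⟨φ + η, u⟩` satisfies `p' = -λp` up to small terms, where `λ = k·Lk`. The
resulting error `O(|k| + |k|³t)` for bounded `|k|²t` (`amplitude_estimate`,
`exists_effective_matrix`) vanishes for `k = z/√τ` at time `τt`, while `λτt = t z·Lz`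
(`IsDiffusive.tendstoUniformlyOn`). The argument is a differential inequality and not a spectral
one, and complex `z` are treated like real ones.

For real `k ≠ 0`, `Re k·Lk` equals `Re⟨(B†)⁻¹q, q⟩` for the source `q` of the corrector, and it is
positive unless the velocity vector vanishes, which the nondegeneracy of the hopping excludes
(`re_inner_pos`, `velVec_ne_zero`). The form is real on real vectors because `M_t(-conj k) = conj
M_t(k)` (`im_bilin_eq_zero`). Hence `D = L + Lᵀ`.

Paths are only right-continuous and `v₀` is only bounded and measurable. Therefore all time
derivatives are right derivatives in `L²`, and increments are taken relative to the semigroup, as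
`u(t+h) - S_h u(t)`, so that no vector has to lie in the domain of `B`. Solutions, their adaptedness
and all summability come from a Dyson series with exponential weights. -/

noncomputable section

namespace MarkovAnderson

/-! ### Right derivatives and differential inequalities -/

/-- All upper right Dini derivates of `f` at `t` are at most `b`. -/
def RightSlopeLE (f : ℝ → ℝ) (t b : ℝ) : Prop :=
  ∀ r, b < r → ∀ᶠ h in 𝓝[>] (0 : ℝ), h⁻¹ * (f (t + h) - f t) < r

theorem RightSlopeLE.of_tendsto {f β : ℝ → ℝ} {t b : ℝ}
    (h : ∀ᶠ h in 𝓝[>] (0 : ℝ), h⁻¹ * (f (t + h) - f t) ≤ β h)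
    (hβ : Tendsto β (𝓝[>] 0) (𝓝 b)) : RightSlopeLE f t b := by
  intro r hr
  filter_upwards [h, hβ.eventually (gt_mem_nhds hr)] with x hx hx' using hx.trans_lt hx'

theorem RightSlopeLE.mono {f : ℝ → ℝ} {t a b : ℝ} (h : RightSlopeLE f t a) (hab : a ≤ b) :
    RightSlopeLE f t b :=
  fun r hr => h r (hab.trans_lt hr)

theorem RightSlopeLE.add {f g : ℝ → ℝ} {t a b : ℝ} (hf : RightSlopeLE f t a)
    (hg : RightSlopeLE g t b) : RightSlopeLE (fun s => f s + g s) t (a + b) := by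
  intro r hr
  filter_upwards [hf (a + (r - (a + b)) / 2) (by linarith),
    hg (b + (r - (a + b)) / 2) (by linarith)] with x hx hx'
  have : x⁻¹ * (f (t + x) + g (t + x) - (f t + g t))
    = x⁻¹ * (f (t + x) - f t) + x⁻¹ * (g (t + x) - g t) := by ring
  rw [this]; linarith

theorem eventually_nhdsGT_of_zero {p : ℝ → Prop} {t : ℝ}
    (h : ∀ᶠ h in 𝓝[>] (0 : ℝ), p (t + h)) : ∀ᶠ z in 𝓝[>] t, p z := by
  have h1 : Tendsto (fun z : ℝ => z - t) (𝓝[>] t) (𝓝[>] 0) := by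
    refine tendsto_nhdsWithin_iff.2 ⟨?_, ?_⟩
    · have : Tendsto (fun z : ℝ => z - t) (𝓝 t) (𝓝 (t - t)) := tendsto_id.sub_const t
      rw [sub_self] at this
      exact this.mono_left nhdsWithin_le_nhds
    · filter_upwards [self_mem_nhdsWithin] with z hz using sub_pos.2 (Set.mem_Ioi.1 hz)
  filter_upwards [h1.eventually h] with z hz
  simpa using hz

/-- Gronwall's inequality for a bound on the upper right Dini derivates. -/
theorem le_gronwallBound_of_rightSlopeLE {f f' : ℝ → ℝ} {δ K ε b : ℝ}
    (hf : ContinuousOn f (Set.Icc 0 b))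
    (hf' : ∀ x ∈ Set.Ico 0 b, RightSlopeLE f x (f' x)) (ha : f 0 ≤ δ)
    (bound : ∀ x ∈ Set.Ico 0 b, f' x ≤ K * f x + ε) :
    ∀ x ∈ Set.Icc 0 b, f x ≤ gronwallBound δ K ε x := by
  intro x hx
  have := le_gronwallBound_of_liminf_deriv_right_le hf (f' := f') (fun x hx r hr => ?_) ha bound x hx
  · simpa using this
  · refine (eventually_nhdsGT_of_zero (t := x) ?_).frequently
    filter_upwards [hf' x hx r hr] with h hh
    simpa using hh

theorem hasDerivWithinAt_of_tendsto_right {E : Type*} [NormedAddCommGroup E] [NormedSpace ℝ E]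
    {f : ℝ → E} {t : ℝ} {v : E}
    (h : Tendsto (fun h : ℝ => h⁻¹ • (f (t + h) - f t)) (𝓝[>] 0) (𝓝 v)) :
    HasDerivWithinAt f v (Set.Ici t) t := by
  rw [← hasDerivWithinAt_Ioi_iff_Ici, hasDerivWithinAt_iff_tendsto_slope' (by simp)]
  have h1 : Tendsto (fun z : ℝ => z - t) (𝓝[>] t) (𝓝[>] 0) := by
    refine tendsto_nhdsWithin_iff.2 ⟨?_, ?_⟩
    · have : Tendsto (fun z : ℝ => z - t) (𝓝 t) (𝓝 (t - t)) := tendsto_id.sub_const t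
      rw [sub_self] at this
      exact this.mono_left nhdsWithin_le_nhds
    · filter_upwards [self_mem_nhdsWithin] with z hz using sub_pos.2 (Set.mem_Ioi.1 hz)
  refine (h.comp h1).congr fun z => ?_
  simp [slope_def_module]

theorem tendsto_id_nhdsGT_zero : Tendsto (fun h : ℝ => h) (𝓝[>] 0) (𝓝 0) :=
  tendsto_id.mono_left nhdsWithin_le_nhds

theorem rightSlopeLE_norm_sq {E : Type*} [NormedAddCommGroup E] [InnerProductSpace ℂ E]
    {p : ℝ → E} {t : ℝ} {v : E}
    (h : Tendsto (fun h : ℝ => h⁻¹ • (p (t + h) - p t)) (𝓝[>] 0) (𝓝 v)) :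
    RightSlopeLE (fun s => ‖p s‖ ^ 2) t (2 * (inner ℂ (p t) v).re) := by
  set d : ℝ → E := fun h => h⁻¹ • (p (t + h) - p t) with hd
  have hlim : Tendsto (fun h : ℝ => 2 * (inner ℂ (p t) (d h)).re + h * ‖d h‖ ^ 2) (𝓝[>] 0)
      (𝓝 (2 * (inner ℂ (p t) v).re + 0 * ‖v‖ ^ 2)) := by
    refine Tendsto.add (Tendsto.const_mul _ ?_) (tendsto_id_nhdsGT_zero.mul (h.norm.pow 2))
    exact (Complex.continuous_re.tendsto _).comp (tendsto_const_nhds.inner h)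
  rw [zero_mul, add_zero] at hlim
  refine RightSlopeLE.of_tendsto ?_ hlim
  filter_upwards [self_mem_nhdsWithin] with h hh
  have hh' : h ≠ 0 := ne_of_gt hh
  have e : p (t + h) = p t + h • d h := by
    simp [hd, hh']
  have e2 : ‖p (t + h)‖ ^ 2 = ‖p t‖ ^ 2 + 2 * (h * (inner ℂ (p t) (d h)).re) + h ^ 2 * ‖d h‖ ^ 2 := by
    rw [e, norm_add_sq (𝕜 := ℂ), norm_smul, mul_pow, Real.norm_eq_abs, sq_abs,
      ← Complex.coe_smul, inner_smul_right, RCLike.re_eq_complex_re, Complex.re_ofReal_mul]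
  rw [e2]
  apply le_of_eq
  field_simp
  ring

set_option maxHeartbeats 1000000 in
/-- A slow amplitude `p` with `p' ≈ -λ p`, coupled weakly to a fast decaying quantity `F`. -/
theorem slow_fast_estimate {c K : ℝ} (hc : 0 < c) (hK : 0 ≤ K) :
    ∃ C : ℝ, 0 ≤ C ∧ ∀ (κ : ℝ) (lam : ℂ) (p p' : ℝ → ℂ) (F : ℝ → ℝ) (t : ℝ), 0 ≤ t → 0 ≤ κ → κ ≤ 1 →
      ‖lam‖ ≤ K * κ ^ 2 → Continuous p → Continuous F → (∀ s, 0 ≤ F s) →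
      (∀ s, 0 ≤ s → Tendsto (fun h : ℝ => h⁻¹ • (p (s + h) - p s)) (𝓝[>] 0) (𝓝 (p' s))) →
      (∀ s, 0 ≤ s → ‖p' s + lam * p s‖ ≤ K * (κ ^ 2 * √(F s) + κ ^ 3 * ‖p s‖)) →
      (∀ s, 0 ≤ s → RightSlopeLE F s (-c * F s + K * κ ^ 2 * ‖p s‖ ^ 2)) →
      ‖p t - Complex.exp (-lam * t) * p 0‖
          ≤ C * Real.exp (C * κ ^ 2 * t) * (κ ^ 2 + κ ^ 3 * t) * √(‖p 0‖ ^ 2 + F 0) ∧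
        F t ≤ (Real.exp (C * κ ^ 2 * t)) ^ 2 * (‖p 0‖ ^ 2 + F 0) := by
  -- `L` is the growth rate of `‖p‖² + F` in units of `κ²`: the equation for `p` costs `5K`, the
  -- feeding of `F` by `p` another `K`. `N` is the level to which `√F / κ` relaxes. `C` leaves room
  -- for the two factors `e^{Kκ²t}` of the rotating frame.
  set L : ℝ := 6 * K + 1 with hL
  set N : ℝ := √(K / c) with hN
  have hN0 : 0 ≤ N := Real.sqrt_nonneg _
  set C : ℝ := L + 2 * K + K * (2 / c + N + 1) with hC
  have hC0 : 0 ≤ C := by positivity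
  have hLC : L ≤ C := by
    have : 0 ≤ 2 * K + K * (2 / c + N + 1) := by positivity
    linarith
  refine ⟨C, hC0, ?_⟩
  intro κ lam p p' F t ht hκ hκ1 hlam hpc hFc hF0 hp hp' hF
  set E0 : ℝ := ‖p 0‖ ^ 2 + F 0 with hE0
  have hE0n : 0 ≤ E0 := add_nonneg (by positivity) (hF0 0)
  have hκ3 : κ ^ 3 ≤ κ ^ 2 := pow_le_pow_of_le_one hκ hκ1 (by norm_num)
  have hκ2 : 0 ≤ κ ^ 2 := by positivity
  -- the total energy grows slowly
  have hEslope : ∀ s ∈ Set.Ico 0 t, RightSlopeLE (fun s => ‖p s‖ ^ 2 + F s) s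
      (2 * (inner ℂ (p s) (p' s)).re + (-c * F s + K * κ ^ 2 * ‖p s‖ ^ 2)) := fun s hs =>
    (rightSlopeLE_norm_sq (hp s hs.1)).add (hF s hs.1)
  have hre : ∀ s, 0 ≤ s → 2 * (inner ℂ (p s) (p' s)).re
      ≤ K * κ ^ 2 * (5 * ‖p s‖ ^ 2 + F s) := by
    intro s hs
    have h1 : (inner ℂ (p s) (p' s)).re ≤ ‖p s‖ * ‖p' s‖ :=
      (Complex.re_le_norm _).trans (norm_inner_le_norm _ _)
    have h2 : ‖p' s‖ ≤ K * κ ^ 2 * (√(F s) + 2 * ‖p s‖) := by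
      have h3 : p' s = (p' s + lam * p s) - lam * p s := by ring
      have h4 : ‖p' s‖ ≤ ‖p' s + lam * p s‖ + ‖lam * p s‖ := by
        conv_lhs => rw [h3]
        exact norm_sub_le _ _
      rw [norm_mul] at h4
      have h5 := hp' s hs
      have h6 : ‖lam‖ * ‖p s‖ ≤ K * κ ^ 2 * ‖p s‖ := by gcongr
      have h7 : K * (κ ^ 3 * ‖p s‖) ≤ K * (κ ^ 2 * ‖p s‖) := by gcongr
      nlinarith
    have h8 : 2 * (‖p s‖ * (√(F s) + 2 * ‖p s‖)) ≤ 5 * ‖p s‖ ^ 2 + F s := by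
      have := Real.sq_sqrt (hF0 s)
      nlinarith [sq_nonneg (‖p s‖ - √(F s))]
    have h9 : ‖p s‖ * ‖p' s‖ ≤ ‖p s‖ * (K * κ ^ 2 * (√(F s) + 2 * ‖p s‖)) := by gcongr
    have h10 : K * κ ^ 2 * (2 * (‖p s‖ * (√(F s) + 2 * ‖p s‖)))
      ≤ K * κ ^ 2 * (5 * ‖p s‖ ^ 2 + F s) := by gcongr
    nlinarith
  have hE : ∀ s ∈ Set.Icc 0 t, ‖p s‖ ^ 2 + F s ≤ E0 * Real.exp (L * κ ^ 2 * s) := by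
    intro s hs
    have := le_gronwallBound_of_rightSlopeLE (δ := E0) (K := L * κ ^ 2) (ε := 0) (b := t)
      (f := fun s => ‖p s‖ ^ 2 + F s) (by fun_prop) hEslope le_rfl (fun s hs => ?_) s hs
    · rwa [gronwallBound_ε0] at this
    · have h1 := hre s hs.1
      have h2 := hF0 s
      have h3 : 0 ≤ c * F s := by positivity
      have h4 : 0 ≤ K * κ ^ 2 * F s := by positivity
      have h5 : 0 ≤ κ ^ 2 * F s := by positivity
      have h6 : 0 ≤ κ ^ 2 * ‖p s‖ ^ 2 := by positivity
      simp only [hL]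
      nlinarith
  set Em : ℝ := E0 * Real.exp (L * κ ^ 2 * t) with hEm
  have hEmn : 0 ≤ Em := by positivity
  have hE' : ∀ s ∈ Set.Icc 0 t, ‖p s‖ ^ 2 + F s ≤ Em := fun s hs => by
    refine (hE s hs).trans ?_
    have := hs.2
    have hL0 : 0 ≤ L := by positivity
    simp only [hEm]
    gcongr
  -- A second Gronwall argument with the energy bound inserted for `‖p‖²`: `F` decays at rate `c`
  -- down to a floor of order `κ²`.
  have hFE : ∀ s ∈ Set.Icc 0 t, F s ≤ E0 * Real.exp (-c * s) + K * κ ^ 2 * Em / c := by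
    intro s hs
    have := le_gronwallBound_of_rightSlopeLE (δ := E0) (K := -c) (ε := K * κ ^ 2 * Em) (b := t)
      (f := F) hFc.continuousOn (fun s hs => hF s hs.1) (by simp only [hE0]; nlinarith [sq_nonneg ‖p 0‖])
      (fun s hs => ?_) s hs
    · rw [gronwallBound_of_K_ne_0 (by linarith)] at this
      refine this.trans ?_
      beta_reduce
      have h1 : K * κ ^ 2 * Em / -c * (Real.exp (-c * s) - 1)
        = K * κ ^ 2 * Em / c - K * κ ^ 2 * Em / c * Real.exp (-c * s) := by
        field_simp; ring
      rw [h1]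
      have : 0 ≤ K * κ ^ 2 * Em / c * Real.exp (-c * s) := by positivity
      linarith
    · have h1 := hE' s ⟨hs.1, hs.2.le⟩
      have h2 := hF0 s
      have : K * κ ^ 2 * ‖p s‖ ^ 2 ≤ K * κ ^ 2 * Em := by gcongr; linarith
      linarith
  have hE0m : E0 ≤ Em := by
    have h1 : 1 ≤ Real.exp (L * κ ^ 2 * t) := Real.one_le_exp (by positivity)
    simp only [hEm]; nlinarith
  have hsqF : ∀ s ∈ Set.Icc 0 t, √(F s) ≤ √Em * (Real.exp (-(c / 2) * s) + N * κ) := by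
    intro s hs
    have h1 : F s ≤ Em * (Real.exp (-(c / 2) * s) ^ 2 + N ^ 2 * κ ^ 2) := by
      have h2 : Real.exp (-(c / 2) * s) ^ 2 = Real.exp (-c * s) := by
        rw [← Real.exp_nat_mul]; congr 1; push_cast; ring
      have h3 : N ^ 2 = K / c := Real.sq_sqrt (by positivity)
      rw [h2, h3]
      have h4 := hFE s hs
      have h5 : E0 * Real.exp (-c * s) ≤ Em * Real.exp (-c * s) := by gcongr
      have h6 : K * κ ^ 2 * Em / c = Em * (K / c * κ ^ 2) := by ring
      nlinarith
    have h2 : F s ≤ Em * (Real.exp (-(c / 2) * s) + N * κ) ^ 2 := by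
      refine h1.trans ?_
      gcongr
      have : 0 ≤ Real.exp (-(c / 2) * s) * (N * κ) := by positivity
      nlinarith
    calc √(F s) ≤ √(Em * (Real.exp (-(c / 2) * s) + N * κ) ^ 2) := Real.sqrt_le_sqrt h2
      _ = √Em * (Real.exp (-(c / 2) * s) + N * κ) := by
        rw [Real.sqrt_mul hEmn, Real.sqrt_sq (by positivity)]
  have hpE : ∀ s ∈ Set.Icc 0 t, ‖p s‖ ≤ √Em := fun s hs =>
    Real.le_sqrt_of_sq_le (by linarith [hE' s hs, hF0 s])
  have hsqEm : √Em = √E0 * Real.exp (L / 2 * κ ^ 2 * t) := by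
    rw [hEm, Real.sqrt_mul hE0n]
    congr 1
    rw [show L * κ ^ 2 * t = (L / 2 * κ ^ 2 * t) + (L / 2 * κ ^ 2 * t) by ring, Real.exp_add,
      Real.sqrt_mul_self (Real.exp_pos _).le]
  refine ⟨?_, ?_⟩
  · -- the amplitude in the rotating frame
    set m : ℝ := Real.exp (K * κ ^ 2 * t) with hm
    set q : ℝ → ℂ := fun s => Complex.exp (lam * s) * p s - p 0 with hq
    -- `B` is the integral of the bound on `‖q'‖`. The transient of `√F` contributes only `κ² · 2/c`
    -- whatever the time; its floor `Nκ` and the term `κ³‖p‖` contribute `κ³s`.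
    set B : ℝ → ℝ := fun s => m * (K * √Em * (κ ^ 2 * (2 / c * (1 - Real.exp (-(c / 2) * s)))
      + (N + 1) * κ ^ 3 * s)) with hB
    have hexp : ∀ s ∈ Set.Icc 0 t, ∀ ε : ℂ, ‖ε‖ ≤ 1 → ‖Complex.exp (ε * lam * s)‖ ≤ m := by
      intro s hs ε hε
      rw [Complex.norm_exp]
      apply Real.exp_le_exp.2
      have h1 : ‖ε * lam * s‖ ≤ K * κ ^ 2 * t := by
        rw [norm_mul, norm_mul, Complex.norm_real, Real.norm_eq_abs, abs_of_nonneg hs.1]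
        have h2 : ‖ε‖ * ‖lam‖ ≤ 1 * (K * κ ^ 2) := by gcongr
        rw [one_mul] at h2
        exact mul_le_mul h2 hs.2 hs.1 (by positivity)
      exact (Complex.re_le_norm _).trans h1
    have hqd : ∀ s ∈ Set.Ico 0 t, HasDerivWithinAt q
        (Complex.exp (lam * s) * (p' s + lam * p s)) (Set.Ici s) s := by
      intro s hs
      have h1 := hasDerivWithinAt_of_tendsto_right (hp s hs.1)
      have h2 : HasDerivWithinAt (fun s : ℝ => Complex.exp (lam * s)) (Complex.exp (lam * s) * lam)
          (Set.Ici s) s := by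
        have h3 : HasDerivAt (fun s : ℝ => lam * (s : ℂ)) lam s := by
          simpa using (Complex.ofRealCLM.hasDerivAt (x := s)).const_mul lam
        exact h3.cexp.hasDerivWithinAt
      convert! (h2.mul h1).sub_const (p 0) using 1
      ring
    have hBd : ∀ s, HasDerivAt B (m * (K * √Em * (κ ^ 2 * Real.exp (-(c / 2) * s)
        + (N + 1) * κ ^ 3))) s := by
      intro s
      have h1 : HasDerivAt (fun s : ℝ => Real.exp (-(c / 2) * s))
          (Real.exp (-(c / 2) * s) * (-(c / 2))) s := by
        simpa using ((hasDerivAt_id s).const_mul (-(c / 2))).exp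
      have h2 := ((((h1.const_sub 1).const_mul (2 / c)).const_mul (κ ^ 2)).add
        ((hasDerivAt_id s).const_mul ((N + 1) * κ ^ 3))).const_mul (K * √Em) |>.const_mul m
      convert! h2 using 1
      field_simp
    have hfin := image_norm_le_of_norm_deriv_right_le_deriv_boundary (f := q) (a := 0) (b := t)
      (B := B) (by fun_prop) hqd (by simp [hq, hB]) hBd (fun s hs => ?_) ⟨ht, le_rfl⟩
    · have e1 : p t - Complex.exp (-lam * t) * p 0 = Complex.exp (-1 * lam * t) * q t := by
        simp only [hq, mul_sub, ← mul_assoc, ← Complex.exp_add]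
        rw [show -1 * lam * (t : ℂ) + lam * t = 0 by ring]
        simp
      rw [e1, norm_mul]
      have h1 := hexp t ⟨ht, le_rfl⟩ (-1) (by simp)
      have h2 : B t ≤ m * (K * √Em * ((2 / c + N + 1) * (κ ^ 2 + κ ^ 3 * t))) := by
        simp only [hB]
        gcongr
        have h3 : 2 / c * (1 - Real.exp (-(c / 2) * t)) ≤ 2 / c := by
          have : 0 ≤ 2 / c * Real.exp (-(c / 2) * t) := by positivity
          nlinarith
        have h4 : κ ^ 2 * (2 / c * (1 - Real.exp (-(c / 2) * t))) ≤ κ ^ 2 * (2 / c) := by gcongr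
        have h5 : 0 ≤ (N + 1) * κ ^ 2 := by positivity
        have h6 : 0 ≤ 2 / c * (κ ^ 3 * t) := by positivity
        nlinarith
      have h3 : ‖Complex.exp (-1 * lam * t)‖ * ‖q t‖
          ≤ m * (m * (K * √Em * ((2 / c + N + 1) * (κ ^ 2 + κ ^ 3 * t)))) := by
        gcongr
        exact hfin.trans h2
      refine h3.trans ?_
      have h4 : m * m * Real.exp (L / 2 * κ ^ 2 * t) ≤ Real.exp (C * κ ^ 2 * t) := by
        rw [hm, ← Real.exp_add, ← Real.exp_add]
        apply Real.exp_le_exp.2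
        have : 2 * K + L / 2 ≤ C := by
          have h0 : 0 ≤ K * (2 / c + N + 1) := by positivity
          have h1 : 0 ≤ L := by positivity
          simp only [hC]; linarith
        calc _ = (2 * K + L / 2) * κ ^ 2 * t := by ring
          _ ≤ C * κ ^ 2 * t := by gcongr
      have h5 : K * (2 / c + N + 1) ≤ C := by
        have h1 : 0 ≤ L := by positivity
        simp only [hC]; linarith
      calc m * (m * (K * √Em * ((2 / c + N + 1) * (κ ^ 2 + κ ^ 3 * t))))
          = (K * (2 / c + N + 1)) * (m * m * Real.exp (L / 2 * κ ^ 2 * t))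
            * (κ ^ 2 + κ ^ 3 * t) * √E0 := by rw [hsqEm]; ring
        _ ≤ C * Real.exp (C * κ ^ 2 * t) * (κ ^ 2 + κ ^ 3 * t) * √E0 := by gcongr
    · rw [norm_mul]
      have hs' : s ∈ Set.Icc 0 t := ⟨hs.1, hs.2.le⟩
      have h1 := hexp s hs' 1 (by simp)
      rw [one_mul] at h1
      have h2 := hp' s hs.1
      have h3 : K * (κ ^ 2 * √(F s) + κ ^ 3 * ‖p s‖)
          ≤ K * (κ ^ 2 * (√Em * (Real.exp (-(c / 2) * s) + N * κ)) + κ ^ 3 * √Em) := by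
        gcongr
        · exact hsqF s hs'
        · exact hpE s hs'
      calc ‖Complex.exp (lam * s)‖ * ‖p' s + lam * p s‖
          ≤ m * (K * (κ ^ 2 * (√Em * (Real.exp (-(c / 2) * s) + N * κ)) + κ ^ 3 * √Em)) := by
            gcongr
            exact h2.trans h3
        _ = _ := by ring
  · have h1 := hE' t ⟨ht, le_rfl⟩
    have h2 : Real.exp (L * κ ^ 2 * t) ≤ (Real.exp (C * κ ^ 2 * t)) ^ 2 := by
      rw [← Real.exp_nat_mul]
      apply Real.exp_le_exp.2
      push_cast
      have : L * κ ^ 2 * t ≤ C * κ ^ 2 * t := by gcongr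
      have h0 : 0 ≤ C * κ ^ 2 * t := by positivity
      linarith
    have : Em ≤ (Real.exp (C * κ ^ 2 * t)) ^ 2 * E0 := by
      rw [hEm, mul_comm]; gcongr
    nlinarith [sq_nonneg ‖p t‖]

end MarkovAnderson

end

noncomputable section

namespace MarkovAnderson

/-! ### Hypocoercive perturbations of a dissipative semigroup -/

section Hypocoercive

variable {H : Type*} [NormedAddCommGroup H] [InnerProductSpace ℂ H]

/-- A contraction semigroup `S` with generator `-B`, which acts trivially on the range of the
orthogonal projection `Q` and decays exponentially on its complement, where `R` is the inverse of
`B`; and a symmetric operator `A`, such that `B + iA` has the kernel spanned by `φ` and `A` couples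
the rest of the range of `Q` to the dissipative part. -/
structure IsHypocoercive (S : ℝ → H →L[ℂ] H) (Q R A : H →L[ℂ] H) (φ : H) (T c : ℝ) : Prop where
  T_pos : 0 < T
  c_pos : 0 < c
  norm_phi : ‖φ‖ = 1
  proj_proj : ∀ u, Q (Q u) = Q u
  proj_symm : ∀ u w, inner ℂ (Q u) w = inner ℂ u (Q w)
  proj_phi : Q φ = φ
  proj_S : ∀ h, 0 ≤ h → ∀ u, Q (S h u) = Q u
  S_proj : ∀ h, 0 ≤ h → ∀ u, S h (Q u) = Q u
  norm_S : ∀ h, 0 ≤ h → ∀ u, ‖S h u‖ ^ 2 ≤ ‖Q u‖ ^ 2 + Real.exp (-(2 * h / T)) * ‖u - Q u‖ ^ 2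
  tendsto_S : ∀ u, Tendsto (fun h => S h u) (𝓝[>] 0) (𝓝 u)
  proj_R : ∀ u, Q (R u) = 0
  R_proj : ∀ u, R (Q u) = 0
  tendsto_R : ∀ u, Tendsto (fun h : ℝ => h⁻¹ • R (S h u - u)) (𝓝[>] 0) (𝓝 (-(u - Q u)))
  accretive : ∀ f, ‖R f‖ ^ 2 ≤ T * (inner ℂ (R f) f).re
  A_symm : ∀ u w, inner ℂ (A u) w = inner ℂ u (A w)
  A_phi : A φ = 0
  proj_A_proj : ∀ u, Q (A (Q u)) = 0
  coercive : ∀ ψ, Q ψ = ψ → inner ℂ φ ψ = 0 → c * ‖ψ‖ ^ 2 ≤ (inner ℂ (R (A ψ)) (A ψ)).re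

/-- The modified energy. -/
def lyapunov (Q R A : H →L[ℂ] H) (ε : ℝ) (w : H) : ℝ :=
  ‖w‖ ^ 2 + 2 * ε * (inner ℂ (A (Q w)) (R w)).im

theorem continuous_lyapunov (Q R A : H →L[ℂ] H) (ε : ℝ) : Continuous (lyapunov Q R A ε) := by
  unfold lyapunov
  refine (continuous_norm.pow 2).add (continuous_const.mul (Complex.continuous_im.comp ?_))
  exact (A.continuous.comp Q.continuous).inner R.continuous

theorem real_smul_eq_complex (h : ℝ) (u : H) : h • u = (h : ℂ) • u := (Complex.coe_smul h u).symm

variable {S : ℝ → H →L[ℂ] H} {Q R A : H →L[ℂ] H} {φ : H} {T c : ℝ}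

namespace IsHypocoercive

theorem norm_sq_split (hyp : IsHypocoercive S Q R A φ T c) (u : H) :
    ‖u‖ ^ 2 = ‖Q u‖ ^ 2 + ‖u - Q u‖ ^ 2 := by
  have h : inner ℂ (Q u) (u - Q u) = 0 := by
    rw [inner_sub_right, ← hyp.proj_symm, hyp.proj_proj, hyp.proj_symm, ← hyp.proj_symm, sub_self]
  have := norm_add_sq_eq_norm_sq_add_norm_sq_of_inner_eq_zero (Q u) (u - Q u) h
  simp only [add_sub_cancel] at this
  nlinarith

theorem norm_proj_le (hyp : IsHypocoercive S Q R A φ T c) (u : H) : ‖Q u‖ ≤ ‖u‖ := by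
  have := hyp.norm_sq_split u
  exact (sq_le_sq₀ (norm_nonneg _) (norm_nonneg _)).1 (by nlinarith [sq_nonneg ‖u - Q u‖])

theorem norm_sub_proj_le (hyp : IsHypocoercive S Q R A φ T c) (u : H) : ‖u - Q u‖ ≤ ‖u‖ := by
  have := hyp.norm_sq_split u
  exact (sq_le_sq₀ (norm_nonneg _) (norm_nonneg _)).1 (by nlinarith [sq_nonneg ‖Q u‖])

theorem R_eq (hyp : IsHypocoercive S Q R A φ T c) (u : H) : R u = R (u - Q u) := by
  rw [map_sub, hyp.R_proj, sub_zero]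

theorem inner_phi_proj (hyp : IsHypocoercive S Q R A φ T c) (u : H) :
    inner ℂ φ (Q u) = inner ℂ φ u := by
  rw [← hyp.proj_symm, hyp.proj_phi]

theorem inner_phi_A (hyp : IsHypocoercive S Q R A φ T c) (u : H) : inner ℂ φ (A u) = 0 := by
  rw [← hyp.A_symm, hyp.A_phi, inner_zero_left]

/-- The derivative of the coupling term of the modified energy. -/
theorem tendsto_coupling (hyp : IsHypocoercive S Q R A φ T c) {w : ℝ → H} {t : ℝ} {v : H}
    (hw : Tendsto (fun h : ℝ => h⁻¹ • (w (t + h) - S h (w t))) (𝓝[>] 0) (𝓝 v)) :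
    Tendsto (fun h : ℝ => (h : ℂ)⁻¹ * (inner ℂ (A (Q (w (t + h)))) (R (w (t + h)))
        - inner ℂ (A (Q (w t))) (R (w t)))) (𝓝[>] 0)
      (𝓝 (inner ℂ (A (Q (w t))) (-(w t - Q (w t))) + inner ℂ (A (Q (w t))) (R v)
        + inner ℂ (A (Q v)) (R (w t)))) := by
  -- With `w (t + h) = S h (w t) + h d`, the factor `Q w` does not see `S`, and `R (S h w - w) / h`
  -- converges for every `w`. Hence the coupling term is differentiable from the right although `w
  -- t` need not lie in the domain of the generator.
  set d : ℝ → H := fun h => h⁻¹ • (w (t + h) - S h (w t)) with hd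
  have h0 : Tendsto (fun h : ℝ => (h : ℂ)) (𝓝[>] 0) (𝓝 0) := by
    have := (Complex.continuous_ofReal.tendsto 0).comp tendsto_id_nhdsGT_zero
    simpa [Function.comp_def] using this
  have hRd : Tendsto (fun h => R (d h)) (𝓝[>] 0) (𝓝 (R v)) := (R.continuous.tendsto v).comp hw
  have hAd : Tendsto (fun h => A (Q (d h))) (𝓝[>] 0) (𝓝 (A (Q v))) :=
    ((A.continuous.comp Q.continuous).tendsto v).comp hw
  have hRS : Tendsto (fun h => R (S h (w t))) (𝓝[>] 0) (𝓝 (R (w t))) :=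
    (R.continuous.tendsto _).comp (hyp.tendsto_S (w t))
  have hlim := (((tendsto_const_nhds (x := A (Q (w t)))).inner (𝕜 := ℂ) (hyp.tendsto_R (w t))).add
    ((tendsto_const_nhds (x := A (Q (w t)))).inner (𝕜 := ℂ) hRd)).add
    ((hAd.inner (𝕜 := ℂ) hRS).add (h0.mul (hAd.inner (𝕜 := ℂ) hRd)))
  rw [zero_mul, add_zero] at hlim
  refine hlim.congr' ?_
  filter_upwards [self_mem_nhdsWithin] with h hh
  have hh' : (h : ℂ) ≠ 0 := by exact_mod_cast (ne_of_gt (Set.mem_Ioi.1 hh))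
  have e : w (t + h) = S h (w t) + (h : ℂ) • d h := by
    simp only [hd, real_smul_eq_complex, smul_smul]
    push_cast
    rw [mul_inv_cancel₀ hh', one_smul]
    abel
  have hQ : Q (w (t + h)) = Q (w t) + (h : ℂ) • Q (d h) := by
    rw [e, map_add, map_smul, hyp.proj_S h (le_of_lt hh)]
  have hR : R (w (t + h)) = R (w t) + R (S h (w t) - w t) + (h : ℂ) • R (d h) := by
    rw [e, map_add, map_smul, map_sub]; abel
  have hR' : R (S h (w t)) = R (w t) + R (S h (w t) - w t) := by rw [map_sub]; abel
  rw [hQ, hR, hR', real_smul_eq_complex]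
  simp only [map_add, map_smul, inner_add_left, inner_add_right, inner_smul_left, inner_smul_right,
    Complex.conj_ofReal]
  push_cast
  field_simp
  ring

/-- Outside the domain of the generator `‖w‖²` need not have a right derivative. The decay bound
`norm_S` still controls its upper Dini derivate, which is all that Gronwall requires. -/
theorem rightSlopeLE_norm_sq (hyp : IsHypocoercive S Q R A φ T c) {w : ℝ → H} {t : ℝ} {v : H}
    (hw : Tendsto (fun h : ℝ => h⁻¹ • (w (t + h) - S h (w t))) (𝓝[>] 0) (𝓝 v)) :
    RightSlopeLE (fun s => ‖w s‖ ^ 2) t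
      (-(2 / T) * ‖w t - Q (w t)‖ ^ 2 + 2 * (inner ℂ (w t) v).re) := by
  set d : ℝ → H := fun h => h⁻¹ • (w (t + h) - S h (w t)) with hd
  have hT := hyp.T_pos
  have hexp : Tendsto (fun h : ℝ => h⁻¹ * (Real.exp (-(2 * h / T)) - 1)) (𝓝[>] 0)
      (𝓝 (-(2 / T))) := by
    have h1 : HasDerivAt (fun h : ℝ => Real.exp (-(2 * h / T))) (-(2 / T)) 0 := by
      have h2 : HasDerivAt (fun h : ℝ => -(2 * h / T)) (-(2 / T)) 0 := by
        have h3 := (((hasDerivAt_id (0 : ℝ)).const_mul 2).div_const T).neg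
        rw [mul_one] at h3
        exact h3
      simpa using h2.exp
    have := h1.tendsto_slope_zero_right
    simpa using this
  have hlim := ((hexp.mul_const (‖w t - Q (w t)‖ ^ 2)).add
    ((((Complex.continuous_re.tendsto _).comp ((hyp.tendsto_S (w t)).inner (𝕜 := ℂ) hw)).const_mul
      2))).add (tendsto_id_nhdsGT_zero.mul (hw.norm.pow 2))
  rw [zero_mul, add_zero] at hlim
  refine RightSlopeLE.of_tendsto ?_ hlim
  filter_upwards [self_mem_nhdsWithin] with h hh
  have hpos : 0 < h := hh
  have hh' : h ≠ 0 := ne_of_gt hpos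
  have e : w (t + h) = S h (w t) + (h : ℂ) • d h := by
    rw [← real_smul_eq_complex]
    simp only [hd, smul_smul, mul_inv_cancel₀ hh', one_smul]
    abel
  have e2 : ‖w (t + h)‖ ^ 2 = ‖S h (w t)‖ ^ 2 + 2 * (h * (inner ℂ (S h (w t)) (d h)).re)
      + h ^ 2 * ‖d h‖ ^ 2 := by
    rw [e, norm_add_sq (𝕜 := ℂ), norm_smul, mul_pow, inner_smul_right]
    simp
  have h1 := hyp.norm_S h hpos.le (w t)
  have h2 := hyp.norm_sq_split (w t)
  have h3 : ‖w (t + h)‖ ^ 2 - ‖w t‖ ^ 2 ≤ (Real.exp (-(2 * h / T)) - 1) * ‖w t - Q (w t)‖ ^ 2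
      + 2 * (h * (inner ℂ (S h (w t)) (d h)).re) + h ^ 2 * ‖d h‖ ^ 2 := by
    rw [e2, h2]; linarith
  calc h⁻¹ * (‖w (t + h)‖ ^ 2 - ‖w t‖ ^ 2) ≤ h⁻¹ * ((Real.exp (-(2 * h / T)) - 1) *
      ‖w t - Q (w t)‖ ^ 2 + 2 * (h * (inner ℂ (S h (w t)) (d h)).re) + h ^ 2 * ‖d h‖ ^ 2) := by
        gcongr
    _ = _ := by
      simp only [Function.comp]
      field_simp

theorem im_le_of_norm_le {z : ℂ} {b : ℝ} (h : ‖z‖ ≤ b) : z.im ≤ b :=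
  (Complex.im_le_norm z).trans h

set_option maxHeartbeats 1000000 in
/-- The modified energy is equivalent to the norm, and decays up to the forcing `g`. -/
theorem exists_lyapunov (hyp : IsHypocoercive S Q R A φ T c) :
    ∃ ε c₁ C : ℝ, 0 < c₁ ∧ 0 ≤ C ∧
      (∀ w, ‖w‖ ^ 2 ≤ 2 * lyapunov Q R A ε w ∧ lyapunov Q R A ε w ≤ 2 * ‖w‖ ^ 2) ∧
      ∀ (w : ℝ → H) (t : ℝ) (g : H), inner ℂ φ (w t) = 0 →
        Tendsto (fun h : ℝ => h⁻¹ • (w (t + h) - S h (w t))) (𝓝[>] 0)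
          (𝓝 (-(Complex.I • A (w t) + g))) →
        RightSlopeLE (fun s => lyapunov Q R A ε (w s)) t
          (-c₁ * ‖w t‖ ^ 2 + C * ‖g‖ * ‖w t‖) := by
  set a := ‖A‖ with ha
  set r := ‖R‖ with hr
  have ha0 : 0 ≤ a := norm_nonneg _
  have hr0 : 0 ≤ r := norm_nonneg _
  have hT := hyp.T_pos
  have hc := hyp.c_pos
  set K : ℝ := a + a * a * r + a * r with hK
  have hK0 : 0 ≤ K := by positivity
  set M : ℝ := K + K ^ 2 / (2 * c) with hM
  have hM0 : 0 ≤ M := by positivity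
  -- Small enough for two purposes: `2εM ≤ 1/T` lets half of the dissipation `2/T` absorb the losses
  -- in the mean-zero part, and `4ε‖A‖‖R‖ ≤ 1` keeps the modified energy comparable with `‖w‖²`.
  set ε : ℝ := 1 / (2 * T * (M + 1) + 4 * a * r + 1) with hε
  have hden : 0 < 2 * T * (M + 1) + 4 * a * r + 1 := by positivity
  have hε0 : 0 < ε := by positivity
  have hεM : 2 * ε * M ≤ 1 / T := by
    rw [hε, le_div_iff₀ hT, mul_one_div, div_mul_eq_mul_div, div_mul_eq_mul_div, div_le_one hden]
    have : 0 ≤ a * r := by positivity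
    nlinarith
  have hεar : 4 * ε * (a * r) ≤ 1 := by
    rw [hε, mul_one_div, div_mul_eq_mul_div, div_le_one hden]
    have : 0 ≤ T * (M + 1) := by positivity
    nlinarith
  refine ⟨ε, min (2 * ε * c / 2) (1 / T), 2 + 4 * ε * K, by positivity, by positivity, ?_, ?_⟩
  · intro w
    have h1 : |(inner ℂ (A (Q w)) (R w)).im| ≤ a * r * ‖w‖ ^ 2 := by
      refine (Complex.abs_im_le_norm _).trans ((norm_inner_le_norm _ _).trans ?_)
      have h2 : ‖A (Q w)‖ ≤ a * ‖w‖ := (A.le_opNorm _).trans (by gcongr; exact hyp.norm_proj_le w)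
      have h3 : ‖R w‖ ≤ r * ‖w‖ := R.le_opNorm _
      calc ‖A (Q w)‖ * ‖R w‖ ≤ (a * ‖w‖) * (r * ‖w‖) := by gcongr
        _ = _ := by ring
    have h2 : |2 * ε * (inner ℂ (A (Q w)) (R w)).im| ≤ 1 / 2 * ‖w‖ ^ 2 := by
      rw [abs_mul, abs_of_pos (by positivity : (0 : ℝ) < 2 * ε)]
      calc 2 * ε * |(inner ℂ (A (Q w)) (R w)).im| ≤ 2 * ε * (a * r * ‖w‖ ^ 2) := by gcongr
        _ = 1 / 2 * (4 * ε * (a * r)) * ‖w‖ ^ 2 := by ring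
        _ ≤ 1 / 2 * 1 * ‖w‖ ^ 2 := by gcongr
        _ = _ := by ring
    have h3 := abs_le.1 h2
    unfold lyapunov
    have h4 : 0 ≤ ‖w‖ ^ 2 := by positivity
    constructor <;> linarith [h3.1, h3.2]
  · intro w t g hφ hw
    have hslope1 := hyp.rightSlopeLE_norm_sq hw
    have hX := hyp.tendsto_coupling hw
    set w₀ := Q (w t) with hw₀
    set w₁ := w t - Q (w t) with hw₁
    set v : H := -(Complex.I • A (w t) + g) with hv
    have hslope2 : RightSlopeLE (fun s => 2 * ε * (inner ℂ (A (Q (w s))) (R (w s))).im) t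
        (2 * ε * (inner ℂ (A w₀) (-w₁) + inner ℂ (A w₀) (R v) + inner ℂ (A (Q v)) (R (w t))).im) := by
      refine RightSlopeLE.of_tendsto ?_
        (((Complex.continuous_im.tendsto _).comp hX).const_mul (2 * ε))
      refine Eventually.of_forall fun h => le_of_eq ?_
      simp only [Function.comp]
      rw [← Complex.ofReal_inv, Complex.im_ofReal_mul, Complex.sub_im]
      ring
    refine (hslope1.add hslope2).mono ?_
    have hsplit : w t = w₀ + w₁ := by simp [hw₀, hw₁]
    have hx : ‖w t‖ ^ 2 = ‖w₀‖ ^ 2 + ‖w₁‖ ^ 2 := hyp.norm_sq_split (w t)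
    have hxn : ‖w₀‖ ≤ ‖w t‖ := hyp.norm_proj_le _
    have hyn : ‖w₁‖ ≤ ‖w t‖ := hyp.norm_sub_proj_le _
    have hre : (inner ℂ (w t) v).re ≤ ‖w t‖ * ‖g‖ := by
      have h1 : (inner ℂ (w t) (Complex.I • A (w t))).re = 0 := by
        have h2 : (inner ℂ (w t) (A (w t))).im = 0 := by
          have h3 : (starRingEnd ℂ) (inner ℂ (w t) (A (w t))) = inner ℂ (w t) (A (w t)) := by
            rw [inner_conj_symm, hyp.A_symm]
          exact Complex.conj_eq_iff_im.1 h3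
        rw [inner_smul_right]
        simp [h2]
      rw [hv, inner_neg_right, inner_add_right, Complex.neg_re, Complex.add_re, h1, zero_add]
      exact (neg_le_abs _).trans ((Complex.abs_re_le_norm _).trans (norm_inner_le_norm _ _))
    have hAw0 : ‖A w₀‖ ≤ a * ‖w₀‖ := A.le_opNorm _
    have hAw1 : ‖A w₁‖ ≤ a * ‖w₁‖ := A.le_opNorm _
    have hRw : R (w t) = R w₁ := hyp.R_eq _
    have hRw1 : ‖R w₁‖ ≤ r * ‖w₁‖ := R.le_opNorm _
    have hco : c * ‖w₀‖ ^ 2 ≤ (inner ℂ (A w₀) (R (A w₀))).re := by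
      have := hyp.coercive w₀ (hyp.proj_proj _) (by rw [hw₀, hyp.inner_phi_proj, hφ])
      rwa [← inner_conj_symm, Complex.conj_re] at this
    -- The imaginary part of `-i⟨Aw₀, RAw₀⟩` is `-Re⟨Aw₀, RAw₀⟩ ≤ -c‖w₀‖²`. This is the gain in the
    -- directions where the semigroup does not dissipate.
    have e1 : inner ℂ (A w₀) (R v) = -(Complex.I * inner ℂ (A w₀) (R (A w₀)))
        - Complex.I * inner ℂ (A w₀) (R (A w₁)) - inner ℂ (A w₀) (R g) := by
      rw [hv, hsplit]
      simp only [map_neg, map_add, map_smul, inner_neg_right, inner_add_right, inner_smul_right,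
        smul_add]
      ring
    -- Because `QAQ = 0`, the part `w₀` drops out of `QA w`. The last term of the derivative is thus
    -- bounded by `‖w₁‖²` and the forcing, with no `‖w₀‖²`.
    have e2 : A (Q v) = -(Complex.I • A (Q (A w₁)) + A (Q g)) := by
      have h1 : Q (A (w t)) = Q (A w₁) := by
        rw [hsplit, map_add, map_add, hw₀, hyp.proj_A_proj, zero_add]
      rw [hv, map_neg, map_neg, map_add, map_add, map_smul, map_smul, h1]
    have i1 : (inner ℂ (A w₀) (-w₁)).im ≤ a * ‖w₀‖ * ‖w₁‖ := by
      refine im_le_of_norm_le ((norm_inner_le_norm _ _).trans ?_)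
      rw [norm_neg]; gcongr
    have i2 : (inner ℂ (A w₀) (R v)).im ≤ -(c * ‖w₀‖ ^ 2) + a * a * r * ‖w₀‖ * ‖w₁‖
        + a * r * ‖w₀‖ * ‖g‖ := by
      rw [e1, Complex.sub_im, Complex.sub_im, Complex.neg_im, Complex.I_mul_im]
      have h1 : -(Complex.I * inner ℂ (A w₀) (R (A w₁))).im ≤ a * a * r * ‖w₀‖ * ‖w₁‖ := by
        refine (neg_le_abs _).trans ((Complex.abs_im_le_norm _).trans ?_)
        rw [norm_mul, Complex.norm_I, one_mul]
        refine (norm_inner_le_norm _ _).trans ?_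
        have : ‖R (A w₁)‖ ≤ r * (a * ‖w₁‖) := (R.le_opNorm _).trans (by gcongr)
        calc ‖A w₀‖ * ‖R (A w₁)‖ ≤ (a * ‖w₀‖) * (r * (a * ‖w₁‖)) := by gcongr
          _ = _ := by ring
      have h2 : -(inner ℂ (A w₀) (R g)).im ≤ a * r * ‖w₀‖ * ‖g‖ := by
        refine (neg_le_abs _).trans ((Complex.abs_im_le_norm _).trans ?_)
        refine (norm_inner_le_norm _ _).trans ?_
        have : ‖R g‖ ≤ r * ‖g‖ := R.le_opNorm _
        calc ‖A w₀‖ * ‖R g‖ ≤ (a * ‖w₀‖) * (r * ‖g‖) := by gcongr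
          _ = _ := by ring
      linarith
    have i3 : (inner ℂ (A (Q v)) (R (w t))).im ≤ a * a * r * ‖w₁‖ ^ 2 + a * r * ‖g‖ * ‖w₁‖ := by
      refine im_le_of_norm_le ((norm_inner_le_norm _ _).trans ?_)
      rw [e2, hRw, norm_neg]
      have h1 : ‖Complex.I • A (Q (A w₁)) + A (Q g)‖ ≤ a * (a * ‖w₁‖) + a * ‖g‖ := by
        refine (norm_add_le _ _).trans ?_
        rw [norm_smul, Complex.norm_I, one_mul]
        gcongr
        · exact (A.le_opNorm _).trans (by gcongr; exact (hyp.norm_proj_le _).trans hAw1)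
        · exact (A.le_opNorm _).trans (by gcongr; exact hyp.norm_proj_le _)
      calc _ ≤ (a * (a * ‖w₁‖) + a * ‖g‖) * (r * ‖w₁‖) := by gcongr
        _ = _ := by ring
    rw [Complex.add_im, Complex.add_im]
    set x := ‖w₀‖ with hxdef
    set y := ‖w₁‖ with hydef
    set n := ‖w t‖ with hn
    have hx0 : 0 ≤ x := norm_nonneg _
    have hy0 : 0 ≤ y := norm_nonneg _
    have hg0 : 0 ≤ ‖g‖ := norm_nonneg _
    have hsum : (inner ℂ (A w₀) (-w₁)).im + (inner ℂ (A w₀) (R v)).im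
        + (inner ℂ (A (Q v)) (R (w t))).im ≤ -(c * x ^ 2) + K * (x * y) + K * y ^ 2
          + 2 * K * (‖g‖ * n) := by
      have p1 : 0 ≤ a * r * (x * y) := by positivity
      have p2 : 0 ≤ (a + a * r) * y ^ 2 := by positivity
      have p3 : a * r * x * ‖g‖ ≤ K * (‖g‖ * n) := by
        have : x * ‖g‖ ≤ ‖g‖ * n := by rw [mul_comm]; gcongr
        have h5 : a * r ≤ K := by have : 0 ≤ a + a * a * r := by positivity
                                  linarith
        calc a * r * x * ‖g‖ = a * r * (x * ‖g‖) := by ring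
          _ ≤ K * (‖g‖ * n) := by gcongr
      have p4 : a * r * ‖g‖ * y ≤ K * (‖g‖ * n) := by
        have h5 : a * r ≤ K := by have : 0 ≤ a + a * a * r := by positivity
                                  linarith
        calc a * r * ‖g‖ * y = a * r * (‖g‖ * y) := by ring
          _ ≤ K * (‖g‖ * n) := by gcongr
      have p5 : K * (x * y) = a * x * y + a * a * r * x * y + a * r * (x * y) := by
        simp only [hK]; ring
      have p6 : K * y ^ 2 = a * a * r * y ^ 2 + (a + a * r) * y ^ 2 := by
        simp only [hK]; ring
      linarith
    have hyoung : K * (x * y) ≤ c / 2 * x ^ 2 + K ^ 2 / (2 * c) * y ^ 2 := by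
      have h1 : 0 ≤ (c * x - K * y) ^ 2 / (2 * c) := by positivity
      have h2 : (c * x - K * y) ^ 2 / (2 * c)
        = c / 2 * x ^ 2 - K * (x * y) + K ^ 2 / (2 * c) * y ^ 2 := by
        field_simp; ring
      linarith
    have hfin : 2 * ε * ((inner ℂ (A w₀) (-w₁)).im + (inner ℂ (A w₀) (R v)).im
        + (inner ℂ (A (Q v)) (R (w t))).im) ≤ 2 * ε * (-(c / 2 * x ^ 2) + M * y ^ 2
          + 2 * K * (‖g‖ * n)) := by
      refine mul_le_mul_of_nonneg_left ?_ (by positivity)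
      have : M * y ^ 2 = K * y ^ 2 + K ^ 2 / (2 * c) * y ^ 2 := by rw [hM]; ring
      linarith
    have hMy : 2 * ε * M * y ^ 2 ≤ 1 / T * y ^ 2 := by gcongr
    have m1 : min (2 * ε * c / 2) (1 / T) * x ^ 2 ≤ 2 * ε * c / 2 * x ^ 2 := by
      gcongr; exact min_le_left _ _
    have m2 : min (2 * ε * c / 2) (1 / T) * y ^ 2 ≤ 1 / T * y ^ 2 := by
      gcongr; exact min_le_right _ _
    rw [hx]
    have f1 : 2 * ε * (-(c / 2 * x ^ 2) + M * y ^ 2 + 2 * K * (‖g‖ * n))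
      = -(2 * ε * c / 2 * x ^ 2) + 2 * ε * M * y ^ 2 + 4 * ε * K * (‖g‖ * n) := by ring
    have f2 : -(2 / T) * y ^ 2 = -(1 / T * y ^ 2) - 1 / T * y ^ 2 := by ring
    have f3 : -(min (2 * ε * c / 2) (1 / T)) * (x ^ 2 + y ^ 2) + (2 + 4 * ε * K) * ‖g‖ * n
      = -(min (2 * ε * c / 2) (1 / T) * x ^ 2) - min (2 * ε * c / 2) (1 / T) * y ^ 2
        + 2 * (n * ‖g‖) + 4 * ε * K * (‖g‖ * n) := by ring
    rw [f2, f3]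
    linarith

end IsHypocoercive

end Hypocoercive

end MarkovAnderson

end

/-! ### The a priori estimate and the adjoint corrector equation -/

noncomputable section

namespace MarkovAnderson

section Hypocoercive

variable {H : Type*} [NormedAddCommGroup H] [InnerProductSpace ℂ H]
  {S : ℝ → H →L[ℂ] H} {Q R A : H →L[ℂ] H} {φ : H} {T c : ℝ}

namespace IsHypocoercive

theorem inner_A_self_im (hyp : IsHypocoercive S Q R A φ T c) (y : H) :
    (inner ℂ y (A y)).im = 0 :=
  Complex.conj_eq_iff_im.1 (by rw [inner_conj_symm, hyp.A_symm])

set_option maxHeartbeats 1000000 in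
/-- The a priori estimate for the equation `(B + iA) y = f` on the orthogonal complement of `φ`,
in terms of bounded operators. -/
theorem exists_bounded_below (hyp : IsHypocoercive S Q R A φ T c) :
    ∃ C : ℝ, 0 < C ∧ ∀ y f : H,
      f = y - Q y + Complex.I • (Q (A y) + R (A y)) + inner ℂ φ y • φ → ‖y‖ ≤ C * ‖f‖ := by
  set a := ‖A‖ with ha
  set r := ‖R‖ with hr
  have ha0 : 0 ≤ a := norm_nonneg _
  have hr0 : 0 ≤ r := norm_nonneg _
  have hT := hyp.T_pos
  have hc := hyp.c_pos
  set C₂ : ℝ := a / c * (1 + r * a) + 1 with hC₂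
  set C₃ : ℝ := C₂ ^ 2 * (T * (2 + a)) with hC₃
  have hC₂0 : 0 ≤ C₂ := by positivity
  have hC₃0 : 0 ≤ C₃ := by positivity
  refine ⟨2 * (1 + C₂ + C₃), by positivity, ?_⟩
  -- The expression for `f` is `Q + R` applied to `(B + iA)y`, using `RB = 1 - Q` and `QB = 0`; the
  -- rank one term removes the kernel spanned by `φ`.
  intro y f hf
  set β := inner ℂ φ y with hβ
  set y₁ := y - Q y with hy₁
  set y₀ := Q y - β • φ with hy₀
  set g := R (A y) with hg
  have hφφ : inner ℂ φ φ = 1 := by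
    rw [inner_self_eq_norm_sq_to_K, hyp.norm_phi]; simp
  have hφR : ∀ z, inner ℂ φ (R z) = 0 := fun z => by
    rw [← hyp.inner_phi_proj, hyp.proj_R, inner_zero_right]
  have hβf : inner ℂ φ f = β := by
    rw [hf, inner_add_right, inner_add_right, inner_smul_right, inner_add_right, hφR,
      hyp.inner_phi_proj, hyp.inner_phi_A, inner_smul_right, hφφ, inner_sub_right,
      hyp.inner_phi_proj]
    simp
  have hβn : ‖β‖ ≤ ‖f‖ := by
    rw [← hβf]
    refine (norm_inner_le_norm _ _).trans ?_
    rw [hyp.norm_phi, one_mul]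
  have hQy₁ : Q y₁ = 0 := by rw [hy₁, map_sub, hyp.proj_proj, sub_self]
  have hQAy : Q (A y) = Q (A y₁) := by
    rw [hy₁, map_sub, map_sub, hyp.proj_A_proj, sub_zero]
  have hQf : Q f = Complex.I • Q (A y₁) + β • φ := by
    rw [hf, map_add, map_add, hQy₁, map_smul, map_add, hyp.proj_proj, hyp.proj_R, map_smul,
      hyp.proj_phi, hQAy]
    simp
  have hQAn : ‖Q (A y₁)‖ ≤ 2 * ‖f‖ := by
    have h1 : Complex.I • Q (A y₁) = Q f - β • φ := by rw [hQf]; abel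
    have h2 : ‖Q (A y₁)‖ = ‖Q f - β • φ‖ := by
      rw [← h1, norm_smul, Complex.norm_I, one_mul]
    rw [h2]
    refine (norm_sub_le _ _).trans ?_
    rw [norm_smul, hyp.norm_phi, mul_one]
    linarith [hyp.norm_proj_le f]
  set f₁ := f - Q f with hf₁
  have hf₁n : ‖f₁‖ ≤ ‖f‖ := hyp.norm_sub_proj_le f
  have hg' : g = Complex.I • (y₁ - f₁) := by
    have h1 : f₁ = y₁ + Complex.I • g := by
      rw [hf₁, hQf, hf, hQAy]
      simp only [smul_add]
      abel
    rw [h1, sub_add_cancel_left, smul_neg, smul_smul, Complex.I_mul_I]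
    simp
  have hy₁n : ‖y₁‖ ≤ ‖f‖ + ‖g‖ := by
    have h1 : y₁ = f₁ - Complex.I • g := by
      rw [hg', smul_smul, Complex.I_mul_I]; simp
    rw [h1]
    refine (norm_sub_le _ _).trans ?_
    rw [norm_smul, Complex.norm_I, one_mul]
    linarith
  have hAn : ‖A y‖ ≤ a * ‖y‖ := A.le_opNorm _
  -- Accretivity of `R` is applied at `Ay`. Substituting `g = i(y₁ - f₁)`, the quadratic term `⟨y₁,
  -- Ay₁⟩` is real and contributes nothing to the real part; every remaining term carries a factor
  -- controlled by `‖f‖`.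
  have hgn : ‖g‖ ^ 2 ≤ T * (2 + a) * (‖f‖ * ‖y‖) := by
    have h1 := hyp.accretive (A y)
    have h2 : inner ℂ g (A y) = -Complex.I * inner ℂ y₁ (A y₁) - Complex.I * inner ℂ (Q (A y₁)) y
        + Complex.I * inner ℂ f₁ (A y) := by
      have h3 : inner ℂ y₁ (A y) = inner ℂ y₁ (A y₁) + inner ℂ (Q (A y₁)) y := by
        have : y = y₁ + Q y := by rw [hy₁]; abel
        conv_lhs => rw [this]
        rw [map_add, inner_add_right, hyp.proj_symm, ← hyp.A_symm y₁ (Q y)]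
      rw [hg', inner_smul_left, inner_sub_left, h3, Complex.conj_I]
      ring
    have h4 : (inner ℂ g (A y)).re ≤ 2 * ‖f‖ * ‖y‖ + ‖f‖ * (a * ‖y‖) := by
      rw [h2, Complex.add_re, Complex.sub_re]
      have h5 : (-Complex.I * inner ℂ y₁ (A y₁)).re = 0 := by
        simp [hyp.inner_A_self_im]
      have h6 : -(Complex.I * inner ℂ (Q (A y₁)) y).re ≤ 2 * ‖f‖ * ‖y‖ := by
        refine (neg_le_abs _).trans ((Complex.abs_re_le_norm _).trans ?_)
        rw [norm_mul, Complex.norm_I, one_mul]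
        refine (norm_inner_le_norm _ _).trans ?_
        gcongr
      have h7 : (Complex.I * inner ℂ f₁ (A y)).re ≤ ‖f‖ * (a * ‖y‖) := by
        refine (Complex.re_le_norm _).trans ?_
        rw [norm_mul, Complex.norm_I, one_mul]
        refine (norm_inner_le_norm _ _).trans ?_
        gcongr
      linarith
    calc ‖g‖ ^ 2 ≤ T * (inner ℂ g (A y)).re := h1
      _ ≤ T * (2 * ‖f‖ * ‖y‖ + ‖f‖ * (a * ‖y‖)) := by gcongr
      _ = _ := by ring
  have hy₀n : c * ‖y₀‖ ≤ a * (‖g‖ + r * a * ‖y₁‖) := by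
    rcases eq_or_ne y₀ 0 with h0 | h0
    · rw [h0]; simp; positivity
    have h1 : Q y₀ = y₀ := by
      rw [hy₀, map_sub, hyp.proj_proj, map_smul, hyp.proj_phi]
    have h2 : inner ℂ φ y₀ = 0 := by
      rw [hy₀, inner_sub_right, hyp.inner_phi_proj, inner_smul_right, hφφ, mul_one, ← hβ, sub_self]
    have h3 := hyp.coercive y₀ h1 h2
    have h4 : A y₀ = A y - A y₁ := by
      rw [hy₀, hy₁, map_sub, map_smul, hyp.A_phi, map_sub]; simp
    have h5 : ‖R (A y₀)‖ ≤ ‖g‖ + r * a * ‖y₁‖ := by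
      rw [h4, map_sub]
      refine (norm_sub_le _ _).trans ?_
      gcongr
      calc ‖R (A y₁)‖ ≤ r * ‖A y₁‖ := R.le_opNorm _
        _ ≤ r * (a * ‖y₁‖) := by gcongr; exact A.le_opNorm _
        _ = _ := by ring
    have h6 : c * ‖y₀‖ ^ 2 ≤ (‖g‖ + r * a * ‖y₁‖) * (a * ‖y₀‖) := by
      refine h3.trans ((Complex.re_le_norm _).trans ((norm_inner_le_norm _ _).trans ?_))
      gcongr
      exact A.le_opNorm _
    exact le_of_mul_le_mul_right (by nlinarith) (norm_pos_iff.2 h0)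
  have hyn : ‖y‖ ≤ (1 + C₂) * ‖f‖ + C₂ * ‖g‖ := by
    have h1 : y = β • φ + y₀ + y₁ := by rw [hy₀, hy₁]; abel
    have h2 : ‖y‖ ≤ ‖β‖ + ‖y₀‖ + ‖y₁‖ := by
      conv_lhs => rw [h1]
      refine (norm_add_le _ _).trans ?_
      gcongr
      refine (norm_add_le _ _).trans ?_
      rw [norm_smul, hyp.norm_phi, mul_one]
    have h3 : ‖y₀‖ ≤ a / c * (‖g‖ + r * a * ‖y₁‖) := by
      rw [div_mul_eq_mul_div, le_div_iff₀ hc]; linarith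
    have h4 : a / c * (‖g‖ + r * a * ‖y₁‖) ≤ a / c * (‖g‖ + r * a * (‖f‖ + ‖g‖)) := by gcongr
    have h5 : 0 ≤ a / c * ‖f‖ := by positivity
    calc ‖y‖ ≤ ‖f‖ + a / c * (‖g‖ + r * a * (‖f‖ + ‖g‖)) + (‖f‖ + ‖g‖) := by linarith
      _ ≤ (1 + C₂) * ‖f‖ + C₂ * ‖g‖ := by rw [hC₂]; nlinarith
  -- Since `‖g‖²` is bounded by a multiple of `‖f‖‖y‖`, half of `‖y‖` can be split off and moved to
  -- the left-hand side.
  have hamgm : C₂ * ‖g‖ ≤ 1 / 2 * ‖y‖ + C₃ * ‖f‖ := by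
    refine (sq_le_sq₀ (by positivity) (by positivity)).1 ?_
    calc (C₂ * ‖g‖) ^ 2 = C₂ ^ 2 * ‖g‖ ^ 2 := by ring
      _ ≤ C₂ ^ 2 * (T * (2 + a) * (‖f‖ * ‖y‖)) := by gcongr
      _ = 2 * (1 / 2 * ‖y‖) * (C₃ * ‖f‖) := by rw [hC₃]; ring
      _ ≤ _ := by nlinarith [sq_nonneg (1 / 2 * ‖y‖), sq_nonneg (C₃ * ‖f‖)]
  nlinarith

end IsHypocoercive

variable [CompleteSpace H]

open ContinuousLinearMap in
/-- An operator whose adjoint is bounded below is onto. -/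
theorem surjective_of_adjoint_bounded_below (M : H →L[ℂ] H) {c : ℝ} (hc : 0 < c)
    (h : ∀ y, c * ‖y‖ ≤ ‖adjoint M y‖) : Function.Surjective M := by
  -- `M M†` is bounded below, so its range is closed; a vector orthogonal to that range is killed by
  -- `M†` and hence zero. The range of `M` contains that of `M M†`.
  set N : H →L[ℂ] H := M.comp (adjoint M) with hN
  have hinner : ∀ y, (inner ℂ (N y) y).re = ‖adjoint M y‖ ^ 2 := fun y => by
    rw [hN, comp_apply, ← adjoint_inner_right, inner_self_eq_norm_sq_to_K]
    norm_cast
  have hbelow : ∀ y, c ^ 2 * ‖y‖ ≤ ‖N y‖ := fun y => by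
    rcases eq_or_ne y 0 with rfl | hy
    · simp
    have h1 : (c * ‖y‖) ^ 2 ≤ ‖N y‖ * ‖y‖ := by
      calc (c * ‖y‖) ^ 2 ≤ ‖adjoint M y‖ ^ 2 := by gcongr; exact h y
        _ = (inner ℂ (N y) y).re := (hinner y).symm
        _ ≤ _ := (Complex.re_le_norm _).trans (norm_inner_le_norm _ _)
    have h2 : 0 < ‖y‖ := norm_pos_iff.2 hy
    exact le_of_mul_le_mul_right (by nlinarith) h2
  have hanti : AntilipschitzWith (c ^ 2)⁻¹.toNNReal N := by
    refine N.antilipschitz_of_bound fun x => ?_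
    rw [Real.coe_toNNReal _ (by positivity), ← div_eq_inv_mul, le_div_iff₀ (by positivity),
      mul_comm]
    exact hbelow x
  have hcl : IsClosed (N.range : Set H) := hanti.isClosed_range N.uniformContinuous
  have htop : N.range = ⊤ := by
    have := hcl.completeSpace_coe
    rw [← N.range.orthogonal_orthogonal, Submodule.eq_top_iff']
    intro v w hw
    have h1 : inner ℂ (N w) w = 0 := hw _ ⟨w, rfl⟩
    have h2 := hinner w
    rw [h1, Complex.zero_re] at h2
    have h3 := h w
    have h4 : ‖adjoint M w‖ = 0 := by
      exact pow_eq_zero_iff (two_ne_zero) |>.1 h2.symm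
    rw [h4] at h3
    have h5 : ‖w‖ = 0 := le_antisymm (by nlinarith) (norm_nonneg _)
    rw [norm_eq_zero.1 h5, inner_zero_left]
  intro e
  have : e ∈ N.range := htop ▸ Submodule.mem_top
  obtain ⟨y, hy⟩ := this
  exact ⟨adjoint M y, hy⟩

namespace IsHypocoercive

open ContinuousLinearMap in
theorem adjoint_R_proj (hyp : IsHypocoercive S Q R A φ T c) (u : H) : adjoint R (Q u) = 0 := by
  refine ext_inner_right ℂ fun y => ?_
  rw [adjoint_inner_left, hyp.proj_symm, hyp.proj_R, inner_zero_right, inner_zero_left]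

open ContinuousLinearMap in
theorem proj_adjoint_R (hyp : IsHypocoercive S Q R A φ T c) (u : H) : Q (adjoint R u) = 0 := by
  refine ext_inner_right ℂ fun y => ?_
  rw [hyp.proj_symm, adjoint_inner_left, hyp.R_proj, inner_zero_right, inner_zero_left]

open ContinuousLinearMap in
-- Completing the square, `‖Rf‖² ≤ T Re⟨Rf, f⟩` for all `f` says exactly that `‖R - T/2‖ ≤ T/2`, and
-- the operator norm is invariant under taking adjoints.
theorem accretive_adjoint (hyp : IsHypocoercive S Q R A φ T c) (f : H) :
    ‖adjoint R f‖ ^ 2 ≤ T * (inner ℂ (adjoint R f) f).re := by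
  have hT := hyp.T_pos
  have key : ∀ (W : H →L[ℂ] H) (f : H), ‖W f - ((T / 2 : ℝ) : ℂ) • f‖ ^ 2
      = ‖W f‖ ^ 2 - T * (inner ℂ (W f) f).re + (T / 2 * ‖f‖) ^ 2 := fun W f => by
    rw [norm_sub_sq (𝕜 := ℂ), norm_smul, inner_smul_right, Complex.norm_real, Real.norm_eq_abs,
      abs_of_pos (by positivity : 0 < T / 2)]
    simp only [RCLike.re_eq_complex_re, Complex.re_ofReal_mul]
    ring
  set W : H →L[ℂ] H := R - ((T / 2 : ℝ) : ℂ) • ContinuousLinearMap.id ℂ H with hW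
  have hn : ‖W‖ ≤ T / 2 := by
    refine opNorm_le_bound _ (by positivity) fun f => ?_
    refine (sq_le_sq₀ (norm_nonneg _) (by positivity)).1 ?_
    have h1 := key R f
    have h2 := hyp.accretive f
    simp only [hW, sub_apply, smul_apply, id_apply]
    rw [h1]; linarith
  have hadj : adjoint W f = adjoint R f - ((T / 2 : ℝ) : ℂ) • f := by
    rw [hW, map_sub, sub_apply]
    congr 1
    refine ext_inner_right ℂ fun y => ?_
    rw [adjoint_inner_left]
    simp only [smul_apply, id_apply, inner_smul_left, inner_smul_right, Complex.conj_ofReal]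
  have h3 : ‖adjoint W f‖ ≤ T / 2 * ‖f‖ := by
    refine (le_opNorm _ _).trans ?_
    rw [LinearIsometryEquiv.norm_map]
    gcongr
  have h4 := key (adjoint R) f
  rw [← hadj] at h4
  have h5 : ‖adjoint W f‖ ^ 2 ≤ (T / 2 * ‖f‖) ^ 2 := by gcongr
  linarith

open ContinuousLinearMap in
/-- The equation `(B + iA)† η = e`, with `η = η₀ + (B†)⁻¹ q`, is solvable for `e ⟂ φ`. -/
theorem exists_adjoint_solution (hyp : IsHypocoercive S Q R A φ T c) (e : H)
    (he : inner ℂ φ e = 0) :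
    ∃ q η₀ : H, Q q = 0 ∧ Q η₀ = η₀ ∧ inner ℂ φ η₀ = 0 ∧
      q - Complex.I • A (η₀ + adjoint R q) = e := by
  -- One unknown `z` carries both pieces, `η₀ = Qz` and `q = z - Qz`. The adjoint of `M` is the
  -- operator of `exists_bounded_below`, so `M` is onto. Pairing with `φ` and using `e ⟂ φ` shows
  -- that the rank one term vanishes at the solution.
  set M : H →L[ℂ] H := ContinuousLinearMap.id ℂ H - Q - Complex.I • A.comp (Q + adjoint R)
    + (innerSL ℂ φ).smulRight φ with hM
  have hMapp : ∀ z, M z = z - Q z - Complex.I • A (Q z + adjoint R z) + inner ℂ φ z • φ :=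
    fun z => by simp [hM]
  set N : H →L[ℂ] H := ContinuousLinearMap.id ℂ H - Q + Complex.I • (Q + R).comp A
    + (innerSL ℂ φ).smulRight φ with hN
  have hNapp : ∀ y, N y = y - Q y + Complex.I • (Q (A y) + R (A y)) + inner ℂ φ y • φ :=
    fun z => by simp [hN]
  have hadj : N = adjoint M := by
    rw [eq_adjoint_iff]
    intro x y
    rw [hMapp, hNapp]
    simp only [inner_add_left, inner_sub_left, inner_smul_left, inner_add_right, inner_sub_right,
      inner_smul_right, hyp.proj_symm, hyp.A_symm, ← adjoint_inner_right, map_add,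
      Complex.conj_I]
    rw [inner_conj_symm]
    ring
  obtain ⟨C, hC, hCb⟩ := hyp.exists_bounded_below
  obtain ⟨z, hz⟩ := surjective_of_adjoint_bounded_below M (inv_pos.2 hC) (fun y => by
    rw [← hadj, inv_mul_le_iff₀ hC]
    exact hCb y _ (hNapp y)) e
  have hφφ : inner ℂ φ φ = 1 := by
    rw [inner_self_eq_norm_sq_to_K, hyp.norm_phi]; simp
  have hφz : inner ℂ φ z = 0 := by
    rw [hMapp] at hz
    have := congrArg (fun x => inner ℂ φ x) hz
    simp only [inner_add_right, inner_sub_right, inner_smul_right, hyp.inner_phi_A, hφφ,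
      hyp.inner_phi_proj, he] at this
    simpa using this
  refine ⟨z - Q z, Q z, ?_, hyp.proj_proj z, ?_, ?_⟩
  · rw [map_sub, hyp.proj_proj, sub_self]
  · rw [hyp.inner_phi_proj, hφz]
  · rw [map_sub, hyp.adjoint_R_proj, sub_zero, ← hz, hMapp, hφz]
    simp

end IsHypocoercive

end Hypocoercive

end MarkovAnderson

end

/-! ### The slow amplitude under a weak perturbation -/

noncomputable section

namespace MarkovAnderson

section Hypocoercive

theorem norm_sub_inner_smul_le {H : Type*} [NormedAddCommGroup H] [InnerProductSpace ℂ H] {φ : H}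
    (hφ : ‖φ‖ = 1) (x : H) : ‖x - inner ℂ φ x • φ‖ ≤ ‖x‖ := by
  have h : inner ℂ (inner ℂ φ x • φ) (x - inner ℂ φ x • φ) = 0 := by
    rw [inner_smul_left, inner_sub_right, inner_smul_right, inner_self_eq_norm_sq_to_K, hφ]
    simp
  have h2 := norm_add_sq_eq_norm_sq_add_norm_sq_of_inner_eq_zero _ _ h
  rw [add_sub_cancel] at h2
  refine (sq_le_sq₀ (norm_nonneg _) (norm_nonneg _)).1 ?_
  nlinarith [mul_self_nonneg ‖inner ℂ φ x • φ‖]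

variable {H : Type*} [NormedAddCommGroup H] [InnerProductSpace ℂ H] [CompleteSpace H]
  {S : ℝ → H →L[ℂ] H} {Q R A : H →L[ℂ] H} {φ : H} {T c : ℝ}

namespace IsHypocoercive

open ContinuousLinearMap in
/-- The derivative of `⟨φ + η, u⟩`, where `η = η₀ + (B†)⁻¹ q`. -/
theorem tendsto_inner_step (hyp : IsHypocoercive S Q R A φ T c) {u : ℝ → H} {t : ℝ} {v q η₀ : H}
    (hu : Tendsto (fun h : ℝ => h⁻¹ • (u (t + h) - S h (u t))) (𝓝[>] 0) (𝓝 v))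
    (hq : Q q = 0) (hη : Q η₀ = η₀) :
    Tendsto (fun h : ℝ => h⁻¹ • (inner ℂ (η₀ + adjoint R q) (u (t + h))
        - inner ℂ (η₀ + adjoint R q) (u t))) (𝓝[>] 0)
      (𝓝 (inner ℂ (η₀ + adjoint R q) v - inner ℂ q (u t))) := by
  set d : ℝ → H := fun h => h⁻¹ • (u (t + h) - S h (u t)) with hd
  set η := η₀ + adjoint R q
  have h1 : Tendsto (fun h => inner ℂ η (d h)) (𝓝[>] 0) (𝓝 (inner ℂ η v)) :=
    (tendsto_const_nhds (x := η)).inner (𝕜 := ℂ) hu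
  have h2 : Tendsto (fun h : ℝ => inner ℂ q (h⁻¹ • R (S h (u t) - u t))) (𝓝[>] 0)
      (𝓝 (-inner ℂ q (u t))) := by
    have := (tendsto_const_nhds (x := q)).inner (𝕜 := ℂ) (hyp.tendsto_R (u t))
    have e : inner ℂ q (-(u t - Q (u t))) = -inner ℂ q (u t) := by
      rw [inner_neg_right, inner_sub_right, ← hyp.proj_symm, hq, inner_zero_left, sub_zero]
    rwa [e] at this
  refine (h1.add h2).congr' ?_
  filter_upwards [self_mem_nhdsWithin] with h hh
  have hpos : 0 < h := hh
  -- The part `η₀` lies in the range of `Q` and does not see `S h u - u`; for the other part `R` is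
  -- moved to the right, where `tendsto_R` applies.
  have e1 : inner ℂ q (h⁻¹ • R (S h (u t) - u t)) = h⁻¹ • inner ℂ η (S h (u t) - u t) := by
    have h3 : inner ℂ η₀ (S h (u t) - u t) = 0 := by
      rw [← hη, hyp.proj_symm, map_sub, hyp.proj_S h hpos.le, sub_self, inner_zero_right]
    rw [inner_add_left, h3, zero_add, adjoint_inner_left, real_smul_eq_complex, inner_smul_right,
      real_smul_eq_complex, smul_eq_mul]
  have e2 : inner ℂ η (d h) = h⁻¹ • inner ℂ η (u (t + h) - S h (u t)) := by
    simp only [hd]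
    rw [real_smul_eq_complex, inner_smul_right, real_smul_eq_complex, smul_eq_mul]
  rw [e1, e2, ← smul_add]
  congr 1
  simp only [inner_sub_right]
  ring

set_option maxHeartbeats 1000000 in
open ContinuousLinearMap in
/-- For a weak perturbation `Δ` of size `κ` the amplitude `⟨φ, u⟩` decays with the rate given by
second order perturbation theory, up to small errors on the time scale `κ⁻²`. -/
theorem amplitude_estimate (hyp : IsHypocoercive S Q R A φ T c) {C₁ : ℝ} (hC₁ : 0 ≤ C₁) :
    ∃ C κ₀ : ℝ, 0 ≤ C ∧ 0 < κ₀ ∧ ∀ (κ : ℝ) (Δ A₁ : H →L[ℂ] H) (q η₀ η : H) (lam : ℂ) (u : ℝ → H),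
      0 ≤ κ → κ ≤ κ₀ → ‖Δ‖ ≤ C₁ * κ → ‖Δ - A₁‖ ≤ C₁ * κ ^ 2 →
      inner ℂ φ (Δ φ) = 0 → inner ℂ φ (A₁ φ) = 0 → Q q = 0 → Q η₀ = η₀ → inner ℂ φ η₀ = 0 →
      η = η₀ + adjoint R q → ‖η‖ ≤ C₁ * κ →
      (∀ x, inner ℂ (q - Complex.I • A η) x = -(Complex.I * inner ℂ φ (A₁ x))) →
      lam = Complex.I * inner ℂ η (A₁ φ) → Continuous u →
      (∀ t, 0 ≤ t → Tendsto (fun h : ℝ => h⁻¹ • (u (t + h) - S h (u t))) (𝓝[>] 0)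
        (𝓝 (-(Complex.I • (A (u t) + Δ (u t)))))) →
      ∀ t, 0 ≤ t → ‖inner ℂ φ (u t) - Complex.exp (-lam * t) * inner ℂ φ (u 0)‖
        ≤ C * Real.exp (C * κ ^ 2 * t) * (κ + κ ^ 3 * t) * ‖u 0‖ := by
  obtain ⟨ε, c₁, C₀, hc₁, hC₀, hequiv, hdec⟩ := hyp.exists_lyapunov
  set K : ℝ := 2 * C₁ ^ 2 + 4 * (C₁ + 2 * C₁ ^ 2 + 3 * C₁ ^ 3) + (C₀ * C₁) ^ 2 / c₁ with hK
  have hK0 : 0 ≤ K := by positivity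
  obtain ⟨C, hC0, hslow⟩ := slow_fast_estimate (c := c₁ / 4) (K := K) (by positivity) hK0
  -- Besides `κ ≤ 1` this ensures `C₁κ ≤ 1`, so `‖α‖` is controlled by `‖p‖ + ‖w‖`, and `2C₀C₁κ ≤
  -- c₁/4`, so the decay of the fast part absorbs its own perturbation.
  set κ₀ : ℝ := min 1 (min (1 / (C₁ + 1)) (c₁ / (8 * (C₀ * C₁ + 1)))) with hκ₀
  -- What matters of this constant is that it is at least `4C + 9C₁`, for the prefactor, and at
  -- least `C` and `K`, for the exponential rates.
  refine ⟨3 * (C + 1) * (1 + C₁) ^ 2 * 3 + 4 * (C + K) , κ₀, by positivity, by positivity, ?_⟩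
  intro κ Δ A₁ q η₀ η lam u hκ hκκ hΔ hΔA hΔφ hA₁φ hq hη₀ hφη₀ hη hηn hadj hlam hu hstep t ht
  have hκ1 : κ ≤ 1 := hκκ.trans (min_le_left _ _)
  have hCκ : C₁ * κ ≤ 1 := by
    have h1 : κ ≤ 1 / (C₁ + 1) := hκκ.trans ((min_le_right _ _).trans (min_le_left _ _))
    rw [le_div_iff₀ (by positivity)] at h1
    nlinarith
  have hCCκ : 2 * C₀ * (C₁ * κ) ≤ c₁ / 4 := by
    have h1 : κ ≤ c₁ / (8 * (C₀ * C₁ + 1)) := hκκ.trans ((min_le_right _ _).trans (min_le_right _ _))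
    rw [le_div_iff₀ (by positivity)] at h1
    nlinarith
  have hφφ : inner ℂ φ φ = 1 := by
    rw [inner_self_eq_norm_sq_to_K, hyp.norm_phi]; simp
  have hφη : inner ℂ φ η = 0 := by
    rw [hη, inner_add_right, hφη₀, zero_add, ← hyp.inner_phi_proj, hyp.proj_adjoint_R,
      inner_zero_right]
  have hηφ : inner ℂ η φ = 0 := by rw [← inner_conj_symm, hφη, map_zero]
  set α : ℝ → ℂ := fun s => inner ℂ φ (u s) with hα
  set w : ℝ → H := fun s => u s - α s • φ with hw
  -- The corrected amplitude. In its derivative the first order term `⟨φ, A₁w⟩` cancels by the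
  -- equation for `η`; what is left is `-λα`, of second order, terms of order `κ²‖w‖` and a term of
  -- order `κ³‖α‖`.
  set p : ℝ → ℂ := fun s => α s + inner ℂ η (u s) with hp
  set F : ℝ → ℝ := fun s => lyapunov Q R A ε (w s) with hF
  have hαc : Continuous α := continuous_const.inner hu
  have hwc : Continuous w := hu.sub (hαc.smul continuous_const)
  have hpc : Continuous p := hαc.add (continuous_const.inner hu)
  have hFc : Continuous F := (continuous_lyapunov Q R A ε).comp hwc
  have hφw : ∀ s, inner ℂ φ (w s) = 0 := fun s => by
    simp only [hw, inner_sub_right, inner_smul_right, hφφ, mul_one, hα, sub_self]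
  have huw : ∀ s, u s = α s • φ + w s := fun s => by simp [hw]
  have hηu : ∀ s, inner ℂ η (u s) = inner ℂ η (w s) := fun s => by
    rw [huw, inner_add_right, inner_smul_right, hηφ, mul_zero, zero_add]
  have hηw : ∀ s, ‖inner ℂ η (w s)‖ ≤ C₁ * κ * ‖w s‖ := fun s =>
    (norm_inner_le_norm _ _).trans (by gcongr)
  have hαp : ∀ s, ‖α s‖ ≤ ‖p s‖ + C₁ * κ * ‖w s‖ := fun s => by
    have : α s = p s - inner ℂ η (w s) := by simp only [hp, hηu]; ring
    rw [this]
    exact (norm_sub_le _ _).trans (by gcongr; exact hηw s)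
  have hFw : ∀ s, ‖w s‖ ^ 2 ≤ 2 * F s ∧ F s ≤ 2 * ‖w s‖ ^ 2 := fun s => hequiv (w s)
  have hF0 : ∀ s, 0 ≤ F s := fun s => by nlinarith [(hFw s).1, sq_nonneg ‖w s‖]
  have hwF : ∀ s, ‖w s‖ ≤ 2 * √(F s) := fun s => by
    refine (sq_le_sq₀ (norm_nonneg _) (by positivity)).1 ?_
    rw [mul_pow, Real.sq_sqrt (hF0 s)]
    linarith [(hFw s).1, hF0 s]
  have hA₁n : ‖A₁‖ ≤ 2 * (C₁ * κ) := by
    have h1 : A₁ = Δ - (Δ - A₁) := by abel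
    rw [h1]
    refine (norm_sub_le _ _).trans ?_
    have : C₁ * κ ^ 2 ≤ C₁ * κ := by
      have : κ ^ 2 ≤ κ := by nlinarith
      gcongr
    linarith
  have hlamn : ‖lam‖ ≤ 2 * C₁ ^ 2 * κ ^ 2 := by
    rw [hlam, norm_mul, Complex.norm_I, one_mul]
    refine (norm_inner_le_norm _ _).trans ?_
    have h1 : ‖A₁ φ‖ ≤ 2 * (C₁ * κ) := by
      refine (A₁.le_opNorm _).trans ?_
      rw [hyp.norm_phi, mul_one]; exact hA₁n
    calc ‖η‖ * ‖A₁ φ‖ ≤ (C₁ * κ) * (2 * (C₁ * κ)) := by gcongr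
      _ = _ := by ring
  -- the derivative of the slow amplitude
  set p' : ℝ → ℂ := fun s => -(Complex.I * inner ℂ φ ((Δ - A₁) (w s)))
    - Complex.I * α s * inner ℂ η (Δ φ) - Complex.I * inner ℂ η (Δ (w s)) with hp'
  have hpd : ∀ s, 0 ≤ s →
      Tendsto (fun h : ℝ => h⁻¹ • (p (s + h) - p s)) (𝓝[>] 0) (𝓝 (p' s)) := by
    intro s hs
    have h1 := hyp.tendsto_inner_step (hstep s hs) hq hη₀
    have h2 := hyp.tendsto_inner_step (q := 0) (η₀ := φ) (hstep s hs) (map_zero _) hyp.proj_phi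
    rw [map_zero, add_zero, inner_zero_left, sub_zero] at h2
    rw [← hη] at h1
    have h3 : inner ℂ φ (-(Complex.I • (A (u s) + Δ (u s))))
        + (inner ℂ η (-(Complex.I • (A (u s) + Δ (u s)))) - inner ℂ q (u s)) = p' s := by
      have h4 := hadj (u s)
      rw [inner_sub_left, inner_smul_left, Complex.conj_I] at h4
      have h5 : inner ℂ q (u s) = -(Complex.I * inner ℂ φ (A₁ (u s)))
          - Complex.I * inner ℂ (A η) (u s) := by rw [← h4]; ring
      rw [h5, hp', hyp.A_symm]
      simp only [inner_neg_right, inner_smul_right, inner_add_right, hyp.inner_phi_A]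
      have e1 : inner ℂ φ (Δ (u s)) = inner ℂ φ (Δ (w s)) := by
        rw [huw, map_add, map_smul, inner_add_right, inner_smul_right, hΔφ]; ring
      have e2 : inner ℂ φ (A₁ (u s)) = inner ℂ φ (A₁ (w s)) := by
        rw [huw, map_add, map_smul, inner_add_right, inner_smul_right, hA₁φ]; ring
      have e3 : inner ℂ η (Δ (u s)) = α s * inner ℂ η (Δ φ) + inner ℂ η (Δ (w s)) := by
        rw [huw, map_add, map_smul, inner_add_right, inner_smul_right]
      rw [e1, e2, e3, sub_apply, inner_sub_right]
      ring
    rw [← h3]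
    refine (h2.add h1).congr fun h => ?_
    rw [← smul_add]
    congr 1
    simp only [hp, hα]
    ring
  have hpl : ∀ s, 0 ≤ s → ‖p' s + lam * p s‖ ≤ K * (κ ^ 2 * √(F s) + κ ^ 3 * ‖p s‖) := by
    intro s hs
    have e : p' s + lam * p s = -(Complex.I * inner ℂ φ ((Δ - A₁) (w s)))
        - Complex.I * α s * inner ℂ η ((Δ - A₁) φ) - Complex.I * inner ℂ η (Δ (w s))
        + lam * inner ℂ η (w s) := by
      simp only [hp', hp, hηu, hlam, sub_apply, inner_sub_right]
      ring
    have n1 : ‖inner ℂ φ ((Δ - A₁) (w s))‖ ≤ C₁ * κ ^ 2 * ‖w s‖ := by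
      refine (norm_inner_le_norm _ _).trans ?_
      rw [hyp.norm_phi, one_mul]
      exact (le_opNorm _ _).trans (by gcongr)
    have n2 : ‖α s * inner ℂ η ((Δ - A₁) φ)‖ ≤ (‖p s‖ + C₁ * κ * ‖w s‖) * (C₁ ^ 2 * κ ^ 3) := by
      rw [norm_mul]
      have h1 : ‖inner ℂ η ((Δ - A₁) φ)‖ ≤ (C₁ * κ) * (C₁ * κ ^ 2) := by
        refine (norm_inner_le_norm _ _).trans ?_
        have : ‖(Δ - A₁) φ‖ ≤ C₁ * κ ^ 2 := by
          refine (le_opNorm _ _).trans ?_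
          rw [hyp.norm_phi, mul_one]; exact hΔA
        gcongr
      calc _ ≤ (‖p s‖ + C₁ * κ * ‖w s‖) * ((C₁ * κ) * (C₁ * κ ^ 2)) := by gcongr; exact hαp s
        _ = _ := by ring
    have n3 : ‖inner ℂ η (Δ (w s))‖ ≤ C₁ ^ 2 * κ ^ 2 * ‖w s‖ := by
      refine (norm_inner_le_norm _ _).trans ?_
      have : ‖Δ (w s)‖ ≤ C₁ * κ * ‖w s‖ := (le_opNorm _ _).trans (by gcongr)
      calc ‖η‖ * ‖Δ (w s)‖ ≤ (C₁ * κ) * (C₁ * κ * ‖w s‖) := by gcongr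
        _ = _ := by ring
    have n4 : ‖lam * inner ℂ η (w s)‖ ≤ 2 * C₁ ^ 3 * κ ^ 3 * ‖w s‖ := by
      rw [norm_mul]
      calc ‖lam‖ * ‖inner ℂ η (w s)‖ ≤ (2 * C₁ ^ 2 * κ ^ 2) * (C₁ * κ * ‖w s‖) := by
            gcongr; exact hηw s
        _ = _ := by ring
    have n5 : ‖p' s + lam * p s‖ ≤ C₁ * κ ^ 2 * ‖w s‖
        + (‖p s‖ + C₁ * κ * ‖w s‖) * (C₁ ^ 2 * κ ^ 3) + C₁ ^ 2 * κ ^ 2 * ‖w s‖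
        + 2 * C₁ ^ 3 * κ ^ 3 * ‖w s‖ := by
      rw [e]
      refine (norm_add_le _ _).trans (add_le_add ?_ n4)
      refine (norm_sub_le _ _).trans (add_le_add ?_ (by rwa [norm_mul, Complex.norm_I, one_mul]))
      refine (norm_sub_le _ _).trans (add_le_add ?_
        (by rwa [mul_assoc, norm_mul, Complex.norm_I, one_mul]))
      rwa [norm_neg, norm_mul, Complex.norm_I, one_mul]
    have k1 : κ ^ 3 ≤ κ ^ 2 := pow_le_pow_of_le_one hκ hκ1 (by norm_num)
    have k2 : κ ^ 4 ≤ κ ^ 2 := pow_le_pow_of_le_one hκ hκ1 (by norm_num)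
    have n6 : ‖p' s + lam * p s‖ ≤ (C₁ + C₁ ^ 2 + 3 * C₁ ^ 3) * (κ ^ 2 * ‖w s‖)
        + C₁ ^ 2 * (κ ^ 3 * ‖p s‖) := by
      have a1 : C₁ ^ 3 * (κ ^ 4 * ‖w s‖) ≤ C₁ ^ 3 * (κ ^ 2 * ‖w s‖) := by gcongr
      have a2 : C₁ ^ 3 * (κ ^ 3 * ‖w s‖) ≤ C₁ ^ 3 * (κ ^ 2 * ‖w s‖) := by gcongr
      have a3 : (‖p s‖ + C₁ * κ * ‖w s‖) * (C₁ ^ 2 * κ ^ 3)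
        = C₁ ^ 2 * (κ ^ 3 * ‖p s‖) + C₁ ^ 3 * (κ ^ 4 * ‖w s‖) := by ring
      rw [a3] at n5
      linarith
    have b1 : (C₁ + C₁ ^ 2 + 3 * C₁ ^ 3) * (κ ^ 2 * ‖w s‖)
        ≤ (C₁ + C₁ ^ 2 + 3 * C₁ ^ 3) * (κ ^ 2 * (2 * √(F s))) := by gcongr; exact hwF s
    have b2 : (C₁ + C₁ ^ 2 + 3 * C₁ ^ 3) * 2 ≤ K := by
      have : 0 ≤ (C₀ * C₁) ^ 2 / c₁ := by positivity
      have : 0 ≤ C₁ ^ 3 := by positivity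
      have : 0 ≤ C₁ ^ 2 := by positivity
      rw [hK]; linarith
    have b3 : C₁ ^ 2 ≤ K := by
      have : 0 ≤ (C₀ * C₁) ^ 2 / c₁ := by positivity
      have : 0 ≤ C₁ ^ 3 := by positivity
      have : 0 ≤ C₁ ^ 2 := by positivity
      rw [hK]; linarith
    calc ‖p' s + lam * p s‖
        ≤ ((C₁ + C₁ ^ 2 + 3 * C₁ ^ 3) * 2) * (κ ^ 2 * √(F s)) + C₁ ^ 2 * (κ ^ 3 * ‖p s‖) := by
          linarith
      _ ≤ K * (κ ^ 2 * √(F s)) + K * (κ ^ 3 * ‖p s‖) := by gcongr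
      _ = _ := by ring
  -- the decay of the fast part
  have hFslope : ∀ s, 0 ≤ s → RightSlopeLE F s (-(c₁ / 4) * F s + K * κ ^ 2 * ‖p s‖ ^ 2) := by
    intro s hs
    -- The forcing of the fast part `w` is the perturbation without its component along `φ`, which
    -- is what keeps `w` orthogonal to `φ`.
    set g : H := Complex.I • (Δ (u s) - inner ℂ φ (Δ (u s)) • φ) with hg
    have hgn : ‖g‖ ≤ C₁ * κ * ‖p s‖ + 2 * (C₁ * κ) * ‖w s‖ := by
      rw [hg, norm_smul, Complex.norm_I, one_mul]
      have h1 := norm_sub_inner_smul_le hyp.norm_phi (Δ (u s))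
      have h2 : ‖u s‖ ≤ ‖α s‖ + ‖w s‖ := by
        rw [huw s]
        refine (norm_add_le _ _).trans ?_
        rw [norm_smul, hyp.norm_phi, mul_one]
      have h3 : ‖u s‖ ≤ ‖p s‖ + 2 * ‖w s‖ := by
        have := hαp s
        have h4 : C₁ * κ * ‖w s‖ ≤ 1 * ‖w s‖ := by gcongr
        linarith
      calc ‖Δ (u s) - inner ℂ φ (Δ (u s)) • φ‖ ≤ ‖Δ (u s)‖ := h1
        _ ≤ C₁ * κ * ‖u s‖ := (le_opNorm _ _).trans (by gcongr)
        _ ≤ C₁ * κ * (‖p s‖ + 2 * ‖w s‖) := by gcongr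
        _ = _ := by ring
    have hAu : A (u s) = A (w s) := by
      rw [huw, map_add, map_smul, hyp.A_phi, smul_zero, zero_add]
    have hwstep : Tendsto (fun h : ℝ => h⁻¹ • (w (s + h) - S h (w s))) (𝓝[>] 0)
        (𝓝 (-(Complex.I • A (w s) + g))) := by
      have h2 := hyp.tendsto_inner_step (q := 0) (η₀ := φ) (hstep s hs) (map_zero _) hyp.proj_phi
      rw [map_zero, add_zero, inner_zero_left, sub_zero] at h2
      have h3 := (hstep s hs).sub (h2.smul_const φ)
      have e : -(Complex.I • (A (u s) + Δ (u s)))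
          - inner ℂ φ (-(Complex.I • (A (u s) + Δ (u s)))) • φ = -(Complex.I • A (w s) + g) := by
        rw [hg, hAu, inner_neg_right, inner_smul_right, inner_add_right, hyp.inner_phi_A, zero_add,
          smul_sub, smul_smul, smul_add]
        module
      rw [e] at h3
      refine h3.congr' ?_
      filter_upwards [self_mem_nhdsWithin] with h hh
      have hSφ : S h φ = φ := by
        have := hyp.S_proj h (le_of_lt hh) φ
        rwa [hyp.proj_phi] at this
      simp only [hw, map_sub, map_smul, hSφ, hα]
      rw [smul_assoc, ← smul_sub]
      congr 1
      module
    refine (hdec w s g (hφw s) hwstep).mono ?_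
    have hcross : C₀ * ‖g‖ * ‖w s‖ ≤ c₁ / 2 * ‖w s‖ ^ 2 + (C₀ * C₁) ^ 2 / c₁ * (κ ^ 2 * ‖p s‖ ^ 2) := by
      have h1 : C₀ * ‖g‖ * ‖w s‖ ≤ C₀ * (C₁ * κ * ‖p s‖ + 2 * (C₁ * κ) * ‖w s‖) * ‖w s‖ := by
        gcongr
      have h2 : 2 * C₀ * (C₁ * κ) * ‖w s‖ ^ 2 ≤ c₁ / 4 * ‖w s‖ ^ 2 := by gcongr
      have h3 : C₀ * C₁ * κ * ‖p s‖ * ‖w s‖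
          ≤ c₁ / 4 * ‖w s‖ ^ 2 + (C₀ * C₁) ^ 2 / c₁ * (κ ^ 2 * ‖p s‖ ^ 2) := by
        have h4 : 0 ≤ (c₁ / 2 * ‖w s‖ - C₀ * C₁ * κ * ‖p s‖) ^ 2 / c₁ := by positivity
        have h5 : (c₁ / 2 * ‖w s‖ - C₀ * C₁ * κ * ‖p s‖) ^ 2 / c₁ = c₁ / 4 * ‖w s‖ ^ 2
          + (C₀ * C₁) ^ 2 / c₁ * (κ ^ 2 * ‖p s‖ ^ 2) - C₀ * C₁ * κ * ‖p s‖ * ‖w s‖ := by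
          field_simp; ring
        linarith
      nlinarith
    have hKc : (C₀ * C₁) ^ 2 / c₁ * (κ ^ 2 * ‖p s‖ ^ 2) ≤ K * (κ ^ 2 * ‖p s‖ ^ 2) := by
      gcongr
      rw [hK]
      have : 0 ≤ 2 * C₁ ^ 2 + 4 * (C₁ + 2 * C₁ ^ 2 + 3 * C₁ ^ 3) := by positivity
      linarith
    have hFs := (hFw s).2
    nlinarith
  have hlamK : ‖lam‖ ≤ K * κ ^ 2 := by
    refine hlamn.trans ?_
    gcongr
    rw [hK]
    have : 0 ≤ 4 * (C₁ + 2 * C₁ ^ 2 + 3 * C₁ ^ 3) + (C₀ * C₁) ^ 2 / c₁ := by positivity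
    linarith
  obtain ⟨hmain, hFt⟩ := hslow κ lam p p' F t ht hκ hκ1 hlamK hpc hFc hF0 hpd hpl hFslope
  -- conclusion
  set E := Real.exp (C * κ ^ 2 * t) with hE
  have hE1 : 1 ≤ E := Real.one_le_exp (by positivity)
  have hwn : ∀ s, ‖w s‖ ≤ 2 * ‖u s‖ := fun s => by
    simp only [hw]
    refine (norm_sub_le _ _).trans ?_
    rw [norm_smul, hyp.norm_phi, mul_one]
    have : ‖α s‖ ≤ ‖u s‖ := by
      refine (norm_inner_le_norm _ _).trans ?_
      rw [hyp.norm_phi, one_mul]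
    linarith
  have hα0 : ‖α 0‖ ≤ ‖u 0‖ := by
    refine (norm_inner_le_norm _ _).trans ?_
    rw [hyp.norm_phi, one_mul]
  have hp0 : ‖p 0‖ ≤ (1 + C₁ * κ) * ‖u 0‖ := by
    refine (norm_add_le _ _).trans ?_
    have : ‖inner ℂ η (u 0)‖ ≤ C₁ * κ * ‖u 0‖ := (norm_inner_le_norm _ _).trans (by gcongr)
    linarith
  have hp02 : ‖p 0‖ ≤ 2 * ‖u 0‖ := by
    have : (1 + C₁ * κ) * ‖u 0‖ ≤ 2 * ‖u 0‖ := by gcongr; linarith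
    linarith
  have hE0 : √(‖p 0‖ ^ 2 + F 0) ≤ 4 * ‖u 0‖ := by
    apply Real.sqrt_le_iff.2 ⟨by positivity, ?_⟩
    have h1 := (hFw 0).2
    have h2 := hwn 0
    have h3 : ‖w 0‖ ^ 2 ≤ (2 * ‖u 0‖) ^ 2 := by gcongr
    have h4 : ‖p 0‖ ^ 2 ≤ (2 * ‖u 0‖) ^ 2 := by gcongr
    nlinarith
  have hwt : ‖w t‖ ≤ 8 * E * ‖u 0‖ := by
    refine (hwF t).trans ?_
    have h1 : √(F t) ≤ E * (4 * ‖u 0‖) := by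
      calc √(F t) ≤ √(E ^ 2 * (‖p 0‖ ^ 2 + F 0)) := Real.sqrt_le_sqrt hFt
        _ = E * √(‖p 0‖ ^ 2 + F 0) := by
          rw [Real.sqrt_mul (by positivity), Real.sqrt_sq (by positivity)]
        _ ≤ _ := by gcongr
    linarith
  set E' := Real.exp ((3 * (C + 1) * (1 + C₁) ^ 2 * 3 + 4 * (C + K)) * κ ^ 2 * t) with hE'
  have hEE' : E ≤ E' := by
    apply Real.exp_le_exp.2
    gcongr
    have : 0 ≤ 3 * (C + 1) * (1 + C₁) ^ 2 * 3 := by positivity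
    linarith
  have hlE' : ‖Complex.exp (-lam * t)‖ ≤ E' := by
    rw [Complex.norm_exp]
    apply Real.exp_le_exp.2
    refine (Complex.re_le_norm _).trans ?_
    rw [norm_mul, norm_neg, Complex.norm_real, Real.norm_eq_abs, abs_of_nonneg ht]
    gcongr
    refine hlamK.trans ?_
    gcongr
    have : 0 ≤ 3 * (C + 1) * (1 + C₁) ^ 2 * 3 := by positivity
    linarith
  -- Passing from `p` back to `⟨φ, u⟩` at times `t` and `0` costs `⟨η, ·⟩ = O(κ)`. This is why the
  -- final error starts with `κ` and not with the `κ²` of `slow_fast_estimate`.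
  have e : inner ℂ φ (u t) - Complex.exp (-lam * t) * inner ℂ φ (u 0)
      = (p t - Complex.exp (-lam * t) * p 0) - inner ℂ η (w t)
        + Complex.exp (-lam * t) * inner ℂ η (u 0) := by
    simp only [hp, hα, ← hηu]; ring
  rw [e]
  have f1 : ‖p t - Complex.exp (-lam * t) * p 0‖ ≤ 4 * C * E' * (κ + κ ^ 3 * t) * ‖u 0‖ := by
    refine hmain.trans ?_
    have : κ ^ 2 ≤ κ := by nlinarith
    calc C * E * (κ ^ 2 + κ ^ 3 * t) * √(‖p 0‖ ^ 2 + F 0)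
        ≤ C * E' * (κ + κ ^ 3 * t) * (4 * ‖u 0‖) := by gcongr
      _ = _ := by ring
  have f2 : ‖inner ℂ η (w t)‖ ≤ 8 * C₁ * E' * (κ + κ ^ 3 * t) * ‖u 0‖ := by
    refine (hηw t).trans ?_
    have : 0 ≤ κ ^ 3 * t := by positivity
    calc C₁ * κ * ‖w t‖ ≤ C₁ * (κ + κ ^ 3 * t) * (8 * E' * ‖u 0‖) := by
          gcongr
          · linarith
          · exact hwt.trans (by gcongr)
      _ = _ := by ring
  have f3 : ‖Complex.exp (-lam * t) * inner ℂ η (u 0)‖ ≤ C₁ * E' * (κ + κ ^ 3 * t) * ‖u 0‖ := by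
    rw [norm_mul]
    have h1 : ‖inner ℂ η (u 0)‖ ≤ C₁ * κ * ‖u 0‖ := (norm_inner_le_norm _ _).trans (by gcongr)
    have : 0 ≤ κ ^ 3 * t := by positivity
    calc _ ≤ E' * (C₁ * (κ + κ ^ 3 * t) * ‖u 0‖) := by
          gcongr
          exact h1.trans (by gcongr; linarith)
      _ = _ := by ring
  have hX : 0 ≤ E' * (κ + κ ^ 3 * t) * ‖u 0‖ := by positivity
  have hcoef : 4 * C + 9 * C₁ ≤ 3 * (C + 1) * (1 + C₁) ^ 2 * 3 + 4 * (C + K) := by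
    have : 0 ≤ C * (1 + C₁) ^ 2 := by positivity
    nlinarith
  calc _ ≤ 4 * C * E' * (κ + κ ^ 3 * t) * ‖u 0‖ + 8 * C₁ * E' * (κ + κ ^ 3 * t) * ‖u 0‖
        + C₁ * E' * (κ + κ ^ 3 * t) * ‖u 0‖ := by
        refine (norm_add_le _ _).trans (add_le_add ?_ f3)
        exact (norm_sub_le _ _).trans (add_le_add f1 f2)
    _ = (4 * C + 9 * C₁) * (E' * (κ + κ ^ 3 * t) * ‖u 0‖) := by ring
    _ ≤ (3 * (C + 1) * (1 + C₁) ^ 2 * 3 + 4 * (C + K)) * (E' * (κ + κ ^ 3 * t) * ‖u 0‖) := by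
        gcongr
    _ = _ := by ring

end IsHypocoercive

end Hypocoercive

end MarkovAnderson

end

noncomputable section

namespace MarkovAnderson

/-! ### The Markov property -/

section Markov

variable {d : ℕ} {Ω : Type*} [TopologicalSpace Ω] [MeasurableSpace Ω] {μ : Measure Ω}
  {σ : Lattice d → Ω → Ω} {P : Kernel Ω (RCPath Ω)}

theorem measurable_timeShift (s : ℝ≥0) : Measurable (timeShift (Ω := Ω) s) :=
  Measurable.subtype_mk (measurable_pi_lambda _ fun t => measurable_evalPath (t + s))

theorem timeShift_timeShift {Ω : Type*} [TopologicalSpace Ω] (r s : ℝ≥0) (ω : RCPath Ω) :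
    timeShift r (timeShift s ω) = timeShift (r + s) ω := by
  apply Subtype.ext
  funext t
  simp [timeShift, add_assoc]

theorem measurable_kernel_eval (s : ℝ≥0) : Measurable fun ω : RCPath Ω => P (ω.1 s) :=
  P.measurable.comp (measurable_evalPath s)

theorem IsMarkovFamily.lintegral_timeShift (hP : IsMarkovFamily μ σ P) (a : Ω) (s : ℝ≥0)
    {G : RCPath Ω → ℝ≥0∞} (hG : Measurable G) :
    ∫⁻ ω, G (timeShift s ω) ∂(P a) = ∫⁻ ω, ∫⁻ ω', G ω' ∂(P (ω.1 s)) ∂(P a) := by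
  have h : (P a).map (timeShift s) = (P a).bind (fun ω => P (ω.1 s)) := by
    ext A hA
    rw [Measure.map_apply (measurable_timeShift s) hA,
      Measure.bind_apply hA (measurable_kernel_eval s).aemeasurable, hP.markov a s A hA]
  rw [← lintegral_map hG (measurable_timeShift s), h,
    Measure.lintegral_bind (measurable_kernel_eval s).aemeasurable hG.aemeasurable]

theorem IsMarkovFamily.ae_initial_mem (hP : IsMarkovFamily μ σ P) {a : Ω} {A : Set Ω}
    (hA : MeasurableSet A) (ha : a ∈ A) : ∀ᵐ ω ∂(P a), ω.1 0 ∈ A := by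
  have h : ∀ᵐ b ∂((P a).map (fun ω => ω.1 0)), b ∈ A := by
    rw [hP.initial a, ae_iff]
    exact (Measure.dirac_apply' a hA.compl).trans (by simp [ha])
  exact (ae_map_iff (measurable_evalPath 0).aemeasurable hA).1 h

theorem measurableSet_cylinder (I : Finset ℝ≥0) {A : ℝ≥0 → Set Ω} (hA : ∀ r, MeasurableSet (A r))
    (r₀ : ℝ≥0) : MeasurableSet {ω : RCPath Ω | ∀ r ∈ I, ω.1 (r - r₀) ∈ A r} := by
  have : {ω : RCPath Ω | ∀ r ∈ I, ω.1 (r - r₀) ∈ A r}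
      = ⋂ r ∈ I, (fun ω : RCPath Ω => ω.1 (r - r₀)) ⁻¹' A r := by ext; simp
  rw [this]
  exact Finset.measurableSet_biInter _ fun r _ => measurable_evalPath _ (hA r)

/-- The Markov property for cylinder sets of the past. -/
theorem IsMarkovFamily.markov_cylinder (hP : IsMarkovFamily μ σ P) {A : ℝ≥0 → Set Ω}
    (hA : ∀ r, MeasurableSet (A r)) {D : Set (RCPath Ω)} (hD : MeasurableSet D) (s : ℝ≥0)
    (I : Finset ℝ≥0) : ∀ r₀ : ℝ≥0, r₀ ≤ s → (∀ r ∈ I, r₀ ≤ r) → (∀ r ∈ I, r ≤ s) → ∀ a : Ω,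
      P a ({ω | ∀ r ∈ I, ω.1 (r - r₀) ∈ A r} ∩ timeShift (s - r₀) ⁻¹' D)
        = ∫⁻ ω in {ω | ∀ r ∈ I, ω.1 (r - r₀) ∈ A r}, P (ω.1 (s - r₀)) D ∂(P a) := by
  classical
  -- The earliest time `r` is split off. By the Markov property the path restarts there at `b =
  -- ω_r`, and the constraint at time `r` then holds almost surely or fails almost surely, according
  -- to whether `b ∈ A r`. The origin `r₀` is kept general so that the induction hypothesis applies
  -- to the restarted path.
  induction I using Finset.induction_on_min with
  | empty =>
    intro r₀ _ _ _ a
    simp [hP.markov a _ D hD]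
  | insert r I hI ih =>
    intro r₀ hr₀ h1 h2 a
    have hr₀r : r₀ ≤ r := h1 r (Finset.mem_insert_self r I)
    have hrs : r ≤ s := h2 r (Finset.mem_insert_self r I)
    set C₂ : Set (RCPath Ω) := {ω | ∀ r' ∈ I, ω.1 (r' - r) ∈ A r'} with hC₂
    have hC₂m : MeasurableSet C₂ := measurableSet_cylinder I hA r
    set C₁ : Set (RCPath Ω) := {ω | ω.1 0 ∈ A r} ∩ C₂ with hC₁
    have hC₁m : MeasurableSet C₁ := (measurable_evalPath 0 (hA r)).inter hC₂m
    have hsub : s - r + (r - r₀) = s - r₀ := tsub_add_tsub_cancel hrs hr₀r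
    have hcyl : {ω : RCPath Ω | ∀ r' ∈ insert r I, ω.1 (r' - r₀) ∈ A r'}
        = timeShift (r - r₀) ⁻¹' C₁ := by
      ext ω
      simp only [Finset.mem_insert, forall_eq_or_imp, Set.mem_ofPred_eq, Set.mem_preimage, hC₁,
        hC₂, Set.mem_inter_iff, timeShift, zero_add]
      refine and_congr Iff.rfl (forall₂_congr fun r' hr' => ?_)
      rw [tsub_add_tsub_cancel (hI r' hr').le hr₀r]
    have hshift : timeShift (s - r₀) ⁻¹' D
        = timeShift (r - r₀) ⁻¹' (timeShift (s - r) ⁻¹' D) := by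
      ext ω
      simp only [Set.mem_preimage, timeShift_timeShift, hsub]
    have hg : Measurable fun ω : RCPath Ω => P (ω.1 (s - r)) D :=
      (P.measurable_coe hD).comp (measurable_evalPath _)
    have key : ∀ b, P b (C₁ ∩ timeShift (s - r) ⁻¹' D)
        = ∫⁻ ω, C₁.indicator (fun ω => P (ω.1 (s - r)) D) ω ∂(P b) := by
      intro b
      rw [lintegral_indicator hC₁m]
      by_cases hb : b ∈ A r
      · have hae : C₁ =ᵐ[P b] C₂ := by
          filter_upwards [hP.ae_initial_mem (hA r) hb] with ω hω
          exact propext ⟨fun h => h.2, fun h => ⟨hω, h⟩⟩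
        rw [measure_congr (hae.inter (ae_eq_refl (timeShift (s - r) ⁻¹' D))), setLIntegral_congr hae]
        exact ih r hrs (fun r' hr' => (hI r' hr').le)
          (fun r' hr' => h2 r' (Finset.mem_insert_of_mem hr')) b
      · have hae : C₁ =ᵐ[P b] (∅ : Set (RCPath Ω)) := by
          filter_upwards [hP.ae_initial_mem (hA r).compl hb] with ω hω
          exact propext ⟨fun h => hω h.1, fun h => h.elim⟩
        rw [measure_congr (hae.inter (ae_eq_refl (timeShift (s - r) ⁻¹' D))), setLIntegral_congr hae]
        simp
    rw [hcyl, hshift, ← Set.preimage_inter,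
      hP.markov a _ _ (hC₁m.inter (measurable_timeShift _ hD))]
    simp only [key]
    rw [← hP.lintegral_timeShift a (r - r₀) (hg.indicator hC₁m),
      ← lintegral_indicator (measurable_timeShift _ hC₁m)]
    refine lintegral_congr fun ω => ?_
    simp only [Set.indicator, Set.mem_preimage, timeShift, hsub]

/-- The `σ`-algebra of the past up to time `s`. -/
abbrev past (Ω : Type*) [TopologicalSpace Ω] [MeasurableSpace Ω] (s : ℝ≥0) :
    MeasurableSpace (RCPath Ω) :=
  ⨆ r ∈ Set.Iic s, MeasurableSpace.comap (fun ω : RCPath Ω => ω.1 r) inferInstance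

theorem past_le (s : ℝ≥0) : past Ω s ≤ (inferInstance : MeasurableSpace (RCPath Ω)) :=
  iSup₂_le fun r _ => (measurable_evalPath r).comap_le

theorem past_mono {s t : ℝ≥0} (hst : s ≤ t) : past Ω s ≤ past Ω t :=
  biSup_mono fun _ hr => le_trans hr hst

theorem measurable_past_eval {r s : ℝ≥0} (hrs : r ≤ s) :
    Measurable[past Ω s] fun ω : RCPath Ω => ω.1 r := by
  refine Measurable.mono (comap_measurable _) ?_ le_rfl
  exact le_iSup₂_of_le (f := fun r _ => MeasurableSpace.comap (fun ω : RCPath Ω => ω.1 r) inferInstance)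
    r hrs le_rfl

instance isProbabilityMeasure_jointLaw [IsProbabilityMeasure μ] [IsMarkovKernel P] :
    IsProbabilityMeasure (jointLaw μ P) := by
  unfold jointLaw; infer_instance

/-- The Markov property of the stationary process. -/
theorem IsMarkovFamily.markov_past [IsProbabilityMeasure μ] [IsMarkovKernel P]
    (hP : IsMarkovFamily μ σ P) (s : ℝ≥0) {C D : Set (RCPath Ω)} (hC : MeasurableSet[past Ω s] C)
    (hD : MeasurableSet D) :
    jointLaw μ P (C ∩ timeShift s ⁻¹' D) = ∫⁻ ω in C, P (ω.1 s) D ∂(jointLaw μ P) := by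
  classical
  have hg : Measurable fun ω : RCPath Ω => P (ω.1 s) D :=
    (P.measurable_coe hD).comp (measurable_evalPath _)
  -- As functions of `C` both sides are finite measures. They agree on cylinder sets, which form a
  -- `π`-system generating the past.
  set ν₁ := (jointLaw μ P).restrict (timeShift s ⁻¹' D)
  set ν₂ := (jointLaw μ P).withDensity fun ω => P (ω.1 s) D
  have hDs : MeasurableSet (timeShift s ⁻¹' D) := measurable_timeShift s hD
  have hval : ∀ C, MeasurableSet C → ν₁ C = jointLaw μ P (C ∩ timeShift s ⁻¹' D) ∧
      ν₂ C = ∫⁻ ω in C, P (ω.1 s) D ∂(jointLaw μ P) := fun C hC =>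
    ⟨Measure.restrict_apply hC, withDensity_apply _ hC⟩
  have hcyl : ∀ (I : Finset ℝ≥0) (A : ℝ≥0 → Set Ω), (∀ r, MeasurableSet (A r)) → (∀ r ∈ I, r ≤ s) →
      ν₁ {ω | ∀ r ∈ I, ω.1 r ∈ A r} = ν₂ {ω | ∀ r ∈ I, ω.1 r ∈ A r} := by
    intro I A hA hI
    have hm : MeasurableSet {ω : RCPath Ω | ∀ r ∈ I, ω.1 r ∈ A r} := by
      simpa using measurableSet_cylinder I hA 0
    rw [(hval _ hm).1, (hval _ hm).2, jointLaw,
      Measure.bind_apply (hm.inter hDs) P.measurable.aemeasurable, ← lintegral_indicator hm,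
      Measure.lintegral_bind P.measurable.aemeasurable (hg.indicator hm).aemeasurable]
    refine lintegral_congr fun a => ?_
    rw [lintegral_indicator hm]
    simpa using hP.markov_cylinder hA hD s I 0 zero_le (fun _ _ => zero_le) hI a
  have heq : ν₁.trim (past_le s) = ν₂.trim (past_le s) := by
    refine ext_of_generate_finite
      (piiUnionInter (fun r => {t | MeasurableSet[MeasurableSpace.comap
        (fun ω : RCPath Ω => ω.1 r) inferInstance] t}) (Set.Iic s))
      (generateFrom_piiUnionInter_measurableSet _ _).symm
      (isPiSystem_piiUnionInter _ (fun r => @MeasurableSpace.isPiSystem_measurableSet _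
        (MeasurableSpace.comap (fun ω : RCPath Ω => ω.1 r) inferInstance)) _) ?_ ?_
    · rintro t ⟨I, hI, f, hf, rfl⟩
      have hm : MeasurableSet[past Ω s] (⋂ x ∈ I, f x) := by
        refine @Finset.measurableSet_biInter _ _ (past Ω s) _ I fun r hr => ?_
        exact le_iSup₂ (f := fun r _ => MeasurableSpace.comap (fun ω : RCPath Ω => ω.1 r)
          inferInstance) r (hI hr) _ (hf r hr)
      rw [trim_measurableSet_eq _ hm, trim_measurableSet_eq _ hm]
      choose! A hA hAf using hf
      have e : (⋂ x ∈ I, f x)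
          = {ω : RCPath Ω | ∀ r ∈ I, ω.1 r ∈ (if r ∈ I then A r else Set.univ)} := by
        ext ω
        simp only [Set.mem_iInter, Set.mem_ofPred_eq]
        refine forall₂_congr fun r hr => ?_
        rw [if_pos hr, ← hAf r hr]
        rfl
      rw [e]
      refine hcyl I _ (fun r => ?_) (fun r hr => hI hr)
      split_ifs with hr
      · exact hA r hr
      · exact MeasurableSet.univ
    · rw [trim_measurableSet_eq _ MeasurableSet.univ, trim_measurableSet_eq _ MeasurableSet.univ]
      simpa using hcyl ∅ (fun _ => Set.univ) (fun _ => MeasurableSet.univ) (by simp)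
  rw [← (hval C (past_le s C hC)).1, ← (hval C (past_le s C hC)).2,
    ← trim_measurableSet_eq (past_le s) hC, heq, trim_measurableSet_eq _ hC]

end Markov

end MarkovAnderson

end

noncomputable section

namespace MarkovAnderson

/-! ### The semigroup on `L²(μ)` -/

section SemigroupL2

variable {d : ℕ} {Ω : Type*} [TopologicalSpace Ω] [MeasurableSpace Ω] {μ : Measure Ω}
  {σ : Lattice d → Ω → Ω} {P : Kernel Ω (RCPath Ω)}

/-- The adjoint of `f ↦ f(ω_t)`, that is, the conditional expectation given `ω_t`. -/
def condL2 (hP : IsMarkovFamily μ σ P) (t : ℝ≥0) : Lp ℂ 2 (jointLaw μ P) →L[ℂ] Lp ℂ 2 μ :=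
  ContinuousLinearMap.adjoint (evalL2 hP t)

theorem adjSemigroup_apply (hP : IsMarkovFamily μ σ P) (t : ℝ≥0) (f : Lp ℂ 2 μ) :
    adjSemigroup hP t f = condL2 hP t (evalL2 hP 0 f) := rfl

theorem evalL2_apply (hP : IsMarkovFamily μ σ P) (t : ℝ≥0) (f : Lp ℂ 2 μ) :
    evalL2 hP t f = Lp.compMeasurePreserving _ (hP.measurePreserving_eval t) f := rfl

theorem coeFn_evalL2 (hP : IsMarkovFamily μ σ P) (t : ℝ≥0) (f : Lp ℂ 2 μ) :
    evalL2 hP t f =ᵐ[jointLaw μ P] fun ω => f (ω.1 t) :=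
  Lp.coeFn_compMeasurePreserving f (hP.measurePreserving_eval t)

theorem norm_evalL2 (hP : IsMarkovFamily μ σ P) (t : ℝ≥0) (f : Lp ℂ 2 μ) :
    ‖evalL2 hP t f‖ = ‖f‖ :=
  Lp.norm_compMeasurePreserving f (hP.measurePreserving_eval t)

theorem inner_evalL2 (hP : IsMarkovFamily μ σ P) (t : ℝ≥0) (f g : Lp ℂ 2 μ) :
    inner ℂ (evalL2 hP t f) (evalL2 hP t g) = inner ℂ f g :=
  (Lp.compMeasurePreservingₗᵢ ℂ (fun ω : RCPath Ω => ω.1 t)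
    (hP.measurePreserving_eval t)).inner_map_map f g

theorem inner_condL2 (hP : IsMarkovFamily μ σ P) (t : ℝ≥0) (f : Lp ℂ 2 μ)
    (X : Lp ℂ 2 (jointLaw μ P)) : inner ℂ f (condL2 hP t X) = inner ℂ (evalL2 hP t f) X :=
  ContinuousLinearMap.adjoint_inner_right _ _ _

theorem inner_condL2_left (hP : IsMarkovFamily μ σ P) (t : ℝ≥0) (f : Lp ℂ 2 μ)
    (X : Lp ℂ 2 (jointLaw μ P)) : inner ℂ (condL2 hP t X) f = inner ℂ X (evalL2 hP t f) :=
  ContinuousLinearMap.adjoint_inner_left _ _ _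

theorem condL2_evalL2 (hP : IsMarkovFamily μ σ P) (t : ℝ≥0) (f : Lp ℂ 2 μ) :
    condL2 hP t (evalL2 hP t f) = f :=
  ext_inner_left ℂ fun g => by rw [inner_condL2, inner_evalL2]

theorem norm_condL2_le (hP : IsMarkovFamily μ σ P) (t : ℝ≥0) (X : Lp ℂ 2 (jointLaw μ P)) :
    ‖condL2 hP t X‖ ≤ ‖X‖ := by
  have h : ‖condL2 hP t‖ ≤ 1 := by
    unfold condL2
    rw [LinearIsometryEquiv.norm_map]
    exact ContinuousLinearMap.opNorm_le_bound _ zero_le_one fun f => by rw [norm_evalL2, one_mul]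
  calc ‖condL2 hP t X‖ ≤ ‖condL2 hP t‖ * ‖X‖ := ContinuousLinearMap.le_opNorm _ _
    _ ≤ 1 * ‖X‖ := by gcongr
    _ = _ := one_mul _

theorem norm_adjSemigroup_le (hP : IsMarkovFamily μ σ P) (t : ℝ≥0) (f : Lp ℂ 2 μ) :
    ‖adjSemigroup hP t f‖ ≤ ‖f‖ := by
  rw [adjSemigroup_apply]
  exact (norm_condL2_le _ _ _).trans (norm_evalL2 _ _ _).le

theorem adjSemigroup_zero (hP : IsMarkovFamily μ σ P) (f : Lp ℂ 2 μ) : adjSemigroup hP 0 f = f := by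
  rw [adjSemigroup_apply, condL2_evalL2]

theorem evalL2_indicatorConstLp (hP : IsMarkovFamily μ σ P) (t : ℝ≥0) {A : Set Ω}
    (hA : MeasurableSet A) (hμA : μ A ≠ ∞) (c : ℂ) (hμA' : jointLaw μ P ((fun ω => ω.1 t) ⁻¹' A) ≠ ∞) :
    evalL2 hP t (indicatorConstLp 2 hA hμA c)
      = indicatorConstLp 2 (measurable_evalPath t hA) hμA' c := by
  rw [evalL2_apply, Lp.indicatorConstLp_compMeasurePreserving]

theorem indicatorConstLp_eq_smul {α : Type*} [MeasurableSpace α] {ν : Measure α} {C : Set α}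
    (hC : MeasurableSet C) (hν : ν C ≠ ∞) (c : ℂ) :
    indicatorConstLp 2 hC hν c = c • indicatorConstLp 2 hC hν (1 : ℂ) := by
  refine Lp.ext ?_
  filter_upwards [indicatorConstLp_coeFn (hs := hC) (hμs := hν) (c := c) (p := 2),
    indicatorConstLp_coeFn (hs := hC) (hμs := hν) (c := (1 : ℂ)) (p := 2),
    Lp.coeFn_smul c (indicatorConstLp 2 hC hν (1 : ℂ))] with ω h1 h2 h3
  rw [h1, h3, Pi.smul_apply, h2]
  by_cases hω : ω ∈ C <;> simp [hω]

theorem aestronglyMeasurable_past_evalL2 (hP : IsMarkovFamily μ σ P) {r s : ℝ≥0} (hrs : r ≤ s)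
    (f : Lp ℂ 2 μ) : AEStronglyMeasurable[past Ω s] (evalL2 hP r f) (jointLaw μ P) :=
  ⟨fun ω => f (ω.1 r), (Lp.stronglyMeasurable f).comp_measurable (measurable_past_eval hrs),
    coeFn_evalL2 hP r f⟩

theorem isClosed_setOf_tendsto_evalL2 (hP : IsMarkovFamily μ σ P) :
    IsClosed {f : Lp ℂ 2 μ |
      Tendsto (fun h : ℝ≥0 => evalL2 hP h f) (𝓝[>] 0) (𝓝 (evalL2 hP 0 f))} := by
  refine isClosed_of_closure_subset fun f hf => ?_
  rw [Set.mem_ofPred_eq, Metric.tendsto_nhds]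
  intro ε hε
  obtain ⟨g, hg, hfg⟩ := Metric.mem_closure_iff.1 hf (ε / 3) (by positivity)
  rw [Set.mem_ofPred_eq, Metric.tendsto_nhds] at hg
  filter_upwards [hg (ε / 3) (by positivity)] with h hh
  have h1 : ∀ t, dist (evalL2 hP t f) (evalL2 hP t g) = dist f g := fun t => by
    rw [dist_eq_norm, dist_eq_norm, ← map_sub, norm_evalL2]
  have h2 := dist_triangle4 (evalL2 hP h f) (evalL2 hP h g) (evalL2 hP 0 g) (evalL2 hP 0 f)
  rw [h1, dist_comm (evalL2 hP 0 g), h1] at h2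
  linarith

variable [IsProbabilityMeasure μ]

theorem lp_ext_setIntegral {Ω : Type*} [MeasurableSpace Ω] {μ : Measure Ω}
    [IsProbabilityMeasure μ] {f g : Lp ℂ 2 μ}
    (h : ∀ s : Set Ω, MeasurableSet s → ∫ x in s, f x ∂μ = ∫ x in s, g x ∂μ) : f = g := by
  refine Lp.ext (Lp.ae_eq_of_forall_setIntegral_eq f g (by simp) (by simp) ?_ ?_ fun s hs _ => h s hs)
  · exact fun s _ _ => ((Lp.memLp f).integrable (by norm_num)).integrableOn
  · exact fun s _ _ => ((Lp.memLp g).integrable (by norm_num)).integrableOn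

variable [IsMarkovKernel P]

/-- The transition probability as an element of `L²(μ)`. -/
theorem condL2_zero_evalL2_indicator (hP : IsMarkovFamily μ σ P) (h : ℝ≥0) {A : Set Ω}
    (hA : MeasurableSet A) :
    condL2 hP 0 (evalL2 hP h (indicatorConstLp 2 hA (measure_ne_top μ A) (1 : ℂ)))
      =ᵐ[μ] fun a => (((P a).real ((fun ω => ω.1 h) ⁻¹' A) : ℝ) : ℂ) := by
  set D : Set (RCPath Ω) := (fun ω => ω.1 h) ⁻¹' A with hD
  have hDm : MeasurableSet D := measurable_evalPath h hA
  have hkm : Measurable fun a => P a D := P.measurable_coe hDm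
  have hkm' : Measurable fun a => (((P a).real D : ℝ) : ℂ) :=
    Complex.measurable_ofReal.comp hkm.ennreal_toReal
  have hk : MemLp (fun a => (((P a).real D : ℝ) : ℂ)) 2 μ := by
    refine MemLp.of_bound hkm'.aestronglyMeasurable 1 (Eventually.of_forall fun a => ?_)
    rw [Complex.norm_real, Real.norm_of_nonneg measureReal_nonneg]
    exact measureReal_le_one
  suffices H : condL2 hP 0 (evalL2 hP h (indicatorConstLp 2 hA (measure_ne_top μ A) (1 : ℂ)))
      = hk.toLp _ by rw [H]; exact hk.coeFn_toLp
  refine lp_ext_setIntegral fun B hB => ?_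
  rw [← L2.inner_indicatorConstLp_one hB (measure_ne_top μ B), inner_condL2,
    evalL2_indicatorConstLp hP 0 hB _ _ (measure_ne_top _ _),
    evalL2_indicatorConstLp hP h hA _ _ (measure_ne_top _ _),
    L2.inner_indicatorConstLp_indicatorConstLp,
    setIntegral_congr_ae hB (hk.coeFn_toLp.mono fun a ha _ => ha), integral_complex_ofReal]
  have h1 := hP.markov_past 0 (C := (fun ω : RCPath Ω => ω.1 0) ⁻¹' B) (D := D)
    (measurable_past_eval le_rfl hB) hDm
  have h2 : timeShift 0 ⁻¹' D = D := by
    ext ω; simp [hD, timeShift]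
  have h3 : ∫⁻ ω in (fun ω : RCPath Ω => ω.1 0) ⁻¹' B, P (ω.1 0) D ∂(jointLaw μ P)
      = ∫⁻ a in B, P a D ∂μ :=
    (hP.measurePreserving_eval 0).setLIntegral_comp_preimage hB hkm
  rw [h2, h3] at h1
  simp only [Measure.real]
  rw [integral_toReal hkm.aemeasurable (Eventually.of_forall fun a => measure_lt_top _ _), ← hD, h1]
  simp

/-- The Markov property in terms of conditional expectations. -/
theorem condL2_add (hP : IsMarkovFamily μ σ P) (s h : ℝ≥0) (X : Lp ℂ 2 (jointLaw μ P))
    (hX : AEStronglyMeasurable[past Ω s] X (jointLaw μ P)) :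
    condL2 hP (s + h) X = adjSemigroup hP h (condL2 hP s X) := by
  refine Lp.induction_stronglyMeasurable (past_le s) ENNReal.ofNat_ne_top
    (fun X => condL2 hP (s + h) X = adjSemigroup hP h (condL2 hP s X)) ?_ ?_ ?_ X hX
  · intro c C hC hμC
    rw [Lp.simpleFunc.coe_indicatorConst]
    have hCm : MeasurableSet C := past_le s C hC
    rw [indicatorConstLp_eq_smul, map_smul, map_smul, map_smul]
    congr 1
    refine lp_ext_setIntegral fun A hA => ?_
    set D : Set (RCPath Ω) := (fun ω => ω.1 h) ⁻¹' A with hD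
    have hDm : MeasurableSet D := measurable_evalPath h hA
    have hkm : Measurable fun a => P a D := P.measurable_coe hDm
    set κ := condL2 hP 0 (evalL2 hP h (indicatorConstLp 2 hA (measure_ne_top μ A) (1 : ℂ))) with hκ
    have hκs : evalL2 hP s κ =ᵐ[jointLaw μ P] fun ω => (((P (ω.1 s)).real D : ℝ) : ℂ) := by
      filter_upwards [coeFn_evalL2 hP s κ, (hP.measurePreserving_eval s).quasiMeasurePreserving.ae
        (condL2_zero_evalL2_indicator hP h hA)] with ω h1 h2
      rw [h1, hκ, h2]
    -- By duality, pairing the right-hand side with `1_A` amounts to integrating the transition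
    -- probability `P_{ω_s}(ω_h ∈ A)` over `C`, which `markov_past` identifies with the probability
    -- of `C ∩ {ω_{s+h} ∈ A}`.
    have e1 : inner ℂ (evalL2 hP h (indicatorConstLp 2 hA (measure_ne_top μ A) (1 : ℂ)))
        (evalL2 hP 0 (condL2 hP s (indicatorConstLp 2 hCm hμC.ne (1 : ℂ))))
        = (starRingEnd ℂ) (∫ ω in C, evalL2 hP s κ ω ∂(jointLaw μ P)) := by
      rw [← L2.inner_indicatorConstLp_one hCm hμC.ne, inner_conj_symm,
        ← inner_condL2 hP s κ (indicatorConstLp 2 hCm hμC.ne (1 : ℂ)), hκ,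
        inner_condL2_left]
    rw [← L2.inner_indicatorConstLp_one hA (measure_ne_top μ A),
      ← L2.inner_indicatorConstLp_one hA (measure_ne_top μ A), inner_condL2, adjSemigroup_apply,
      inner_condL2, e1, evalL2_indicatorConstLp hP (s + h) hA _ _ (measure_ne_top _ _),
      L2.inner_indicatorConstLp_indicatorConstLp,
      setIntegral_congr_ae hCm (hκs.mono fun a ha _ => ha), integral_complex_ofReal]
    have h1 := hP.markov_past s hC hDm
    have h2 : timeShift s ⁻¹' D = (fun ω : RCPath Ω => ω.1 (s + h)) ⁻¹' A := by
      ext ω; simp [hD, timeShift, add_comm]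
    rw [h2, Set.inter_comm] at h1
    simp only [Measure.real]
    have hkm₂ : Measurable fun ω : RCPath Ω => P (ω.1 s) D := hkm.comp (measurable_evalPath s)
    rw [integral_toReal hkm₂.aemeasurable
      (Eventually.of_forall fun a => measure_lt_top _ _), h1]
    simp
  · intro f g hf hg _ _ _ hf' hg'
    rw [map_add, map_add, map_add, hf', hg']
  · exact isClosed_eq (by fun_prop) (by fun_prop)

theorem condL2_add_evalL2 (hP : IsMarkovFamily μ σ P) (s h : ℝ≥0) (f : Lp ℂ 2 μ) :
    condL2 hP (s + h) (evalL2 hP s f) = adjSemigroup hP h f := by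
  rw [condL2_add hP s h _ (aestronglyMeasurable_past_evalL2 hP le_rfl f), condL2_evalL2]

theorem adjSemigroup_add (hP : IsMarkovFamily μ σ P) (s h : ℝ≥0) (f : Lp ℂ 2 μ) :
    adjSemigroup hP (s + h) f = adjSemigroup hP h (adjSemigroup hP s f) := by
  rw [adjSemigroup_apply, condL2_add hP s h _ (aestronglyMeasurable_past_evalL2 hP zero_le f),
    ← adjSemigroup_apply]

/-- The constant function `1` in `L²`. -/
def oneL2 {Ω : Type*} [MeasurableSpace Ω] (μ : Measure Ω) [IsProbabilityMeasure μ] : Lp ℂ 2 μ :=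
  indicatorConstLp 2 MeasurableSet.univ (measure_ne_top μ _) 1

theorem inner_oneL2 {Ω : Type*} [MeasurableSpace Ω] {μ : Measure Ω} [IsProbabilityMeasure μ]
    (f : Lp ℂ 2 μ) : inner ℂ (oneL2 μ) f = ∫ a, f a ∂μ := by
  rw [oneL2, L2.inner_indicatorConstLp_one, setIntegral_univ]

theorem norm_oneL2 {Ω : Type*} [MeasurableSpace Ω] {μ : Measure Ω} [IsProbabilityMeasure μ] :
    ‖oneL2 μ‖ = 1 := by
  rw [oneL2, norm_indicatorConstLp (by simp) (by simp)]
  simp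

theorem coeFn_oneL2 {Ω : Type*} [MeasurableSpace Ω] {μ : Measure Ω} [IsProbabilityMeasure μ] :
    oneL2 μ =ᵐ[μ] fun _ => (1 : ℂ) := by
  refine indicatorConstLp_coeFn.trans ?_
  simp

theorem evalL2_oneL2 (hP : IsMarkovFamily μ σ P) (t : ℝ≥0) :
    evalL2 hP t (oneL2 μ) = oneL2 (jointLaw μ P) := by
  rw [oneL2, evalL2_indicatorConstLp hP t _ _ _ (measure_ne_top _ _)]
  rfl

theorem adjSemigroup_oneL2 (hP : IsMarkovFamily μ σ P) (t : ℝ≥0) :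
    adjSemigroup hP t (oneL2 μ) = oneL2 μ := by
  rw [adjSemigroup_apply, evalL2_oneL2, ← evalL2_oneL2 hP t, condL2_evalL2]

theorem inner_oneL2_adjSemigroup (hP : IsMarkovFamily μ σ P) (t : ℝ≥0) (f : Lp ℂ 2 μ) :
    inner ℂ (oneL2 μ) (adjSemigroup hP t f) = inner ℂ (oneL2 μ) f := by
  rw [adjSemigroup_apply, inner_condL2, evalL2_oneL2, ← evalL2_oneL2 hP 0, inner_evalL2]

/-- For open `A`, right-continuity of paths gives `1_A(ω_h) 1_A(ω_0) → 1_A(ω_0)`. By stationarity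
both indicators have the same `L²` norm, so convergence of the inner products is convergence in
norm. The property passes to complements and, by closedness, to countable disjoint unions, hence to
all Borel sets without any metric on `Ω`. -/
theorem tendsto_evalL2_indicator [BorelSpace Ω] (hP : IsMarkovFamily μ σ P) {A : Set Ω}
    (hA : MeasurableSet A) :
    Tendsto (fun h : ℝ≥0 => evalL2 hP h (indicatorConstLp 2 hA (measure_ne_top μ A) (1 : ℂ)))
      (𝓝[>] 0) (𝓝 (evalL2 hP 0 (indicatorConstLp 2 hA (measure_ne_top μ A) (1 : ℂ)))) := by
  induction A, hA using MeasurableSet.induction_on_open with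
  | isOpen A hA =>
    set f := indicatorConstLp 2 hA.measurableSet (measure_ne_top μ A) (1 : ℂ) with hf
    have h1 : Tendsto (fun h : ℝ≥0 => (jointLaw μ P).real ((fun ω : RCPath Ω => ω.1 h) ⁻¹' A ∩
        (fun ω : RCPath Ω => ω.1 0) ⁻¹' A)) (𝓝[>] 0)
        (𝓝 ((jointLaw μ P).real ((fun ω : RCPath Ω => ω.1 0) ⁻¹' A))) := by
      refine (ENNReal.tendsto_toReal (measure_ne_top _ _)).comp
        (tendsto_measure_of_tendsto_indicator_of_isFiniteMeasure _ _ (fun h =>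
          (measurable_evalPath h hA.measurableSet).inter (measurable_evalPath 0 hA.measurableSet))
          fun ω => ?_)
      by_cases hω : ω.1 0 ∈ A
      · have h2 : Tendsto ω.1 (𝓝[>] 0) (𝓝 (ω.1 0)) :=
          (ω.2 0).mono_left (nhdsWithin_mono _ Set.Ioi_subset_Ici_self)
        filter_upwards [h2.eventually (hA.mem_nhds hω)] with h hh
        have hh' : ω.1 h ∈ A := hh
        simp [hω, hh']
      · exact Eventually.of_forall fun h => by simp [hω]
    have h2 : ∀ h, inner ℂ (evalL2 hP h f) (evalL2 hP 0 f)
        = (((jointLaw μ P).real ((fun ω : RCPath Ω => ω.1 h) ⁻¹' A ∩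
        (fun ω : RCPath Ω => ω.1 0) ⁻¹' A) : ℝ) : ℂ) := fun h => by
      rw [hf, evalL2_indicatorConstLp hP h _ _ _ (measure_ne_top _ _),
        evalL2_indicatorConstLp hP 0 _ _ _ (measure_ne_top _ _),
        L2.inner_indicatorConstLp_indicatorConstLp]
      simp
    have h3 : (jointLaw μ P).real ((fun ω : RCPath Ω => ω.1 0) ⁻¹' A) = ‖f‖ ^ 2 := by
      have := h2 0
      rw [Set.inter_self] at this
      have h3 := congrArg Complex.re this
      rw [Complex.ofReal_re] at h3
      rw [← h3, ← norm_evalL2 hP 0 f]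
      exact inner_self_eq_norm_sq (𝕜 := ℂ) _
    rw [tendsto_iff_norm_sub_tendsto_zero]
    have h4 : Tendsto (fun h : ℝ≥0 => ‖evalL2 hP h f - evalL2 hP 0 f‖ ^ 2) (𝓝[>] 0) (𝓝 0) := by
      have h5 := (h1.const_mul 2).const_sub (2 * ‖f‖ ^ 2)
      rw [h3, sub_self] at h5
      refine h5.congr fun h => ?_
      rw [norm_sub_sq (𝕜 := ℂ), h2, norm_evalL2, norm_evalL2]
      simp only [RCLike.re_eq_complex_re, Complex.ofReal_re]
      ring
    have h6 := h4.sqrt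
    simpa using h6
  | compl A hA ih =>
    have e : indicatorConstLp 2 hA.compl (measure_ne_top μ Aᶜ) (1 : ℂ)
        = oneL2 μ - indicatorConstLp 2 hA (measure_ne_top μ A) (1 : ℂ) := by
      rw [eq_sub_iff_add_eq, ← indicatorConstLp_disjoint_union _ _ _ _ disjoint_compl_left]
      simp only [Set.compl_union_self]
      rfl
    rw [e]
    simp only [map_sub, evalL2_oneL2]
    exact tendsto_const_nhds.sub ih
  | iUnion f hd hf ih =>
    have hB : ∀ N : ℕ, MeasurableSet (⋃ i ∈ Finset.range N, f i) := fun N =>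
      Finset.measurableSet_biUnion _ fun i _ => hf i
    have hN : ∀ N : ℕ, indicatorConstLp 2 (hB N) (measure_ne_top μ _) (1 : ℂ) ∈
        {f : Lp ℂ 2 μ | Tendsto (fun h : ℝ≥0 => evalL2 hP h f) (𝓝[>] 0) (𝓝 (evalL2 hP 0 f))} := by
      intro N
      induction N with
      | zero =>
        simp only [Finset.range_zero, Finset.notMem_empty, Set.iUnion_of_empty, Set.iUnion_empty,
          indicatorConstLp_empty, Set.mem_ofPred_eq, map_zero]
        exact tendsto_const_nhds
      | succ N ihN =>
        have hdis : Disjoint (f N) (⋃ i ∈ Finset.range N, f i) := by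
          rw [Set.disjoint_iUnion₂_right]
          intro i hi
          exact hd (Finset.mem_range.1 hi).ne'
        simp only [Finset.range_add_one, Finset.mem_insert, Set.iUnion_iUnion_eq_or_left]
        rw [indicatorConstLp_disjoint_union (hf N) (hB N) (measure_ne_top _ _) (measure_ne_top _ _)
          hdis, Set.mem_ofPred_eq]
        simp only [map_add]
        exact (ih N).add ihN
    refine (isClosed_setOf_tendsto_evalL2 hP).mem_of_tendsto (b := atTop)
      (tendsto_indicatorConstLp_set (ht := hB) (hμt := fun N => measure_ne_top μ _) (by simp) ?_)
      (Eventually.of_forall hN)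
    have := tendsto_measure_of_tendsto_indicator_of_isFiniteMeasure (A := ∅) atTop μ
      (As := fun N : ℕ => symmDiff (⋃ i ∈ Finset.range N, f i) (⋃ i, f i))
      (fun N => (hB N).symmDiff (MeasurableSet.iUnion hf)) fun x => ?_
    · simpa using this
    · by_cases hx : ∃ i, x ∈ f i
      · obtain ⟨i, hi⟩ := hx
        filter_upwards [eventually_gt_atTop i] with N hN
        have h1 : x ∈ ⋃ i ∈ Finset.range N, f i := by
          simp only [Set.mem_iUnion, Finset.mem_range]
          exact ⟨i, hN, hi⟩
        have h2 : x ∈ ⋃ i, f i := Set.mem_iUnion.2 ⟨i, hi⟩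
        exact iff_of_false (fun h => by
          rcases h with ⟨ha, hb⟩ | ⟨ha, hb⟩ <;>
            first | exact hb h1 | exact hb h2) (Set.notMem_empty x)
      · refine Eventually.of_forall fun N => ?_
        have h2 : x ∉ ⋃ i, f i := fun h => hx (Set.mem_iUnion.1 h)
        have h1 : x ∉ ⋃ i ∈ Finset.range N, f i := fun h => by
          simp only [Set.mem_iUnion] at h
          obtain ⟨i, _, hi⟩ := h
          exact hx ⟨i, hi⟩
        exact iff_of_false (fun h => by
          rcases h with ⟨ha, hb⟩ | ⟨ha, hb⟩ <;>
            first | exact h1 ha | exact h2 ha) (Set.notMem_empty x)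

/-- The process is continuous in `L²` at time `0`. -/
theorem tendsto_evalL2 [BorelSpace Ω] (hP : IsMarkovFamily μ σ P) (f : Lp ℂ 2 μ) :
    Tendsto (fun h : ℝ≥0 => evalL2 hP h f) (𝓝[>] 0) (𝓝 (evalL2 hP 0 f)) := by
  refine Lp.induction (p := 2) ENNReal.ofNat_ne_top (motive := fun f : Lp ℂ 2 μ =>
    Tendsto (fun h : ℝ≥0 => evalL2 hP h f) (𝓝[>] 0) (𝓝 (evalL2 hP 0 f))) ?_ ?_
    (isClosed_setOf_tendsto_evalL2 hP) f
  · intro c A hA hμA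
    rw [Lp.simpleFunc.coe_indicatorConst]
    rw [indicatorConstLp_eq_smul]
    simp only [map_smul]
    exact (tendsto_evalL2_indicator hP hA).const_smul c
  · intro f g hf hg _ hf' hg'
    simp only [map_add]
    exact hf'.add hg'

theorem tendsto_adjSemigroup [BorelSpace Ω] (hP : IsMarkovFamily μ σ P) (f : Lp ℂ 2 μ) :
    Tendsto (fun h : ℝ≥0 => adjSemigroup hP h f) (𝓝[>] 0) (𝓝 f) := by
  rw [tendsto_iff_norm_sub_tendsto_zero]
  have h := (tendsto_iff_norm_sub_tendsto_zero.1 (tendsto_evalL2 hP f))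
  refine squeeze_zero (fun _ => norm_nonneg _) (fun t => ?_) h
  calc ‖adjSemigroup hP t f - f‖ = ‖condL2 hP t (evalL2 hP 0 f - evalL2 hP t f)‖ := by
        rw [map_sub, condL2_evalL2, adjSemigroup_apply]
    _ ≤ ‖evalL2 hP 0 f - evalL2 hP t f‖ := norm_condL2_le _ _ _
    _ = _ := norm_sub_rev _ _

/-- The process is right-continuous in `L²`. -/
theorem tendsto_evalL2_add [BorelSpace Ω] (hP : IsMarkovFamily μ σ P) (t : ℝ≥0) (f : Lp ℂ 2 μ) :
    Tendsto (fun h : ℝ≥0 => evalL2 hP (t + h) f) (𝓝[>] 0) (𝓝 (evalL2 hP t f)) := by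
  rw [tendsto_iff_norm_sub_tendsto_zero]
  -- Expanding the square leaves only `⟨f, S_h† f⟩`, so continuity at time `t` reduces to continuity
  -- of the semigroup at `0`.
  have h1 : ∀ h, ‖evalL2 hP (t + h) f - evalL2 hP t f‖ ^ 2
      = 2 * ‖f‖ ^ 2 - 2 * (inner ℂ f (adjSemigroup hP h f)).re := fun h => by
    rw [norm_sub_sq (𝕜 := ℂ), norm_evalL2, norm_evalL2, ← inner_condL2, condL2_add_evalL2]
    simp only [RCLike.re_eq_complex_re]
    ring
  have h2 : Tendsto (fun h : ℝ≥0 => ‖evalL2 hP (t + h) f - evalL2 hP t f‖ ^ 2) (𝓝[>] 0) (𝓝 0) := by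
    simp only [h1]
    have h3 := (((Complex.continuous_re.tendsto _).comp
      ((tendsto_const_nhds (x := f)).inner (𝕜 := ℂ) (tendsto_adjSemigroup hP f))).const_mul
        2).const_sub (2 * ‖f‖ ^ 2)
    have h4 : 2 * ‖f‖ ^ 2 - 2 * (inner ℂ f f).re = 0 := by
      have := inner_self_eq_norm_sq (𝕜 := ℂ) f
      rw [RCLike.re_eq_complex_re] at this
      rw [this, sub_self]
    rw [h4] at h3
    exact h3
  have h6 := h2.sqrt
  simpa using h6

end SemigroupL2

end MarkovAnderson

end

noncomputable section

namespace MarkovAnderson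

/-! ### Contraction semigroups with a spectral gap -/

section Gapped

variable {X : Type*} [NormedAddCommGroup X] [InnerProductSpace ℂ X]

/-- `g = B f` for the generator `-B` of the semigroup `S`. -/
def HasGenerator (S : ℝ → X →L[ℂ] X) (f g : X) : Prop :=
  Tendsto (fun h : ℝ => h⁻¹ • (f - S h f)) (𝓝[>] 0) (𝓝 g)

/-- A strongly continuous contraction semigroup which fixes the unit vector `e`, and whose generator
has the gap `1 / T` on the complement of `e`. -/
structure IsGapped (S : ℝ → X →L[ℂ] X) (e : X) (T : ℝ) : Prop where
  T_pos : 0 < T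
  norm_e : ‖e‖ = 1
  of_nonpos : ∀ t, t ≤ 0 → ∀ f, S t f = f
  add : ∀ s t, 0 ≤ s → 0 ≤ t → ∀ f, S (s + t) f = S s (S t f)
  norm_le : ∀ t f, ‖S t f‖ ≤ ‖f‖
  tendsto : ∀ f, Tendsto (fun h => S h f) (𝓝[>] 0) (𝓝 f)
  apply_e : ∀ t, S t e = e
  inner_e : ∀ t f, inner ℂ e (S t f) = inner ℂ e f
  gap : ∀ f g, HasGenerator S f g → inner ℂ e f = 0 → ‖f‖ ^ 2 ≤ T * (inner ℂ f g).re

namespace IsGapped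

variable {S : ℝ → X →L[ℂ] X} {e : X} {T : ℝ}

theorem apply_comm (hS : IsGapped S e T) {s t : ℝ} (hs : 0 ≤ s) (ht : 0 ≤ t) (f : X) :
    S s (S t f) = S t (S s f) := by
  rw [← hS.add s t hs ht, ← hS.add t s ht hs, add_comm]

theorem continuous_apply (hS : IsGapped S e T) (f : X) : Continuous fun t => S t f := by
  have hm : Tendsto (fun r : ℝ => ‖f - S |r| f‖) (𝓝 0) (𝓝 0) := by
    have h1 : Tendsto (fun r : ℝ => ‖f - S r f‖) (𝓝[≥] 0) (𝓝 0) := by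
      rw [← Set.Ioi_union_left, nhdsWithin_union, tendsto_sup]
      constructor
      · have := ((hS.tendsto f).const_sub f).norm
        simpa using this
      · rw [nhdsWithin_singleton, tendsto_pure_left]
        intro s hs
        simpa [hS.of_nonpos 0 le_rfl] using mem_of_mem_nhds hs
    refine h1.comp (tendsto_nhdsWithin_iff.2 ⟨?_, Eventually.of_forall fun r => abs_nonneg r⟩)
    simpa using (continuous_abs.tendsto (0 : ℝ))
  have key : ∀ a b : ℝ, 0 ≤ a → a ≤ b → ‖S b f - S a f‖ ≤ ‖f - S |b - a| f‖ := by
    intro a b ha hab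
    have : S b f = S a (S (b - a) f) := by
      rw [← hS.add a (b - a) ha (by linarith)]; congr 2; ring
    rw [this, ← map_sub, abs_of_nonneg (by linarith), norm_sub_rev f]
    exact hS.norm_le _ _
  have key2 : ∀ a b : ℝ, 0 ≤ a → 0 ≤ b → ‖S b f - S a f‖ ≤ ‖f - S |b - a| f‖ := by
    intro a b ha hb
    rcases le_total a b with h | h
    · exact key a b ha h
    · rw [norm_sub_rev, abs_sub_comm]; exact key b a hb h
  have hon : Continuous fun t : ℝ => S (max t 0) f := by
    rw [continuous_iff_continuousAt]
    intro a
    rw [ContinuousAt, tendsto_iff_norm_sub_tendsto_zero]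
    refine squeeze_zero (fun _ => norm_nonneg _)
      (fun b => key2 (max a 0) (max b 0) (le_max_right _ _) (le_max_right _ _)) ?_
    refine hm.comp ?_
    have : Continuous fun b : ℝ => max b 0 - max a 0 := by fun_prop
    simpa using this.tendsto a
  refine hon.congr fun t => ?_
  rcases le_total t 0 with h | h
  · rw [max_eq_right h, hS.of_nonpos t h, hS.of_nonpos 0 le_rfl]
  · rw [max_eq_left h]

theorem norm_sub_mean_le (hS : IsGapped S e T) (f : X) : ‖f - inner ℂ e f • e‖ ≤ ‖f‖ :=
  norm_sub_inner_smul_le hS.norm_e f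

theorem inner_e_sub_mean (hS : IsGapped S e T) (f : X) : inner ℂ e (f - inner ℂ e f • e) = 0 := by
  rw [inner_sub_right, inner_smul_right, inner_self_eq_norm_sq_to_K, hS.norm_e]
  simp

/-- The semigroup preserves the domain of its generator, and along the orbit `‖S t f‖²` has right
derivative `-2 Re⟨S t f, B S t f⟩ ≤ -(2/T)‖S t f‖²`; Gronwall gives the rate. -/
theorem norm_apply_le_of_generator (hS : IsGapped S e T) {f g : X} (hf : inner ℂ e f = 0)
    (hg : HasGenerator S f g) {t : ℝ} (ht : 0 ≤ t) : ‖S t f‖ ≤ Real.exp (-(t / T)) * ‖f‖ := by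
  have hT := hS.T_pos
  have hstep : ∀ s, 0 ≤ s → Tendsto (fun h : ℝ => h⁻¹ • (S (s + h) f - S s f)) (𝓝[>] 0)
      (𝓝 (-S s g)) := by
    intro s hs
    have h1 : Tendsto (fun h : ℝ => -S s (h⁻¹ • (f - S h f))) (𝓝[>] 0) (𝓝 (-S s g)) :=
      (((S s).continuous.tendsto g).comp hg).neg
    refine h1.congr' ?_
    filter_upwards [self_mem_nhdsWithin] with h hh
    rw [hS.add s h hs (Set.mem_Ioi.1 hh).le, (S s).map_smul_of_tower, map_sub, ← smul_neg, neg_sub]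
  have hgen : ∀ s, 0 ≤ s → HasGenerator S (S s f) (S s g) := by
    intro s hs
    refine (((S s).continuous.tendsto g).comp hg).congr' ?_
    filter_upwards [self_mem_nhdsWithin] with h hh
    simp only [Function.comp]
    rw [hS.apply_comm (Set.mem_Ioi.1 hh).le hs, (S s).map_smul_of_tower, map_sub]
  have hcont : Continuous fun s => ‖S s f‖ ^ 2 := (hS.continuous_apply f).norm.pow 2
  have hgr := le_gronwallBound_of_rightSlopeLE (f := fun s => ‖S s f‖ ^ 2) (b := t)
    (f' := fun s => 2 * (inner ℂ (S s f) (-S s g)).re) (δ := ‖f‖ ^ 2) (K := -(2 / T)) (ε := 0)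
    hcont.continuousOn (fun s hs => rightSlopeLE_norm_sq (hstep s hs.1))
    (by rw [hS.of_nonpos 0 le_rfl]) (fun s hs => by
      have h1 := hS.gap _ _ (hgen s hs.1) (by rw [hS.inner_e, hf])
      rw [inner_neg_right, Complex.neg_re, add_zero]
      have h2 : ‖S s f‖ ^ 2 / T ≤ (inner ℂ (S s f) (S s g)).re := by
        rw [div_le_iff₀ hT]; linarith
      have h3 : -(2 / T) * ‖S s f‖ ^ 2 = -2 * (‖S s f‖ ^ 2 / T) := by ring
      rw [h3]; linarith) t ⟨ht, le_rfl⟩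
  rw [gronwallBound_ε0] at hgr
  have h4 : ‖f‖ ^ 2 * Real.exp (-(2 / T) * t) = (Real.exp (-(t / T)) * ‖f‖) ^ 2 := by
    rw [mul_pow, ← Real.exp_nat_mul, mul_comm]; congr 2; push_cast; ring
  rw [h4] at hgr
  exact (sq_le_sq₀ (norm_nonneg _) (by positivity)).1 hgr

variable [CompleteSpace X]

theorem hasDerivAt_integral (hS : IsGapped S e T) (f : X) (t : ℝ) :
    HasDerivAt (fun x => ∫ s in (0 : ℝ)..x, S s f) (S t f) t :=
  intervalIntegral.integral_hasDerivAt_right ((hS.continuous_apply f).intervalIntegrable _ _)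
    ((hS.continuous_apply f).stronglyMeasurableAtFilter _ _) (hS.continuous_apply f).continuousAt

theorem apply_integral (hS : IsGapped S e T) (f : X) {h a b : ℝ} (hh : 0 ≤ h) (ha : 0 ≤ a)
    (hb : 0 ≤ b) : S h (∫ s in a..b, S s f) = ∫ s in (a + h)..(b + h), S s f := by
  rw [← intervalIntegral.integral_comp_add_right (fun s => S s f) h,
    ← ContinuousLinearMap.intervalIntegral_comp_comm _
      ((hS.continuous_apply f).intervalIntegrable _ _)]
  refine intervalIntegral.integral_congr fun s hs => ?_
  have hs0 : 0 ≤ s := (le_min ha hb).trans hs.1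
  rw [add_comm s h, hS.add h s hh hs0]

theorem hasGenerator_integral (hS : IsGapped S e T) (f : X) {ε : ℝ} (hε : 0 ≤ ε) :
    HasGenerator S (∫ s in (0 : ℝ)..ε, S s f) (f - S ε f) := by
  have h1 := (hS.hasDerivAt_integral f 0).tendsto_slope_zero_right
  have h2 := (hS.hasDerivAt_integral f ε).tendsto_slope_zero_right
  rw [hS.of_nonpos 0 le_rfl] at h1
  refine (h1.sub h2).congr' ?_
  filter_upwards [self_mem_nhdsWithin] with h hh
  rw [← smul_sub, hS.apply_integral f (Set.mem_Ioi.1 hh).le le_rfl hε]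
  congr 1
  have hi : ∀ a b : ℝ, IntervalIntegrable (fun s => S s f) volume a b := fun a b =>
    (hS.continuous_apply f).intervalIntegrable a b
  rw [zero_add, ← intervalIntegral.integral_add_adjacent_intervals (hi 0 h) (hi h (ε + h))]
  simp only [intervalIntegral.integral_same, sub_zero]
  abel

theorem inner_e_integral (hS : IsGapped S e T) {f : X} (hf : inner ℂ e f = 0) (a b : ℝ) :
    inner ℂ e (∫ s in a..b, S s f) = 0 := by
  have := ContinuousLinearMap.intervalIntegral_comp_comm (innerSL ℂ e)
    ((hS.continuous_apply f).intervalIntegrable (μ := volume) a b)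
  simp only [innerSL_apply_apply, hS.inner_e, hf, intervalIntegral.integral_zero] at this
  exact this.symm

/-- The semigroup decays exponentially on the complement of `e`. -/
theorem norm_apply_le (hS : IsGapped S e T) {f : X} (hf : inner ℂ e f = 0) {t : ℝ} (ht : 0 ≤ t) :
    ‖S t f‖ ≤ Real.exp (-(t / T)) * ‖f‖ := by
  -- The averages `h⁻¹ ∫₀ʰ S s f` lie in the domain of the generator, remain orthogonal to `e` and
  -- converge to `f`, so the bound extends from the domain.
  have h1 := (hS.hasDerivAt_integral f 0).tendsto_slope_zero_right
  rw [hS.of_nonpos 0 le_rfl] at h1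
  simp only [zero_add, intervalIntegral.integral_same, sub_zero] at h1
  have h2 := (((S t).continuous.tendsto f).comp h1).norm
  refine le_of_tendsto_of_tendsto h2 (h1.norm.const_mul (Real.exp (-(t / T)))) ?_
  filter_upwards [self_mem_nhdsWithin] with h hh
  simp only [Function.comp]
  rw [(S t).map_smul_of_tower, norm_smul, norm_smul]
  have := hS.norm_apply_le_of_generator (hS.inner_e_integral hf 0 h)
    (hS.hasGenerator_integral f (Set.mem_Ioi.1 hh).le) ht
  calc _ ≤ ‖h⁻¹‖ * (Real.exp (-(t / T)) * ‖∫ s in (0 : ℝ)..h, S s f‖) := by gcongr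
    _ = _ := by ring

theorem integrable_exp (hT : 0 < T) : IntegrableOn (fun t => Real.exp (-(t / T))) (Set.Ioi 0) := by
  have := integrableOn_exp_mul_Ioi (a := -(1 / T)) (by simpa using hT) 0
  refine this.congr_fun (fun t _ => ?_) measurableSet_Ioi
  simp only [neg_mul, one_div, inv_mul_eq_div]

theorem integrableOn_apply (hS : IsGapped S e T) {f : X} (hf : inner ℂ e f = 0) :
    IntegrableOn (fun t => S t f) (Set.Ioi 0) := by
  refine Integrable.mono' ((integrable_exp hS.T_pos).mul_const ‖f‖)
    (hS.continuous_apply f).aestronglyMeasurable ?_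
  refine (ae_restrict_iff' measurableSet_Ioi).2 (Eventually.of_forall fun t ht => ?_)
  exact hS.norm_apply_le hf (Set.mem_Ioi.1 ht).le

/-- The inverse of the generator on the complement of `e`. -/
def resolvent (hS : IsGapped S e T) : X →L[ℂ] X :=
  LinearMap.mkContinuous
    { toFun := fun f => ∫ t in Set.Ioi (0 : ℝ), S t (f - inner ℂ e f • e)
      map_add' := fun f g => by
        rw [← integral_add (hS.integrableOn_apply (hS.inner_e_sub_mean f))
          (hS.integrableOn_apply (hS.inner_e_sub_mean g))]
        refine integral_congr_ae (Eventually.of_forall fun t => ?_)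
        simp only
        rw [← map_add, inner_add_right, add_smul]
        congr 1; abel
      map_smul' := fun c f => by
        rw [RingHom.id_apply, ← integral_smul]
        refine integral_congr_ae (Eventually.of_forall fun t => ?_)
        simp only
        rw [← map_smul, inner_smul_right, smul_sub, smul_smul] }
    (∫ t in Set.Ioi (0 : ℝ), Real.exp (-(t / T))) fun f => by
      rw [← integral_mul_const]
      refine norm_integral_le_of_norm_le ((integrable_exp hS.T_pos).mul_const ‖f‖)
        ((ae_restrict_iff' measurableSet_Ioi).2 (Eventually.of_forall fun t ht => ?_))
      refine (hS.norm_apply_le (hS.inner_e_sub_mean f) (Set.mem_Ioi.1 ht).le).trans ?_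
      gcongr
      exact hS.norm_sub_mean_le f

theorem resolvent_apply (hS : IsGapped S e T) (f : X) :
    hS.resolvent f = ∫ t in Set.Ioi (0 : ℝ), S t (f - inner ℂ e f • e) := rfl

theorem resolvent_e (hS : IsGapped S e T) : hS.resolvent e = 0 := by
  rw [resolvent_apply, inner_self_eq_norm_sq_to_K, hS.norm_e]
  simp

theorem inner_e_resolvent (hS : IsGapped S e T) (f : X) : inner ℂ e (hS.resolvent f) = 0 := by
  have := ContinuousLinearMap.integral_comp_comm (innerSL ℂ e)
    (hS.integrableOn_apply (hS.inner_e_sub_mean f))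
  simp only [innerSL_apply_apply, hS.inner_e, hS.inner_e_sub_mean, integral_zero] at this
  exact this.symm

/-- The two time integrals over `(0, ∞)` and `(h, ∞)` telescope. Dividing by `h` yields both the
generator of the resolvent and the uniform bound `norm_resolvent_sub_le`. -/
theorem resolvent_sub (hS : IsGapped S e T) (f : X) {h : ℝ} (hh : 0 ≤ h) :
    hS.resolvent f - S h (hS.resolvent f) = ∫ s in (0 : ℝ)..h, S s (f - inner ℂ e f • e) := by
  have hInt := hS.integrableOn_apply (hS.inner_e_sub_mean f)
  rw [resolvent_apply, ← ContinuousLinearMap.integral_comp_comm _ hInt]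
  have h1 : ∫ t in Set.Ioi (0 : ℝ), S h (S t (f - inner ℂ e f • e))
      = ∫ t in Set.Ioi (0 : ℝ), S (t + h) (f - inner ℂ e f • e) := by
    refine setIntegral_congr_fun measurableSet_Ioi fun t ht => ?_
    rw [add_comm t h, hS.add h t hh (Set.mem_Ioi.1 ht).le]
  have h2 : ∫ t in Set.Ioi (0 : ℝ), S (t + h) (f - inner ℂ e f • e)
      = ∫ t in Set.Ioi (0 + h), S t (f - inner ℂ e f • e) := by
    have := (measurePreserving_add_right volume h).setIntegral_preimage_emb
      (measurableEmbedding_addRight h) (fun t => S t (f - inner ℂ e f • e)) (Set.Ioi (0 + h))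
    rw [← this]
    simp
  rw [h1, h2, zero_add, intervalIntegral.integral_of_le hh, sub_eq_iff_eq_add,
    ← setIntegral_union (Set.Ioc_disjoint_Ioi le_rfl) measurableSet_Ioi
      (hInt.mono_set Set.Ioc_subset_Ioi_self) (hInt.mono_set (Set.Ioi_subset_Ioi hh)),
    Set.Ioc_union_Ioi_eq_Ioi hh]

theorem resolvent_comm (hS : IsGapped S e T) (f : X) {h : ℝ} (hh : 0 ≤ h) :
    hS.resolvent (S h f) = S h (hS.resolvent f) := by
  rw [resolvent_apply, resolvent_apply,
    ← ContinuousLinearMap.integral_comp_comm _ (hS.integrableOn_apply (hS.inner_e_sub_mean f))]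
  refine setIntegral_congr_fun measurableSet_Ioi fun t ht => ?_
  rw [hS.apply_comm hh (Set.mem_Ioi.1 ht).le, hS.inner_e, map_sub (S h), map_smul (S h),
    hS.apply_e]

theorem hasGenerator_resolvent (hS : IsGapped S e T) (f : X) :
    HasGenerator S (hS.resolvent f) (f - inner ℂ e f • e) := by
  have h1 := (hS.hasDerivAt_integral (f - inner ℂ e f • e) 0).tendsto_slope_zero_right
  rw [hS.of_nonpos 0 le_rfl] at h1
  refine h1.congr' ?_
  filter_upwards [self_mem_nhdsWithin] with h hh
  rw [hS.resolvent_sub f (Set.mem_Ioi.1 hh).le]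
  simp

/-- This is the identity `RB = 1 - Q` in a form that makes sense outside the domain of `B`. -/
theorem tendsto_resolvent (hS : IsGapped S e T) (f : X) :
    Tendsto (fun h : ℝ => h⁻¹ • hS.resolvent (S h f - f)) (𝓝[>] 0)
      (𝓝 (-(f - inner ℂ e f • e))) := by
  refine (hS.hasGenerator_resolvent f).neg.congr' ?_
  filter_upwards [self_mem_nhdsWithin] with h hh
  rw [map_sub, hS.resolvent_comm f (Set.mem_Ioi.1 hh).le, ← smul_neg, neg_sub]

/-- The gap inequality at the vector `Rf`, where `B R f = f - ⟨e, f⟩e` and `Rf` is orthogonal to the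
subtracted mean. -/
theorem accretive_resolvent (hS : IsGapped S e T) (f : X) :
    ‖hS.resolvent f‖ ^ 2 ≤ T * (inner ℂ (hS.resolvent f) f).re := by
  have := hS.gap _ _ (hS.hasGenerator_resolvent f) (hS.inner_e_resolvent f)
  rwa [inner_sub_right, inner_smul_right, ← inner_conj_symm _ e, hS.inner_e_resolvent, map_zero,
    mul_zero, sub_zero] at this

theorem norm_sq_apply_le (hS : IsGapped S e T) (f : X) {t : ℝ} (ht : 0 ≤ t) :
    ‖S t f‖ ^ 2 ≤ ‖inner ℂ e f • e‖ ^ 2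
      + Real.exp (-(2 * t / T)) * ‖f - inner ℂ e f • e‖ ^ 2 := by
  set g := f - inner ℂ e f • e with hg
  have hg0 : inner ℂ e g = 0 := hS.inner_e_sub_mean f
  have h1 : S t f = inner ℂ e f • e + S t g := by
    rw [hg, map_sub, map_smul, hS.apply_e, add_sub_cancel]
  have h2 : inner ℂ (inner ℂ e f • e) (S t g) = 0 := by
    rw [inner_smul_left, hS.inner_e, hg0, mul_zero]
  have h3 := norm_add_sq_eq_norm_sq_add_norm_sq_of_inner_eq_zero _ _ h2
  have h4 := hS.norm_apply_le hg0 ht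
  have h5 : ‖S t g‖ ^ 2 ≤ Real.exp (-(2 * t / T)) * ‖g‖ ^ 2 := by
    calc ‖S t g‖ ^ 2 ≤ (Real.exp (-(t / T)) * ‖g‖) ^ 2 := by gcongr
      _ = _ := by rw [mul_pow, ← Real.exp_nat_mul]; congr 2; push_cast; ring
  rw [h1]
  nlinarith

end IsGapped

end Gapped

end MarkovAnderson

end

noncomputable section

namespace MarkovAnderson

/-! ### The semigroup of the Markov process and the shifts -/

section MarkovSemigroup

variable {d : ℕ} {Ω : Type*} [TopologicalSpace Ω] [MeasurableSpace Ω] {μ : Measure Ω}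
  {σ : Lattice d → Ω → Ω} {P : Kernel Ω (RCPath Ω)}

/-- The semigroup `S_t†` as a function of real times; it is the identity for `t ≤ 0`. -/
def semigroup (hP : IsMarkovFamily μ σ P) (t : ℝ) : Lp ℂ 2 μ →L[ℂ] Lp ℂ 2 μ :=
  adjSemigroup hP t.toNNReal

theorem tendsto_toNNReal_nhdsGT : Tendsto Real.toNNReal (𝓝[>] 0) (𝓝[>] 0) := by
  refine tendsto_nhdsWithin_iff.2 ⟨?_, ?_⟩
  · have := (continuous_real_toNNReal.tendsto 0)
    rw [Real.toNNReal_zero] at this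
    exact this.mono_left nhdsWithin_le_nhds
  · filter_upwards [self_mem_nhdsWithin] with h hh
    exact Real.toNNReal_pos.2 hh

theorem tendsto_coe_nhdsGT : Tendsto (fun t : ℝ≥0 => (t : ℝ)) (𝓝[>] 0) (𝓝[>] 0) := by
  refine tendsto_nhdsWithin_iff.2 ⟨?_, ?_⟩
  · have := (NNReal.continuous_coe.tendsto 0)
    rw [NNReal.coe_zero] at this
    exact this.mono_left nhdsWithin_le_nhds
  · filter_upwards [self_mem_nhdsWithin] with h hh
    exact NNReal.coe_pos.2 hh

theorem isGen_of_hasGenerator (hP : IsMarkovFamily μ σ P) {f g : Lp ℂ 2 μ}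
    (h : HasGenerator (semigroup hP) f g) : IsGen hP f g := by
  refine (h.comp tendsto_coe_nhdsGT).congr fun t => ?_
  simp only [Function.comp, semigroup, Real.toNNReal_coe]
  rw [real_smul_eq_complex, Complex.ofReal_inv]

theorem exists_isGapped [BorelSpace Ω] [IsProbabilityMeasure μ] [IsMarkovKernel P]
    (hP : IsMarkovFamily μ σ P) (hB : GapAndSector hP) :
    ∃ T, IsGapped (semigroup hP) (oneL2 μ) T := by
  obtain ⟨T, b, q, hT, hgap⟩ := hB
  refine ⟨T, hT, norm_oneL2, ?_, ?_, ?_, ?_, ?_, ?_, ?_⟩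
  · intro t ht f
    rw [semigroup, Real.toNNReal_of_nonpos ht, adjSemigroup_zero]
  · intro s t hs ht f
    rw [semigroup, add_comm, Real.toNNReal_add ht hs, adjSemigroup_add]
    rfl
  · exact fun t f => norm_adjSemigroup_le hP _ f
  · exact fun f => (tendsto_adjSemigroup hP f).comp tendsto_toNNReal_nhdsGT
  · exact fun t => adjSemigroup_oneL2 hP _
  · exact fun t f => inner_oneL2_adjSemigroup hP _ f
  · intro f g hfg hf
    rw [inner_oneL2] at hf
    have := (hgap f g (isGen_of_hasGenerator hP hfg) hf).1
    rw [one_div, inv_mul_le_iff₀ hT] at this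
    exact this

/-- The unitary `f ↦ f ∘ σ_x` on `L²(μ)`. -/
def shiftL2 (hσ : IsShiftAction μ σ) (x : Lattice d) : Lp ℂ 2 μ →L[ℂ] Lp ℂ 2 μ :=
  (Lp.compMeasurePreservingₗᵢ ℂ (σ x) (hσ.measurePreserving x)).toContinuousLinearMap

theorem coeFn_shiftL2 {d : ℕ} {Ω : Type*} [MeasurableSpace Ω] {μ : Measure Ω}
    {σ : Lattice d → Ω → Ω} (hσ : IsShiftAction μ σ) (x : Lattice d) (f : Lp ℂ 2 μ) :
    shiftL2 hσ x f =ᵐ[μ] fun a => f (σ x a) :=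
  Lp.coeFn_compMeasurePreserving f (hσ.measurePreserving x)

theorem norm_shiftL2 {d : ℕ} {Ω : Type*} [MeasurableSpace Ω] {μ : Measure Ω}
    {σ : Lattice d → Ω → Ω} (hσ : IsShiftAction μ σ) (x : Lattice d) (f : Lp ℂ 2 μ) :
    ‖shiftL2 hσ x f‖ = ‖f‖ :=
  Lp.norm_compMeasurePreserving f (hσ.measurePreserving x)

theorem inner_shiftL2 {d : ℕ} {Ω : Type*} [MeasurableSpace Ω] {μ : Measure Ω}
    {σ : Lattice d → Ω → Ω} (hσ : IsShiftAction μ σ) (x : Lattice d) (f g : Lp ℂ 2 μ) :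
    inner ℂ (shiftL2 hσ x f) (shiftL2 hσ x g) = inner ℂ f g :=
  (Lp.compMeasurePreservingₗᵢ ℂ (σ x) (hσ.measurePreserving x)).inner_map_map f g

theorem shiftL2_shiftL2 {d : ℕ} {Ω : Type*} [MeasurableSpace Ω] {μ : Measure Ω}
    {σ : Lattice d → Ω → Ω} (hσ : IsShiftAction μ σ) (x y : Lattice d) (f : Lp ℂ 2 μ) :
    shiftL2 hσ x (shiftL2 hσ y f) = shiftL2 hσ (x + y) f := by
  refine Lp.ext ?_
  filter_upwards [coeFn_shiftL2 hσ x (shiftL2 hσ y f), coeFn_shiftL2 hσ (x + y) f,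
    (hσ.measurePreserving x).quasiMeasurePreserving.ae (coeFn_shiftL2 hσ y f)] with a h1 h2 h3
  rw [h1, h2, h3, add_comm x y, ← hσ.comp y x]
  rfl

theorem shiftL2_zero {d : ℕ} {Ω : Type*} [MeasurableSpace Ω] {μ : Measure Ω}
    {σ : Lattice d → Ω → Ω} (hσ : IsShiftAction μ σ) (f : Lp ℂ 2 μ) : shiftL2 hσ 0 f = f := by
  refine Lp.ext ?_
  filter_upwards [coeFn_shiftL2 hσ 0 f] with a h1
  rw [h1, hσ.zero]
  rfl

theorem shiftL2_shiftL2_neg {d : ℕ} {Ω : Type*} [MeasurableSpace Ω] {μ : Measure Ω}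
    {σ : Lattice d → Ω → Ω} (hσ : IsShiftAction μ σ) (x : Lattice d) (f : Lp ℂ 2 μ) :
    shiftL2 hσ x (shiftL2 hσ (-x) f) = f := by
  rw [shiftL2_shiftL2, add_neg_cancel, shiftL2_zero]

theorem inner_shiftL2_left {d : ℕ} {Ω : Type*} [MeasurableSpace Ω] {μ : Measure Ω}
    {σ : Lattice d → Ω → Ω} (hσ : IsShiftAction μ σ) (x : Lattice d) (f g : Lp ℂ 2 μ) :
    inner ℂ (shiftL2 hσ x f) g = inner ℂ f (shiftL2 hσ (-x) g) := by
  rw [← inner_shiftL2 hσ x f, shiftL2_shiftL2_neg]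

theorem shiftL2_oneL2 {d : ℕ} {Ω : Type*} [MeasurableSpace Ω] {μ : Measure Ω}
    [IsProbabilityMeasure μ] {σ : Lattice d → Ω → Ω} (hσ : IsShiftAction μ σ) (x : Lattice d) :
    shiftL2 hσ x (oneL2 μ) = oneL2 μ := by
  refine Lp.ext ?_
  filter_upwards [coeFn_shiftL2 hσ x (oneL2 μ), coeFn_oneL2 (μ := μ),
    (hσ.measurePreserving x).quasiMeasurePreserving.ae (coeFn_oneL2 (μ := μ))] with a h1 h2 h3
  rw [h1, h2, h3]

/-- Shifting the path is the same as shifting its starting point, and the distribution `μ` of the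
starting point is shift invariant. -/
theorem map_shift_pair (hσ : IsShiftAction μ σ) (hP : IsMarkovFamily μ σ P) (x : Lattice d)
    (s t : ℝ≥0) :
    (jointLaw μ P).map (fun ω => (σ x (ω.1 s), σ x (ω.1 t)))
      = (jointLaw μ P).map (fun ω => (ω.1 s, ω.1 t)) := by
  have hm := (hσ.measurePreserving x).measurable
  have hpair : Measurable fun ω : RCPath Ω => (ω.1 s, ω.1 t) :=
    (measurable_evalPath s).prodMk (measurable_evalPath t)
  have hpair' : Measurable fun ω : RCPath Ω => (σ x (ω.1 s), σ x (ω.1 t)) :=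
    (hm.comp (measurable_evalPath s)).prodMk (hm.comp (measurable_evalPath t))
  ext B hB
  rw [Measure.map_apply hpair' hB, Measure.map_apply hpair hB, jointLaw,
    Measure.bind_apply (hpair' hB) P.measurable.aemeasurable,
    Measure.bind_apply (hpair hB) P.measurable.aemeasurable,
    ← (hσ.measurePreserving x).lintegral_comp (P.measurable_coe (hpair hB))]
  refine lintegral_congr fun a => ?_
  have hev : Measurable fun r : ℝ≥0 → Ω => (r s, r t) :=
    (measurable_pi_apply s).prodMk (measurable_pi_apply t)
  have h1 := congrArg (fun ν => ν ((fun r : ℝ≥0 → Ω => (r s, r t)) ⁻¹' B)) (hP.shift a x)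
  have hpath : Measurable fun (ω : RCPath Ω) t => σ x (ω.1 t) :=
    measurable_pi_lambda _ fun t => hm.comp (measurable_evalPath t)
  rw [Measure.map_apply measurable_subtype_coe (hev hB), Measure.map_apply hpath (hev hB)] at h1
  exact h1.symm

/-- The matrix elements of the semigroup depend only on the joint law of `(ω_0, ω_h)`, which is
shift invariant. This commutation is what makes the Fourier transform compatible with the dynamics.
-/
theorem adjSemigroup_shiftL2 (hσ : IsShiftAction μ σ) (hP : IsMarkovFamily μ σ P)
    (x : Lattice d) (h : ℝ≥0) (f : Lp ℂ 2 μ) :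
    adjSemigroup hP h (shiftL2 hσ x f) = shiftL2 hσ x (adjSemigroup hP h f) := by
  have key : ∀ f g : Lp ℂ 2 μ, inner ℂ (evalL2 hP h (shiftL2 hσ x g)) (evalL2 hP 0 (shiftL2 hσ x f))
      = inner ℂ (evalL2 hP h g) (evalL2 hP 0 f) := by
    intro f g
    have hm := (hσ.measurePreserving x).measurable
    set Φ : Ω × Ω → ℂ := fun p => inner ℂ (g p.2) (f p.1) with hΦ
    have hΦm : StronglyMeasurable Φ :=
      ((Lp.stronglyMeasurable g).comp_measurable measurable_snd).inner
        ((Lp.stronglyMeasurable f).comp_measurable measurable_fst)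
    have h1 : inner ℂ (evalL2 hP h g) (evalL2 hP 0 f)
        = ∫ p, Φ p ∂((jointLaw μ P).map (fun ω => (ω.1 0, ω.1 h))) := by
      rw [integral_map ((measurable_evalPath 0).prodMk (measurable_evalPath h)).aemeasurable
        hΦm.aestronglyMeasurable, L2.inner_def]
      refine integral_congr_ae ?_
      filter_upwards [coeFn_evalL2 hP h g, coeFn_evalL2 hP 0 f] with ω h2 h3
      rw [h2, h3]
    have h2 : inner ℂ (evalL2 hP h (shiftL2 hσ x g)) (evalL2 hP 0 (shiftL2 hσ x f))
        = ∫ p, Φ p ∂((jointLaw μ P).map (fun ω => (σ x (ω.1 0), σ x (ω.1 h)))) := by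
      have hpm : Measurable fun ω : RCPath Ω => (σ x (ω.1 0), σ x (ω.1 h)) :=
        (hm.comp (measurable_evalPath 0)).prodMk (hm.comp (measurable_evalPath h))
      rw [integral_map hpm.aemeasurable hΦm.aestronglyMeasurable, L2.inner_def]
      refine integral_congr_ae ?_
      filter_upwards [coeFn_evalL2 hP h (shiftL2 hσ x g), coeFn_evalL2 hP 0 (shiftL2 hσ x f),
        (hP.measurePreserving_eval h).quasiMeasurePreserving.ae (coeFn_shiftL2 hσ x g),
        (hP.measurePreserving_eval 0).quasiMeasurePreserving.ae (coeFn_shiftL2 hσ x f)]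
        with ω h2 h3 h4 h5
      rw [h2, h3, h4, h5]
    rw [h1, h2, map_shift_pair hσ hP]
  refine ext_inner_left ℂ fun g => ?_
  rw [← shiftL2_shiftL2_neg hσ x g, inner_shiftL2, adjSemigroup_apply, inner_condL2, key,
    adjSemigroup_apply, inner_condL2]

end MarkovSemigroup

end MarkovAnderson

end

noncomputable section

namespace MarkovAnderson

/-! ### Exponential weights on the lattice -/

section Lattice

variable {d : ℕ}

theorem latticeNorm_eq_norm (x : Lattice d) :
    latticeNorm x = ‖(WithLp.toLp 2 (fun i => (x i : ℝ)) : EuclideanSpace ℝ (Fin d))‖ := by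
  rw [EuclideanSpace.norm_eq, latticeNorm]
  simp

theorem latticeNorm_nonneg (x : Lattice d) : 0 ≤ latticeNorm x := Real.sqrt_nonneg _

theorem latticeNorm_add_le (x y : Lattice d) :
    latticeNorm (x + y) ≤ latticeNorm x + latticeNorm y := by
  rw [latticeNorm_eq_norm, latticeNorm_eq_norm, latticeNorm_eq_norm]
  refine le_of_eq_of_le ?_ (norm_add_le _ _)
  congr 1
  ext i
  simp

theorem latticeNorm_neg (x : Lattice d) : latticeNorm (-x) = latticeNorm x := by
  simp [latticeNorm]

theorem abs_le_latticeNorm (x : Lattice d) (i : Fin d) : |(x i : ℝ)| ≤ latticeNorm x := by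
  rw [latticeNorm, ← Real.sqrt_sq_eq_abs]
  exact Real.sqrt_le_sqrt (Finset.single_le_sum (f := fun i => (x i : ℝ) ^ 2)
    (fun i _ => sq_nonneg _) (Finset.mem_univ i))

theorem summable_prod_pi {g : ℤ → ℝ} (hg : Summable g) (hg0 : ∀ n, 0 ≤ g n) (d : ℕ) :
    Summable fun x : Fin d → ℤ => ∏ i, g (x i) := by
  induction d with
  | zero => exact (hasSum_fintype _).summable
  | succ d ih =>
    have h0 : ∀ x : Fin d → ℤ, 0 ≤ ∏ i, g (x i) := fun x => Finset.prod_nonneg fun i _ => hg0 _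
    have h1 : Summable fun p : ℤ × (Fin d → ℤ) => g p.1 * ∏ i, g (p.2 i) :=
      Summable.mul_of_nonneg (f := g) (g := fun x : Fin d → ℤ => ∏ i, g (x i)) hg ih
        (Pi.le_def.2 hg0) (Pi.le_def.2 h0)
    refine (Equiv.summable_iff (f := fun x : Fin (d + 1) → ℤ => ∏ i, g (x i))
      (Fin.consEquiv fun _ : Fin (d + 1) => ℤ)).1 (h1.congr fun p => ?_)
    simp [Fin.prod_univ_succ, Fin.consEquiv]

theorem summable_exp_neg_abs {a : ℝ} (ha : 0 < a) :
    Summable fun n : ℤ => Real.exp (-(a * |(n : ℝ)|)) := by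
  have h1 : Summable fun n : ℕ => Real.exp (-(a * n)) := by
    have := Real.summable_exp_nat_mul_iff.2 (neg_lt_zero.2 ha)
    refine this.congr fun n => ?_
    congr 1; ring
  refine Summable.of_nat_of_neg (h1.congr fun n => ?_) (h1.congr fun n => ?_) <;> simp

theorem summable_exp_neg_latticeNorm {a : ℝ} (ha : 0 < a) :
    Summable fun x : Lattice d => Real.exp (-(a * latticeNorm x)) := by
  rcases Nat.eq_zero_or_pos d with rfl | hd
  · exact (hasSum_fintype _).summable
  have hd' : (0 : ℝ) < d := by exact_mod_cast hd
  refine Summable.of_nonneg_of_le (fun _ => (Real.exp_pos _).le) (fun x => ?_)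
    (summable_prod_pi (summable_exp_neg_abs (div_pos ha hd')) (fun _ => (Real.exp_pos _).le) d)
  rw [← Real.exp_sum, Real.exp_le_exp, Finset.sum_neg_distrib, neg_le_neg_iff, ← Finset.mul_sum]
  have : ∑ i, |(x i : ℝ)| ≤ d * latticeNorm x := by
    calc ∑ i, |(x i : ℝ)| ≤ ∑ _i : Fin d, latticeNorm x :=
          Finset.sum_le_sum fun i _ => abs_le_latticeNorm x i
      _ = _ := by simp
  calc a / d * ∑ i, |(x i : ℝ)| ≤ a / d * (d * latticeNorm x) := by gcongr
    _ = _ := by field_simp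

/-- The exponential weight `e^{-ν|x|}`. -/
def weight (ν : ℝ) (x : Lattice d) : ℝ := Real.exp (-(ν * latticeNorm x))

theorem weight_pos (ν : ℝ) (x : Lattice d) : 0 < weight ν x := Real.exp_pos _

theorem weight_le_mul {ν : ℝ} (hν : 0 ≤ ν) (x y : Lattice d) :
    weight ν y ≤ Real.exp (ν * latticeNorm (x - y)) * weight ν x := by
  rw [weight, weight, ← Real.exp_add, Real.exp_le_exp]
  have := latticeNorm_add_le (x - y) y
  rw [sub_add_cancel] at this
  nlinarith

theorem weight_le_one {ν : ℝ} (hν : 0 ≤ ν) (x : Lattice d) : weight ν x ≤ 1 := by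
  rw [weight, Real.exp_le_one_iff, neg_nonpos]
  exact mul_nonneg hν (latticeNorm_nonneg x)

theorem weight_anti {ν ν' : ℝ} (hν : ν ≤ ν') (x : Lattice d) : weight ν' x ≤ weight ν x := by
  rw [weight, weight, Real.exp_le_exp, neg_le_neg_iff]
  exact mul_le_mul_of_nonneg_right hν (latticeNorm_nonneg x)

variable {h : Lattice d → ℂ} {ν : ℝ}

/-- The exponential moment `∑ e^{ν|z|} |h(z)|`. -/
def expMoment (h : Lattice d → ℂ) (ν : ℝ) : ℝ := ∑' z, Real.exp (ν * latticeNorm z) * ‖h z‖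

theorem expMoment_nonneg : 0 ≤ expMoment h ν := tsum_nonneg fun _ => by positivity

/-- The triangle inequality `|x| ≤ |x - y| + |y|` moves the weight from `y` to `x` at the price of
`e^{ν|x-y|}`, which the hopping kernel can afford. Exponential localization thus survives the
evolution at finite times. -/
theorem summable_hop_weight (hν : 0 ≤ ν)
    (hh : Summable fun z => Real.exp (ν * latticeNorm z) * ‖h z‖) (x : Lattice d) :
    Summable (fun y => ‖h (x - y)‖ * weight ν y) ∧
      ∑' y, ‖h (x - y)‖ * weight ν y ≤ expMoment h ν * weight ν x := by
  have h1 : Summable fun y => Real.exp (ν * latticeNorm (x - y)) * ‖h (x - y)‖ * weight ν x :=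
    (((Equiv.subLeft x).summable_iff (f := fun z => Real.exp (ν * latticeNorm z) * ‖h z‖)).2
      hh).mul_right _
  have hle : ∀ y, ‖h (x - y)‖ * weight ν y
      ≤ Real.exp (ν * latticeNorm (x - y)) * ‖h (x - y)‖ * weight ν x := fun y => by
    calc ‖h (x - y)‖ * weight ν y
        ≤ ‖h (x - y)‖ * (Real.exp (ν * latticeNorm (x - y)) * weight ν x) := by
          gcongr; exact weight_le_mul hν x y
      _ = _ := by ring
  have h2 : Summable (fun y => ‖h (x - y)‖ * weight ν y) :=
    Summable.of_nonneg_of_le (fun y => mul_nonneg (norm_nonneg _) (weight_pos _ _).le) hle h1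
  refine ⟨h2, (h2.tsum_le_tsum hle h1).trans_eq ?_⟩
  rw [tsum_mul_right, expMoment]
  congr 1
  exact (Equiv.subLeft x).tsum_eq fun z => Real.exp (ν * latticeNorm z) * ‖h z‖

theorem summable_hop (hν : 0 ≤ ν) (hh : Summable fun z => Real.exp (ν * latticeNorm z) * ‖h z‖)
    {g : Lattice d → ℂ} {B : ℝ} (hg : ∀ y, ‖g y‖ ≤ B * weight ν y) (x : Lattice d) :
    Summable fun y => ‖h (x - y) * g y‖ := by
  refine Summable.of_nonneg_of_le (fun _ => norm_nonneg _) (fun y => ?_)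
    ((summable_hop_weight hν hh x).1.mul_left B)
  rw [norm_mul]
  calc ‖h (x - y)‖ * ‖g y‖ ≤ ‖h (x - y)‖ * (B * weight ν y) := by gcongr; exact hg y
    _ = _ := by ring

theorem norm_hop_le (hν : 0 ≤ ν) (hh : Summable fun z => Real.exp (ν * latticeNorm z) * ‖h z‖)
    {g : Lattice d → ℂ} {B : ℝ} (hg : ∀ y, ‖g y‖ ≤ B * weight ν y) (x : Lattice d) :
    ‖∑' y, h (x - y) * g y‖ ≤ B * expMoment h ν * weight ν x := by
  have hB : 0 ≤ B := by
    have := (norm_nonneg _).trans (hg 0)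
    exact nonneg_of_mul_nonneg_left this (weight_pos _ _)
  have h0 := (summable_hop_weight hν hh x)
  refine (tsum_of_norm_bounded ((h0.1.mul_left B).hasSum) fun y => ?_).trans ?_
  · rw [norm_mul]
    calc ‖h (x - y)‖ * ‖g y‖ ≤ ‖h (x - y)‖ * (B * weight ν y) := by gcongr; exact hg y
      _ = _ := by ring
  · rw [tsum_mul_left, mul_assoc]
    exact mul_le_mul_of_nonneg_left h0.2 hB

end Lattice

end MarkovAnderson

end

noncomputable section

namespace MarkovAnderson

/-! ### The Dyson series -/

/-! ### Measurability of series and time integrals relative to a sub-`σ`-algebra -/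

section Measurability

variable {Θ ι : Type*} [Countable ι]

theorem stronglyMeasurable_tsum [MeasurableSpace Θ] {f : ι → Θ → ℂ}
    (hf : ∀ i, StronglyMeasurable (f i)) (hs : ∀ θ, Summable fun i => f i θ) :
    StronglyMeasurable fun θ => ∑' i, f i θ := by
  refine stronglyMeasurable_of_tendsto (atTop : Filter (Finset ι))
    (f := fun s θ => ∑ i ∈ s, f i θ) (fun s => ?_) (tendsto_pi_nhds.2 fun θ => (hs θ).hasSum)
  exact Finset.stronglyMeasurable_fun_sum s fun i _ => hf i

/-- The modifications of the terms obey the bounds only almost everywhere. They are therefore set to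
zero where they exceed `c i`, and the modified series converges everywhere. -/
theorem aestronglyMeasurable_tsum {m m₀ : MeasurableSpace Θ} {ρ : Measure[m₀] Θ} {f : ι → Θ → ℂ}
    (hf : ∀ i, AEStronglyMeasurable[m] (f i) ρ) {c : ι → ℝ} (hc : Summable c)
    (hfc : ∀ i θ, ‖f i θ‖ ≤ c i) : AEStronglyMeasurable[m] (fun θ => ∑' i, f i θ) ρ := by
  classical
  set g : ι → Θ → ℂ := fun i => Set.indicator {θ | ‖(hf i).mk _ θ‖ ≤ c i} ((hf i).mk _) with hg
  have hgm : ∀ i, StronglyMeasurable[m] (g i) := fun i =>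
    (hf i).stronglyMeasurable_mk.indicator
      ((hf i).stronglyMeasurable_mk.norm.measurableSet_le stronglyMeasurable_const)
  have hgc : ∀ i θ, ‖g i θ‖ ≤ c i := fun i θ => by
    simp only [hg, Set.indicator, Set.mem_ofPred_eq]
    split_ifs with h
    · exact h
    · rw [norm_zero]
      exact (norm_nonneg _).trans (hfc i θ)
  refine ⟨fun θ => ∑' i, g i θ, @stronglyMeasurable_tsum Θ ι _ m g hgm
    fun θ => Summable.of_norm_bounded hc fun i => hgc i θ, ?_⟩
  filter_upwards [ae_all_iff.2 fun i => (hf i).ae_eq_mk] with θ hθ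
  refine tsum_congr fun i => ?_
  have h1 : ‖(hf i).mk _ θ‖ ≤ c i := by rw [← hθ i]; exact hfc i θ
  rw [hg, hθ i]
  exact (Set.indicator_of_mem (s := {θ | ‖(hf i).mk _ θ‖ ≤ c i}) h1 _).symm

/-- A time integral of random variables measurable with respect to `m` is measurable with respect
to `m`. -/
theorem aestronglyMeasurable_integral {m m₀ : MeasurableSpace Θ} (hm : m ≤ m₀) {ρ : Measure[m₀] Θ}
    [IsFiniteMeasure ρ] {Y : ℝ × Θ → ℂ} (hY : StronglyMeasurable Y) {t B : ℝ}
    (hB : ∀ s ∈ Set.Ioc 0 t, ∀ θ, ‖Y (s, θ)‖ ≤ B)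
    (hYm : ∀ᵐ s ∂(volume.restrict (Set.Ioc 0 t)), AEStronglyMeasurable[m] (fun θ => Y (s, θ)) ρ) :
    AEStronglyMeasurable[m] (fun θ => ∫ s in Set.Ioc 0 t, Y (s, θ)) ρ := by
  have : Fact (m ≤ m₀) := ⟨hm⟩
  set Z : Θ → ℂ := fun θ => ∫ s in Set.Ioc 0 t, Y (s, θ) with hZ
  have hZm : StronglyMeasurable Z := hY.integral_prod_left'
  have hYb : ∀ᵐ p ∂((volume.restrict (Set.Ioc 0 t)).prod ρ), ‖Y p‖ ≤ B := by
    rw [Measure.ae_prod_iff_ae_ae (measurableSet_le hY.norm.measurable measurable_const)]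
    exact (ae_restrict_iff' measurableSet_Ioc).2
      (Eventually.of_forall fun s hs => Eventually.of_forall (hB s hs))
  have hYi : Integrable Y ((volume.restrict (Set.Ioc 0 t)).prod ρ) :=
    Integrable.of_bound hY.aestronglyMeasurable B hYb
  have hZL : MemLp Z 2 ρ := by
    refine MemLp.of_bound hZm.aestronglyMeasurable (B * volume.real (Set.Ioc 0 t))
      (Eventually.of_forall fun θ => ?_)
    exact norm_setIntegral_le_of_norm_le_const measure_Ioc_lt_top fun s hs => hB s hs θ
  -- Measurability with respect to `m` is known only separately for almost every time, so no jointly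
  -- measurable version is at hand. Instead, `Z` is shown to be orthogonal to everything orthogonal
  -- to the closed subspace of `m`-measurable functions, exchanging the two integrals by Fubini.
  have hmem : hZL.toLp Z ∈ lpMeas ℂ ℂ m 2 ρ := by
    have : CompleteSpace (lpMeas ℂ ℂ m 2 ρ) := inferInstance
    rw [← Submodule.orthogonal_orthogonal (lpMeas ℂ ℂ m 2 ρ), Submodule.mem_orthogonal]
    intro g hg
    have hgi : Integrable (fun p : ℝ × Θ => inner ℂ (g p.2) (Y p))
        ((volume.restrict (Set.Ioc 0 t)).prod ρ) := by
      have h1 : Integrable (fun θ => g θ) ρ := (Lp.memLp g).integrable (by norm_num)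
      have h2 : Integrable (fun p : ℝ × Θ => g p.2) ((volume.restrict (Set.Ioc 0 t)).prod ρ) :=
        h1.comp_snd _
      refine Integrable.mono' (h2.norm.mul_const B)
        (h2.aestronglyMeasurable.inner hY.aestronglyMeasurable) ?_
      filter_upwards [hYb] with p hp
      exact (norm_inner_le_norm _ _).trans (mul_le_mul_of_nonneg_left hp (norm_nonneg _))
    have h1 : inner ℂ g (hZL.toLp Z) = ∫ θ, (∫ s in Set.Ioc 0 t, inner ℂ (g θ) (Y (s, θ))) ∂ρ := by
      rw [L2.inner_def]
      refine integral_congr_ae ?_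
      filter_upwards [hZL.coeFn_toLp, hYi.prod_left_ae] with θ hθ hθi
      rw [hθ, hZ]
      exact (integral_inner hθi (g θ)).symm
    rw [h1, ← integral_integral_swap (f := fun s θ => inner ℂ (g θ) (Y (s, θ))) hgi]
    refine integral_eq_zero_of_ae ?_
    filter_upwards [hYm, (ae_restrict_iff' measurableSet_Ioc).2
      (Eventually.of_forall fun s hs => hs)] with s hs hs'
    have hYs : MemLp (fun θ => Y (s, θ)) 2 ρ := by
      refine MemLp.of_bound (hs.mono hm) B (Eventually.of_forall (hB s hs'))
    have h2 : hYs.toLp _ ∈ lpMeas ℂ ℂ m 2 ρ :=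
      mem_lpMeas_iff_aestronglyMeasurable.2 (hs.congr hYs.coeFn_toLp.symm)
    have h3 := (Submodule.mem_orthogonal _ _).1 hg _ h2
    rw [← inner_conj_symm, map_eq_zero, L2.inner_def] at h3
    rw [Pi.zero_apply, ← h3]
    refine integral_congr_ae ?_
    filter_upwards [hYs.coeFn_toLp] with θ hθ
    rw [hθ]
  exact (mem_lpMeas_iff_aestronglyMeasurable.1 hmem).congr hZL.coeFn_toLp

end Measurability

section Dyson

variable {d : ℕ} {Θ : Type*}

/-- The terms of the Dyson series of the Schrödinger equation with the potential `F`. -/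
def dyson (h : Lattice d → ℂ) (F : Lattice d → ℝ × Θ → ℝ) (ψ₀ : Lattice d → ℂ) :
    ℕ → Lattice d → ℝ × Θ → ℂ
  | 0, x, _ => ψ₀ x
  | n + 1, x, p => -Complex.I * ∫ s in Set.Ioc 0 p.1,
      ((∑' y, h (x - y) * dyson h F ψ₀ n y (s, p.2)) + F x (s, p.2) * dyson h F ψ₀ n x (s, p.2))

/-- The Dyson series. -/
def dysonSum (h : Lattice d → ℂ) (F : Lattice d → ℝ × Θ → ℝ) (ψ₀ : Lattice d → ℂ) (x : Lattice d)
    (p : ℝ × Θ) : ℂ :=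
  ∑' n, dyson h F ψ₀ n x p

/-- The right-hand side of the Schrödinger equation, for a function of time and a parameter. -/
def rhs (h : Lattice d → ℂ) (F : Lattice d → ℝ × Θ → ℝ) (a : Lattice d → ℝ × Θ → ℂ) (x : Lattice d)
    (p : ℝ × Θ) : ℂ :=
  (∑' y, h (x - y) * a y p) + F x p * a x p

/-- Exponentially bounded data for the Schrödinger equation. -/
structure IsExpBounded (h : Lattice d → ℂ) (F : Lattice d → ℝ × Θ → ℝ) (ψ₀ : Lattice d → ℂ)
    (ν M C : ℝ) : Prop where
  nu_pos : 0 < ν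
  summable : Summable fun z => Real.exp (ν * latticeNorm z) * ‖h z‖
  bound : ∀ x p, |F x p| ≤ M
  initial : ∀ x, ‖ψ₀ x‖ ≤ C * weight ν x

variable {h : Lattice d → ℂ} {F : Lattice d → ℝ × Θ → ℝ} {ψ₀ : Lattice d → ℂ} {ν M C : ℝ}

theorem dyson_succ (n : ℕ) (x : Lattice d) (p : ℝ × Θ) :
    dyson h F ψ₀ (n + 1) x p
      = -Complex.I * ∫ s in Set.Ioc 0 p.1, rhs h F (dyson h F ψ₀ n) x (s, p.2) := rfl

namespace IsExpBounded

theorem C_nonneg (hF : IsExpBounded h F ψ₀ ν M C) : 0 ≤ C :=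
  nonneg_of_mul_nonneg_left ((norm_nonneg _).trans (hF.initial 0)) (weight_pos _ _)

theorem M_nonneg [Nonempty Θ] (hF : IsExpBounded h F ψ₀ ν M C) : 0 ≤ M :=
  (abs_nonneg _).trans (hF.bound 0 (0, Classical.arbitrary Θ))

theorem norm_rhs_le_of_abs_le (hF : IsExpBounded h F ψ₀ ν M C) {G : Lattice d → ℝ × Θ → ℝ}
    {a : Lattice d → ℝ × Θ → ℂ} {p : ℝ × Θ} {x : Lattice d} (hG : |G x p| ≤ M) {B : ℝ}
    (ha : ∀ y, ‖a y p‖ ≤ B * weight ν y) :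
    ‖rhs h G a x p‖ ≤ B * (expMoment h ν + M) * weight ν x := by
  have h1 := norm_hop_le hF.nu_pos.le hF.summable ha x
  have h2 : ‖(G x p : ℂ) * a x p‖ ≤ M * (B * weight ν x) := by
    rw [norm_mul, Complex.norm_real, Real.norm_eq_abs]
    exact mul_le_mul hG (ha x) (norm_nonneg _) ((abs_nonneg _).trans hG)
  calc _ ≤ _ := norm_add_le _ _
    _ ≤ _ := add_le_add h1 h2
    _ = _ := by ring

theorem norm_rhs_le (hF : IsExpBounded h F ψ₀ ν M C) {a : Lattice d → ℝ × Θ → ℂ} {p : ℝ × Θ}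
    {B : ℝ} (ha : ∀ y, ‖a y p‖ ≤ B * weight ν y) (x : Lattice d) :
    ‖rhs h F a x p‖ ≤ B * (expMoment h ν + M) * weight ν x :=
  hF.norm_rhs_le_of_abs_le (hF.bound x p) ha

/-- Each step multiplies by at most `expMoment h ν + M` without losing weight, and the nested time
integrals produce `tⁿ/n!`. -/
theorem norm_dyson_le (hF : IsExpBounded h F ψ₀ ν M C) (n : ℕ) (x : Lattice d) {t : ℝ} (ht : 0 ≤ t)
    (θ : Θ) : ‖dyson h F ψ₀ n x (t, θ)‖
      ≤ C * (((expMoment h ν + M) * t) ^ n / n.factorial) * weight ν x := by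
  have : Nonempty Θ := ⟨θ⟩
  set Λ := expMoment h ν + M with hΛ
  induction n generalizing x t with
  | zero => simpa [dyson] using hF.initial x
  | succ n ih =>
    rw [dyson_succ, norm_mul, norm_neg, Complex.norm_I, one_mul]
    have h1 : ∀ s ∈ Set.Ioc 0 t, ‖rhs h F (dyson h F ψ₀ n) x (s, θ)‖
        ≤ C * Λ ^ (n + 1) / n.factorial * weight ν x * s ^ n := by
      intro s hs
      refine (hF.norm_rhs_le (fun y => ih y hs.1.le) x).trans_eq ?_
      rw [mul_pow]; ring
    have h2 : IntegrableOn (fun s : ℝ => C * Λ ^ (n + 1) / n.factorial * weight ν x * s ^ n)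
        (Set.Ioc 0 t) := by
      rw [← intervalIntegrable_iff_integrableOn_Ioc_of_le ht]
      exact Continuous.intervalIntegrable (by fun_prop) _ _
    refine (norm_integral_le_of_norm_le h2 ((ae_restrict_iff' measurableSet_Ioc).2
      (Eventually.of_forall h1))).trans_eq ?_
    rw [integral_const_mul, ← intervalIntegral.integral_of_le ht, integral_pow, mul_pow,
      Nat.factorial_succ]
    push_cast
    field_simp
    simp

theorem stronglyMeasurable_rhs [MeasurableSpace Θ] (hFm : ∀ x, Measurable (F x))
    {a : Lattice d → ℝ × Θ → ℂ} (ha : ∀ x, StronglyMeasurable (a x))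
    (hs : ∀ x p, Summable fun y => h (x - y) * a y p) (x : Lattice d) :
    StronglyMeasurable (rhs h F a x) :=
  (stronglyMeasurable_tsum (fun y => (ha y).const_mul _) (hs x)).add
    ((Complex.measurable_ofReal.comp (hFm x)).stronglyMeasurable.mul (ha x))

end IsExpBounded

end Dyson

end MarkovAnderson

end

/-! ### Convergence and adaptedness of the Dyson series -/

noncomputable section

namespace MarkovAnderson

section DysonSum

variable {d : ℕ} {Θ : Type*} {h : Lattice d → ℂ} {F : Lattice d → ℝ × Θ → ℝ} {ψ₀ : Lattice d → ℂ}
  {ν M C : ℝ}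

/-- At negative times the interval of integration is empty, so the series is frozen at its initial
value. This makes the estimates available at all real times. -/
theorem dyson_max (n : ℕ) (x : Lattice d) (t : ℝ) (θ : Θ) :
    dyson h F ψ₀ n x (t, θ) = dyson h F ψ₀ n x (max t 0, θ) := by
  cases n with
  | zero => rfl
  | succ n =>
    rw [dyson_succ, dyson_succ]
    rcases le_total t 0 with ht | ht
    · simp [ht]
    · rw [max_eq_left ht]

theorem stronglyMeasurable_integral_Ioc [MeasurableSpace Θ] {G : ℝ × Θ → ℂ}
    (hG : StronglyMeasurable G) :
    StronglyMeasurable fun p : ℝ × Θ => ∫ s in Set.Ioc 0 p.1, G (s, p.2) := by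
  have hset : MeasurableSet {q : (ℝ × Θ) × ℝ | q.2 ∈ Set.Ioc 0 q.1.1} :=
    (measurableSet_lt measurable_const measurable_snd).inter
      (measurableSet_le measurable_snd (measurable_fst.comp measurable_fst))
  have h1 : StronglyMeasurable fun q : (ℝ × Θ) × ℝ => G (q.2, q.1.2) :=
    hG.comp_measurable (measurable_snd.prodMk (measurable_snd.comp measurable_fst))
  have h2 := (h1.indicator hset).integral_prod_right' (ν := (volume : Measure ℝ))
  have h3 : (fun p : ℝ × Θ => ∫ s in Set.Ioc 0 p.1, G (s, p.2)) = fun p => ∫ s,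
      {q : (ℝ × Θ) × ℝ | q.2 ∈ Set.Ioc 0 q.1.1}.indicator (fun q => G (q.2, q.1.2)) (p, s) := by
    funext p
    rw [← integral_indicator measurableSet_Ioc]
    rfl
  rw [h3]
  exact h2

namespace IsExpBounded

theorem norm_dyson_le_max (hF : IsExpBounded h F ψ₀ ν M C) (n : ℕ) (x : Lattice d) (p : ℝ × Θ) :
    ‖dyson h F ψ₀ n x p‖
      ≤ C * (((expMoment h ν + M) * max p.1 0) ^ n / n.factorial) * weight ν x := by
  rw [← Prod.mk.eta (p := p), dyson_max]
  exact hF.norm_dyson_le n x (le_max_right _ _) _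

theorem hasSum_bound (C L w : ℝ) :
    HasSum (fun n : ℕ => C * (L ^ n / n.factorial) * w) (C * Real.exp L * w) := by
  have := NormedSpace.expSeries_div_hasSum_exp (𝔸 := ℝ) L
  rw [← Real.exp_eq_exp_ℝ] at this
  exact (this.mul_left C).mul_right w

theorem summable_dyson (hF : IsExpBounded h F ψ₀ ν M C) (x : Lattice d) (p : ℝ × Θ) :
    Summable fun n => dyson h F ψ₀ n x p :=
  Summable.of_norm_bounded (hasSum_bound _ _ _).summable fun n => hF.norm_dyson_le_max n x p

theorem norm_dysonSum_le (hF : IsExpBounded h F ψ₀ ν M C) (x : Lattice d) (p : ℝ × Θ) :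
    ‖dysonSum h F ψ₀ x p‖ ≤ C * Real.exp ((expMoment h ν + M) * max p.1 0) * weight ν x :=
  tsum_of_norm_bounded (hasSum_bound _ _ _) fun n => hF.norm_dyson_le_max n x p

theorem stronglyMeasurable_dyson [MeasurableSpace Θ] (hF : IsExpBounded h F ψ₀ ν M C)
    (hFm : ∀ x, Measurable (F x)) (n : ℕ) (x : Lattice d) :
    StronglyMeasurable (dyson h F ψ₀ n x) := by
  induction n generalizing x with
  | zero => exact stronglyMeasurable_const
  | succ n ih =>
    exact (stronglyMeasurable_integral_Ioc (stronglyMeasurable_rhs hFm ih (fun x p =>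
      (summable_hop hF.nu_pos.le hF.summable (fun y => hF.norm_dyson_le_max n y p)
        x).of_norm) x)).const_mul _

theorem stronglyMeasurable_dysonSum [MeasurableSpace Θ] (hF : IsExpBounded h F ψ₀ ν M C)
    (hFm : ∀ x, Measurable (F x)) (x : Lattice d) : StronglyMeasurable (dysonSum h F ψ₀ x) :=
  stronglyMeasurable_tsum (fun n => hF.stronglyMeasurable_dyson hFm n x) (hF.summable_dyson x)

theorem stronglyMeasurable_rhs_dysonSum [MeasurableSpace Θ] (hF : IsExpBounded h F ψ₀ ν M C)
    (hFm : ∀ x, Measurable (F x)) (x : Lattice d) :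
    StronglyMeasurable (rhs h F (dysonSum h F ψ₀) x) :=
  stronglyMeasurable_rhs hFm (hF.stronglyMeasurable_dysonSum hFm) (fun x p =>
      (summable_hop hF.nu_pos.le hF.summable (fun y => hF.norm_dysonSum_le y p) x).of_norm) x

theorem hasSum_rhs_dyson (hF : IsExpBounded h F ψ₀ ν M C) (x : Lattice d) (p : ℝ × Θ) :
    HasSum (fun n => rhs h F (dyson h F ψ₀ n) x p) (rhs h F (dysonSum h F ψ₀) x p) := by
  refine HasSum.add ?_ ((hF.summable_dyson x p).hasSum.mul_left _)
  have h1 : Summable fun q : Lattice d × ℕ => h (x - q.1) * dyson h F ψ₀ q.2 q.1 p := by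
    have h2 := Summable.mul_of_nonneg (summable_hop_weight hF.nu_pos.le hF.summable x).1
      (hasSum_bound C ((expMoment h ν + M) * max p.1 0) 1).summable
      (Pi.le_def.2 fun y => mul_nonneg (norm_nonneg _) (weight_pos _ _).le)
      (Pi.le_def.2 fun n => by
        have h3 : Nonempty Θ := ⟨p.2⟩
        have := hF.C_nonneg
        have := hF.M_nonneg
        have := expMoment_nonneg (h := h) (ν := ν)
        rw [Pi.zero_apply]
        positivity)
    refine Summable.of_norm_bounded h2 fun q => ?_
    rw [norm_mul]
    calc _ ≤ ‖h (x - q.1)‖ * (C * (((expMoment h ν + M) * max p.1 0) ^ q.2 / q.2.factorial)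
          * weight ν q.1) := by gcongr; exact hF.norm_dyson_le_max q.2 q.1 p
      _ = _ := by ring
  have h4 := h1.prod_symm.hasSum.prod_fiberwise fun n => (h1.prod_symm.prod_factor n).hasSum
  have h5 := h1.hasSum.prod_fiberwise fun y => (h1.prod_factor y).hasSum
  have h6 : (∑' q : Lattice d × ℕ, h (x - q.1) * dyson h F ψ₀ q.2 q.1 p)
      = ∑' y, h (x - y) * dysonSum h F ψ₀ y p := by
    rw [← h5.tsum_eq]
    refine tsum_congr fun y => ?_
    simp only
    rw [tsum_mul_left]
    rfl
  rw [← h6, ← (Equiv.prodComm ℕ (Lattice d)).tsum_eq]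
  exact h4

theorem integrableOn_rhs [MeasurableSpace Θ] (hF : IsExpBounded h F ψ₀ ν M C)
    {a : Lattice d → ℝ × Θ → ℂ} {x : Lattice d}
    (ha : StronglyMeasurable (rhs h F a x)) {t B : ℝ} (θ : Θ)
    (hB : ∀ s ∈ Set.Ioc 0 t, ∀ y, ‖a y (s, θ)‖ ≤ B * weight ν y) :
    IntegrableOn (fun s => rhs h F a x (s, θ)) (Set.Ioc 0 t) :=
  IntegrableOn.of_bound measure_Ioc_lt_top
    (ha.comp_measurable measurable_prodMk_right).aestronglyMeasurable _
    ((ae_restrict_iff' measurableSet_Ioc).2 (Eventually.of_forall fun s hs =>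
      hF.norm_rhs_le (hB s hs) x))

/-- The Dyson series solves the time integrated Schrödinger equation. -/
theorem dysonSum_eq [MeasurableSpace Θ] (hF : IsExpBounded h F ψ₀ ν M C)
    (hFm : ∀ x, Measurable (F x)) (x : Lattice d) (t : ℝ) (θ : Θ) :
    dysonSum h F ψ₀ x (t, θ)
      = ψ₀ x - Complex.I * ∫ s in Set.Ioc 0 t, rhs h F (dysonSum h F ψ₀) x (s, θ) := by
  have hne : Nonempty Θ := ⟨θ⟩
  have hC := hF.C_nonneg
  have hM := hF.M_nonneg
  have hH := expMoment_nonneg (h := h) (ν := ν)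
  set Λ := expMoment h ν + M with hΛ
  have hΛ0 : 0 ≤ Λ := by positivity
  have hbd : ∀ n, ∀ s ∈ Set.Ioc 0 t, ∀ y, ‖dyson h F ψ₀ n y (s, θ)‖
      ≤ C * ((Λ * t) ^ n / n.factorial) * weight ν y := fun n s hs y => by
    refine (hF.norm_dyson_le n y hs.1.le θ).trans ?_
    have := (weight_pos ν y).le
    have := hs.1.le
    gcongr
    exact hs.2
  have hInt : ∀ n, IntegrableOn (fun s => rhs h F (dyson h F ψ₀ n) x (s, θ)) (Set.Ioc 0 t) :=
    fun n => hF.integrableOn_rhs (stronglyMeasurable_rhs hFm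
      (hF.stronglyMeasurable_dyson hFm n) (fun x p => (summable_hop hF.nu_pos.le hF.summable
        (fun y => hF.norm_dyson_le_max n y p) x).of_norm) x) θ (hbd n)
  have hsum : Summable fun n => ∫ s in Set.Ioc 0 t, ‖rhs h F (dyson h F ψ₀ n) x (s, θ)‖ := by
    refine Summable.of_nonneg_of_le (fun n => integral_nonneg fun _ => norm_nonneg _) (fun n => ?_)
      (((hasSum_bound C (Λ * t) (Λ * weight ν x)).summable).mul_right (volume.real (Set.Ioc 0 t)))
    have h1 := norm_setIntegral_le_of_norm_le_const (μ := volume) (s := Set.Ioc 0 t)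
      (f := fun s => ‖rhs h F (dyson h F ψ₀ n) x (s, θ)‖)
      (C := C * ((Λ * t) ^ n / n.factorial) * (Λ * weight ν x)) measure_Ioc_lt_top
      (fun s hs => by
        rw [norm_norm]
        refine (hF.norm_rhs_le (hbd n s hs) x).trans_eq ?_
        ring)
    exact (Real.le_norm_self _).trans h1
  have h1 := hasSum_integral_of_summable_integral_norm hInt hsum
  have h2 : (fun s => ∑' n, rhs h F (dyson h F ψ₀ n) x (s, θ))
      = fun s => rhs h F (dysonSum h F ψ₀) x (s, θ) :=
    funext fun s => (hF.hasSum_rhs_dyson x (s, θ)).tsum_eq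
  rw [h2] at h1
  rw [dysonSum, (hF.summable_dyson x (t, θ)).tsum_eq_zero_add]
  simp only [dyson_succ]
  rw [tsum_mul_left, h1.tsum_eq, neg_mul, ← sub_eq_add_neg]
  rfl

theorem dysonSum_sub [MeasurableSpace Θ] (hF : IsExpBounded h F ψ₀ ν M C)
    (hFm : ∀ x, Measurable (F x)) (x : Lattice d) {s t : ℝ} (hs : 0 ≤ s) (hst : s ≤ t) (θ : Θ) :
    dysonSum h F ψ₀ x (t, θ) - dysonSum h F ψ₀ x (s, θ)
        = -Complex.I * (∫ r in Set.Ioc s t, rhs h F (dysonSum h F ψ₀) x (r, θ)) ∧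
    ‖dysonSum h F ψ₀ x (t, θ) - dysonSum h F ψ₀ x (s, θ)‖
      ≤ C * Real.exp ((expMoment h ν + M) * t) * (expMoment h ν + M) * weight ν x * (t - s) := by
  have hne : Nonempty Θ := ⟨θ⟩
  have hC := hF.C_nonneg
  have hM := hF.M_nonneg
  have hH := expMoment_nonneg (h := h) (ν := ν)
  have hb : ∀ r ∈ Set.Ioc 0 t, ∀ y, ‖dysonSum h F ψ₀ y (r, θ)‖
      ≤ C * Real.exp ((expMoment h ν + M) * t) * weight ν y := by
    intro r hr y
    refine (hF.norm_dysonSum_le y (r, θ)).trans ?_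
    have := (weight_pos ν y).le
    simp only
    rw [max_eq_left hr.1.le]
    gcongr
    exact hr.2
  have hInt : IntegrableOn (fun r => rhs h F (dysonSum h F ψ₀) x (r, θ)) (Set.Ioc 0 t) :=
    hF.integrableOn_rhs (hF.stronglyMeasurable_rhs_dysonSum hFm x) θ hb
  have e : dysonSum h F ψ₀ x (t, θ) - dysonSum h F ψ₀ x (s, θ)
      = -Complex.I * ∫ r in Set.Ioc s t, rhs h F (dysonSum h F ψ₀) x (r, θ) := by
    rw [hF.dysonSum_eq hFm x t, hF.dysonSum_eq hFm x s, ← Set.Ioc_union_Ioc_eq_Ioc hs hst,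
      setIntegral_union (Set.Ioc_disjoint_Ioc_of_le le_rfl) measurableSet_Ioc
        (hInt.mono_set (Set.Ioc_subset_Ioc_right hst)) (hInt.mono_set (Set.Ioc_subset_Ioc_left hs))]
    ring
  refine ⟨e, ?_⟩
  rw [e, norm_mul, norm_neg, Complex.norm_I, one_mul]
  refine (norm_setIntegral_le_of_norm_le_const measure_Ioc_lt_top fun r hr =>
    hF.norm_rhs_le (hb r ⟨hs.trans_lt hr.1, hr.2⟩) x).trans_eq ?_
  rw [Real.volume_real_Ioc_of_le hst]

variable {m₀ : MeasurableSpace Θ} {ρ : Measure Θ} {𝓕 : ℝ → MeasurableSpace Θ}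

theorem aestronglyMeasurable_rhs {m : MeasurableSpace Θ} (hF : IsExpBounded h F ψ₀ ν M C)
    {G : Lattice d → ℝ × Θ → ℝ}
    {a : Lattice d → ℝ × Θ → ℂ} {s B : ℝ} (ha : ∀ x, AEStronglyMeasurable[m] (fun θ => a x (s, θ)) ρ)
    (hB : ∀ y θ, ‖a y (s, θ)‖ ≤ B * weight ν y) {x : Lattice d}
    (hFs : AEStronglyMeasurable[m] (fun θ => G x (s, θ)) ρ) :
    AEStronglyMeasurable[m] (fun θ => rhs h G a x (s, θ)) ρ := by
  refine AEStronglyMeasurable.add ?_ ?_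
  · refine aestronglyMeasurable_tsum (fun y => (ha y).const_mul _)
      ((summable_hop_weight hF.nu_pos.le hF.summable x).1.mul_left B) fun y θ => ?_
    rw [norm_mul]
    calc ‖h (x - y)‖ * ‖a y (s, θ)‖ ≤ ‖h (x - y)‖ * (B * weight ν y) := by gcongr; exact hB y θ
      _ = _ := by ring
  · exact (Complex.continuous_ofReal.comp_aestronglyMeasurable hFs).mul (ha x)

/-- The term at time `t` involves the potential only at times in `(0, t]`, and it suffices that the
version `F` is adapted at almost every time. Adaptedness is what allows the Markov property to be
applied to the solution. -/
theorem aestronglyMeasurable_dyson [IsFiniteMeasure ρ] (hF : IsExpBounded h F ψ₀ ν M C)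
    (hFm : ∀ x, Measurable (F x)) (h𝓕 : Monotone 𝓕) (hle : ∀ t, 𝓕 t ≤ m₀)
    (hFa : ∀ x, ∀ᵐ s ∂(volume.restrict (Set.Ici (0 : ℝ))),
      AEStronglyMeasurable[𝓕 s] (fun θ => F x (s, θ)) ρ) (n : ℕ) (x : Lattice d) {t : ℝ}
    (ht : 0 ≤ t) : AEStronglyMeasurable[𝓕 t] (fun θ => dyson h F ψ₀ n x (t, θ)) ρ := by
  induction n generalizing x t with
  | zero => exact aestronglyMeasurable_const
  | succ n ih =>
    rcases isEmpty_or_nonempty Θ with hΘ | hΘ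
    · exact ⟨fun _ => 0, stronglyMeasurable_const, Eventually.of_forall fun θ => hΘ.elim θ⟩
    have hC := hF.C_nonneg
    have hM := hF.M_nonneg
    have hH := expMoment_nonneg (h := h) (ν := ν)
    set Λ := expMoment h ν + M with hΛ
    have hΛ0 : 0 ≤ Λ := by positivity
    have hbd : ∀ s ∈ Set.Ioc 0 t, ∀ y θ, ‖dyson h F ψ₀ n y (s, θ)‖
        ≤ C * ((Λ * t) ^ n / n.factorial) * weight ν y := fun s hs y θ => by
      refine (hF.norm_dyson_le n y hs.1.le θ).trans ?_
      have := (weight_pos ν y).le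
      have := hs.1.le
      gcongr
      exact hs.2
    refine (aestronglyMeasurable_integral (hle t) (stronglyMeasurable_rhs hFm
      (hF.stronglyMeasurable_dyson hFm n) (fun x p => (summable_hop hF.nu_pos.le hF.summable
        (fun y => hF.norm_dyson_le_max n y p) x).of_norm) x)
      (fun s hs θ => hF.norm_rhs_le (fun y => hbd s hs y θ) x) ?_).const_mul _
    filter_upwards [ae_restrict_of_ae_restrict_of_subset
      (Set.Ioc_subset_Ioi_self.trans Set.Ioi_subset_Ici_self) (hFa x),
      (ae_restrict_iff' measurableSet_Ioc).2 (Eventually.of_forall fun s hs => hs)] with s hs hs'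
    exact hF.aestronglyMeasurable_rhs
      (fun y => (ih y hs'.1.le).mono (h𝓕 hs'.2)) (hbd s hs') (hs.mono (h𝓕 hs'.2))

theorem aestronglyMeasurable_dysonSum [IsFiniteMeasure ρ] (hF : IsExpBounded h F ψ₀ ν M C)
    (hFm : ∀ x, Measurable (F x)) (h𝓕 : Monotone 𝓕) (hle : ∀ t, 𝓕 t ≤ m₀)
    (hFa : ∀ x, ∀ᵐ s ∂(volume.restrict (Set.Ici (0 : ℝ))),
      AEStronglyMeasurable[𝓕 s] (fun θ => F x (s, θ)) ρ) (x : Lattice d) {t : ℝ} (ht : 0 ≤ t) :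
    AEStronglyMeasurable[𝓕 t] (fun θ => dysonSum h F ψ₀ x (t, θ)) ρ :=
  aestronglyMeasurable_tsum (fun n => hF.aestronglyMeasurable_dyson hFm h𝓕 hle hFa n x ht)
    (hasSum_bound _ _ _).summable fun n θ => hF.norm_dyson_le n x ht θ

end IsExpBounded

end DysonSum

end MarkovAnderson

end

noncomputable section

namespace MarkovAnderson

/-! ### Existence and uniqueness of solutions -/

section Solution

variable {d : ℕ}

theorem summable_exp_moment {h : Lattice d → ℂ} {m ν : ℝ}
    (hh : Summable fun z => Real.exp (m * latticeNorm z) * ‖h z‖) (hν : ν ≤ m) :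
    Summable fun z => Real.exp (ν * latticeNorm z) * ‖h z‖ := by
  refine Summable.of_nonneg_of_le (fun z => by positivity) (fun z => ?_) hh
  gcongr
  exact latticeNorm_nonneg z

theorem summable_weight_sq {ν : ℝ} (hν : 0 < ν) : Summable fun x : Lattice d => weight ν x ^ 2 := by
  refine Summable.of_nonneg_of_le (fun x => sq_nonneg _) (fun x => ?_)
    (summable_exp_neg_latticeNorm hν)
  have h1 := weight_le_one hν.le x
  have h2 := weight_pos ν x
  show weight ν x ^ 2 ≤ weight ν x
  nlinarith

theorem memℓp_of_weight {ν : ℝ} (hν : 0 < ν) {f : Lattice d → ℂ} {B : ℝ}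
    (hf : ∀ x, ‖f x‖ ≤ B * weight ν x) : Memℓp f 2 := by
  refine memℓp_gen ?_
  simp only [ENNReal.toReal_ofNat, Real.rpow_ofNat]
  refine Summable.of_nonneg_of_le (fun x => sq_nonneg _) (fun x => ?_)
    ((summable_weight_sq hν).mul_left (B ^ 2))
  rw [← mul_pow]
  exact pow_le_pow_left₀ (norm_nonneg _) (hf x) 2

theorem norm_le_of_weight {ν : ℝ} (hν : 0 < ν) {f : EllTwo d} {B : ℝ} (hB : 0 ≤ B)
    (hf : ∀ x, ‖f x‖ ≤ B * weight ν x) :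
    ‖f‖ ≤ B * Real.sqrt (∑' x : Lattice d, weight ν x ^ 2) := by
  have h1 : ‖f‖ ^ 2 = ∑' x, ‖f x‖ ^ 2 := by
    have := lp.norm_rpow_eq_tsum (p := 2) (by simp) f
    simpa using this
  have hs : Summable fun x => ‖f x‖ ^ 2 := by
    have := (lp.memℓp f).summable (by simp)
    simpa using this
  refine abs_le_of_sq_le_sq' ?_ (by positivity) |>.2
  rw [h1, mul_pow, Real.sq_sqrt (tsum_nonneg fun x => sq_nonneg _), ← tsum_mul_left]
  refine hs.tsum_le_tsum (fun x => ?_) ((summable_weight_sq hν).mul_left _)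
  rw [← mul_pow]
  exact pow_le_pow_left₀ (norm_nonneg _) (hf x) 2

variable {Θ : Type*} [MeasurableSpace Θ] {h : Lattice d → ℂ} {F : Lattice d → ℝ × Θ → ℝ}
  {ν M C : ℝ} {ψ₀ : EllTwo d}

/-- The Dyson series as a curve in `ℓ²`. -/
def dysonCurve (hF : IsExpBounded h F ψ₀ ν M C) (θ : Θ) (t : ℝ≥0) : EllTwo d :=
  ⟨fun x => dysonSum h F ψ₀ x (t, θ), memℓp_of_weight hF.nu_pos fun x =>
    hF.norm_dysonSum_le x ((t : ℝ), θ)⟩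

theorem continuous_dysonCurve (hF : IsExpBounded h F ψ₀ ν M C) (hFm : ∀ x, Measurable (F x))
    (θ : Θ) : Continuous (dysonCurve hF θ) := by
  have hne : Nonempty Θ := ⟨θ⟩
  have hC := hF.C_nonneg
  have hM := hF.M_nonneg
  have hH := expMoment_nonneg (h := h) (ν := ν)
  set N := Real.sqrt (∑' x : Lattice d, weight ν x ^ 2)
  have key : ∀ s t : ℝ≥0, s ≤ t → ∀ r, t ≤ r → ‖dysonCurve hF θ t - dysonCurve hF θ s‖
      ≤ C * Real.exp ((expMoment h ν + M) * r) * (expMoment h ν + M) * N * dist t s := by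
    intro s t hst r hr
    have hst' : (s : ℝ) ≤ t := hst
    have hr' : (t : ℝ) ≤ r := hr
    refine (norm_le_of_weight hF.nu_pos (B := C * Real.exp ((expMoment h ν + M) * r)
      * (expMoment h ν + M) * (t - s)) (by have := sub_nonneg.2 hst'; positivity)
      fun x => ?_).trans_eq ?_
    · refine ((hF.dysonSum_sub hFm x s.coe_nonneg hst' θ).2).trans ?_
      have h1 := sub_nonneg.2 hst'
      have h2 := (weight_pos ν x).le
      calc _ ≤ C * Real.exp ((expMoment h ν + M) * r) * (expMoment h ν + M) * weight ν x
            * (t - s) := by gcongr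
        _ = _ := by ring
    · rw [NNReal.dist_eq, abs_of_nonneg (sub_nonneg.2 hst')]; ring
  rw [continuous_iff_continuousAt]
  intro a
  set K := C * Real.exp ((expMoment h ν + M) * ((a + 1 : ℝ≥0) : ℝ)) * (expMoment h ν + M) * N
  rw [ContinuousAt, tendsto_iff_norm_sub_tendsto_zero]
  have h1 : Tendsto (fun b : ℝ≥0 => K * dist b a) (𝓝 a) (𝓝 0) := by
    have : Continuous fun b : ℝ≥0 => K * dist b a := by fun_prop
    simpa using this.tendsto a
  refine squeeze_zero' (Eventually.of_forall fun _ => norm_nonneg _) ?_ h1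
  have h2 : ∀ᶠ b : ℝ≥0 in 𝓝 a, b < a + 1 := Iio_mem_nhds (by simp)
  filter_upwards [h2] with b hb
  rcases le_total a b with hab | hab
  · exact key a b hab (a + 1) hb.le
  · rw [norm_sub_rev, dist_comm]
    exact key b a hab (a + 1) (by simp)

theorem ae_rhs_eq {Θ : Type*} {F : Lattice d → ℝ × Θ → ℝ} {w : ℝ≥0 → Lattice d → ℝ} {θ : Θ} {x : Lattice d}
    (hw : ∀ᵐ s ∂(volume.restrict (Set.Ici (0 : ℝ))), w s.toNNReal x = F x (s, θ))
    (hF : IsExpBounded h F ψ₀ ν M C) (t : ℝ≥0) :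
    (fun s : ℝ => hop h (dysonCurve hF θ s.toNNReal) x
      + (w s.toNNReal x : ℂ) * dysonCurve hF θ s.toNNReal x)
      =ᵐ[volume.restrict (Set.Ioc (0 : ℝ) t)] fun s => rhs h F (dysonSum h F ψ₀) x (s, θ) := by
  filter_upwards [ae_restrict_of_ae_restrict_of_subset
      (Set.Ioc_subset_Ioi_self.trans Set.Ioi_subset_Ici_self) hw,
      (ae_restrict_iff' measurableSet_Ioc).2 (Eventually.of_forall fun s hs => hs)] with s hs hs'
  rw [hs]
  simp only [hop, rhs, dysonCurve, Real.coe_toNNReal s hs'.1.le]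

theorem isSolution_dysonCurve {w : ℝ≥0 → Lattice d → ℝ} {θ : Θ}
    (hw : ∀ x, ∀ᵐ s ∂(volume.restrict (Set.Ici (0 : ℝ))), w s.toNNReal x = F x (s, θ))
    (hF : IsExpBounded h F ψ₀ ν M C) (hFm : ∀ x, Measurable (F x)) :
    IsSolution h w ψ₀ (dysonCurve hF θ) where
  continuous := continuous_dysonCurve hF hFm θ
  integrable t x := by
    have hne : Nonempty Θ := ⟨θ⟩
    have hC := hF.C_nonneg
    have hM := hF.M_nonneg
    have hH := expMoment_nonneg (h := h) (ν := ν)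
    rw [intervalIntegrable_iff_integrableOn_Ioc_of_le t.coe_nonneg]
    refine Integrable.congr ?_ (ae_rhs_eq (hw x) hF t).symm
    refine hF.integrableOn_rhs (hF.stronglyMeasurable_rhs_dysonSum hFm x) θ
      (B := C * Real.exp ((expMoment h ν + M) * t)) fun s hs y => ?_
    refine (hF.norm_dysonSum_le y (s, θ)).trans ?_
    have := (weight_pos ν y).le
    simp only
    rw [max_eq_left hs.1.le]
    gcongr
    exact hs.2
  integral_eq t x := by
    rw [intervalIntegral.integral_of_le t.coe_nonneg, integral_congr_ae (ae_rhs_eq (hw x) hF t),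
      ← hF.dysonSum_eq hFm x t θ]
    rfl

theorem summable_hop_ellTwo {h : Lattice d → ℂ} (hh : Summable fun z => ‖h z‖) (ψ : EllTwo d)
    (x : Lattice d) : Summable fun y => h (x - y) * ψ y := by
  refine Summable.of_norm_bounded
    (((Equiv.subLeft x).summable_iff (f := fun z => ‖h z‖)).2 hh |>.mul_right ‖ψ‖) fun y => ?_
  rw [norm_mul]
  exact mul_le_mul_of_nonneg_left (lp.norm_apply_le_norm (by simp) ψ y) (norm_nonneg _)

/-- On a compact time interval the difference of two solutions is bounded uniformly in the site.
Iterating the integral equation improves the bound to `B(Λt)ⁿ/n!` for every `n`. A bound on the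
potential at almost every time is enough. -/
theorem isSolution_unique {h : Lattice d → ℂ} (hh : Summable fun z => ‖h z‖)
    {w : ℝ≥0 → Lattice d → ℝ} {M : ℝ} (hM : 0 ≤ M)
    (hw : ∀ x, ∀ᵐ s ∂(volume.restrict (Set.Ici (0 : ℝ))), |w s.toNNReal x| ≤ M)
    {ψ₀ : EllTwo d} {ψ ψ' : ℝ≥0 → EllTwo d} (hψ : IsSolution h w ψ₀ ψ)
    (hψ' : IsSolution h w ψ₀ ψ') : ψ = ψ' := by
  funext T
  obtain ⟨B, hB⟩ := (isCompact_Icc (a := (0 : ℝ≥0)) (b := T)).exists_bound_of_continuousOn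
    ((hψ.continuous.sub hψ'.continuous).continuousOn)
  have hh0 : Summable fun z => Real.exp (0 * latticeNorm z) * ‖h z‖ := by simpa using hh
  have hH := expMoment_nonneg (h := h) (ν := 0)
  set Λ := expMoment h 0 + M with hΛ
  have hΛ0 : 0 ≤ Λ := by positivity
  have key : ∀ n : ℕ, ∀ t : ℝ≥0, t ≤ T → ∀ x, ‖ψ t x - ψ' t x‖ ≤ B * ((Λ * t) ^ n / n.factorial) := by
    intro n
    induction n with
    | zero =>
      intro t ht x
      simp only [pow_zero, Nat.factorial_zero, Nat.cast_one, div_one, mul_one]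
      exact (lp.norm_apply_le_norm (by simp) (ψ t - ψ' t) x).trans (hB t ⟨zero_le, ht⟩)
    | succ n ih =>
      intro t ht x
      rw [hψ.integral_eq t x, hψ'.integral_eq t x, sub_sub_sub_cancel_left, ← mul_sub,
        ← intervalIntegral.integral_sub (hψ'.integrable t x) (hψ.integrable t x), norm_mul,
        Complex.norm_I, one_mul]
      have hbound : ∀ᵐ s ∂volume, s ∈ Set.Ioc (0 : ℝ) t →
          ‖hop h (ψ' s.toNNReal) x + (w s.toNNReal x : ℂ) * ψ' s.toNNReal x
            - (hop h (ψ s.toNNReal) x + (w s.toNNReal x : ℂ) * ψ s.toNNReal x)‖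
          ≤ B * Λ ^ (n + 1) / n.factorial * s ^ n := by
        rw [← ae_restrict_iff' measurableSet_Ioc]
        filter_upwards [ae_restrict_of_ae_restrict_of_subset
          (Set.Ioc_subset_Ioi_self.trans Set.Ioi_subset_Ici_self) (hw x),
          (ae_restrict_iff' measurableSet_Ioc).2 (Eventually.of_forall fun s hs => hs)] with s hs hs'
        have hsT : s.toNNReal ≤ T := (Real.toNNReal_le_iff_le_coe.2 hs'.2).trans ht
        have hsc : ((s.toNNReal : ℝ≥0) : ℝ) = s := Real.coe_toNNReal s hs'.1.le
        have h1 := fun y => ih s.toNNReal hsT y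
        rw [hsc] at h1
        have h2 : hop h (ψ' s.toNNReal) x - hop h (ψ s.toNNReal) x
            = ∑' y, h (x - y) * (ψ' s.toNNReal y - ψ s.toNNReal y) := by
          rw [hop, hop, ← (summable_hop_ellTwo hh _ x).tsum_sub (summable_hop_ellTwo hh _ x)]
          exact tsum_congr fun y => (mul_sub _ _ _).symm
        have h3 := norm_hop_le (ν := 0) le_rfl hh0
          (g := fun y => ψ' s.toNNReal y - ψ s.toNNReal y)
          (B := B * ((Λ * s) ^ n / n.factorial)) (fun y => by
            rw [norm_sub_rev]; simpa [weight] using h1 y) x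
        have h4 : ‖(w s.toNNReal x : ℂ) * (ψ' s.toNNReal x - ψ s.toNNReal x)‖
            ≤ M * (B * ((Λ * s) ^ n / n.factorial)) := by
          rw [norm_mul, Complex.norm_real, Real.norm_eq_abs, norm_sub_rev]
          exact mul_le_mul hs (h1 x) (norm_nonneg _) hM
        have h5 : hop h (ψ' s.toNNReal) x + (w s.toNNReal x : ℂ) * ψ' s.toNNReal x
            - (hop h (ψ s.toNNReal) x + (w s.toNNReal x : ℂ) * ψ s.toNNReal x)
            = (∑' y, h (x - y) * (ψ' s.toNNReal y - ψ s.toNNReal y))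
              + (w s.toNNReal x : ℂ) * (ψ' s.toNNReal x - ψ s.toNNReal x) := by
          rw [← h2]; ring
        rw [h5]
        refine (norm_add_le _ _).trans ((add_le_add h3 h4).trans_eq ?_)
        simp only [weight, zero_mul, neg_zero, Real.exp_zero, mul_one]
        rw [mul_pow, hΛ]; ring
      refine (intervalIntegral.norm_integral_le_of_norm_le t.coe_nonneg hbound
        (Continuous.intervalIntegrable (by fun_prop) _ _)).trans_eq ?_
      rw [intervalIntegral.integral_const_mul, integral_pow, mul_pow, Nat.factorial_succ]
      push_cast
      field_simp
      simp
  refine lp.ext (funext fun x => ?_)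
  have hlim : Tendsto (fun n : ℕ => B * ((Λ * (T : ℝ)) ^ n / n.factorial)) atTop (𝓝 0) := by
    simpa using (FloorSemiring.tendsto_pow_div_factorial_atTop (Λ * (T : ℝ))).const_mul B
  have := ge_of_tendsto' hlim fun n => key n T le_rfl x
  exact sub_eq_zero.1 (norm_le_zero_iff.1 this)

theorem solution_eq {h : Lattice d → ℂ} {w : ℝ≥0 → Lattice d → ℝ} {ψ₀ : EllTwo d}
    {ψ : ℝ≥0 → EllTwo d} (hψ : IsSolution h w ψ₀ ψ)
    (huniq : ∀ ψ', IsSolution h w ψ₀ ψ' → ψ' = ψ) : solution h w ψ₀ = ψ := by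
  have H : ∃ ψ, IsSolution h w ψ₀ ψ := ⟨ψ, hψ⟩
  rw [solution, dif_pos H]
  exact huniq _ H.choose_spec

end Solution

end MarkovAnderson

end

noncomputable section

namespace MarkovAnderson

/-! ### Multiplication by bounded functions -/

section Mul

variable {α : Type*} [MeasurableSpace α] {ρ : Measure α}

/-- Multiplication by a bounded function on `L²`. -/
def mulL2 {w : α → ℂ} (hw : MemLp w ∞ ρ) : Lp ℂ 2 ρ →L[ℂ] Lp ℂ 2 ρ :=
  (ContinuousLinearMap.mul ℂ ℂ).holderL ρ ∞ 2 2 (hw.toLp w)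

theorem coeFn_mulL2 {w : α → ℂ} (hw : MemLp w ∞ ρ) (f : Lp ℂ 2 ρ) :
    mulL2 hw f =ᵐ[ρ] fun a => w a * f a := by
  filter_upwards [(ContinuousLinearMap.mul ℂ ℂ).coeFn_holder (r := 2) (hw.toLp w) f, hw.coeFn_toLp]
    with a h1 h2
  rw [← h2]
  exact h1

theorem norm_mulL2_le {w : α → ℂ} (hw : MemLp w ∞ ρ) {M : ℝ} (hM : ∀ᵐ a ∂ρ, ‖w a‖ ≤ M)
    (f : Lp ℂ 2 ρ) : ‖mulL2 hw f‖ ≤ M * ‖f‖ := by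
  refine Lp.norm_le_mul_norm_of_ae_le_mul ?_
  filter_upwards [coeFn_mulL2 hw f, hM] with a h1 h2
  rw [h1, norm_mul]
  gcongr

theorem integral_norm_le_norm [IsProbabilityMeasure ρ] (g : Lp ℂ 2 ρ) : ∫ a, ‖g a‖ ∂ρ ≤ ‖g‖ := by
  have h1 : MemLp (fun a => (‖g a‖ : ℂ)) 2 ρ := by
    refine (Lp.memLp g).norm.ofReal
  have h2 : inner ℂ (oneL2 ρ) (h1.toLp _) = ((∫ a, ‖g a‖ ∂ρ : ℝ) : ℂ) := by
    rw [inner_oneL2, ← integral_complex_ofReal]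
    exact integral_congr_ae h1.coeFn_toLp
  have h3 : ‖h1.toLp _‖ ≤ ‖g‖ := by
    refine Lp.norm_le_norm_of_ae_le ?_
    filter_upwards [h1.coeFn_toLp] with a ha
    rw [ha]; simp
  have h4 := norm_inner_le_norm (𝕜 := ℂ) (oneL2 ρ) (h1.toLp _)
  rw [h2, norm_oneL2, one_mul, Complex.norm_real] at h4
  exact (Real.le_norm_self _).trans (h4.trans h3)

/-- The interpolation `‖g‖₂² ≤ ‖g‖_∞ ‖g‖₁`, used to upgrade right differentiability from `L¹` to
`L²`. -/
theorem norm_toLp_sq_le {g : α → ℂ} (hg : MemLp g 2 ρ) {B : ℝ} [IsFiniteMeasure ρ]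
    (hB : ∀ᵐ a ∂ρ, ‖g a‖ ≤ B) : ‖hg.toLp g‖ ^ 2 ≤ B * ∫ a, ‖g a‖ ∂ρ := by
  have h1 : ((‖hg.toLp g‖ ^ 2 : ℝ) : ℂ) = ((∫ a, ‖g a‖ ^ 2 ∂ρ : ℝ) : ℂ) := by
    have h2 := inner_self_eq_norm_sq_to_K (𝕜 := ℂ) (hg.toLp g)
    push_cast
    rw [← integral_complex_ofReal]
    refine h2.symm.trans ?_
    rw [L2.inner_def]
    refine integral_congr_ae ?_
    filter_upwards [hg.coeFn_toLp] with a ha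
    rw [ha, inner_self_eq_norm_sq_to_K]
    simp
  rw [Complex.ofReal_injective h1, ← integral_const_mul]
  refine integral_mono_ae ?_ ((hg.integrable (by norm_num)).norm.const_mul B) ?_
  · exact hg.norm.integrable_sq
  · filter_upwards [hB] with a ha
    nlinarith [norm_nonneg (g a)]

end Mul

/-! ### A bounded measurable version of the potential and the solution along a path -/

section Potential

variable {d : ℕ} {Ω : Type*} [TopologicalSpace Ω] [MeasurableSpace Ω] {μ : Measure Ω}
  {σ : Lattice d → Ω → Ω} {P : Kernel Ω (RCPath Ω)}

/-- A bounded measurable version `F` of the processes `v_x(ω_t)`. -/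
structure IsVersion (μ : Measure Ω) (σ : Lattice d → Ω → Ω) (P : Kernel Ω (RCPath Ω)) (v₀ : Ω → ℝ)
    (F : Lattice d → ℝ × RCPath Ω → ℝ) (M : ℝ) : Prop where
  M_nonneg : 0 ≤ M
  measurable : ∀ x, Measurable (F x)
  bound : ∀ x p, |F x p| ≤ M
  ae_eq : ∀ x, ∀ᵐ p ∂((volume.restrict (Set.Ici (0 : ℝ))).prod (jointLaw μ P)),
    v₀ (σ x (p.2.1 p.1.toNNReal)) = F x p
  ae_bound : ∀ᵐ a ∂μ, |v₀ a| ≤ M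

theorem aestronglyMeasurable_past_comp (hP : IsMarkovFamily μ σ P) {f : Ω → ℝ}
    (hf : AEStronglyMeasurable f μ) {s t : ℝ≥0} (hst : s ≤ t) :
    AEStronglyMeasurable[past Ω t] (fun ω => f (ω.1 s)) (jointLaw μ P) := by
  obtain ⟨g, hg, hfg⟩ := hf
  have h1 : StronglyMeasurable[past Ω t] fun ω : RCPath Ω => g (ω.1 s) :=
    hg.comp_measurable (measurable_past_eval hst)
  exact ⟨_, h1, (hP.measurePreserving_eval s).quasiMeasurePreserving.ae hfg⟩

theorem IsPotential.aestronglyMeasurable_shift (hσ : IsShiftAction μ σ) {hP : IsMarkovFamily μ σ P}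
    {v₀ : Ω → ℝ} (hv : IsPotential hP v₀) (x : Lattice d) :
    AEStronglyMeasurable (fun a => v₀ (σ x a)) μ :=
  hv.memLp.1.comp_measurePreserving (hσ.measurePreserving x)

theorem IsVersion.ae_bound_eval {v₀ : Ω → ℝ} {F : Lattice d → ℝ × RCPath Ω → ℝ} {M : ℝ}
    (hF : IsVersion μ σ P v₀ F M) (hσ : IsShiftAction μ σ)
    (hP : IsMarkovFamily μ σ P) (x : Lattice d) (t : ℝ≥0) :
    ∀ᵐ ω ∂(jointLaw μ P), |v₀ (σ x (ω.1 t))| ≤ M :=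
  ((hσ.measurePreserving x).comp (hP.measurePreserving_eval t)).quasiMeasurePreserving.ae hF.ae_bound

variable [IsProbabilityMeasure μ] [IsMarkovKernel P]

theorem exists_isVersion (hσ : IsShiftAction μ σ) (hP : IsMarkovFamily μ σ P) {v₀ : Ω → ℝ}
    (hv : IsPotential hP v₀) : ∃ F M, IsVersion μ σ P v₀ F M := by
  obtain ⟨M, hM⟩ : ∃ M, ∀ᵐ a ∂μ, |v₀ a| ≤ M := by
    have h1 := hv.memLp.2
    rw [eLpNorm_exponent_top] at h1
    refine ⟨(eLpNormEssSup v₀ μ).toReal, ?_⟩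
    filter_upwards [ae_le_eLpNormEssSup (f := v₀) (μ := μ)] with a ha
    have := ENNReal.toReal_mono h1.ne ha
    simpa using this
  have hM0 : 0 ≤ M := by
    obtain ⟨a, ha⟩ := hM.exists
    exact (abs_nonneg _).trans ha
  -- The measurable modification is clamped to `[-M, M]`. By stationarity it already lies there
  -- almost everywhere, so the clamping changes it only on a null set while making the bound hold
  -- everywhere.
  refine ⟨fun x p => max (-M) (min ((hv.measurable x).mk _ p) M), M, hM0, fun x => ?_,
    fun x p => ?_, fun x => ?_, hM⟩
  · exact measurable_const.max ((hv.measurable x).measurable_mk.min measurable_const)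
  · exact abs_le.2 ⟨le_max_left _ _, max_le (by linarith) (min_le_right _ _)⟩
  · set F := (hv.measurable x).mk _ with hF
    have hFm : Measurable F := (hv.measurable x).measurable_mk
    have hae := (hv.measurable x).ae_eq_mk
    have h1 : ∀ᵐ p ∂((volume.restrict (Set.Ici (0 : ℝ))).prod (jointLaw μ P)), |F p| ≤ M := by
      rw [Measure.ae_prod_iff_ae_ae (measurableSet_le hFm.abs measurable_const)]
      filter_upwards [Measure.ae_ae_of_ae_prod hae] with s hs
      have h2 := ((hσ.measurePreserving x).comp
        (hP.measurePreserving_eval s.toNNReal)).quasiMeasurePreserving.ae hM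
      filter_upwards [hs, h2] with ω h3 h4
      rw [hF, ← h3]
      exact h4
    filter_upwards [hae, h1] with p h2 h3
    rw [h2, min_eq_left (abs_le.1 h3).2, max_eq_right (abs_le.1 h3).1]

namespace IsVersion

variable {v₀ : Ω → ℝ} {F : Lattice d → ℝ × RCPath Ω → ℝ} {M : ℝ}

theorem ae_time (hF : IsVersion μ σ P v₀ F M) (x : Lattice d) :
    ∀ᵐ s ∂(volume.restrict (Set.Ici (0 : ℝ))), ∀ᵐ ω ∂(jointLaw μ P),
      v₀ (σ x (ω.1 s.toNNReal)) = F x (s, ω) :=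
  Measure.ae_ae_of_ae_prod (hF.ae_eq x)

/-- Fubini in the other order: along almost every path the potential and its version agree at almost
every time. The time integrated Schrödinger equation does not distinguish them. -/
theorem ae_path (hF : IsVersion μ σ P v₀ F M) :
    ∀ᵐ ω ∂(jointLaw μ P), ∀ x, ∀ᵐ s ∂(volume.restrict (Set.Ici (0 : ℝ))),
      pathPotential σ v₀ ω s.toNNReal x = F x (s, ω) := by
  rw [ae_all_iff]
  intro x
  have h1 := hF.ae_eq x
  rw [← Measure.prod_swap] at h1
  have h2 := ae_of_ae_map measurable_swap.aemeasurable h1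
  exact Measure.ae_ae_of_ae_prod h2

theorem adapted (hF : IsVersion μ σ P v₀ F M) (hσ : IsShiftAction μ σ) (hP : IsMarkovFamily μ σ P)
    (hv : IsPotential hP v₀) (x : Lattice d) : ∀ᵐ s ∂(volume.restrict (Set.Ici (0 : ℝ))),
      AEStronglyMeasurable[past Ω s.toNNReal] (fun ω => F x (s, ω)) (jointLaw μ P) := by
  filter_upwards [hF.ae_time x] with s hs
  exact (aestronglyMeasurable_past_comp hP (hv.aestronglyMeasurable_shift hσ x) le_rfl).congr hs

variable {h : Lattice d → ℂ} {ψ₀ : EllTwo d} {ν C : ℝ}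

theorem ae_solution (hF : IsVersion μ σ P v₀ F M) (hb : IsExpBounded h F ψ₀ ν M C) :
    ∀ᵐ ω ∂(jointLaw μ P), IsSolution h (pathPotential σ v₀ ω) ψ₀ (dysonCurve hb ω) ∧
      ∀ ψ, IsSolution h (pathPotential σ v₀ ω) ψ₀ ψ → ψ = dysonCurve hb ω := by
  filter_upwards [hF.ae_path] with ω hω
  have h1 := isSolution_dysonCurve hω hb hF.measurable
  refine ⟨h1, fun ψ hψ => isSolution_unique ?_ hF.M_nonneg (fun x => ?_) hψ h1⟩
  · simpa using summable_exp_moment hb.summable hb.nu_pos.le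
  · filter_upwards [hω x] with s hs
    rw [hs]
    exact hF.bound x _

end IsVersion

theorem exists_isExpBounded {Θ : Type*} {h : Lattice d → ℂ} (hh : IsHoppingKernel h)
    {F : Lattice d → ℝ × Θ → ℝ} {M : ℝ} (hM : ∀ x p, |F x p| ≤ M) {ψ₀ : EllTwo d}
    (hψ₀ : ExpDecay ψ₀) : ∃ ν C, IsExpBounded h F ψ₀ ν M C := by
  obtain ⟨m, hm, hs⟩ := hh.expBounded
  obtain ⟨ν, hν, C, hC⟩ := hψ₀
  refine ⟨min m ν, C, lt_min hm hν, summable_exp_moment hs (min_le_left _ _), hM, fun x => ?_⟩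
  have h1 : Real.exp (ν * latticeNorm x) * ‖ψ₀ x‖ ≤ C := hC ⟨x, rfl⟩
  have h2 : ‖ψ₀ x‖ ≤ C * weight ν x := by
    rw [weight, Real.exp_neg, ← div_eq_mul_inv, le_div_iff₀ (Real.exp_pos _), mul_comm]
    exact h1
  have h3 : 0 ≤ C := le_trans (by positivity) h1
  exact h2.trans (mul_le_mul_of_nonneg_left (weight_anti (min_le_right _ _) x) h3)

end Potential

end MarkovAnderson

end

noncomputable section

namespace MarkovAnderson

/-! ### The solution as a process in `L²` -/

section SumLp

variable {α ι : Type*} [MeasurableSpace α] {ρ : Measure α} [IsProbabilityMeasure ρ]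

theorem norm_toLp_le {f : α → ℂ} (hf : MemLp f 2 ρ) {c : ℝ} (hc : 0 ≤ c)
    (hfc : ∀ᵐ a ∂ρ, ‖f a‖ ≤ c) : ‖hf.toLp f‖ ≤ c := by
  have := Lp.norm_le_of_ae_bound (f := hf.toLp f) hc (by
    filter_upwards [hfc, hf.coeFn_toLp] with a h1 h2
    rwa [h2])
  simpa [measureUnivNNReal] using this

theorem hasSum_toLp {f : ι → α → ℂ} (hf : ∀ i, MemLp (f i) 2 ρ) {c : ι → ℝ} (hc : Summable c)
    (hfc : ∀ i a, ‖f i a‖ ≤ c i) {g : α → ℂ} (hg : MemLp g 2 ρ)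
    (hgf : ∀ a, g a = ∑' i, f i a) : HasSum (fun i => (hf i).toLp (f i)) (hg.toLp g) := by
  classical
  have hne : Nonempty α := ρ.nonempty_of_neZero
  have hc0 : ∀ i, 0 ≤ c i := fun i => (norm_nonneg _).trans (hfc i (Classical.arbitrary α))
  have hs : ∀ a, Summable fun i => f i a := fun a => Summable.of_norm_bounded hc fun i => hfc i a
  rw [HasSum, SummationFilter.unconditional_filter, tendsto_iff_norm_sub_tendsto_zero]
  refine squeeze_zero (fun _ => norm_nonneg _) (fun s => ?_) (tendsto_tsum_compl_atTop_zero c)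
  have h1 : MemLp (fun a => g a - ∑ i ∈ s, f i a) 2 ρ :=
    hg.sub (memLp_finsetSum s fun i _ => hf i)
  have h2 : hg.toLp g - ∑ i ∈ s, (hf i).toLp (f i) = h1.toLp _ := by
    refine Lp.ext ?_
    filter_upwards [h1.coeFn_toLp, hg.coeFn_toLp, Lp.coeFn_sub (hg.toLp g)
      (∑ i ∈ s, (hf i).toLp (f i)), Lp.coeFn_finsetSum s (fun i => (hf i).toLp (f i)),
      (ae_ball_iff s.countable_toSet).2 fun i _ => (hf i).coeFn_toLp] with a e1 e2 e3 e4 e5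
    rw [e3, Pi.sub_apply, e1, e2, e4, Finset.sum_apply]
    congr 1
    exact Finset.sum_congr rfl fun i hi => e5 i hi
  rw [norm_sub_rev, h2]
  refine norm_toLp_le h1 (tsum_nonneg fun i => hc0 _) (Eventually.of_forall fun a => ?_)
  rw [hgf a, ← (hs a).sum_add_tsum_compl (s := s), add_sub_cancel_left]
  exact tsum_of_norm_bounded (hc.subtype _).hasSum fun i => hfc i a

end SumLp

section PotentialProcess

variable {d : ℕ} {Ω : Type*} [TopologicalSpace Ω] [MeasurableSpace Ω] {μ : Measure Ω}
  {σ : Lattice d → Ω → Ω} {P : Kernel Ω (RCPath Ω)}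
  {v₀ : Ω → ℝ} {F : Lattice d → ℝ × RCPath Ω → ℝ} {M : ℝ}
  {h : Lattice d → ℂ} {ψ₀ : Lattice d → ℂ} {ν C : ℝ}

/-- The process `v_x(ω_t)`. -/
def potentialProcess (σ : Lattice d → Ω → Ω) (v₀ : Ω → ℝ) (x : Lattice d) (p : ℝ × RCPath Ω) : ℝ :=
  v₀ (σ x (p.2.1 p.1.toNNReal))

theorem norm_dysonSum_le_of_le {Θ : Type*} {F : Lattice d → ℝ × Θ → ℝ}
    (hb : IsExpBounded h F ψ₀ ν M C) {s τ : ℝ} (hs : 0 ≤ s) (hsτ : s ≤ τ) (θ : Θ) (x : Lattice d) :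
    ‖dysonSum h F ψ₀ x (s, θ)‖ ≤ C * Real.exp ((expMoment h ν + M) * τ) * weight ν x := by
  have hne : Nonempty Θ := ⟨θ⟩
  have hC := hb.C_nonneg
  have hM := hb.M_nonneg
  have hH := expMoment_nonneg (h := h) (ν := ν)
  refine (hb.norm_dysonSum_le x (s, θ)).trans ?_
  have := (weight_pos ν x).le
  rw [max_eq_left hs]
  gcongr

variable [IsProbabilityMeasure μ] [IsMarkovKernel P] [BorelSpace Ω]

set_option maxHeartbeats 1000000 in
/-- The solution is differentiable from the right in `L¹`. -/
theorem tendsto_integral_norm_slope (hσ : IsShiftAction μ σ) (hP : IsMarkovFamily μ σ P)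
    (hv : IsPotential hP v₀) (hF : IsVersion μ σ P v₀ F M) (hb : IsExpBounded h F ψ₀ ν M C)
    (x : Lattice d) {t : ℝ} (ht : 0 ≤ t) :
    Tendsto (fun δ : ℝ => ∫ ω, ‖δ⁻¹ • (dysonSum h F ψ₀ x (t + δ, ω) - dysonSum h F ψ₀ x (t, ω))
      - -Complex.I * rhs h (potentialProcess σ v₀) (dysonSum h F ψ₀) x (t, ω)‖ ∂(jointLaw μ P))
      (𝓝[>] 0) (𝓝 0) := by
  have hne : Nonempty (RCPath Ω) := (jointLaw μ P).nonempty_of_neZero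
  have hC := hb.C_nonneg
  have hM := hb.M_nonneg
  have hH := expMoment_nonneg (h := h) (ν := ν)
  set Λ := expMoment h ν + M with hΛ
  have hΛ0 : 0 ≤ Λ := by positivity
  set A := C * Real.exp (Λ * (t + 1)) with hA
  have hA0 : 0 ≤ A := by positivity
  have hW := weight_pos ν x
  have hvm := hv.aestronglyMeasurable_shift hσ x
  have hvL : MemLp (fun a => ((v₀ (σ x a) : ℝ) : ℂ)) 2 μ := by
    refine MemLp.of_bound (Complex.continuous_ofReal.comp_aestronglyMeasurable hvm) M ?_
    filter_upwards [(hσ.measurePreserving x).quasiMeasurePreserving.ae hF.ae_bound] with a ha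
    simpa using ha
  set V : Lp ℂ 2 μ := hvL.toLp _ with hV
  have hVe : ∀ s : ℝ≥0, evalL2 hP s V =ᵐ[jointLaw μ P] fun ω => ((v₀ (σ x (ω.1 s)) : ℝ) : ℂ) :=
    fun s => by
      filter_upwards [coeFn_evalL2 hP s V,
        (hP.measurePreserving_eval s).quasiMeasurePreserving.ae hvL.coeFn_toLp] with ω h1 h2
      rw [h1, h2]
  set R : RCPath Ω → ℂ := fun ω => rhs h (potentialProcess σ v₀) (dysonSum h F ψ₀) x (t, ω) with hR
  have hRb : ∀ᵐ ω ∂(jointLaw μ P), ‖R ω‖ ≤ A * Λ * weight ν x := by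
    filter_upwards [hF.ae_bound_eval hσ hP x t.toNNReal] with ω hω
    exact hb.norm_rhs_le_of_abs_le hω (norm_dysonSum_le_of_le hb ht (by linarith) ω)
  have hRm : AEStronglyMeasurable R (jointLaw μ P) := by
    refine hb.aestronglyMeasurable_rhs (B := A) (fun y =>
      ((hb.stronglyMeasurable_dysonSum hF.measurable y).comp_measurable
        measurable_prodMk_left).aestronglyMeasurable)
      (fun y ω => norm_dysonSum_le_of_le hb ht (by linarith) ω y) ?_
    exact hvm.comp_quasiMeasurePreserving 
      (hP.measurePreserving_eval t.toNNReal).quasiMeasurePreserving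
  have hrm := hb.stronglyMeasurable_rhs_dysonSum hF.measurable x
  rw [Metric.tendsto_nhds]
  intro e he
  -- The potential `t ↦ v_x(ω_t)` need not be right-continuous along paths, since `v₀` is only
  -- measurable. Right-continuity of the process in `L²` takes its place.
  have hlim : Tendsto (fun δ : ℝ => A * Λ * Λ * weight ν x * δ + A * weight ν x
      * ‖evalL2 hP (t.toNNReal + δ.toNNReal) V - evalL2 hP t.toNNReal V‖) (𝓝[>] 0) (𝓝 0) := by
    have h1 := ((tendsto_iff_norm_sub_tendsto_zero.1
      (tendsto_evalL2_add hP t.toNNReal V)).comp tendsto_toNNReal_nhdsGT).const_mul (A * weight ν x)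
    have h2 := (tendsto_id_nhdsGT_zero).const_mul (A * Λ * Λ * weight ν x)
    simpa using h2.add h1
  have hlim' := (hlim.eventually (gt_mem_nhds (half_pos he)))
  rw [eventually_nhdsWithin_iff, Metric.eventually_nhds_iff] at hlim'
  obtain ⟨δ₀, hδ₀, hsmall⟩ := hlim'
  have hev : ∀ᶠ δ : ℝ in 𝓝[>] 0, δ < min δ₀ 1 :=
    (gt_mem_nhds (lt_min hδ₀ one_pos)).filter_mono nhdsWithin_le_nhds
  filter_upwards [hev, self_mem_nhdsWithin] with δ hδ hδ0
  have hδ0' : (0 : ℝ) < δ := hδ0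
  have hδ1 : δ < 1 := hδ.trans_le (min_le_right _ _)
  -- The integrand at time `r` is built from the version `F`, whereas `R` uses the potential itself:
  -- at the fixed time `t` the two may differ, and they agree only for almost every `r`.
  set G : ℝ × RCPath Ω → ℂ := fun p => rhs h F (dysonSum h F ψ₀) x p - R p.2 with hG
  have hGi : Integrable G ((volume.restrict (Set.Ioc t (t + δ))).prod (jointLaw μ P)) := by
    refine Integrable.of_bound (hrm.aestronglyMeasurable.sub hRm.comp_snd)
      (A * Λ * weight ν x + A * Λ * weight ν x) ?_
    filter_upwards [Measure.quasiMeasurePreserving_fst.ae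
      (ae_restrict_mem (μ := volume) (measurableSet_Ioc (a := t) (b := t + δ))),
      Measure.quasiMeasurePreserving_snd.ae hRb] with p h1 h2
    refine (norm_sub_le _ _).trans (add_le_add ?_ h2)
    exact hb.norm_rhs_le (fun y => norm_dysonSum_le_of_le hb (ht.trans h1.1.le)
      (by linarith [h1.2]) p.2 y) x
  have hae : ∀ᵐ r ∂(volume.restrict (Set.Ioc t (t + δ))), ∫ ω, ‖G (r, ω)‖ ∂(jointLaw μ P) ≤ e / 2 := by
    filter_upwards [ae_restrict_of_ae_restrict_of_subset (fun r hr => Set.mem_Ici.2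
      (ht.trans (Set.mem_Ioc.1 hr).1.le)) (hF.ae_time x),
      ae_restrict_mem (measurableSet_Ioc (a := t) (b := t + δ))] with r hr hr'
    have hr0 : 0 < r - t := sub_pos.2 hr'.1
    have hrn : r.toNNReal = t.toNNReal + (r - t).toNNReal := by
      rw [← Real.toNNReal_add ht hr0.le, add_sub_cancel]
    have hs := hsmall (y := r - t) (by
      rw [dist_zero_right, Real.norm_of_nonneg hr0.le]
      exact lt_of_le_of_lt (by linarith [hr'.2]) (hδ.trans_le (min_le_left _ _))) hr0
    rw [← hrn] at hs
    set D := evalL2 hP r.toNNReal V - evalL2 hP t.toNNReal V with hD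
    have hDi : Integrable (fun ω => ‖D ω‖) (jointLaw μ P) :=
      ((Lp.memLp D).integrable (by norm_num)).norm
    have h1 : ∫ ω, ‖G (r, ω)‖ ∂(jointLaw μ P)
        ≤ ∫ ω, (A * Λ * Λ * weight ν x * (r - t) + A * weight ν x * ‖D ω‖) ∂(jointLaw μ P) := by
      refine integral_mono_of_nonneg (Eventually.of_forall fun _ => norm_nonneg _)
        ((integrable_const _).add (hDi.const_mul _)) ?_
      filter_upwards [hr, hVe r.toNNReal, hVe t.toNNReal,
        Lp.coeFn_sub (evalL2 hP r.toNNReal V) (evalL2 hP t.toNNReal V)] with ω h2 h3 h4 h5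
      have h6 : D ω = ((F x (r, ω) : ℝ) : ℂ) - ((potentialProcess σ v₀ x (t, ω) : ℝ) : ℂ) := by
        rw [hD, h5, Pi.sub_apply, h3, h4, h2]; rfl
      have hsum : ∀ s, 0 ≤ s → s ≤ t + 1 → Summable fun y => h (x - y) * dysonSum h F ψ₀ y (s, ω) :=
        fun s hs hs' => (summable_hop hb.nu_pos.le hb.summable
          (fun y => norm_dysonSum_le_of_le hb hs hs' ω y) x).of_norm
      -- The change splits into that of the amplitudes, which is Lipschitz in time, and that of the
      -- potential, which is `D`.
      have h7 : G (r, ω) = rhs h F (fun y p => dysonSum h F ψ₀ y p - dysonSum h F ψ₀ y (t, p.2)) x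
          (r, ω) + D ω * dysonSum h F ψ₀ x (t, ω) := by
        rw [hG, h6]
        simp only [hR, rhs, mul_sub]
        rw [(hsum r (ht.trans hr'.1.le) (by linarith [hr'.2])).tsum_sub
          (hsum t ht (by linarith))]
        ring
      rw [h7]
      refine (norm_add_le _ _).trans (add_le_add ?_ ?_)
      · have h8 := hb.norm_rhs_le (a := fun y p => dysonSum h F ψ₀ y p - dysonSum h F ψ₀ y (t, p.2))
          (p := (r, ω)) (B := A * Λ * (r - t)) (fun y => by
            refine (hb.dysonSum_sub hF.measurable y ht hr'.1.le ω).2.trans ?_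
            have := (weight_pos ν y).le
            calc C * Real.exp (Λ * r) * Λ * weight ν y * (r - t)
                ≤ C * Real.exp (Λ * (t + 1)) * Λ * weight ν y * (r - t) := by
                  gcongr; linarith [hr'.2]
              _ = _ := by rw [hA]; ring) x
        refine h8.trans_eq ?_
        ring
      · rw [norm_mul]
        calc _ ≤ ‖D ω‖ * (A * weight ν x) := by
              gcongr; exact norm_dysonSum_le_of_le hb ht (by linarith) ω x
          _ = _ := by ring
    refine h1.trans ?_
    rw [integral_add (integrable_const _) (hDi.const_mul _), integral_const, integral_const_mul]
    simp only [probReal_univ, one_smul]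
    refine le_trans ?_ hs.le
    gcongr
    exact integral_norm_le_norm D
  rw [dist_zero_right, Real.norm_of_nonneg (integral_nonneg fun _ => norm_nonneg _)]
  have hpt : ∀ ω, ‖δ⁻¹ • (dysonSum h F ψ₀ x (t + δ, ω) - dysonSum h F ψ₀ x (t, ω))
      - -Complex.I * R ω‖ ≤ δ⁻¹ * ∫ r in Set.Ioc t (t + δ), ‖G (r, ω)‖ := by
    intro ω
    have hInt : IntegrableOn (fun r => rhs h F (dysonSum h F ψ₀) x (r, ω)) (Set.Ioc t (t + δ)) := by
      refine IntegrableOn.mono_set (t := Set.Ioc 0 (t + δ)) ?_ (Set.Ioc_subset_Ioc_left ht)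
      exact hb.integrableOn_rhs hrm ω (fun r hr y =>
        norm_dysonSum_le_of_le hb hr.1.le (τ := t + 1) (by linarith [hr.2]) ω y)
    have h1 : δ⁻¹ • (dysonSum h F ψ₀ x (t + δ, ω) - dysonSum h F ψ₀ x (t, ω)) - -Complex.I * R ω
        = -Complex.I * (δ⁻¹ • ∫ r in Set.Ioc t (t + δ), G (r, ω)) := by
      rw [(hb.dysonSum_sub hF.measurable x ht (by linarith : t ≤ t + δ) ω).1]
      have h2 : ∫ r in Set.Ioc t (t + δ), G (r, ω)
          = (∫ r in Set.Ioc t (t + δ), rhs h F (dysonSum h F ψ₀) x (r, ω)) - δ • R ω := by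
        simp only [hG]
        rw [integral_sub hInt (integrable_const _), integral_const]
        simp [hδ0'.le]
      rw [h2, smul_sub, smul_smul, inv_mul_cancel₀ hδ0'.ne', one_smul, mul_sub, mul_smul_comm]
    rw [h1, norm_mul, norm_neg, Complex.norm_I, one_mul, norm_smul, Real.norm_of_nonneg
      (inv_pos.2 hδ0').le]
    gcongr
    exact norm_integral_le_integral_norm _
  have hGn := hGi.norm
  calc ∫ ω, ‖δ⁻¹ • (dysonSum h F ψ₀ x (t + δ, ω) - dysonSum h F ψ₀ x (t, ω))
      - -Complex.I * R ω‖ ∂(jointLaw μ P)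
      ≤ ∫ ω, δ⁻¹ * (∫ r in Set.Ioc t (t + δ), ‖G (r, ω)‖) ∂(jointLaw μ P) :=
        integral_mono_of_nonneg (Eventually.of_forall fun _ => norm_nonneg _)
          (hGn.integral_prod_right.const_mul _) (Eventually.of_forall hpt)
    _ = δ⁻¹ * ∫ r in Set.Ioc t (t + δ), ∫ ω, ‖G (r, ω)‖ ∂(jointLaw μ P) := by
        rw [integral_const_mul, integral_integral_swap (f := fun r ω => ‖G (r, ω)‖) hGn]
    _ ≤ δ⁻¹ * ∫ _r in Set.Ioc t (t + δ), e / 2 := by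
        gcongr ?_ * ?_
        exact integral_mono_ae hGn.integral_prod_left (integrable_const _) hae
    _ = e / 2 := by
        rw [integral_const]
        simp [hδ0'.le, hδ0'.ne']
    _ < e := half_lt_self he

end PotentialProcess

end MarkovAnderson

end

noncomputable section

namespace MarkovAnderson

/-! ### Two-point correlations -/

section Correlations

variable {d : ℕ} {Ω : Type*} [TopologicalSpace Ω] [MeasurableSpace Ω] {μ : Measure Ω}
  {σ : Lattice d → Ω → Ω} {P : Kernel Ω (RCPath Ω)}

/-- The data of the model, with a bounded version of the potential and exponential bounds. -/
structure IsModel (hσ : IsShiftAction μ σ) (hP : IsMarkovFamily μ σ P) (v₀ : Ω → ℝ)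
    (F : Lattice d → ℝ × RCPath Ω → ℝ) (h ψ₀ : Lattice d → ℂ) (ν M C : ℝ) : Prop where
  potential : IsPotential hP v₀
  version : IsVersion μ σ P v₀ F M
  bounded : IsExpBounded h F ψ₀ ν M C

variable {hσ : IsShiftAction μ σ} {hP : IsMarkovFamily μ σ P} {v₀ : Ω → ℝ}
  {F : Lattice d → ℝ × RCPath Ω → ℝ} {M : ℝ} {h : Lattice d → ℂ} {ψ₀ : Lattice d → ℂ} {ν C : ℝ}

/-- The product `ψ_t(x) conj ψ_t(y)`. -/
def pairFn {Θ : Type*} (h : Lattice d → ℂ) (F : Lattice d → ℝ × Θ → ℝ) (ψ₀ : Lattice d → ℂ)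
    (x y : Lattice d) (t : ℝ) (θ : Θ) : ℂ :=
  dysonSum h F ψ₀ x (t, θ) * (starRingEnd ℂ) (dysonSum h F ψ₀ y (t, θ))

/-- The right derivative of `ψ_t(x)`. -/
def velFn (σ : Lattice d → Ω → Ω) (v₀ : Ω → ℝ) (h : Lattice d → ℂ)
    (F : Lattice d → ℝ × RCPath Ω → ℝ) (ψ₀ : Lattice d → ℂ) (x : Lattice d) (t : ℝ)
    (ω : RCPath Ω) : ℂ :=
  -Complex.I * rhs h (potentialProcess σ v₀) (dysonSum h F ψ₀) x (t, ω)

/-- The right derivative of `ψ_t(x) conj ψ_t(y)`. -/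
def pairVelFn (σ : Lattice d → Ω → Ω) (v₀ : Ω → ℝ) (h : Lattice d → ℂ)
    (F : Lattice d → ℝ × RCPath Ω → ℝ) (ψ₀ : Lattice d → ℂ) (x y : Lattice d) (t : ℝ)
    (ω : RCPath Ω) : ℂ :=
  velFn σ v₀ h F ψ₀ x t ω * (starRingEnd ℂ) (dysonSum h F ψ₀ y (t, ω))
    + dysonSum h F ψ₀ x (t, ω) * (starRingEnd ℂ) (velFn σ v₀ h F ψ₀ y t ω)

/-- The growth bound of the solution up to time `τ`. -/
def ampBound (h : Lattice d → ℂ) (ν M C τ : ℝ) : ℝ := C * Real.exp ((expMoment h ν + M) * τ)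

/-- A function of `ω_t` can be taken out of the conditional expectation given `ω_t`; by duality this
is the symmetry of multiplication by a real function. -/
theorem condL2_mulL2 (hP : IsMarkovFamily μ σ P) (t : ℝ≥0) {w : Ω → ℝ}
    (hw : MemLp (fun a => (w a : ℂ)) ∞ μ)
    (hw' : MemLp (fun ω : RCPath Ω => (w (ω.1 t) : ℂ)) ∞ (jointLaw μ P))
    (X : Lp ℂ 2 (jointLaw μ P)) :
    condL2 hP t (mulL2 hw' X) = mulL2 hw (condL2 hP t X) := by
  have hsymm : ∀ f g : Lp ℂ 2 μ, inner ℂ f (mulL2 hw g) = inner ℂ (mulL2 hw f) g := by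
    intro f g
    rw [L2.inner_def, L2.inner_def]
    refine integral_congr_ae ?_
    filter_upwards [coeFn_mulL2 hw f, coeFn_mulL2 hw g] with a h1 h2
    rw [h1, h2]
    simp only [RCLike.inner_apply, map_mul, Complex.conj_ofReal]
    ring
  refine ext_inner_left ℂ fun g => ?_
  rw [hsymm, inner_condL2, inner_condL2, L2.inner_def, L2.inner_def]
  refine integral_congr_ae ?_
  filter_upwards [coeFn_mulL2 hw' X, coeFn_evalL2 hP t g, coeFn_evalL2 hP t (mulL2 hw g),
    (hP.measurePreserving_eval t).quasiMeasurePreserving.ae (coeFn_mulL2 hw g)] with ω h1 h2 h3 h4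
  rw [h1, h2, h3, h4]
  simp only [RCLike.inner_apply, map_mul, Complex.conj_ofReal]
  ring

namespace IsModel

theorem lam_nonneg (hm : IsModel hσ hP v₀ F h ψ₀ ν M C) : 0 ≤ expMoment h ν + M :=
  add_nonneg expMoment_nonneg hm.version.M_nonneg

theorem ampBound_nonneg (hm : IsModel hσ hP v₀ F h ψ₀ ν M C) (τ : ℝ) : 0 ≤ ampBound h ν M C τ :=
  mul_nonneg hm.bounded.C_nonneg (Real.exp_pos _).le

theorem norm_amp_le (hm : IsModel hσ hP v₀ F h ψ₀ ν M C) {t τ : ℝ} (ht : 0 ≤ t) (htτ : t ≤ τ)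
    (ω : RCPath Ω) (x : Lattice d) :
    ‖dysonSum h F ψ₀ x (t, ω)‖ ≤ ampBound h ν M C τ * weight ν x :=
  norm_dysonSum_le_of_le hm.bounded ht htτ ω x

theorem stronglyMeasurable_amp (hm : IsModel hσ hP v₀ F h ψ₀ ν M C) (t : ℝ) (x : Lattice d) :
    StronglyMeasurable fun ω => dysonSum h F ψ₀ x (t, ω) :=
  (hm.bounded.stronglyMeasurable_dysonSum hm.version.measurable x).comp_measurable
    measurable_prodMk_left

theorem norm_velFn_le (hm : IsModel hσ hP v₀ F h ψ₀ ν M C) {t τ : ℝ} (ht : 0 ≤ t) (htτ : t ≤ τ)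
    (x : Lattice d) : ∀ᵐ ω ∂(jointLaw μ P), ‖velFn σ v₀ h F ψ₀ x t ω‖
      ≤ ampBound h ν M C τ * (expMoment h ν + M) * weight ν x := by
  filter_upwards [hm.version.ae_bound_eval hσ hP x t.toNNReal] with ω hω
  rw [velFn, norm_mul, norm_neg, Complex.norm_I, one_mul]
  exact hm.bounded.norm_rhs_le_of_abs_le hω (hm.norm_amp_le ht htτ ω)

theorem norm_amp_sub_le (hm : IsModel hσ hP v₀ F h ψ₀ ν M C) {s t τ : ℝ} (hs : 0 ≤ s) (hst : s ≤ t)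
    (htτ : t ≤ τ) (ω : RCPath Ω) (x : Lattice d) :
    ‖dysonSum h F ψ₀ x (t, ω) - dysonSum h F ψ₀ x (s, ω)‖
      ≤ ampBound h ν M C τ * (expMoment h ν + M) * weight ν x * (t - s) := by
  refine (hm.bounded.dysonSum_sub hm.version.measurable x hs hst ω).2.trans ?_
  have h1 := hm.lam_nonneg
  have h2 := hm.bounded.C_nonneg
  have h3 := (weight_pos ν x).le
  have h4 := sub_nonneg.2 hst
  rw [ampBound]
  gcongr

theorem norm_pairFn_le (hm : IsModel hσ hP v₀ F h ψ₀ ν M C) {t τ : ℝ} (ht : 0 ≤ t) (htτ : t ≤ τ)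
    (ω : RCPath Ω) (x y : Lattice d) :
    ‖pairFn h F ψ₀ x y t ω‖ ≤ ampBound h ν M C τ ^ 2 * (weight ν x * weight ν y) := by
  rw [pairFn, norm_mul, RCLike.norm_conj]
  have h1 := hm.norm_amp_le ht htτ ω x
  have h2 := hm.norm_amp_le ht htτ ω y
  calc _ ≤ (ampBound h ν M C τ * weight ν x) * (ampBound h ν M C τ * weight ν y) :=
        mul_le_mul h1 h2 (norm_nonneg _) ((norm_nonneg _).trans h1)
    _ = _ := by ring

theorem norm_pairFn_sub_le (hm : IsModel hσ hP v₀ F h ψ₀ ν M C) {s t τ : ℝ} (hs : 0 ≤ s)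
    (hst : s ≤ t) (htτ : t ≤ τ) (ω : RCPath Ω) (x y : Lattice d) :
    ‖pairFn h F ψ₀ x y t ω - pairFn h F ψ₀ x y s ω‖
      ≤ 2 * ampBound h ν M C τ ^ 2 * (expMoment h ν + M) * (weight ν x * weight ν y) * (t - s) := by
  have e : pairFn h F ψ₀ x y t ω - pairFn h F ψ₀ x y s ω
      = (dysonSum h F ψ₀ x (t, ω) - dysonSum h F ψ₀ x (s, ω))
          * (starRingEnd ℂ) (dysonSum h F ψ₀ y (t, ω))
        + dysonSum h F ψ₀ x (s, ω)
          * (starRingEnd ℂ) (dysonSum h F ψ₀ y (t, ω) - dysonSum h F ψ₀ y (s, ω)) := by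
    rw [pairFn, pairFn, map_sub]; ring
  rw [e]
  refine (norm_add_le _ _).trans ?_
  rw [norm_mul, norm_mul, RCLike.norm_conj, RCLike.norm_conj]
  have h1 := hm.norm_amp_le (hs.trans hst) htτ ω y
  have h2 := hm.norm_amp_le hs (hst.trans htτ) ω x
  have h3 := hm.norm_amp_sub_le hs hst htτ ω x
  have h4 := hm.norm_amp_sub_le hs hst htτ ω y
  refine (add_le_add (mul_le_mul h3 h1 (norm_nonneg _) ((norm_nonneg _).trans h3))
    (mul_le_mul h2 h4 (norm_nonneg _) ((norm_nonneg _).trans h2))).trans_eq ?_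
  ring

theorem norm_pairVelFn_le (hm : IsModel hσ hP v₀ F h ψ₀ ν M C) {t τ : ℝ} (ht : 0 ≤ t) (htτ : t ≤ τ)
    (x y : Lattice d) : ∀ᵐ ω ∂(jointLaw μ P), ‖pairVelFn σ v₀ h F ψ₀ x y t ω‖
      ≤ 2 * ampBound h ν M C τ ^ 2 * (expMoment h ν + M) * (weight ν x * weight ν y) := by
  filter_upwards [hm.norm_velFn_le ht htτ x, hm.norm_velFn_le ht htτ y] with ω h1 h2
  refine (norm_add_le _ _).trans ?_
  rw [norm_mul, norm_mul, RCLike.norm_conj, RCLike.norm_conj]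
  have h3 := hm.norm_amp_le ht htτ ω x
  have h4 := hm.norm_amp_le ht htτ ω y
  refine (add_le_add (mul_le_mul h1 h4 (norm_nonneg _) ((norm_nonneg _).trans h1))
    (mul_le_mul h3 h2 (norm_nonneg _) ((norm_nonneg _).trans h3))).trans_eq ?_
  ring

variable [IsProbabilityMeasure μ] [IsMarkovKernel P]

theorem aestronglyMeasurable_past_amp (hm : IsModel hσ hP v₀ F h ψ₀ ν M C) {t : ℝ} (ht : 0 ≤ t)
    (x : Lattice d) : AEStronglyMeasurable[past Ω t.toNNReal] (fun ω => dysonSum h F ψ₀ x (t, ω))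
      (jointLaw μ P) :=
  hm.bounded.aestronglyMeasurable_dysonSum (𝓕 := fun s => past Ω s.toNNReal) hm.version.measurable
    (fun _ _ hst => past_mono (Real.toNNReal_mono hst)) (fun _ => past_le _)
    (fun x => hm.version.adapted hσ hP hm.potential x) x ht

theorem aestronglyMeasurable_past_rhs (hm : IsModel hσ hP v₀ F h ψ₀ ν M C) {t : ℝ} (ht : 0 ≤ t)
    (x : Lattice d) : AEStronglyMeasurable[past Ω t.toNNReal] (fun ω => velFn σ v₀ h F ψ₀ x t ω)
      (jointLaw μ P) := by
  have h1 : AEStronglyMeasurable[past Ω t.toNNReal] (fun ω => potentialProcess σ v₀ x (t, ω))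
      (jointLaw μ P) := by
    have h0 := hm.potential.aestronglyMeasurable_shift hσ x
    have h1 := aestronglyMeasurable_past_comp hP h0 (le_refl t.toNNReal)
    exact h1
  have h2 : AEStronglyMeasurable[past Ω t.toNNReal]
      (fun ω => rhs h (potentialProcess σ v₀) (dysonSum h F ψ₀) x (t, ω)) (jointLaw μ P) :=
    hm.bounded.aestronglyMeasurable_rhs (fun y => hm.aestronglyMeasurable_past_amp ht y)
      (fun y ω => hm.norm_amp_le ht le_rfl ω y) h1
  have h3 := h2.const_mul (-Complex.I)
  exact h3

theorem aestronglyMeasurable_past_pairFn (hm : IsModel hσ hP v₀ F h ψ₀ ν M C) {t : ℝ} (ht : 0 ≤ t)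
    (x y : Lattice d) : AEStronglyMeasurable[past Ω t.toNNReal] (pairFn h F ψ₀ x y t)
      (jointLaw μ P) :=
  (hm.aestronglyMeasurable_past_amp ht x).mul
    (Complex.continuous_conj.comp_aestronglyMeasurable (hm.aestronglyMeasurable_past_amp ht y))

theorem aestronglyMeasurable_past_pairVelFn (hm : IsModel hσ hP v₀ F h ψ₀ ν M C) {t : ℝ}
    (ht : 0 ≤ t) (x y : Lattice d) : AEStronglyMeasurable[past Ω t.toNNReal]
      (pairVelFn σ v₀ h F ψ₀ x y t) (jointLaw μ P) :=
  ((hm.aestronglyMeasurable_past_rhs ht x).mul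
    (Complex.continuous_conj.comp_aestronglyMeasurable (hm.aestronglyMeasurable_past_amp ht y))).add
  ((hm.aestronglyMeasurable_past_amp ht x).mul
    (Complex.continuous_conj.comp_aestronglyMeasurable (hm.aestronglyMeasurable_past_rhs ht y)))

theorem memLp_pairFn (hm : IsModel hσ hP v₀ F h ψ₀ ν M C) {t : ℝ} (ht : 0 ≤ t) (x y : Lattice d) :
    MemLp (pairFn h F ψ₀ x y t) 2 (jointLaw μ P) :=
  MemLp.of_bound ((hm.aestronglyMeasurable_past_pairFn ht x y).mono (past_le _)) _
    (Eventually.of_forall fun ω => hm.norm_pairFn_le ht le_rfl ω x y)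

theorem memLp_pairVelFn (hm : IsModel hσ hP v₀ F h ψ₀ ν M C) {t : ℝ} (ht : 0 ≤ t)
    (x y : Lattice d) : MemLp (pairVelFn σ v₀ h F ψ₀ x y t) 2 (jointLaw μ P) :=
  MemLp.of_bound ((hm.aestronglyMeasurable_past_pairVelFn ht x y).mono (past_le _)) _
    (hm.norm_pairVelFn_le ht le_rfl x y)

/-- `ψ_t(x) conj ψ_t(y)` as an element of `L²`. -/
def pairL2 (hm : IsModel hσ hP v₀ F h ψ₀ ν M C) (x y : Lattice d) {t : ℝ} (ht : 0 ≤ t) :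
    Lp ℂ 2 (jointLaw μ P) :=
  (hm.memLp_pairFn ht x y).toLp _

/-- The right derivative of `pairL2`. -/
def pairVelL2 (hm : IsModel hσ hP v₀ F h ψ₀ ν M C) (x y : Lattice d) {t : ℝ} (ht : 0 ≤ t) :
    Lp ℂ 2 (jointLaw μ P) :=
  (hm.memLp_pairVelFn ht x y).toLp _

variable [BorelSpace Ω]

set_option maxHeartbeats 1000000 in
-- The product rule, with the amplitudes differentiable in `L¹` and all factors bounded, gives an
-- `L¹` limit; the difference quotients are bounded uniformly in `δ`, so `norm_toLp_sq_le` makes it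
-- an `L²` limit. The function `f` names the later correlations because `pairL2` asks for a proof
-- that the time is nonnegative.
theorem tendsto_pairL2 (hm : IsModel hσ hP v₀ F h ψ₀ ν M C) (x y : Lattice d) {t : ℝ} (ht : 0 ≤ t)
    {f : ℝ → Lp ℂ 2 (jointLaw μ P)}
    (hf : ∀ δ, (hδ : 0 < δ) → f δ = hm.pairL2 x y (add_nonneg ht hδ.le)) :
    Tendsto (fun δ : ℝ => δ⁻¹ • (f δ - hm.pairL2 x y ht)) (𝓝[>] 0) (𝓝 (hm.pairVelL2 x y ht)) := by
  have hsl := tendsto_integral_norm_slope hσ hP hm.potential hm.version hm.bounded (h := h)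
    (ψ₀ := ψ₀) (ht := ht)
  set A := ampBound h ν M C (t + 1) with hA
  have hA0 : 0 ≤ A := hm.ampBound_nonneg _
  set Λ := expMoment h ν + M with hΛ
  have hΛ0 : 0 ≤ Λ := hm.lam_nonneg
  have hWx := (weight_pos ν x).le
  have hWy := (weight_pos ν y).le
  set slope : Lattice d → ℝ → RCPath Ω → ℝ := fun x δ ω =>
    ‖δ⁻¹ • (dysonSum h F ψ₀ x (t + δ, ω) - dysonSum h F ψ₀ x (t, ω)) - velFn σ v₀ h F ψ₀ x t ω‖
    with hslope
  have hlim : Tendsto (fun δ : ℝ => 4 * A ^ 2 * Λ * (weight ν x * weight ν y)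
      * (A * weight ν y * (∫ ω, slope x δ ω ∂(jointLaw μ P))
        + A * Λ * weight ν x * (A * Λ * weight ν y * δ)
        + A * weight ν x * (∫ ω, slope y δ ω ∂(jointLaw μ P)))) (𝓝[>] 0) (𝓝 0) := by
    have h1 := (hsl x).const_mul (A * weight ν y)
    have h2 := (hsl y).const_mul (A * weight ν x)
    have h3 := (tendsto_id_nhdsGT_zero.const_mul (A * Λ * weight ν y)).const_mul
      (A * Λ * weight ν x)
    have h4 := ((h1.add h3).add h2).const_mul (4 * A ^ 2 * Λ * (weight ν x * weight ν y))
    simp only [mul_zero, add_zero] at h4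
    exact h4
  rw [tendsto_iff_norm_sub_tendsto_zero]
  have hsq : Tendsto (fun δ : ℝ => ‖δ⁻¹ • (f δ - hm.pairL2 x y ht) - hm.pairVelL2 x y ht‖ ^ 2)
      (𝓝[>] 0) (𝓝 0) := by
    refine squeeze_zero' (Eventually.of_forall fun _ => sq_nonneg _) ?_ hlim
    have hev : ∀ᶠ δ : ℝ in 𝓝[>] 0, δ < 1 := (gt_mem_nhds one_pos).filter_mono nhdsWithin_le_nhds
    filter_upwards [hev, self_mem_nhdsWithin] with δ hδ1 hδ
    have hδ0 : (0 : ℝ) < δ := hδ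
    rw [hf δ hδ0]
    have htδ : 0 ≤ t + δ := by linarith
    set g : RCPath Ω → ℂ := fun ω => δ⁻¹ • (pairFn h F ψ₀ x y (t + δ) ω - pairFn h F ψ₀ x y t ω)
      - pairVelFn σ v₀ h F ψ₀ x y t ω with hg
    have hgL : MemLp g 2 (jointLaw μ P) :=
      (((hm.memLp_pairFn htδ x y).sub (hm.memLp_pairFn ht x y)).const_smul δ⁻¹).sub
        (hm.memLp_pairVelFn ht x y)
    have e : δ⁻¹ • (hm.pairL2 x y htδ - hm.pairL2 x y ht) - hm.pairVelL2 x y ht = hgL.toLp g := rfl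
    rw [e]
    have hgb : ∀ᵐ ω ∂(jointLaw μ P), ‖g ω‖ ≤ 4 * A ^ 2 * Λ * (weight ν x * weight ν y) := by
      filter_upwards [hm.norm_pairVelFn_le ht (by linarith : t ≤ t + 1) x y] with ω hω
      have h1 := hm.norm_pairFn_sub_le ht (by linarith : t ≤ t + δ) (by linarith : t + δ ≤ t + 1)
        ω x y
      rw [add_sub_cancel_left] at h1
      refine (norm_sub_le _ _).trans ?_
      rw [norm_smul, Real.norm_of_nonneg (inv_pos.2 hδ0).le]
      have h2 : δ⁻¹ * ‖pairFn h F ψ₀ x y (t + δ) ω - pairFn h F ψ₀ x y t ω‖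
          ≤ 2 * A ^ 2 * Λ * (weight ν x * weight ν y) := by
        rw [inv_mul_le_iff₀ hδ0]
        linarith
      linarith
    refine (norm_toLp_sq_le hgL hgb).trans ?_
    refine mul_le_mul_of_nonneg_left ?_ (by positivity)
    have hsi : ∀ z, Integrable (slope z δ) (jointLaw μ P) := by
      intro z
      have i1 : ∀ s, 0 ≤ s → Integrable (fun ω => dysonSum h F ψ₀ z (s, ω)) (jointLaw μ P) :=
        fun s hs => Integrable.of_bound (hm.stronglyMeasurable_amp _ z).aestronglyMeasurable _
          (Eventually.of_forall fun ω => hm.norm_amp_le hs le_rfl ω z)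
      have i2 : Integrable (fun ω => velFn σ v₀ h F ψ₀ z t ω) (jointLaw μ P) :=
        Integrable.of_bound ((hm.aestronglyMeasurable_past_rhs ht z).mono (past_le _)) _
          (hm.norm_velFn_le ht le_rfl z)
      exact (((i1 _ htδ).sub (i1 t ht)).smul δ⁻¹ |>.sub i2).norm
    have hpt : ∀ᵐ ω ∂(jointLaw μ P), ‖g ω‖ ≤ A * weight ν y * slope x δ ω
        + A * Λ * weight ν x * (A * Λ * weight ν y * δ) + A * weight ν x * slope y δ ω := by
      filter_upwards [hm.norm_velFn_le ht (by linarith : t ≤ t + 1) x] with ω hω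
      have e2 : g ω = (δ⁻¹ • (dysonSum h F ψ₀ x (t + δ, ω) - dysonSum h F ψ₀ x (t, ω))
            - velFn σ v₀ h F ψ₀ x t ω) * (starRingEnd ℂ) (dysonSum h F ψ₀ y (t + δ, ω))
          + velFn σ v₀ h F ψ₀ x t ω
            * (starRingEnd ℂ) (dysonSum h F ψ₀ y (t + δ, ω) - dysonSum h F ψ₀ y (t, ω))
          + dysonSum h F ψ₀ x (t, ω) * (starRingEnd ℂ)
            (δ⁻¹ • (dysonSum h F ψ₀ y (t + δ, ω) - dysonSum h F ψ₀ y (t, ω))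
              - velFn σ v₀ h F ψ₀ y t ω) := by
        simp only [hg, pairFn, pairVelFn, Complex.real_smul, map_sub, map_mul, Complex.conj_ofReal]
        ring
      rw [e2]
      have hy := hm.norm_amp_le htδ (by linarith : t + δ ≤ t + 1) ω y
      have hx := hm.norm_amp_le ht (by linarith : t ≤ t + 1) ω x
      have hyd := hm.norm_amp_sub_le ht (by linarith : t ≤ t + δ) (by linarith : t + δ ≤ t + 1) ω y
      rw [add_sub_cancel_left] at hyd
      refine (norm_add₃_le).trans ?_
      rw [norm_mul, norm_mul, norm_mul, RCLike.norm_conj, RCLike.norm_conj, RCLike.norm_conj]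
      refine add_le_add (add_le_add ?_ ?_) ?_
      · rw [mul_comm]
        exact mul_le_mul_of_nonneg_right hy (norm_nonneg _)
      · exact mul_le_mul hω hyd (norm_nonneg _) (by positivity)
      · exact mul_le_mul_of_nonneg_right hx (norm_nonneg _)
    refine (integral_mono_ae (g := fun ω => A * weight ν y * slope x δ ω
        + A * Λ * weight ν x * (A * Λ * weight ν y * δ) + A * weight ν x * slope y δ ω)
      (hgL.integrable (by norm_num)).norm
      (((hsi x).const_mul _ |>.add (integrable_const _)).add ((hsi y).const_mul _)) hpt).trans_eq ?_
    have i3 : Integrable (fun ω => A * weight ν y * slope x δ ω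
        + A * Λ * weight ν x * (A * Λ * weight ν y * δ)) (jointLaw μ P) :=
      ((hsi x).const_mul _).add (integrable_const _)
    rw [integral_add i3 ((hsi y).const_mul _),
      integral_add ((hsi x).const_mul _) (integrable_const _), integral_const,
      integral_const_mul, integral_const_mul, probReal_univ, one_smul]
  have h6 := hsq.sqrt
  simpa using h6

end IsModel

end Correlations

end MarkovAnderson

end

/-! ### The evolution equation of the conditional correlations -/

noncomputable section

namespace MarkovAnderson

section CorrelationDynamics

variable {d : ℕ} {Ω : Type*} [TopologicalSpace Ω] [MeasurableSpace Ω] {μ : Measure Ω}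
  {σ : Lattice d → Ω → Ω} {P : Kernel Ω (RCPath Ω)}
  {hσ : IsShiftAction μ σ} {hP : IsMarkovFamily μ σ P} {v₀ : Ω → ℝ}
  {F : Lattice d → ℝ × RCPath Ω → ℝ} {M : ℝ} {h : Lattice d → ℂ} {ψ₀ : Lattice d → ℂ} {ν C : ℝ}

theorem IsPotential.memLp_shift (hσ : IsShiftAction μ σ) (hv : IsPotential hP v₀) (x : Lattice d) :
    MemLp (fun a => v₀ (σ x a)) ∞ μ :=
  hv.memLp.comp_measurePreserving (hσ.measurePreserving x)

theorem IsPotential.memLp_diff (hσ : IsShiftAction μ σ) (hv : IsPotential hP v₀)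
    (x y : Lattice d) : MemLp (fun a => ((v₀ (σ x a) - v₀ (σ y a) : ℝ) : ℂ)) ∞ μ :=
  ((hv.memLp_shift hσ x).sub (hv.memLp_shift hσ y)).ofReal

namespace IsModel

variable [IsProbabilityMeasure μ] [IsMarkovKernel P]

/-- The conditional expectation of `ψ_t(x) conj ψ_t(y)` given `ω_t`, constant for `t ≤ 0`. -/
def corr (hm : IsModel hσ hP v₀ F h ψ₀ ν M C) (x y : Lattice d) (t : ℝ) : Lp ℂ 2 μ :=
  condL2 hP t.toNNReal (hm.pairL2 x y (le_max_right t 0))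

theorem corr_eq (hm : IsModel hσ hP v₀ F h ψ₀ ν M C) (x y : Lattice d) {t : ℝ} (ht : 0 ≤ t) :
    hm.corr x y t = condL2 hP t.toNNReal (hm.pairL2 x y ht) := by
  have : ∀ s (hs : 0 ≤ s), s = t → hm.pairL2 x y hs = hm.pairL2 x y ht := by
    rintro _ _ rfl; rfl
  rw [corr, this _ _ (max_eq_left ht)]

theorem corr_max (hm : IsModel hσ hP v₀ F h ψ₀ ν M C) (x y : Lattice d) (t : ℝ) :
    hm.corr x y (max t 0) = hm.corr x y t := by
  rw [hm.corr_eq x y (le_max_right t 0), corr]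
  congr 1
  rcases le_total t 0 with ht | ht
  · simp [ht, Real.toNNReal_of_nonpos ht]
  · rw [max_eq_left ht]

theorem norm_corr_le (hm : IsModel hσ hP v₀ F h ψ₀ ν M C) (x y : Lattice d) {t τ : ℝ} (ht : 0 ≤ t)
    (htτ : t ≤ τ) : ‖hm.corr x y t‖ ≤ ampBound h ν M C τ ^ 2 * (weight ν x * weight ν y) := by
  rw [hm.corr_eq x y ht]
  refine (norm_condL2_le _ _ _).trans (norm_toLp_le _ ?_
    (Eventually.of_forall fun ω => hm.norm_pairFn_le ht htτ ω x y))
  have := weight_pos ν x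
  have := weight_pos ν y
  positivity

theorem aestronglyMeasurable_past_pairL2 (hm : IsModel hσ hP v₀ F h ψ₀ ν M C) (x y : Lattice d)
    {t : ℝ} (ht : 0 ≤ t) :
    AEStronglyMeasurable[past Ω t.toNNReal] (hm.pairL2 x y ht) (jointLaw μ P) := by
  have h1 := hm.aestronglyMeasurable_past_pairFn ht x y
  have h2 := (hm.memLp_pairFn ht x y).coeFn_toLp
  exact h1.congr h2.symm

theorem aestronglyMeasurable_past_pairVelL2 (hm : IsModel hσ hP v₀ F h ψ₀ ν M C) (x y : Lattice d)
    {t : ℝ} (ht : 0 ≤ t) :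
    AEStronglyMeasurable[past Ω t.toNNReal] (hm.pairVelL2 x y ht) (jointLaw μ P) := by
  have h1 := hm.aestronglyMeasurable_past_pairVelFn ht x y
  have h2 := (hm.memLp_pairVelFn ht x y).coeFn_toLp
  exact h1.congr h2.symm

/-- The correlation at time `t` is measurable with respect to the past, so by the Markov property
conditioning it on the later `ω_{t+δ}` amounts to applying the semigroup. -/
theorem semigroup_corr (hm : IsModel hσ hP v₀ F h ψ₀ ν M C) (x y : Lattice d) {t δ : ℝ}
    (ht : 0 ≤ t) (hδ : 0 ≤ δ) : semigroup hP δ (hm.corr x y t)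
      = condL2 hP (t + δ).toNNReal (hm.pairL2 x y ht) := by
  rw [hm.corr_eq x y ht, Real.toNNReal_add ht hδ,
    condL2_add hP _ _ _ (hm.aestronglyMeasurable_past_pairL2 x y ht)]
  rfl

theorem norm_corr_sub_le (hm : IsModel hσ hP v₀ F h ψ₀ ν M C) (x y : Lattice d) {t δ τ : ℝ}
    (ht : 0 ≤ t) (hδ : 0 ≤ δ) (hτ : t + δ ≤ τ) :
    ‖hm.corr x y (t + δ) - semigroup hP δ (hm.corr x y t)‖
      ≤ 2 * ampBound h ν M C τ ^ 2 * (expMoment h ν + M) * (weight ν x * weight ν y) * δ := by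
  have htδ : 0 ≤ t + δ := by linarith
  rw [hm.semigroup_corr x y ht hδ, hm.corr_eq x y htδ, ← map_sub]
  refine (norm_condL2_le _ _ _).trans ?_
  have e : hm.pairL2 x y htδ - hm.pairL2 x y ht
    = ((hm.memLp_pairFn htδ x y).sub (hm.memLp_pairFn ht x y)).toLp _ := rfl
  rw [e]
  refine norm_toLp_le _ ?_ (Eventually.of_forall fun ω => ?_)
  · have := weight_pos ν x
    have := weight_pos ν y
    have := hm.lam_nonneg
    positivity
  · have := hm.norm_pairFn_sub_le ht (by linarith : t ≤ t + δ) hτ ω x y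
    rwa [add_sub_cancel_left] at this

/-- The increment relative to the semigroup is the conditional expectation of `pairL2` at `t + δ`
minus `pairL2` at `t`, given `ω_{t+δ}`. Its quotient approaches the conditional expectation of the
velocity given `ω_{t+δ}`, which equals `S_δ†` applied to that given `ω_t`, and strong continuity of
the semigroup removes `S_δ†`. -/
theorem tendsto_corr [BorelSpace Ω] (hm : IsModel hσ hP v₀ F h ψ₀ ν M C) (x y : Lattice d) {t : ℝ}
    (ht : 0 ≤ t) :
    Tendsto (fun δ : ℝ => δ⁻¹ • (hm.corr x y (t + δ) - semigroup hP δ (hm.corr x y t))) (𝓝[>] 0)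
      (𝓝 (condL2 hP t.toNNReal (hm.pairVelL2 x y ht))) := by
  set f : ℝ → Lp ℂ 2 (jointLaw μ P) := fun δ => hm.pairL2 x y (le_max_right (t + δ) 0) with hf
  have hfe : ∀ δ, (hδ : 0 < δ) → f δ = hm.pairL2 x y (add_nonneg ht hδ.le) := by
    intro δ hδ
    have : ∀ s (hs : 0 ≤ s), s = t + δ → hm.pairL2 x y hs = hm.pairL2 x y (add_nonneg ht hδ.le) := by
      rintro _ _ rfl; rfl
    exact this _ _ (max_eq_left (by linarith))
  have h1 := tendsto_iff_norm_sub_tendsto_zero.1 (hm.tendsto_pairL2 x y ht hfe)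
  have h2 := (tendsto_adjSemigroup hP (condL2 hP t.toNNReal (hm.pairVelL2 x y ht))).comp
    tendsto_toNNReal_nhdsGT
  have h3 : Tendsto (fun δ : ℝ => condL2 hP (t + δ).toNNReal
      (δ⁻¹ • (f δ - hm.pairL2 x y ht) - hm.pairVelL2 x y ht)) (𝓝[>] 0) (𝓝 0) :=
    squeeze_zero_norm (fun δ => norm_condL2_le _ _ _) h1
  have h4 := h3.add h2
  rw [zero_add] at h4
  refine h4.congr' ?_
  filter_upwards [self_mem_nhdsWithin] with δ hδ
  have hδ0 : 0 < δ := hδ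
  simp only [Function.comp]
  rw [← condL2_add hP _ _ _ (hm.aestronglyMeasurable_past_pairVelL2 x y ht),
    ← Real.toNNReal_add ht hδ0.le, ← map_add, sub_add_cancel, hm.semigroup_corr x y ht hδ0.le,
    hm.corr_eq x y (add_nonneg ht hδ0.le), hfe δ hδ0, ← map_sub,
    ContinuousLinearMap.map_smul_of_tower]

theorem summable_hop_corr (hm : IsModel hσ hP v₀ F h ψ₀ ν M C) (x y : Lattice d) {t : ℝ}
    (ht : 0 ≤ t) : Summable (fun z => ‖h (x - z) • hm.corr z y t‖) ∧
      Summable (fun z => ‖(starRingEnd ℂ) (h (y - z)) • hm.corr x z t‖) := by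
  have hb := hm.bounded
  constructor
  · refine Summable.of_nonneg_of_le (fun _ => norm_nonneg _) (fun z => ?_)
      ((summable_hop_weight hb.nu_pos.le hb.summable x).1.mul_left
        (ampBound h ν M C t ^ 2 * weight ν y))
    rw [norm_smul]
    refine (mul_le_mul_of_nonneg_left (hm.norm_corr_le z y ht le_rfl) (norm_nonneg _)).trans_eq ?_
    ring
  · refine Summable.of_nonneg_of_le (fun _ => norm_nonneg _) (fun z => ?_)
      ((summable_hop_weight hb.nu_pos.le hb.summable y).1.mul_left
        (ampBound h ν M C t ^ 2 * weight ν x))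
    rw [norm_smul, RCLike.norm_conj]
    refine (mul_le_mul_of_nonneg_left (hm.norm_corr_le x z ht le_rfl) (norm_nonneg _)).trans_eq ?_
    ring

set_option maxHeartbeats 1000000 in
-- The velocity is the commutator `-i[K + v, ρ]`. Conditioning closes the equation because the
-- potential is a function of `ω_t` and comes out of the conditional expectation, while hopping acts
-- on the sites alone.
theorem condL2_pairVelL2 (hm : IsModel hσ hP v₀ F h ψ₀ ν M C) (x y : Lattice d) {t : ℝ}
    (ht : 0 ≤ t) : condL2 hP t.toNNReal (hm.pairVelL2 x y ht)
      = -(Complex.I • ((∑' z, h (x - z) • hm.corr z y t)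
        - (∑' z, (starRingEnd ℂ) (h (y - z)) • hm.corr x z t)
        + mulL2 (hm.potential.memLp_diff hσ x y) (hm.corr x y t))) := by
  have hb := hm.bounded
  have hsx : ∀ x ω, Summable fun z => h (x - z) * dysonSum h F ψ₀ z (t, ω) := fun x ω =>
    (summable_hop hb.nu_pos.le hb.summable (fun z => hm.norm_amp_le ht le_rfl ω z) x).of_norm
  set f₁ : RCPath Ω → ℂ := fun ω => ∑' z, h (x - z) * pairFn h F ψ₀ z y t ω with hf₁
  set f₂ : RCPath Ω → ℂ := fun ω => ∑' z, (starRingEnd ℂ) (h (y - z)) * pairFn h F ψ₀ x z t ω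
    with hf₂
  have hc₁ : ∀ z ω, ‖h (x - z) * pairFn h F ψ₀ z y t ω‖
      ≤ ampBound h ν M C t ^ 2 * weight ν y * (‖h (x - z)‖ * weight ν z) := fun z ω => by
    rw [norm_mul]
    refine (mul_le_mul_of_nonneg_left (hm.norm_pairFn_le ht le_rfl ω z y) (norm_nonneg _)).trans_eq ?_
    ring
  have hc₂ : ∀ z ω, ‖(starRingEnd ℂ) (h (y - z)) * pairFn h F ψ₀ x z t ω‖
      ≤ ampBound h ν M C t ^ 2 * weight ν x * (‖h (y - z)‖ * weight ν z) := fun z ω => by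
    rw [norm_mul, RCLike.norm_conj]
    refine (mul_le_mul_of_nonneg_left (hm.norm_pairFn_le ht le_rfl ω x z) (norm_nonneg _)).trans_eq ?_
    ring
  have hs₁ := (summable_hop_weight hb.nu_pos.le hb.summable x).1.mul_left
    (ampBound h ν M C t ^ 2 * weight ν y)
  have hs₂ := (summable_hop_weight hb.nu_pos.le hb.summable y).1.mul_left
    (ampBound h ν M C t ^ 2 * weight ν x)
  have hpm : ∀ x y, StronglyMeasurable (pairFn h F ψ₀ x y t) := fun x y =>
    (hm.stronglyMeasurable_amp t x).mul
      (Complex.continuous_conj.comp_stronglyMeasurable (hm.stronglyMeasurable_amp t y))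
  have hL₁ : MemLp f₁ 2 (jointLaw μ P) :=
    MemLp.of_bound (stronglyMeasurable_tsum (fun z => (hpm z y).const_mul _)
      (fun ω => Summable.of_norm_bounded hs₁ fun z => hc₁ z ω)).aestronglyMeasurable _
      (Eventually.of_forall fun ω => tsum_of_norm_bounded hs₁.hasSum fun z => hc₁ z ω)
  have hL₂ : MemLp f₂ 2 (jointLaw μ P) :=
    MemLp.of_bound (stronglyMeasurable_tsum (fun z => (hpm x z).const_mul _)
      (fun ω => Summable.of_norm_bounded hs₂ fun z => hc₂ z ω)).aestronglyMeasurable _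
      (Eventually.of_forall fun ω => tsum_of_norm_bounded hs₂.hasSum fun z => hc₂ z ω)
  have e₁ : condL2 hP t.toNNReal (hL₁.toLp f₁) = ∑' z, h (x - z) • hm.corr z y t := by
    have := hasSum_toLp (fun z => (hm.memLp_pairFn ht z y).const_smul (h (x - z))) hs₁ hc₁ hL₁
      (fun ω => rfl)
    have := (condL2 hP t.toNNReal).hasSum this
    rw [← this.tsum_eq]
    refine tsum_congr fun z => ?_
    rw [MemLp.toLp_const_smul, map_smul, hm.corr_eq z y ht]
    rfl
  have e₂ : condL2 hP t.toNNReal (hL₂.toLp f₂)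
      = ∑' z, (starRingEnd ℂ) (h (y - z)) • hm.corr x z t := by
    have := hasSum_toLp (fun z => (hm.memLp_pairFn ht x z).const_smul ((starRingEnd ℂ) (h (y - z))))
      hs₂ hc₂ hL₂ (fun ω => rfl)
    have := (condL2 hP t.toNNReal).hasSum this
    rw [← this.tsum_eq]
    refine tsum_congr fun z => ?_
    rw [MemLp.toLp_const_smul, map_smul, hm.corr_eq x z ht]
    rfl
  have hw : MemLp (fun a => ((v₀ (σ x a) - v₀ (σ y a) : ℝ) : ℂ)) ∞ μ :=
    hm.potential.memLp_diff hσ x y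
  have hw' : MemLp (fun ω : RCPath Ω => ((v₀ (σ x (ω.1 t.toNNReal))
      - v₀ (σ y (ω.1 t.toNNReal)) : ℝ) : ℂ)) ∞ (jointLaw μ P) :=
    hw.comp_measurePreserving (hP.measurePreserving_eval t.toNNReal)
  have e₃ := condL2_mulL2 hP t.toNNReal (w := fun a => v₀ (σ x a) - v₀ (σ y a)) hw hw'
    (hm.pairL2 x y ht)
  rw [← hm.corr_eq x y ht] at e₃
  rw [← e₁, ← e₂, ← e₃, ← map_sub, ← map_add, ← map_smul, ← map_neg]
  congr 1
  refine Lp.ext ?_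
  filter_upwards [(hm.memLp_pairVelFn ht x y).coeFn_toLp, hL₁.coeFn_toLp, hL₂.coeFn_toLp,
    coeFn_mulL2 hw' (hm.pairL2 x y ht), (hm.memLp_pairFn ht x y).coeFn_toLp,
    Lp.coeFn_neg (Complex.I • (hL₁.toLp f₁ - hL₂.toLp f₂ + mulL2 hw' (hm.pairL2 x y ht))),
    Lp.coeFn_smul Complex.I (hL₁.toLp f₁ - hL₂.toLp f₂ + mulL2 hw' (hm.pairL2 x y ht)),
    Lp.coeFn_add (hL₁.toLp f₁ - hL₂.toLp f₂) (mulL2 hw' (hm.pairL2 x y ht)),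
    Lp.coeFn_sub (hL₁.toLp f₁) (hL₂.toLp f₂)] with ω g1 g2 g3 g4 g5 g6 g7 g8 g9
  rw [pairVelL2, g1, g6, Pi.neg_apply, g7, Pi.smul_apply, g8, Pi.add_apply, g9, Pi.sub_apply, g2, g3,
    g4, pairL2, g5]
  have k1 : f₁ ω = (∑' z, h (x - z) * dysonSum h F ψ₀ z (t, ω))
      * (starRingEnd ℂ) (dysonSum h F ψ₀ y (t, ω)) := by
    rw [hf₁, ← tsum_mul_right]
    exact tsum_congr fun z => (mul_assoc _ _ _).symm
  have k2 : f₂ ω = dysonSum h F ψ₀ x (t, ω)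
      * (starRingEnd ℂ) (∑' z, h (y - z) * dysonSum h F ψ₀ z (t, ω)) := by
    rw [Complex.conj_tsum, hf₂, ← tsum_mul_left]
    refine tsum_congr fun z => ?_
    rw [map_mul, pairFn]; ring
  rw [k1, k2]
  simp only [pairVelFn, velFn, rhs, pairFn, potentialProcess, map_mul, map_add, map_neg,
    Complex.conj_I, Complex.conj_ofReal, smul_eq_mul, Complex.ofReal_sub]
  ring

end IsModel

end CorrelationDynamics

end MarkovAnderson

end

noncomputable section

namespace MarkovAnderson

/-! ### Operators on Hilbert sums -/

section HilbertSum

variable {ι X : Type*} [NormedAddCommGroup X]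

/-- The space of square summable families in `X`. -/
abbrev EllTwoSum (ι X : Type*) [NormedAddCommGroup X] : Type _ := lp (fun _ : ι => X) 2

theorem hasSum_norm_sq (u : EllTwoSum ι X) : HasSum (fun x => ‖u x‖ ^ 2) (‖u‖ ^ 2) := by
  have := lp.hasSum_norm (p := 2) (by norm_num) u
  simpa using this

theorem memlp_two_of_summable {f : ι → X} (hf : Summable fun x => ‖f x‖ ^ 2) :
    Memℓp (E := fun _ : ι => X) f 2 :=
  memℓp_gen (by simpa using hf)

theorem tendsto_of_dominated {α : Type*} {l : Filter α} {u : α → EllTwoSum ι X}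
    {w g : EllTwoSum ι X} {C : ℝ} (hb : ∀ᶠ a in l, ∀ x, ‖u a x - w x‖ ≤ C * ‖g x‖)
    (hu : ∀ x, Tendsto (fun a => u a x) l (𝓝 (w x))) : Tendsto u l (𝓝 w) := by
  have h1 : Tendsto (fun a => ∑' x, ‖(u a - w) x‖ ^ 2) l (𝓝 (∑' _ : ι, (0 : ℝ))) := by
    refine tendsto_tsum_of_dominated_convergence (bound := fun x => C ^ 2 * ‖g x‖ ^ 2)
      ((hasSum_norm_sq g).summable.mul_left _) (fun x => ?_) ?_
    · have := ((tendsto_iff_norm_sub_tendsto_zero.1 (hu x)).pow 2)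
      simpa using this
    · filter_upwards [hb] with a ha x
      rw [Real.norm_of_nonneg (by positivity), ← mul_pow]
      exact pow_le_pow_left₀ (norm_nonneg _) (ha x) 2
  simp only [tsum_zero, (hasSum_norm_sq _).tsum_eq] at h1
  have h2 := h1.sqrt
  simp only [Real.sqrt_zero, Real.sqrt_sq (norm_nonneg _)] at h2
  exact tendsto_iff_norm_sub_tendsto_zero.2 h2

theorem hasSum_norm_sq_perm (e : ι ≃ ι) (C : ℝ) (u : EllTwoSum ι X) :
    HasSum (fun x => C ^ 2 * ‖u (e x)‖ ^ 2) (C ^ 2 * ‖u‖ ^ 2) :=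
  (e.hasSum_iff.2 (hasSum_norm_sq u)).mul_left _

variable [InnerProductSpace ℂ X]

theorem memlp_perm (e : ι ≃ ι) {T : ι → X →L[ℂ] X} {C : ℝ} (hT : ∀ x f, ‖T x f‖ ≤ C * ‖f‖)
    (u : EllTwoSum ι X) : Memℓp (E := fun _ : ι => X) (fun x => T x (u (e x))) 2 := by
  refine memlp_two_of_summable (Summable.of_nonneg_of_le (fun _ => by positivity) (fun x => ?_)
    (hasSum_norm_sq_perm e C u).summable)
  rw [← mul_pow]
  exact pow_le_pow_left₀ (norm_nonneg _) (hT x _) 2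

/-- The linear map `(T u)(x) = T_x u(e x)`. -/
def permLin (e : ι ≃ ι) (T : ι → X →L[ℂ] X) (C : ℝ) (hT : ∀ x f, ‖T x f‖ ≤ C * ‖f‖) :
    EllTwoSum ι X →ₗ[ℂ] EllTwoSum ι X where
  toFun u := ⟨fun x => T x (u (e x)), memlp_perm e hT u⟩
  map_add' u w := by
    refine lp.ext (funext fun x => ?_)
    exact map_add (T x) (u (e x)) (w (e x))
  map_smul' c u := by
    refine lp.ext (funext fun x => ?_)
    exact map_smul (T x) c (u (e x))

theorem norm_permLin_le (e : ι ≃ ι) (T : ι → X →L[ℂ] X) {C : ℝ} (hC : 0 ≤ C)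
    (hT : ∀ x f, ‖T x f‖ ≤ C * ‖f‖) (u : EllTwoSum ι X) : ‖permLin e T C hT u‖ ≤ C * ‖u‖ := by
  refine (sq_le_sq₀ (norm_nonneg _) (mul_nonneg hC (norm_nonneg _))).1 ?_
  rw [mul_pow]
  refine hasSum_le (fun x => ?_) (hasSum_norm_sq (permLin e T C hT u)) (hasSum_norm_sq_perm e C u)
  rw [← mul_pow]
  exact pow_le_pow_left₀ (norm_nonneg _) (hT x _) 2

/-- The operator `(T u)(x) = T_x u(e x)` for uniformly bounded `T_x` and a bijection `e`. -/
def permOp (e : ι ≃ ι) (T : ι → X →L[ℂ] X) (C : ℝ) (hC : 0 ≤ C) (hT : ∀ x f, ‖T x f‖ ≤ C * ‖f‖) :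
    EllTwoSum ι X →L[ℂ] EllTwoSum ι X :=
  (permLin e T C hT).mkContinuous C (norm_permLin_le e T hC hT)

variable {e : ι ≃ ι} {T : ι → X →L[ℂ] X} {C : ℝ}

theorem permOp_apply (hC : 0 ≤ C) (hT : ∀ x f, ‖T x f‖ ≤ C * ‖f‖) (u : EllTwoSum ι X) (x : ι) :
    permOp e T C hC hT u x = T x (u (e x)) := rfl

theorem norm_permOp_le (hC : 0 ≤ C) (hT : ∀ x f, ‖T x f‖ ≤ C * ‖f‖) :
    ‖permOp e T C hC hT‖ ≤ C :=
  LinearMap.mkContinuous_norm_le _ hC _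

theorem permOp_single [DecidableEq ι] (hC : 0 ≤ C) (hT : ∀ x f, ‖T x f‖ ≤ C * ‖f‖) (x : ι) (f : X) :
    permOp e T C hC hT (lp.single 2 (e x) f) = lp.single 2 x (T x f) := by
  refine lp.ext (funext fun y => ?_)
  rw [permOp_apply]
  rcases eq_or_ne y x with rfl | hy
  · rw [lp.single_apply_self, lp.single_apply_self]
  · rw [lp.single_apply_ne _ _ _ hy, lp.single_apply_ne _ _ _ (fun h => hy (e.injective h)),
      map_zero]

theorem inner_eq_of_apply {u w u' w' : EllTwoSum ι X} (e : ι ≃ ι)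
    (h : ∀ x, inner ℂ (u' (e x)) (w (e x)) = inner ℂ (u x) (w' x)) :
    inner ℂ u' w = inner ℂ u w' := by
  rw [lp.inner_eq_tsum, lp.inner_eq_tsum, ← e.tsum_eq]
  exact tsum_congr h

end HilbertSum

/-! ### The direct sum of copies of a gapped semigroup -/

section Diagonal

variable {ι X : Type*} [NormedAddCommGroup X] [InnerProductSpace ℂ X]

/-- The diagonal operator `(T u)(x) = T u(x)`. -/
def diagOp (ι : Type*) (T : X →L[ℂ] X) : EllTwoSum ι X →L[ℂ] EllTwoSum ι X :=
  permOp (Equiv.refl ι) (fun _ => T) ‖T‖ (norm_nonneg _) fun _ f => T.le_opNorm f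

theorem diagOp_apply (T : X →L[ℂ] X) (u : EllTwoSum ι X) (x : ι) : diagOp ι T u x = T (u x) := rfl

theorem diagOp_single [DecidableEq ι] (T : X →L[ℂ] X) (x : ι) (f : X) :
    diagOp ι T (lp.single 2 x f) = lp.single 2 x (T f) :=
  permOp_single (e := Equiv.refl ι) _ _ x f

/-- The orthogonal projection to the span of the unit vector `e`. -/
def meanProj (e : X) : X →L[ℂ] X := (innerSL ℂ e).smulRight e

theorem meanProj_apply (e f : X) : meanProj e f = inner ℂ e f • e := by
  simp [meanProj]

variable {S : ℝ → X →L[ℂ] X} {e : X} {T : ℝ}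

/-- A bound uniform in `h`, needed to dominate the coordinates when the limit `tendsto_resolvent` is
taken in the Hilbert sum. -/
theorem IsGapped.norm_resolvent_sub_le [CompleteSpace X] (hS : IsGapped S e T) (f : X) {h : ℝ}
    (hh : 0 < h) : ‖h⁻¹ • hS.resolvent (S h f - f)‖ ≤ ‖f‖ := by
  rw [map_sub, hS.resolvent_comm f hh.le, ← neg_sub, smul_neg, norm_neg, hS.resolvent_sub f hh.le,
    norm_smul, Real.norm_of_nonneg (inv_nonneg.2 hh.le), inv_mul_le_iff₀ hh]
  have := intervalIntegral.norm_integral_le_of_norm_le_const (a := 0) (b := h)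
    (f := fun s => S s (f - inner ℂ e f • e)) (C := ‖f‖)
    (fun s _ => (hS.norm_le s _).trans (hS.norm_sub_mean_le f))
  rwa [sub_zero, abs_of_pos hh, mul_comm] at this

theorem IsGapped.meanProj_idem (hS : IsGapped S e T) (f : X) :
    meanProj e (meanProj e f) = meanProj e f := by
  rw [meanProj_apply, meanProj_apply, inner_smul_right, inner_self_eq_norm_sq_to_K, hS.norm_e]
  simp

set_option maxHeartbeats 1000000 in
/-- The direct sum of copies of a gapped semigroup, with a symmetric operator which couples them,
is hypocoercive. -/
theorem IsGapped.isHypocoercive [CompleteSpace X] [DecidableEq ι] (hS : IsGapped S e T) (o : ι)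
    {A : EllTwoSum ι X →L[ℂ] EllTwoSum ι X} {c : ℝ} (hc : 0 < c)
    (A_symm : ∀ u w, inner ℂ (A u) w = inner ℂ u (A w))
    (A_phi : A (lp.single 2 o e) = 0)
    (proj_A_proj : ∀ u, diagOp ι (meanProj e) (A (diagOp ι (meanProj e) u)) = 0)
    (coercive : ∀ ψ, diagOp ι (meanProj e) ψ = ψ → ψ o = 0 →
      c * ‖ψ‖ ^ 2 ≤ (inner ℂ (diagOp ι hS.resolvent (A ψ)) (A ψ)).re) :
    IsHypocoercive (fun h => diagOp ι (S h)) (diagOp ι (meanProj e)) (diagOp ι hS.resolvent) A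
      (lp.single 2 o e) T c where
  T_pos := hS.T_pos
  c_pos := hc
  norm_phi := by rw [lp.norm_single (by norm_num), hS.norm_e]
  proj_proj u := by
    refine lp.ext (funext fun x => ?_)
    exact hS.meanProj_idem (u x)
  proj_symm u w := by
    refine inner_eq_of_apply (Equiv.refl ι) fun x => ?_
    rw [Equiv.refl_apply, diagOp_apply, diagOp_apply, meanProj_apply, meanProj_apply, inner_smul_left, inner_smul_right, inner_conj_symm]
    ring
  proj_phi := by
    rw [diagOp_single, meanProj_apply, inner_self_eq_norm_sq_to_K, hS.norm_e]
    simp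
  proj_S h _ u := by
    refine lp.ext (funext fun x => ?_)
    simp only [diagOp_apply, meanProj_apply, hS.inner_e]
  S_proj h _ u := by
    refine lp.ext (funext fun x => ?_)
    simp only [diagOp_apply, meanProj_apply, map_smul, hS.apply_e]
  norm_S h hh u := by
    refine hasSum_le (fun x => ?_) (hasSum_norm_sq _)
      ((hasSum_norm_sq (diagOp ι (meanProj e) u)).add
        ((hasSum_norm_sq (u - diagOp ι (meanProj e) u)).mul_left _))
    have := hS.norm_sq_apply_le (u x) hh
    rw [← meanProj_apply] at this
    exact this
  tendsto_S u := by
    refine tendsto_of_dominated (g := u) (C := 2) (Eventually.of_forall fun h x => ?_)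
      fun x => hS.tendsto (u x)
    rw [diagOp_apply, two_mul]
    exact (norm_sub_le _ _).trans (add_le_add_left (hS.norm_le h (u x)) _)
  proj_R u := by
    refine lp.ext (funext fun x => ?_)
    simp only [diagOp_apply, meanProj_apply, hS.inner_e_resolvent, zero_smul, lp.coeFn_zero,
      Pi.zero_apply]
  R_proj u := by
    refine lp.ext (funext fun x => ?_)
    simp only [diagOp_apply, meanProj_apply, map_smul, hS.resolvent_e, smul_zero, lp.coeFn_zero,
      Pi.zero_apply]
  tendsto_R u := by
    refine tendsto_of_dominated (g := u) (C := 2) ?_ fun x => ?_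
    · filter_upwards [self_mem_nhdsWithin] with h hh x
      rw [two_mul]
      refine (norm_sub_le _ _).trans
        (add_le_add (hS.norm_resolvent_sub_le (u x) (Set.mem_Ioi.1 hh)) ?_)
      have := hS.norm_sub_mean_le (u x)
      rw [← meanProj_apply, ← norm_neg] at this
      exact this
    · have := hS.tendsto_resolvent (u x)
      rw [← meanProj_apply] at this
      exact this
  accretive f := by
    have h1 := (Complex.hasSum_re (lp.hasSum_inner (𝕜 := ℂ) (diagOp ι hS.resolvent f) f)).mul_left T
    refine hasSum_le (fun x => ?_) (hasSum_norm_sq (diagOp ι hS.resolvent f)) h1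
    have := hS.accretive_resolvent (f x)
    rwa [← diagOp_apply] at this
  A_symm := A_symm
  A_phi := A_phi
  proj_A_proj := proj_A_proj
  coercive ψ h1 h2 := by
    refine coercive ψ h1 ?_
    rw [lp.inner_single_left] at h2
    rw [← h1, diagOp_apply, meanProj_apply, h2, zero_smul]

end Diagonal

end MarkovAnderson

end

noncomputable section

namespace MarkovAnderson

/-! ### Convolution operators -/

section Convolution

variable {G E : Type*} [NormedAddCommGroup E] [InnerProductSpace ℂ E] [CompleteSpace E]

/-- The operator `∑ a(ζ) W_ζ`. -/
def convOp (W : G → E →L[ℂ] E) (a : G → ℂ) : E →L[ℂ] E := ∑' ζ, a ζ • W ζ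

variable {W : G → E →L[ℂ] E} {a b : G → ℂ}

theorem norm_smul_apply_le (hW : ∀ ζ, ‖W ζ‖ ≤ 1) (ζ : G) : ‖a ζ • W ζ‖ ≤ ‖a ζ‖ := by
  rw [norm_smul]
  exact mul_le_of_le_one_right (norm_nonneg _) (hW ζ)

theorem hasSum_convOp (hW : ∀ ζ, ‖W ζ‖ ≤ 1) (ha : Summable fun ζ => ‖a ζ‖) (u : E) :
    HasSum (fun ζ => a ζ • W ζ u) (convOp W a u) := by
  have h1 : Summable fun ζ => a ζ • W ζ := Summable.of_norm_bounded ha (norm_smul_apply_le hW)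
  have h2 := (ContinuousLinearMap.apply ℂ E u).hasSum h1.hasSum
  simp only [ContinuousLinearMap.apply_apply, smul_apply] at h2
  exact h2

theorem norm_convOp_le (hW : ∀ ζ, ‖W ζ‖ ≤ 1) (ha : Summable fun ζ => ‖a ζ‖) {B : ℝ}
    (hB : ∑' ζ, ‖a ζ‖ ≤ B) : ‖convOp W a‖ ≤ B :=
  (tsum_of_norm_bounded ha.hasSum (norm_smul_apply_le hW)).trans hB

theorem convOp_sub (hW : ∀ ζ, ‖W ζ‖ ≤ 1) (ha : Summable fun ζ => ‖a ζ‖)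
    (hb : Summable fun ζ => ‖b ζ‖) : convOp W (fun ζ => a ζ - b ζ) = convOp W a - convOp W b := by
  rw [convOp, convOp, convOp, ← Summable.tsum_sub]
  · exact tsum_congr fun ζ => sub_smul _ _ _
  · exact Summable.of_norm_bounded ha (norm_smul_apply_le hW)
  · exact Summable.of_norm_bounded hb (norm_smul_apply_le hW)

theorem inner_convOp [AddGroup G] (hW : ∀ ζ, ‖W ζ‖ ≤ 1)
    (hWs : ∀ ζ u w, inner ℂ (W ζ u) w = inner ℂ u (W (-ζ) w)) (ha : Summable fun ζ => ‖a ζ‖)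
    (hab : ∀ ζ, b ζ = (starRingEnd ℂ) (a (-ζ))) (u w : E) :
    inner ℂ (convOp W a u) w = inner ℂ u (convOp W b w) := by
  have hb : Summable fun ζ => ‖b ζ‖ := by
    refine ((Equiv.neg G).summable_iff.2 ha).congr fun ζ => ?_
    simp [hab]
  have h1 := (innerSL ℂ u).hasSum (hasSum_convOp hW hb w)
  have h2 := Complex.hasSum_conj'.2 ((innerSL ℂ w).hasSum (hasSum_convOp hW ha u))
  simp only [innerSL_apply_apply, inner_conj_symm] at h1 h2
  refine h2.unique ((Equiv.neg G).hasSum_iff.1 ?_)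
  refine h1.congr_fun fun ζ => ?_
  simp only [Function.comp, Equiv.neg_apply, inner_smul_left, inner_smul_right, hab, hWs, neg_neg]

end Convolution

/-! ### The translation invariant operators -/

section LatticeOperators

variable {d : ℕ} {Ω : Type*} [MeasurableSpace Ω] {μ : Measure Ω} {σ : Lattice d → Ω → Ω}

/-- The translation `(τ_ζ u)(x) = u(x - ζ)`. -/
def translate (μ : Measure Ω) (ζ : Lattice d) :
    EllTwoSum (Lattice d) (Lp ℂ 2 μ) →L[ℂ] EllTwoSum (Lattice d) (Lp ℂ 2 μ) :=
  permOp (Equiv.subRight ζ) (fun _ => ContinuousLinearMap.id ℂ _) 1 zero_le_one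
    fun _ f => (one_mul ‖f‖).ge

/-- The translation `u ↦ u(x - ζ) ∘ σ_ζ`. -/
def shiftTranslate (hσ : IsShiftAction μ σ) (ζ : Lattice d) :
    EllTwoSum (Lattice d) (Lp ℂ 2 μ) →L[ℂ] EllTwoSum (Lattice d) (Lp ℂ 2 μ) :=
  permOp (Equiv.subRight ζ) (fun _ => shiftL2 hσ ζ) 1 zero_le_one
    fun _ f => by rw [norm_shiftL2, one_mul]

theorem translate_apply (ζ : Lattice d) (u : EllTwoSum (Lattice d) (Lp ℂ 2 μ)) (x : Lattice d) :
    translate μ ζ u x = u (x - ζ) := rfl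

theorem shiftTranslate_apply (hσ : IsShiftAction μ σ) (ζ : Lattice d)
    (u : EllTwoSum (Lattice d) (Lp ℂ 2 μ)) (x : Lattice d) :
    shiftTranslate hσ ζ u x = shiftL2 hσ ζ (u (x - ζ)) := rfl

theorem norm_translate_le (ζ : Lattice d) : ‖translate μ ζ‖ ≤ 1 := norm_permOp_le _ _

theorem norm_shiftTranslate_le (hσ : IsShiftAction μ σ) (ζ : Lattice d) :
    ‖shiftTranslate hσ ζ‖ ≤ 1 := norm_permOp_le _ _

theorem translate_single (ζ x : Lattice d) (f : Lp ℂ 2 μ) :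
    translate μ ζ (lp.single 2 x f) = lp.single 2 (x + ζ) f := by
  have := permOp_single (e := Equiv.subRight ζ) (T := fun _ => ContinuousLinearMap.id ℂ (Lp ℂ 2 μ))
    zero_le_one (fun _ f => (one_mul ‖f‖).ge) (x + ζ) f
  rw [Equiv.subRight_apply, add_sub_cancel_right] at this
  exact this

theorem shiftTranslate_single (hσ : IsShiftAction μ σ) (ζ x : Lattice d) (f : Lp ℂ 2 μ) :
    shiftTranslate hσ ζ (lp.single 2 x f) = lp.single 2 (x + ζ) (shiftL2 hσ ζ f) := by
  have := permOp_single (e := Equiv.subRight ζ) (T := fun _ => shiftL2 hσ ζ)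
    zero_le_one (fun _ f => by rw [norm_shiftL2, one_mul]) (x + ζ) f
  rw [Equiv.subRight_apply, add_sub_cancel_right] at this
  exact this

theorem inner_translate (ζ : Lattice d) (u w : EllTwoSum (Lattice d) (Lp ℂ 2 μ)) :
    inner ℂ (translate μ ζ u) w = inner ℂ u (translate μ (-ζ) w) := by
  refine inner_eq_of_apply (Equiv.addRight ζ) fun x => ?_
  rw [translate_apply, translate_apply, Equiv.coe_addRight, add_sub_cancel_right, sub_neg_eq_add]

theorem inner_shiftTranslate (hσ : IsShiftAction μ σ) (ζ : Lattice d)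
    (u w : EllTwoSum (Lattice d) (Lp ℂ 2 μ)) :
    inner ℂ (shiftTranslate hσ ζ u) w = inner ℂ u (shiftTranslate hσ (-ζ) w) := by
  refine inner_eq_of_apply (Equiv.addRight ζ) fun x => ?_
  rw [shiftTranslate_apply, shiftTranslate_apply, Equiv.coe_addRight, add_sub_cancel_right,
    sub_neg_eq_add, inner_shiftL2_left]

theorem inner_mulL2 {w : Ω → ℝ} (hw : MemLp (fun a => (w a : ℂ)) ∞ μ) (f g : Lp ℂ 2 μ) :
    inner ℂ (mulL2 hw f) g = inner ℂ f (mulL2 hw g) := by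
  rw [L2.inner_def, L2.inner_def]
  refine integral_congr_ae ?_
  filter_upwards [coeFn_mulL2 hw f, coeFn_mulL2 hw g] with a h1 h2
  rw [h1, h2, RCLike.inner_apply, RCLike.inner_apply, map_mul, Complex.conj_ofReal]
  ring

variable [IsProbabilityMeasure μ]

/-- A vector fixed by the mean projection is constant in `Ω` at each site, and shifts do not see
constants. -/
theorem shiftTranslate_eq_translate (hσ : IsShiftAction μ σ)
    {u : EllTwoSum (Lattice d) (Lp ℂ 2 μ)} (hu : diagOp (Lattice d) (meanProj (oneL2 μ)) u = u)
    (ζ : Lattice d) : shiftTranslate hσ ζ u = translate μ ζ u := by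
  refine lp.ext (funext fun x => ?_)
  rw [shiftTranslate_apply, translate_apply, ← hu, diagOp_apply, meanProj_apply, map_smul,
    shiftL2_oneL2]

/-- The vector `δ₀ ⊗ 1`. -/
def ground (d : ℕ) (μ : Measure Ω) [IsProbabilityMeasure μ] :
    EllTwoSum (Lattice d) (Lp ℂ 2 μ) := lp.single 2 0 (oneL2 μ)

theorem inner_ground (u : EllTwoSum (Lattice d) (Lp ℂ 2 μ)) :
    inner ℂ (ground d μ) u = inner ℂ (oneL2 μ) (u 0) := lp.inner_single_left _ _ _

theorem convOp_shiftTranslate_ground (hσ : IsShiftAction μ σ) {a : Lattice d → ℂ}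
    (ha : Summable fun ζ => ‖a ζ‖) (x : Lattice d) :
    convOp (shiftTranslate hσ) a (ground d μ) x = a x • oneL2 μ := by
  have h1 := (lp.evalCLM ℂ (fun _ : Lattice d => Lp ℂ 2 μ) 2 x).hasSum
    (hasSum_convOp (norm_shiftTranslate_le hσ) ha (ground d μ))
  have h2 : HasSum (fun ζ => a ζ • (lp.single 2 ζ (oneL2 μ) : EllTwoSum (Lattice d) (Lp ℂ 2 μ)) x)
      (a x • (lp.single 2 x (oneL2 μ) : EllTwoSum (Lattice d) (Lp ℂ 2 μ)) x) :=
    hasSum_single x fun ζ hζ => by rw [lp.single_apply_ne _ _ _ hζ.symm, smul_zero]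
  rw [lp.single_apply_self] at h2
  refine h1.unique (h2.congr_fun fun ζ => ?_)
  rw [ground, shiftTranslate_single, zero_add, shiftL2_oneL2]
  rfl

theorem inner_ground_convOp (hσ : IsShiftAction μ σ) {a : Lattice d → ℂ}
    (ha : Summable fun ζ => ‖a ζ‖) :
    inner ℂ (ground d μ) (convOp (shiftTranslate hσ) a (ground d μ)) = a 0 := by
  rw [inner_ground, convOp_shiftTranslate_ground hσ ha, inner_smul_right,
    inner_self_eq_norm_sq_to_K, norm_oneL2]
  simp

end LatticeOperators

/-! ### The operator `A` of the correlations and its hypocoercivity -/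

section Generator

variable {d : ℕ} {Ω : Type*} [TopologicalSpace Ω] [MeasurableSpace Ω] {μ : Measure Ω}
  {σ : Lattice d → Ω → Ω} {P : Kernel Ω (RCPath Ω)} {hP : IsMarkovFamily μ σ P} {v₀ : Ω → ℝ}
  {h : Lattice d → ℂ}

theorem IsPotential.norm_mulL2_diff_le (hσ : IsShiftAction μ σ) (hv : IsPotential hP v₀)
    (x y : Lattice d) (f : Lp ℂ 2 μ) :
    ‖mulL2 (hv.memLp_diff hσ x y) f‖ ≤ 2 * (eLpNorm v₀ ∞ μ).toReal * ‖f‖ := by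
  have hb : ∀ x, ∀ᵐ a ∂μ, |v₀ (σ x a)| ≤ (eLpNorm v₀ ∞ μ).toReal := fun x => by
    refine (hσ.measurePreserving x).quasiMeasurePreserving.ae
      (p := fun a => |v₀ a| ≤ (eLpNorm v₀ ∞ μ).toReal) ?_
    have h1 := ae_le_eLpNormEssSup (f := v₀) (μ := μ)
    filter_upwards [h1] with a ha
    rw [← eLpNorm_exponent_top] at ha
    have := ENNReal.toReal_mono hv.memLp.2.ne ha
    simpa using this
  refine norm_mulL2_le _ ?_ f
  filter_upwards [hb x, hb y] with a h1 h2
  rw [Complex.norm_real, Real.norm_eq_abs, two_mul]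
  exact (abs_sub _ _).trans (add_le_add h1 h2)

/-- Multiplication by `v_x - v_0` at the lattice point `x`. -/
def potOp (hσ : IsShiftAction μ σ) (hv : IsPotential hP v₀) :
    EllTwoSum (Lattice d) (Lp ℂ 2 μ) →L[ℂ] EllTwoSum (Lattice d) (Lp ℂ 2 μ) :=
  permOp (Equiv.refl _) (fun x => mulL2 (hv.memLp_diff hσ x 0)) (2 * (eLpNorm v₀ ∞ μ).toReal)
    (by positivity) fun x f => hv.norm_mulL2_diff_le hσ x 0 f

theorem potOp_apply (hσ : IsShiftAction μ σ) (hv : IsPotential hP v₀)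
    (u : EllTwoSum (Lattice d) (Lp ℂ 2 μ)) (x : Lattice d) :
    potOp hσ hv u x = mulL2 (hv.memLp_diff hσ x 0) (u x) := rfl

theorem potOp_single (hσ : IsShiftAction μ σ) (hv : IsPotential hP v₀) (x : Lattice d)
    (f : Lp ℂ 2 μ) : potOp hσ hv (lp.single 2 x f)
      = lp.single 2 x (mulL2 (hv.memLp_diff hσ x 0) f) :=
  permOp_single (e := Equiv.refl _) _ _ x f

theorem inner_potOp (hσ : IsShiftAction μ σ) (hv : IsPotential hP v₀)
    (u w : EllTwoSum (Lattice d) (Lp ℂ 2 μ)) :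
    inner ℂ (potOp hσ hv u) w = inner ℂ u (potOp hσ hv w) := by
  refine inner_eq_of_apply (Equiv.refl _) fun x => ?_
  rw [potOp_apply, potOp_apply, Equiv.refl_apply, inner_mulL2]

/-- The symmetric part of the generator of the evolution of the correlations. -/
def symmOp (hσ : IsShiftAction μ σ) (hv : IsPotential hP v₀) (h : Lattice d → ℂ) :
    EllTwoSum (Lattice d) (Lp ℂ 2 μ) →L[ℂ] EllTwoSum (Lattice d) (Lp ℂ 2 μ) :=
  convOp (translate μ) h - convOp (shiftTranslate hσ) h + potOp hσ hv

theorem symmOp_apply (hσ : IsShiftAction μ σ) (hv : IsPotential hP v₀) (h : Lattice d → ℂ)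
    (u : EllTwoSum (Lattice d) (Lp ℂ 2 μ)) : symmOp hσ hv h u
      = convOp (translate μ) h u - convOp (shiftTranslate hσ) h u + potOp hσ hv u := rfl

theorem IsHoppingKernel.summable_norm (hh : IsHoppingKernel h) : Summable fun ζ => ‖h ζ‖ := by
  obtain ⟨m, hm, hs⟩ := hh.expBounded
  refine Summable.of_nonneg_of_le (fun _ => norm_nonneg _) (fun ζ => ?_) hs
  refine le_mul_of_one_le_left (norm_nonneg _) (Real.one_le_exp ?_)
  exact mul_nonneg hm.le (latticeNorm_nonneg ζ)

theorem inner_symmOp (hσ : IsShiftAction μ σ) (hv : IsPotential hP v₀) (hh : IsHoppingKernel h)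
    (u w : EllTwoSum (Lattice d) (Lp ℂ 2 μ)) :
    inner ℂ (symmOp hσ hv h u) w = inner ℂ u (symmOp hσ hv h w) := by
  rw [symmOp_apply, symmOp_apply, inner_add_left, inner_add_right, inner_sub_left, inner_sub_right,
    inner_potOp, inner_convOp norm_translate_le inner_translate hh.summable_norm hh.selfAdjoint,
    inner_convOp (norm_shiftTranslate_le hσ) (inner_shiftTranslate hσ) hh.summable_norm
      hh.selfAdjoint]

variable [IsProbabilityMeasure μ]

/-- On vectors constant in `Ω` the two hopping terms coincide and cancel. Only the potential couples
these vectors to the mean-zero part. -/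
theorem symmOp_of_proj (hσ : IsShiftAction μ σ) (hv : IsPotential hP v₀) (h : Lattice d → ℂ)
    (hh : Summable fun ζ => ‖h ζ‖)
    {u : EllTwoSum (Lattice d) (Lp ℂ 2 μ)} (hu : diagOp (Lattice d) (meanProj (oneL2 μ)) u = u) :
    symmOp hσ hv h u = potOp hσ hv u := by
  rw [symmOp_apply, ← (hasSum_convOp norm_translate_le hh u).tsum_eq,
    ← (hasSum_convOp (norm_shiftTranslate_le hσ) hh u).tsum_eq]
  simp only [shiftTranslate_eq_translate hσ hu, sub_self, zero_add]

theorem coeFn_mulL2_diff_one (hσ : IsShiftAction μ σ) (hv : IsPotential hP v₀) (x : Lattice d) :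
    mulL2 (hv.memLp_diff hσ x 0) (oneL2 μ) =ᵐ[μ] fun a => ((v₀ (σ x a) - v₀ a : ℝ) : ℂ) := by
  filter_upwards [coeFn_mulL2 (hv.memLp_diff hσ x 0) (oneL2 μ), coeFn_oneL2 (μ := μ)] with a h1 h2
  rw [h1, h2, mul_one, hσ.zero]
  rfl

/-- By shift invariance of `μ`, `v_x` and `v_0` have the same mean. This is the source of `QAQ = 0`.
-/
theorem inner_oneL2_mulL2_diff (hσ : IsShiftAction μ σ) (hv : IsPotential hP v₀) (x : Lattice d) :
    inner ℂ (oneL2 μ) (mulL2 (hv.memLp_diff hσ x 0) (oneL2 μ)) = 0 := by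
  rw [inner_oneL2, integral_congr_ae (coeFn_mulL2_diff_one hσ hv x), integral_complex_ofReal,
    integral_sub ((hv.memLp_shift hσ x).integrable (by simp)) (hv.memLp.integrable (by simp))]
  have h1 := integral_map (hσ.measurePreserving x).measurable.aemeasurable (f := v₀)
    (by rw [(hσ.measurePreserving x).map_eq]; exact hv.memLp.1)
  rw [(hσ.measurePreserving x).map_eq] at h1
  rw [← h1, sub_self, Complex.ofReal_zero]

theorem proj_symmOp_proj (hσ : IsShiftAction μ σ) (hv : IsPotential hP v₀) (h : Lattice d → ℂ)
    (hh : Summable fun ζ => ‖h ζ‖)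
    {u : EllTwoSum (Lattice d) (Lp ℂ 2 μ)} (hu : diagOp (Lattice d) (meanProj (oneL2 μ)) u = u) :
    diagOp (Lattice d) (meanProj (oneL2 μ)) (symmOp hσ hv h u) = 0 := by
  rw [symmOp_of_proj hσ hv h hh hu]
  refine lp.ext (funext fun x => ?_)
  rw [diagOp_apply, potOp_apply, ← hu, diagOp_apply, meanProj_apply, meanProj_apply, map_smul,
    inner_smul_right, inner_oneL2_mulL2_diff hσ hv, mul_zero, zero_smul]
  rfl

theorem symmOp_ground (hσ : IsShiftAction μ σ) (hv : IsPotential hP v₀)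
    (hh : Summable fun ζ => ‖h ζ‖) : symmOp hσ hv h (ground d μ) = 0 := by
  rw [symmOp_of_proj hσ hv h hh, ground, potOp_single]
  · have : mulL2 (hv.memLp_diff hσ 0 0) (oneL2 μ) = 0 := by
      refine Lp.ext ?_
      filter_upwards [coeFn_mulL2 (hv.memLp_diff hσ 0 0) (oneL2 μ), Lp.coeFn_zero ℂ 2 μ] with a h1 h2
      rw [h1, h2]
      simp
    rw [this, lp.single_zero]
  · rw [ground, diagOp_single, meanProj_apply, inner_self_eq_norm_sq_to_K, norm_oneL2]
    simp

theorem le_norm_resolvent_mulL2_diff {T : ℝ} (hS : IsGapped (semigroup hP) (oneL2 μ) T)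
    (hσ : IsShiftAction μ σ) (hv : IsPotential hP v₀) {χ : ℝ}
    (hχ : ∀ x : Lattice d, x ≠ 0 → ∀ f g : Lp ℂ 2 μ,
      (g =ᵐ[μ] fun a => ((v₀ (σ x a) - v₀ a : ℝ) : ℂ)) → ∫ a, f a ∂μ = 0 → IsGen hP f g → χ ≤ ‖f‖)
    {x : Lattice d} (hx : x ≠ 0) :
    χ ≤ ‖hS.resolvent (mulL2 (hv.memLp_diff hσ x 0) (oneL2 μ))‖ := by
  refine hχ x hx _ _ (coeFn_mulL2_diff_one hσ hv x) ?_ (isGen_of_hasGenerator hP ?_)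
  · rw [← inner_oneL2, hS.inner_e_resolvent]
  · have := hS.hasGenerator_resolvent (mulL2 (hv.memLp_diff hσ x 0) (oneL2 μ))
    rwa [inner_oneL2_mulL2_diff hσ hv, zero_smul, sub_zero] at this

/-- On the range of `Q` the operator `A` is multiplication by `v_x - v_0`, so coercivity can be
checked site by site: accretivity of `B⁻¹` and the lower bound `χ` give `Re⟨B⁻¹(v_x - v_0), v_x -
v_0⟩ ≥ χ²/T` for `x ≠ 0`. At `x = 0` there is nothing to check off `φ`. -/
theorem exists_isHypocoercive {T : ℝ} (hS : IsGapped (semigroup hP) (oneL2 μ) T)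
    (hσ : IsShiftAction μ σ) (hv : IsPotential hP v₀) (hh : IsHoppingKernel h) :
    ∃ c, IsHypocoercive (fun t => diagOp (Lattice d) (semigroup hP t))
      (diagOp (Lattice d) (meanProj (oneL2 μ))) (diagOp (Lattice d) hS.resolvent)
      (symmOp hσ hv h) (ground d μ) T c := by
  obtain ⟨χ, hχ0, hχ⟩ := hv.nondegenerate
  have hT := hS.T_pos
  refine ⟨χ ^ 2 / T, hS.isHypocoercive 0 (by positivity) (inner_symmOp hσ hv hh)
    (symmOp_ground hσ hv hh.summable_norm) (fun u => proj_symmOp_proj hσ hv h hh.summable_norm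
      (lp.ext (funext fun x => hS.meanProj_idem (u x)))) fun ψ h1 h2 => ?_⟩
  rw [symmOp_of_proj hσ hv h hh.summable_norm h1]
  have h3 := Complex.hasSum_re (lp.hasSum_inner (𝕜 := ℂ)
    (diagOp (Lattice d) hS.resolvent (potOp hσ hv ψ)) (potOp hσ hv ψ))
  refine hasSum_le (fun x => ?_) ((hasSum_norm_sq ψ).mul_left (χ ^ 2 / T)) h3
  rw [diagOp_apply, potOp_apply]
  rcases eq_or_ne x 0 with rfl | hx
  · rw [h2]; simp
  · have h4 : ψ x = inner ℂ (oneL2 μ) (ψ x) • oneL2 μ := by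
      conv_lhs => rw [← h1]
      rw [diagOp_apply, meanProj_apply]
    have h5 := hS.accretive_resolvent (mulL2 (hv.memLp_diff hσ x 0) (ψ x))
    have h6 : ‖ψ x‖ * χ ≤ ‖hS.resolvent (mulL2 (hv.memLp_diff hσ x 0) (ψ x))‖ := by
      rw [h4, map_smul, map_smul, norm_smul, norm_smul, norm_oneL2, mul_one]
      exact mul_le_mul_of_nonneg_left (le_norm_resolvent_mulL2_diff hS hσ hv hχ hx) (norm_nonneg _)
    rw [div_mul_eq_mul_div, div_le_iff₀' hT]
    refine le_trans ?_ h5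
    rw [← mul_pow, mul_comm]
    exact pow_le_pow_left₀ (by positivity) h6 2

end Generator

end MarkovAnderson

end

noncomputable section

namespace MarkovAnderson

/-! ### Expansion in the wave number -/

section WaveNumber

variable {d : ℕ}

/-- The bilinear product `k · x`. -/
def dot (k : Fin d → ℂ) (x : Lattice d) : ℂ := ∑ i, k i * (x i : ℂ)

theorem dot_add (k : Fin d → ℂ) (x y : Lattice d) : dot k (x + y) = dot k x + dot k y := by
  simp [dot, mul_add, Finset.sum_add_distrib]

theorem dot_neg (k : Fin d → ℂ) (x : Lattice d) : dot k (-x) = -dot k x := by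
  simp [dot]

theorem dot_zero (k : Fin d → ℂ) : dot k 0 = 0 := by
  simp [dot]

/-- Pairing the sup norm of `k` with the Euclidean norm of `x` costs a factor `d`. With `d + 1` the
quantity `(d + 1)‖k‖`, the small parameter `κ` of the estimates, dominates `‖k‖` as well. -/
theorem norm_dot_le (k : Fin d → ℂ) (x : Lattice d) :
    ‖dot k x‖ ≤ (d + 1) * ‖k‖ * latticeNorm x := by
  have h1 : ‖dot k x‖ ≤ ∑ _i : Fin d, ‖k‖ * latticeNorm x := by
    refine norm_sum_le_of_le _ fun i _ => ?_
    rw [norm_mul]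
    refine mul_le_mul (norm_le_pi_norm k i) ?_ (norm_nonneg _) (norm_nonneg _)
    have := abs_le_latticeNorm x i
    rwa [← Complex.norm_intCast] at this
  refine h1.trans ?_
  have := latticeNorm_nonneg x
  rw [Finset.sum_const, Finset.card_univ, Fintype.card_fin, nsmul_eq_mul]
  nlinarith [mul_nonneg (norm_nonneg k) this]

theorem norm_exp_I_dot_le (k : Fin d → ℂ) (x : Lattice d) :
    ‖Complex.exp (Complex.I * dot k x)‖ ≤ Real.exp ((d + 1) * ‖k‖ * latticeNorm x) := by
  rw [Complex.norm_exp, Real.exp_le_exp]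
  refine (Complex.re_le_norm _).trans ?_
  rw [norm_mul, Complex.norm_I, one_mul]
  exact norm_dot_le k x

theorem norm_one_sub_exp_neg_le (w : ℂ) : ‖1 - Complex.exp (-w)‖ ≤ ‖w‖ * Real.exp ‖w‖ := by
  have := Complex.norm_exp_sub_sum_le_norm_mul_exp (-w) 1
  rw [norm_sub_rev]
  simpa using this

theorem norm_one_sub_exp_neg_sub_le (w : ℂ) :
    ‖1 - Complex.exp (-w) - w‖ ≤ ‖w‖ ^ 2 * Real.exp ‖w‖ := by
  have := Complex.norm_exp_sub_sum_le_norm_mul_exp (-w) 2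
  simp only [Finset.sum_range_succ, Finset.range_zero, Finset.sum_empty, pow_zero, Nat.factorial,
    Nat.cast_one, div_one, pow_one, zero_add, norm_neg, mul_one] at this
  rw [← norm_neg]
  refine le_of_eq_of_le ?_ this
  congr 1
  ring

/-- The first order part of the perturbation `Δ_k`. -/
def velCoeff (h : Lattice d → ℂ) (k : Fin d → ℂ) (ζ : Lattice d) : ℂ :=
  h ζ * (Complex.I * dot k ζ)

/-- The coefficients of the perturbation `Δ_k`. -/
def phaseCoeff (h : Lattice d → ℂ) (k : Fin d → ℂ) (ζ : Lattice d) : ℂ :=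
  h ζ * (1 - Complex.exp (-(Complex.I * dot k ζ)))

variable {h : Lattice d → ℂ} {m : ℝ}

theorem norm_I_mul_dot_le (k : Fin d → ℂ) (x : Lattice d) :
    ‖Complex.I * dot k x‖ ≤ (d + 1) * ‖k‖ * latticeNorm x := by
  rw [norm_mul, Complex.norm_I, one_mul]
  exact norm_dot_le k x

theorem norm_velCoeff_le (hm : 0 < m) (k : Fin d → ℂ) (ζ : Lattice d) :
    ‖velCoeff h k ζ‖
      ≤ ((d + 1) * ‖k‖) * m⁻¹ * (Real.exp (m * latticeNorm ζ) * ‖h ζ‖) := by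
  rw [velCoeff, norm_mul]
  have h1 := norm_I_mul_dot_le k ζ
  have h2 : latticeNorm ζ ≤ m⁻¹ * Real.exp (m * latticeNorm ζ) := by
    rw [inv_mul_eq_div, le_div_iff₀' hm]
    linarith [Real.add_one_le_exp (m * latticeNorm ζ)]
  calc ‖h ζ‖ * ‖Complex.I * dot k ζ‖
      ≤ ‖h ζ‖ * ((d + 1) * ‖k‖ * (m⁻¹ * Real.exp (m * latticeNorm ζ))) := by
        gcongr
        exact h1.trans (by gcongr)
    _ = _ := by ring

/-- Half of the exponential moment of `h` absorbs the growth `e^{|k·ζ|}` for complex `k`, the other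
half the power of `|ζ|`. The second order remainder is treated in the same way. -/
theorem norm_phaseCoeff_le (hm : 0 < m) {k : Fin d → ℂ} (hk : (d + 1) * ‖k‖ ≤ m / 2)
    (ζ : Lattice d) : ‖phaseCoeff h k ζ‖
      ≤ ((d + 1) * ‖k‖) * (2 * m⁻¹) * (Real.exp (m * latticeNorm ζ) * ‖h ζ‖) := by
  have hr := latticeNorm_nonneg ζ
  set r := latticeNorm ζ
  rw [phaseCoeff, norm_mul]
  have h1 := norm_I_mul_dot_le k ζ
  have h2 : r ≤ 2 * m⁻¹ * Real.exp (m / 2 * r) := by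
    have : 2 * m⁻¹ * Real.exp (m / 2 * r) = Real.exp (m / 2 * r) / (m / 2) := by field_simp
    rw [this, le_div_iff₀' (by positivity)]
    linarith [Real.add_one_le_exp (m / 2 * r)]
  have h3 : Real.exp ‖Complex.I * dot k ζ‖ ≤ Real.exp (m / 2 * r) :=
    Real.exp_le_exp.2 (h1.trans (by gcongr))
  have h4 : Real.exp (m * r) = Real.exp (m / 2 * r) * Real.exp (m / 2 * r) := by
    rw [← Real.exp_add]; congr 1; ring
  calc ‖h ζ‖ * ‖1 - Complex.exp (-(Complex.I * dot k ζ))‖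
      ≤ ‖h ζ‖ * ((d + 1) * ‖k‖ * (2 * m⁻¹ * Real.exp (m / 2 * r)) * Real.exp (m / 2 * r)) := by
        gcongr
        refine (norm_one_sub_exp_neg_le _).trans ?_
        gcongr
        exact h1.trans (by gcongr)
    _ = _ := by rw [h4]; ring

theorem norm_phaseCoeff_sub_le (hm : 0 < m) {k : Fin d → ℂ} (hk : (d + 1) * ‖k‖ ≤ m / 2)
    (ζ : Lattice d) : ‖phaseCoeff h k ζ - velCoeff h k ζ‖
      ≤ ((d + 1) * ‖k‖) ^ 2 * (8 * m⁻¹ ^ 2) * (Real.exp (m * latticeNorm ζ) * ‖h ζ‖) := by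
  have hr := latticeNorm_nonneg ζ
  set r := latticeNorm ζ
  rw [phaseCoeff, velCoeff, ← mul_sub, norm_mul]
  have h1 := norm_I_mul_dot_le k ζ
  have h2 : r ^ 2 ≤ 8 * m⁻¹ ^ 2 * Real.exp (m / 2 * r) := by
    have h3 := Real.pow_div_factorial_le_exp (m / 2 * r) (by positivity) 2
    have : 8 * m⁻¹ ^ 2 * Real.exp (m / 2 * r) = Real.exp (m / 2 * r) * 8 / m ^ 2 := by field_simp
    rw [this, le_div_iff₀' (by positivity)]
    simp only [Nat.factorial] at h3
    push_cast at h3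
    nlinarith
  have h3 : Real.exp ‖Complex.I * dot k ζ‖ ≤ Real.exp (m / 2 * r) :=
    Real.exp_le_exp.2 (h1.trans (by gcongr))
  have h4 : Real.exp (m * r) = Real.exp (m / 2 * r) * Real.exp (m / 2 * r) := by
    rw [← Real.exp_add]; congr 1; ring
  calc ‖h ζ‖ * ‖1 - Complex.exp (-(Complex.I * dot k ζ)) - Complex.I * dot k ζ‖
      ≤ ‖h ζ‖ * (((d + 1) * ‖k‖) ^ 2 * (8 * m⁻¹ ^ 2 * Real.exp (m / 2 * r))
          * Real.exp (m / 2 * r)) := by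
        gcongr
        refine (norm_one_sub_exp_neg_sub_le _).trans ?_
        gcongr
        calc ‖Complex.I * dot k ζ‖ ^ 2 ≤ ((d + 1) * ‖k‖ * r) ^ 2 := by gcongr
          _ = ((d + 1) * ‖k‖) ^ 2 * r ^ 2 := by ring
          _ ≤ _ := by gcongr
    _ = _ := by rw [h4]; ring

theorem IsHoppingKernel.summable_velCoeff (hh : IsHoppingKernel h) (k : Fin d → ℂ) :
    Summable fun ζ => ‖velCoeff h k ζ‖ := by
  obtain ⟨m, hm, hs⟩ := hh.expBounded
  exact Summable.of_nonneg_of_le (fun _ => norm_nonneg _) (norm_velCoeff_le hm k) (hs.mul_left _)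

theorem tsum_le_mul_tsum {ι : Type*} {f g : ι → ℝ} {c : ℝ} (hf : ∀ i, 0 ≤ f i)
    (hfg : ∀ i, f i ≤ c * g i) (hg : Summable g) : Summable f ∧ ∑' i, f i ≤ c * ∑' i, g i := by
  have h1 : Summable f := Summable.of_nonneg_of_le hf hfg (hg.mul_left c)
  exact ⟨h1, (h1.tsum_le_tsum hfg (hg.mul_left c)).trans_eq tsum_mul_left⟩

theorem IsHoppingKernel.exists_phaseCoeff_bound (hh : IsHoppingKernel h) :
    ∃ C κ₁ : ℝ, 0 ≤ C ∧ 0 < κ₁ ∧ ∀ k : Fin d → ℂ, (d + 1) * ‖k‖ ≤ κ₁ →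
      Summable (fun ζ => ‖phaseCoeff h k ζ‖) ∧
      ∑' ζ, ‖phaseCoeff h k ζ‖ ≤ C * ((d + 1) * ‖k‖) ∧
      ∑' ζ, ‖phaseCoeff h k ζ - velCoeff h k ζ‖ ≤ C * ((d + 1) * ‖k‖) ^ 2 := by
  obtain ⟨m, hm, hs⟩ := hh.expBounded
  have h0 : 0 ≤ expMoment h m := expMoment_nonneg
  refine ⟨(2 * m⁻¹ + 8 * m⁻¹ ^ 2) * expMoment h m, m / 2, by positivity, by positivity,
    fun k hk => ?_⟩
  have h1 := tsum_le_mul_tsum (fun _ => norm_nonneg _) (norm_phaseCoeff_le hm hk) hs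
  have h2 := tsum_le_mul_tsum (fun _ => norm_nonneg _) (norm_phaseCoeff_sub_le hm hk) hs
  refine ⟨h1.1, h1.2.trans ?_, h2.2.trans ?_⟩
  · have : 0 ≤ 8 * m⁻¹ ^ 2 * expMoment h m * ((d + 1) * ‖k‖) := by positivity
    rw [← expMoment]
    nlinarith
  · have : 0 ≤ 2 * m⁻¹ * expMoment h m * ((d + 1) * ‖k‖) ^ 2 := by positivity
    rw [← expMoment]
    nlinarith

end WaveNumber

end MarkovAnderson

end

noncomputable section

namespace MarkovAnderson

/-! ### The effective diffusion matrix -/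

section Correctors

variable {d : ℕ}

theorem velCoeff_zero (h : Lattice d → ℂ) (k : Fin d → ℂ) : velCoeff h k 0 = 0 := by
  rw [velCoeff, dot_zero, mul_zero, mul_zero]

theorem phaseCoeff_zero (h : Lattice d → ℂ) (k : Fin d → ℂ) : phaseCoeff h k 0 = 0 := by
  rw [phaseCoeff, dot_zero]
  simp

theorem dot_eq_sum (k : Fin d → ℂ) (x : Lattice d) :
    dot k x = ∑ i, k i * dot (Pi.single i 1) x := by
  simp [dot, Pi.single_apply]

theorem velCoeff_eq_sum (h : Lattice d → ℂ) (k : Fin d → ℂ) (ζ : Lattice d) :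
    velCoeff h k ζ = ∑ i, k i * velCoeff h (Pi.single i 1) ζ := by
  rw [velCoeff, dot_eq_sum, Finset.mul_sum, Finset.mul_sum]
  exact Finset.sum_congr rfl fun i _ => by rw [velCoeff]; ring

/-- The adjoint of the velocity operator at `k` is the velocity operator at `conj k`; for complex
`k` the correctors therefore have to be taken at the conjugate wave number. -/
theorem IsHoppingKernel.velCoeff_conj {h : Lattice d → ℂ} (hh : IsHoppingKernel h)
    (k : Fin d → ℂ) (ζ : Lattice d) :
    velCoeff h k ζ = (starRingEnd ℂ) (velCoeff h (fun i => (starRingEnd ℂ) (k i)) (-ζ)) := by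
  have h1 : (starRingEnd ℂ) (dot (fun i => (starRingEnd ℂ) (k i)) ζ) = dot k ζ := by
    simp [dot, map_sum]
  rw [velCoeff, velCoeff, dot_neg, map_mul, map_mul, map_neg, Complex.conj_I, h1, hh.selfAdjoint ζ]
  simp only [RCLike.star_def]
  ring

variable {Ω : Type*} [MeasurableSpace Ω] {μ : Measure Ω} [IsProbabilityMeasure μ]
  {σ : Lattice d → Ω → Ω} {h : Lattice d → ℂ}

/-- The image of the ground vector under the velocity operator. -/
def velVec (hσ : IsShiftAction μ σ) (h : Lattice d → ℂ) (k : Fin d → ℂ) :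
    EllTwoSum (Lattice d) (Lp ℂ 2 μ) := convOp (shiftTranslate hσ) (velCoeff h k) (ground d μ)

theorem velVec_apply (hσ : IsShiftAction μ σ) (hh : IsHoppingKernel h) (k : Fin d → ℂ)
    (x : Lattice d) : velVec hσ h k x = velCoeff h k x • oneL2 μ :=
  convOp_shiftTranslate_ground hσ (hh.summable_velCoeff k) x

theorem inner_ground_velVec (hσ : IsShiftAction μ σ) (hh : IsHoppingKernel h) (k : Fin d → ℂ) :
    inner ℂ (ground d μ) (velVec hσ h k) = 0 := by
  rw [velVec, inner_ground_convOp hσ (hh.summable_velCoeff k), velCoeff_zero]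

theorem velVec_eq_sum (hσ : IsShiftAction μ σ) (hh : IsHoppingKernel h) (k : Fin d → ℂ) :
    velVec hσ h k = ∑ i, k i • velVec hσ h (Pi.single i 1) := by
  refine lp.ext (funext fun x => ?_)
  rw [lp.coeFn_sum, Finset.sum_apply, velVec_apply hσ hh, velCoeff_eq_sum, Finset.sum_smul]
  refine Finset.sum_congr rfl fun i _ => ?_
  rw [lp.coeFn_smul, Pi.smul_apply, velVec_apply hσ hh, smul_smul]

theorem proj_velVec (hσ : IsShiftAction μ σ) (hh : IsHoppingKernel h) (k : Fin d → ℂ) :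
    diagOp (Lattice d) (meanProj (oneL2 μ)) (velVec hσ h k) = velVec hσ h k := by
  refine lp.ext (funext fun x => ?_)
  rw [diagOp_apply, velVec_apply hσ hh, meanProj_apply, inner_smul_right,
    inner_self_eq_norm_sq_to_K, norm_oneL2]
  simp

/-- Here the nondegeneracy of the hopping enters: at a suitable site `y` both `h y` and `k·y` are
nonzero, and so is the coordinate of the velocity vector. -/
theorem velVec_ne_zero (hσ : IsShiftAction μ σ) (hh : IsHoppingKernel h) {k : Fin d → ℝ}
    (hk : k ≠ 0) : velVec hσ h (fun i => (k i : ℂ)) ≠ 0 := by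
  intro h0
  obtain ⟨y, hy, hhy⟩ := hh.nondegenerate k hk
  have h1 := velVec_apply hσ hh (fun i => (k i : ℂ)) y
  rw [h0] at h1
  have h2 : velCoeff h (fun i => (k i : ℂ)) y = 0 := by
    rcases smul_eq_zero.1 h1.symm with h3 | h3
    · exact h3
    · exact absurd (norm_oneL2 (μ := μ)) (by rw [h3, norm_zero]; norm_num)
  have h3 : dot (fun i => (k i : ℂ)) y = ((∑ i, k i * (y i : ℝ) : ℝ) : ℂ) := by
    simp [dot]
  rw [velCoeff, h3] at h2
  simp only [mul_eq_zero, hhy, Complex.I_ne_zero, Complex.ofReal_eq_zero, hy, or_self] at h2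

theorem inner_convOp_velCoeff (hσ : IsShiftAction μ σ) (hh : IsHoppingKernel h) (k : Fin d → ℂ)
    (x : EllTwoSum (Lattice d) (Lp ℂ 2 μ)) :
    inner ℂ (velVec hσ h fun i => (starRingEnd ℂ) (k i)) x
      = inner ℂ (ground d μ) (convOp (shiftTranslate hσ) (velCoeff h k) x) :=
  inner_convOp (norm_shiftTranslate_le hσ) (inner_shiftTranslate hσ) (hh.summable_velCoeff _)
    (hh.velCoeff_conj k) _ _

end Correctors

/-- The bilinear form `∑ z_i z_j L_{ij}`. -/
def bilin {d : ℕ} (L : Matrix (Fin d) (Fin d) ℂ) (z : Fin d → ℂ) : ℂ :=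
  ∑ i, ∑ j, z i * z j * L i j

/-! ### Correctors and the effective quadratic form -/

section Effective

variable {d : ℕ} {Ω : Type*} [TopologicalSpace Ω] [MeasurableSpace Ω] {μ : Measure Ω}
  {σ : Lattice d → Ω → Ω} {P : Kernel Ω (RCPath Ω)} {hP : IsMarkovFamily μ σ P} {v₀ : Ω → ℝ}
  {h : Lattice d → ℂ} [IsProbabilityMeasure μ]

theorem inner_sum_conj_smul {E : Type*} [NormedAddCommGroup E] [InnerProductSpace ℂ E]
    (η ε : Fin d → E) (z : Fin d → ℂ) :
    inner ℂ (∑ i, (starRingEnd ℂ) (z i) • η i) (∑ j, z j • ε j)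
      = bilin (fun i j => inner ℂ (η i) (ε j)) z := by
  unfold bilin
  rw [sum_inner]
  refine Finset.sum_congr rfl fun i _ => ?_
  rw [inner_sum]
  refine Finset.sum_congr rfl fun j _ => ?_
  rw [inner_smul_left, inner_smul_right, Complex.conj_conj, mul_assoc]

open ContinuousLinearMap in
-- The symmetric operator drops out of the real part, so `Re⟨η, e⟩ = Re⟨R†q, q⟩ ≥ ‖R†q‖²/T`. If this
-- is not positive, then `R†q = 0` and `η = η₀`, and projecting the equation with `QAQ = 0` and `Qq
-- = 0` forces `e = Qe = 0`.
theorem IsHypocoercive.re_inner_pos {H : Type*} [NormedAddCommGroup H] [InnerProductSpace ℂ H]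
    [CompleteSpace H] {S : ℝ → H →L[ℂ] H} {Q R A : H →L[ℂ] H} {φ : H} {T c : ℝ}
    (hyp : IsHypocoercive S Q R A φ T c) {q η₀ e : H} (hq : Q q = 0) (hη₀ : Q η₀ = η₀)
    (he : q - Complex.I • A (η₀ + adjoint R q) = e) (hQe : Q e = e) (he0 : e ≠ 0) :
    0 < (inner ℂ (η₀ + adjoint R q) e).re := by
  set η := η₀ + adjoint R q with hη
  have h1 : inner ℂ η₀ q = 0 := by rw [← hη₀, hyp.proj_symm, hq, inner_zero_right]
  have h2 : (inner ℂ η e).re = (inner ℂ (adjoint R q) q).re := by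
    rw [← he, inner_sub_right, inner_smul_right, Complex.sub_re, Complex.mul_re, Complex.I_re,
      Complex.I_im, hyp.inner_A_self_im, hη, inner_add_left, h1]
    simp
  rw [h2]
  have h3 := hyp.accretive_adjoint q
  by_contra hneg
  have h4 : ‖adjoint R q‖ = 0 := by
    have := mul_nonneg hyp.T_pos.le (sub_nonneg.2 (not_lt.1 hneg))
    exact pow_eq_zero_iff two_ne_zero |>.1 (le_antisymm (by linarith) (sq_nonneg _))
  rw [norm_eq_zero] at h4
  apply he0
  rw [← hQe, ← he, hη, h4, add_zero, map_sub, map_smul, hq, ← hη₀, hyp.proj_A_proj]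
  simp

set_option maxHeartbeats 1000000 in
open ContinuousLinearMap in
/-- The amplitude of the ground vector decays with a rate that is quadratic in the wave number. -/
theorem exists_effective_matrix {T c : ℝ} {S : ℝ → EllTwoSum (Lattice d) (Lp ℂ 2 μ) →L[ℂ]
      EllTwoSum (Lattice d) (Lp ℂ 2 μ)}
    {R : EllTwoSum (Lattice d) (Lp ℂ 2 μ) →L[ℂ] EllTwoSum (Lattice d) (Lp ℂ 2 μ)}
    {hσ : IsShiftAction μ σ} {hv : IsPotential hP v₀} (hh : IsHoppingKernel h)
    (hyp : IsHypocoercive S (diagOp (Lattice d) (meanProj (oneL2 μ))) R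
      (symmOp hσ hv h) (ground d μ) T c) :
    ∃ L : Matrix (Fin d) (Fin d) ℂ,
      (∀ k : Fin d → ℝ, k ≠ 0 → 0 < (bilin L fun i => (k i : ℂ)).re) ∧
      ∃ C κ₀ : ℝ, 0 ≤ C ∧ 0 < κ₀ ∧ ∀ (k : Fin d → ℂ)
        (u : ℝ → EllTwoSum (Lattice d) (Lp ℂ 2 μ)), (d + 1) * ‖k‖ ≤ κ₀ → Continuous u →
        (∀ t, 0 ≤ t → Tendsto (fun δ : ℝ => δ⁻¹ • (u (t + δ) - S δ (u t))) (𝓝[>] 0)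
          (𝓝 (-(Complex.I • (symmOp hσ hv h (u t)
            + convOp (shiftTranslate hσ) (phaseCoeff h k) (u t)))))) →
        ∀ t, 0 ≤ t → ‖inner ℂ (ground d μ) (u t)
            - Complex.exp (-bilin L k * t) * inner ℂ (ground d μ) (u 0)‖
          ≤ C * Real.exp (C * ((d + 1) * ‖k‖) ^ 2 * t)
            * ((d + 1) * ‖k‖ + ((d + 1) * ‖k‖) ^ 3 * t) * ‖u 0‖ := by
  -- Correctors are solved for the coordinate directions only and then combined linearly, so the
  -- rate is exactly a quadratic form in the wave number.
  choose q η₀ hq hη₀ hφη₀ hqη using fun i : Fin d =>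
    hyp.exists_adjoint_solution (velVec hσ h (Pi.single i 1)) (inner_ground_velVec hσ hh _)
  set Q := diagOp (Lattice d) (meanProj (oneL2 μ)) with hQ
  set A := symmOp hσ hv h with hA
  set η : Fin d → EllTwoSum (Lattice d) (Lp ℂ 2 μ) := fun i => η₀ i + adjoint R (q i) with hη
  have hlin : ∀ z : Fin d → ℂ,
      (∑ i, z i • q i) - Complex.I • A ((∑ i, z i • η₀ i) + adjoint R (∑ i, z i • q i))
        = velVec hσ h z := by
    intro z
    rw [velVec_eq_sum hσ hh z, map_sum, ← Finset.sum_add_distrib, map_sum, Finset.smul_sum,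
      ← Finset.sum_sub_distrib]
    refine Finset.sum_congr rfl fun i _ => ?_
    rw [← hqη i, map_smul, ← smul_add, map_smul, smul_sub, smul_comm]
  have hηlin : ∀ z : Fin d → ℂ, (∑ i, z i • η₀ i) + adjoint R (∑ i, z i • q i)
      = ∑ i, z i • η i := by
    intro z
    rw [map_sum, ← Finset.sum_add_distrib]
    refine Finset.sum_congr rfl fun i _ => ?_
    rw [map_smul, ← smul_add]
  have hQq : ∀ z : Fin d → ℂ, Q (∑ i, z i • q i) = 0 := fun z => by
    rw [map_sum]
    exact Finset.sum_eq_zero fun i _ => by rw [map_smul, hq, smul_zero]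
  have hQη : ∀ z : Fin d → ℂ, Q (∑ i, z i • η₀ i) = ∑ i, z i • η₀ i := fun z => by
    rw [map_sum]
    exact Finset.sum_congr rfl fun i _ => by rw [map_smul, hη₀]
  -- The inner product is conjugate linear on the left. Pairing the corrector at `conj z` with the
  -- velocity at `z` makes the form bilinear, hence polynomial in complex `z`.
  set L : Matrix (Fin d) (Fin d) ℂ := fun i j => inner ℂ (η i) (velVec hσ h (Pi.single j 1)) with hL
  have hform : ∀ z : Fin d → ℂ, inner ℂ (∑ i, (starRingEnd ℂ) (z i) • η i) (velVec hσ h z)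
      = bilin L z := fun z => by
    rw [velVec_eq_sum hσ hh z, inner_sum_conj_smul]
  obtain ⟨C₂, κ₁, hC₂, hκ₁, hph⟩ := hh.exists_phaseCoeff_bound
  set C₁ : ℝ := C₂ + ∑ i, ‖η i‖ with hC₁
  have hsum0 : 0 ≤ ∑ i, ‖η i‖ := Finset.sum_nonneg fun i _ => norm_nonneg _
  obtain ⟨C, κ₀, hC, hκ₀, hamp⟩ := hyp.amplitude_estimate (C₁ := C₁) (by positivity)
  refine ⟨L, fun k hk => ?_, C, min κ₀ κ₁, hC, lt_min hκ₀ hκ₁, fun k u hk hu hstep t ht => ?_⟩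
  · have h1 := hyp.re_inner_pos (hQq fun i => (k i : ℂ)) (hQη _) (hlin _)
      (proj_velVec hσ hh _) (velVec_ne_zero hσ hh hk)
    rw [hηlin] at h1
    rw [← hform]
    simpa using h1
  · set κ : ℝ := (d + 1) * ‖k‖ with hκ
    have hκ0 : 0 ≤ κ := by positivity
    obtain ⟨hs, hb1, hb2⟩ := hph k (hk.trans (min_le_right _ _))
    have hC21 : C₂ ≤ C₁ := by linarith
    -- `amplitude_estimate` asks for a source representing `-i⟨φ, A₁ ·⟩`. As the adjoint of `A₁` is
    -- the velocity operator at `conj k`, this source is `i` times the velocity vector at `conj k`;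
    -- the two factors `i` then cancel in the rate.
    set z : Fin d → ℂ := fun i => Complex.I * (starRingEnd ℂ) (k i) with hz
    have hzsmul : ∀ w : Fin d → EllTwoSum (Lattice d) (Lp ℂ 2 μ),
        ∑ i, z i • w i = Complex.I • ∑ i, (starRingEnd ℂ) (k i) • w i := fun w => by
      rw [Finset.smul_sum]
      exact Finset.sum_congr rfl fun i _ => by rw [hz, mul_smul]
    refine hamp κ _ (convOp (shiftTranslate hσ) (velCoeff h k)) (∑ i, z i • q i)
      (∑ i, z i • η₀ i) _ _ u hκ0 (hk.trans (min_le_left _ _)) ?_ ?_ ?_ ?_ (hQq z) (hQη z) ?_ rfl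
      ?_ ?_ ?_ hu hstep t ht
    · exact norm_convOp_le (norm_shiftTranslate_le hσ) hs (hb1.trans (by gcongr))
    · rw [← convOp_sub (norm_shiftTranslate_le hσ) hs (hh.summable_velCoeff k)]
      refine norm_convOp_le (norm_shiftTranslate_le hσ) ?_ (hb2.trans (by gcongr))
      exact Summable.of_nonneg_of_le (fun _ => norm_nonneg _) (fun _ => norm_sub_le _ _)
        (hs.add (hh.summable_velCoeff k))
    · rw [inner_ground_convOp hσ hs, phaseCoeff_zero]
    · exact inner_ground_velVec hσ hh k
    · rw [inner_sum]
      exact Finset.sum_eq_zero fun i _ => by rw [inner_smul_right, hφη₀, mul_zero]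
    · rw [hηlin]
      have h1 : ‖k‖ ≤ κ := by
        rw [hκ]
        nlinarith [norm_nonneg k, mul_nonneg (Nat.cast_nonneg (α := ℝ) d) (norm_nonneg k)]
      calc ‖∑ i, z i • η i‖ ≤ ∑ i, κ * ‖η i‖ := by
            refine norm_sum_le_of_le _ fun i _ => ?_
            rw [norm_smul, hz, norm_mul, Complex.norm_I, one_mul, RCLike.norm_conj]
            gcongr
            exact (norm_le_pi_norm k i).trans h1
        _ = κ * ∑ i, ‖η i‖ := by rw [Finset.mul_sum]
        _ ≤ C₁ * κ := by rw [mul_comm]; gcongr; linarith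
    · intro x
      rw [hlin, velVec_eq_sum hσ hh, hzsmul, ← velVec_eq_sum hσ hh, inner_smul_left,
        Complex.conj_I, inner_convOp_velCoeff hσ hh, neg_mul]
    · rw [hηlin, hzsmul, inner_smul_left, Complex.conj_I]
      have := hform k
      rw [velVec] at this
      rw [this, ← mul_assoc, mul_neg, Complex.I_mul_I, neg_neg, one_mul]

end Effective

end MarkovAnderson

end

noncomputable section

namespace MarkovAnderson

/-! ### The Fourier transformed correlations -/

/-- Two nearby times are both compared with the orbit of `f s₀` for one slightly earlier `s₀`: the
errors are small by the hypothesis, and the orbit of a fixed vector is continuous. This gives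
continuity from both sides out of a forward estimate. -/
theorem IsGapped.continuousOn_of_norm_sub_le {X : Type*} [NormedAddCommGroup X]
    [InnerProductSpace ℂ X] [CompleteSpace X] {S : ℝ → X →L[ℂ] X} {e : X} {T : ℝ}
    (hS : IsGapped S e T) {f : ℝ → X} {K τ : ℝ} (hK : 0 ≤ K)
    (hf : ∀ s t, 0 ≤ s → s ≤ t → t ≤ τ → ‖f t - S (t - s) (f s)‖ ≤ K * (t - s)) :
    ContinuousOn f (Set.Icc 0 τ) := by
  refine Metric.continuousOn_iff.2 fun t ht ε hε => ?_
  set ρ := ε / (4 * (K + 1)) with hρ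
  have hρ0 : 0 < ρ := by positivity
  have hKρ : 4 * K * ρ ≤ ε := by
    rw [hρ, mul_div_assoc', div_le_iff₀ (by positivity)]
    nlinarith
  set s₀ := max 0 (t - ρ) with hs₀
  have hst : s₀ ≤ t := max_le ht.1 (by linarith)
  have hg : Continuous fun s => S (s - s₀) (f s₀) :=
    (hS.continuous_apply (f s₀)).comp (continuous_id.sub continuous_const)
  obtain ⟨δ, hδ, hgδ⟩ := Metric.continuous_iff.1 hg t (ε / 4) (by positivity)
  refine ⟨min δ ρ, lt_min hδ hρ0, fun s hs hd => ?_⟩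
  have hsρ : |s - t| < ρ := hd.trans_le (min_le_right _ _)
  rw [abs_lt] at hsρ
  have hs0s : s₀ ≤ s := max_le hs.1 (by linarith)
  have h1 := hf s₀ s (le_max_left _ _) hs0s hs.2
  have h2 := hf s₀ t (le_max_left _ _) hst ht.2
  have h3 := hgδ s (hd.trans_le (min_le_left _ _))
  have h4 : t - ρ ≤ s₀ := le_max_right _ _
  rw [dist_eq_norm] at h3 ⊢
  have e : f s - f t = (f s - S (s - s₀) (f s₀)) + (S (s - s₀) (f s₀) - S (t - s₀) (f s₀))
    - (f t - S (t - s₀) (f s₀)) := by abel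
  rw [e]
  refine ((norm_sub_le _ _).trans (add_le_add_left (norm_add_le _ _) _)).trans_lt ?_
  have h5 : K * (s - s₀) ≤ K * (2 * ρ) := by gcongr; linarith
  have h6 : K * (t - s₀) ≤ K * ρ := by gcongr; linarith
  nlinarith

/-- The bijection `e` relabels a target `p` and a summation site as a displacement and a source.
Absolute convergence allows the double series to be summed over targets instead of displacements. -/
theorem hasSum_convOp_rearrange {G J E : Type*} [NormedAddCommGroup E] [InnerProductSpace ℂ E]
    [CompleteSpace E] {W : G → E →L[ℂ] E} {a : G → ℂ} (hW : ∀ ζ, ‖W ζ‖ ≤ 1)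
    (ha : Summable fun ζ => ‖a ζ‖) {g : J → E} (hg : Summable fun p => ‖g p‖) (e : J × G ≃ G × J)
    {r : J → E} (hr : ∀ p, HasSum
      (fun z => a (e (p, z)).1 • W (e (p, z)).1 (g (e (p, z)).2)) (r p)) :
    HasSum r (convOp W a (∑' p, g p)) := by
  set f : G × J → E := fun q => a q.1 • W q.1 (g q.2) with hf
  have hs : Summable f := by
    refine Summable.of_norm_bounded (g := fun q : G × J => ‖a q.1‖ * ‖g q.2‖)
      (ha.mul_of_nonneg hg (Pi.le_def.2 fun _ => norm_nonneg _)
        (Pi.le_def.2 fun _ => norm_nonneg _)) fun q => ?_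
    rw [hf, norm_smul]
    exact mul_le_mul_of_nonneg_left (((W q.1).le_opNorm _).trans
      (mul_le_of_le_one_left (norm_nonneg _) (hW _))) (norm_nonneg _)
  have h1 : HasSum (fun ζ => a ζ • W ζ (∑' p, g p)) (∑' q, f q) :=
    hs.hasSum.prod_fiberwise fun ζ => (hg.of_norm.hasSum.mapL (W ζ)).const_smul (a ζ)
  rw [(hasSum_convOp hW ha _).unique h1]
  exact (e.hasSum_iff.2 hs.hasSum).prod_fiberwise hr

section Transfer

variable {d : ℕ} {Ω : Type*} [MeasurableSpace Ω] {μ : Measure Ω} {σ : Lattice d → Ω → Ω}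

/-- The map `f ↦ e^{ik·y} δ_{x-y} ⊗ (f ∘ σ_{-y})`. -/
def transfer (hσ : IsShiftAction μ σ) (k : Fin d → ℂ) (p : Lattice d × Lattice d) :
    Lp ℂ 2 μ →L[ℂ] EllTwoSum (Lattice d) (Lp ℂ 2 μ) :=
  Complex.exp (Complex.I * dot k p.2) •
    (lp.singleContinuousLinearMap ℂ (fun _ : Lattice d => Lp ℂ 2 μ) 2 (p.1 - p.2)).comp
      (shiftL2 hσ (-p.2))

theorem transfer_apply (hσ : IsShiftAction μ σ) (k : Fin d → ℂ) (p : Lattice d × Lattice d)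
    (f : Lp ℂ 2 μ) : transfer hσ k p f
      = Complex.exp (Complex.I * dot k p.2) • lp.single 2 (p.1 - p.2) (shiftL2 hσ (-p.2) f) := rfl

/-- For complex `k` the factor `e^{ik·y}` may grow; half of the weight in `y` pays for it. -/
theorem norm_transfer_le (hσ : IsShiftAction μ σ) {k : Fin d → ℂ} {ν : ℝ}
    (hk : (d + 1) * ‖k‖ ≤ ν / 2) (p : Lattice d × Lattice d) {f : Lp ℂ 2 μ} {B : ℝ} (hB : 0 ≤ B)
    (hf : ‖f‖ ≤ B * (weight ν p.1 * weight ν p.2)) :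
    ‖transfer hσ k p f‖ ≤ B * (weight ν p.1 * weight (ν / 2) p.2) := by
  rw [transfer_apply, norm_smul, lp.norm_single (by norm_num), norm_shiftL2]
  have h1 : ‖Complex.exp (Complex.I * dot k p.2)‖ * weight ν p.2 ≤ weight (ν / 2) p.2 := by
    calc _ ≤ Real.exp (ν / 2 * latticeNorm p.2) * weight ν p.2 := by
          have := weight_pos ν p.2
          gcongr
          refine (norm_exp_I_dot_le k p.2).trans (Real.exp_le_exp.2 ?_)
          exact mul_le_mul_of_nonneg_right hk (latticeNorm_nonneg _)
      _ = _ := by rw [weight, weight, ← Real.exp_add]; congr 1; ring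
  have := weight_pos ν p.1
  calc _ ≤ ‖Complex.exp (Complex.I * dot k p.2)‖ * (B * (weight ν p.1 * weight ν p.2)) := by gcongr
    _ = B * weight ν p.1 * (‖Complex.exp (Complex.I * dot k p.2)‖ * weight ν p.2) := by ring
    _ ≤ B * weight ν p.1 * weight (ν / 2) p.2 := by gcongr
    _ = _ := by ring

theorem summable_weight_mul {ν : ℝ} (hν : 0 < ν) :
    Summable fun p : Lattice d × Lattice d => weight ν p.1 * weight (ν / 2) p.2 :=
  Summable.mul_of_nonneg (f := fun x : Lattice d => weight ν x) (g := fun x => weight (ν / 2) x)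
    (summable_exp_neg_latticeNorm hν) (summable_exp_neg_latticeNorm (by positivity))
    (Pi.le_def.2 fun x => (weight_pos ν x).le) (Pi.le_def.2 fun x => (weight_pos _ x).le)

/-- Hopping of the first site becomes a pure translation. Hopping of the second, in
`shiftTranslate_transfer`, also moves the reference point of the environment and therefore carries a
shift and a phase. -/
theorem translate_transfer (hσ : IsShiftAction μ σ) (k : Fin d → ℂ) (ζ x y : Lattice d)
    (f : Lp ℂ 2 μ) : translate μ ζ (transfer hσ k (x, y) f) = transfer hσ k (x + ζ, y) f := by
  rw [transfer_apply, transfer_apply, map_smul, translate_single, add_sub_right_comm]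

theorem shiftTranslate_transfer (hσ : IsShiftAction μ σ) (k : Fin d → ℂ) (ζ x y : Lattice d)
    (f : Lp ℂ 2 μ) : Complex.exp (-(Complex.I * dot k ζ)) •
      shiftTranslate hσ ζ (transfer hσ k (x, y) f) = transfer hσ k (x, y - ζ) f := by
  rw [transfer_apply, transfer_apply, map_smul, shiftTranslate_single, shiftL2_shiftL2, smul_smul,
    ← Complex.exp_add, sub_add, neg_sub, ← sub_eq_add_neg, sub_eq_add_neg y, dot_add, dot_neg]
  congr 2
  ring

theorem inner_ground_transfer [IsProbabilityMeasure μ] (hσ : IsShiftAction μ σ) (k : Fin d → ℂ)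
    (x y : Lattice d) (f : Lp ℂ 2 μ) : inner ℂ (ground d μ) (transfer hσ k (x, y) f)
      = if x = y then Complex.exp (Complex.I * dot k y) * inner ℂ (oneL2 μ) f else 0 := by
  rw [transfer_apply, inner_smul_right, inner_ground]
  split_ifs with hxy
  · subst hxy
    simp only [sub_self]
    rw [lp.single_apply_self, ← inner_shiftL2_left, shiftL2_oneL2]
  · rw [lp.single_apply_ne _ _ _ (sub_ne_zero.2 hxy).symm, inner_zero_right, mul_zero]

theorem mulL2_shiftL2 (hσ : IsShiftAction μ σ) {w w' : Ω → ℂ} (hw : MemLp w ∞ μ)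
    (hw' : MemLp w' ∞ μ) (x : Lattice d) (hww : ∀ a, w' a = w (σ x a)) (f : Lp ℂ 2 μ) :
    mulL2 hw' (shiftL2 hσ x f) = shiftL2 hσ x (mulL2 hw f) := by
  refine Lp.ext ?_
  filter_upwards [coeFn_mulL2 hw' (shiftL2 hσ x f), coeFn_shiftL2 hσ x f,
    coeFn_shiftL2 hσ x (mulL2 hw f), (hσ.measurePreserving x).quasiMeasurePreserving.ae
      (coeFn_mulL2 hw f)] with a h1 h2 h3 h4
  rw [h1, h2, h3, h4, hww]

end Transfer

section TransferDynamics

variable {d : ℕ} {Ω : Type*} [TopologicalSpace Ω] [MeasurableSpace Ω] {μ : Measure Ω}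
  {σ : Lattice d → Ω → Ω} {P : Kernel Ω (RCPath Ω)} {hP : IsMarkovFamily μ σ P} {v₀ : Ω → ℝ}

theorem diagOp_transfer (hσ : IsShiftAction μ σ) (hP : IsMarkovFamily μ σ P) (k : Fin d → ℂ)
    (p : Lattice d × Lattice d) (t : ℝ) (f : Lp ℂ 2 μ) :
    diagOp (Lattice d) (semigroup hP t) (transfer hσ k p f)
      = transfer hσ k p (semigroup hP t f) := by
  rw [transfer_apply, transfer_apply, map_smul, diagOp_single, semigroup, adjSemigroup_shiftL2]

/-- Composing with `σ_{-y}` turns `v_x - v_y` into `v_{x-y} - v_0`, which depends only on `x - y`.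
This is why each wave number evolves on its own. -/
theorem potOp_transfer (hσ : IsShiftAction μ σ) (hv : IsPotential hP v₀) (k : Fin d → ℂ)
    (p : Lattice d × Lattice d) (f : Lp ℂ 2 μ) : potOp hσ hv (transfer hσ k p f)
      = transfer hσ k p (mulL2 (hv.memLp_diff hσ p.1 p.2) f) := by
  rw [transfer_apply, transfer_apply, map_smul, potOp_single,
    mulL2_shiftL2 hσ (hv.memLp_diff hσ p.1 p.2) _ (-p.2) fun a => ?_]
  have h1 : ∀ x, σ x (σ (-p.2) a) = σ (x - p.2) a := fun x => by
    rw [sub_eq_add_neg, ← hσ.comp]; rfl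
  rw [h1, h1, sub_self]

end TransferDynamics

end MarkovAnderson

end

/-! ### The autonomous equation at a fixed wave number -/

noncomputable section

namespace MarkovAnderson

section Field

variable {d : ℕ} {Ω : Type*} [TopologicalSpace Ω] [MeasurableSpace Ω] {μ : Measure Ω}
  {σ : Lattice d → Ω → Ω} {P : Kernel Ω (RCPath Ω)}
  {hσ : IsShiftAction μ σ} {hP : IsMarkovFamily μ σ P} {v₀ : Ω → ℝ}
  {F : Lattice d → ℝ × RCPath Ω → ℝ} {M : ℝ} {h : Lattice d → ℂ} {ψ₀ : Lattice d → ℂ} {ν C : ℝ}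

namespace IsModel

theorem summable_phase (hm : IsModel hσ hP v₀ F h ψ₀ ν M C) {k : Fin d → ℂ}
    (hk : (d + 1) * ‖k‖ ≤ ν / 2) :
    Summable fun ζ => ‖h ζ * Complex.exp (-(Complex.I * dot k ζ))‖ := by
  refine Summable.of_nonneg_of_le (fun _ => norm_nonneg _) (fun ζ => ?_) hm.bounded.summable
  rw [norm_mul, mul_comm]
  gcongr
  have h1 := norm_exp_I_dot_le k (-ζ)
  rw [dot_neg, mul_neg, latticeNorm_neg] at h1
  refine h1.trans (Real.exp_le_exp.2 (mul_le_mul_of_nonneg_right ?_ (latticeNorm_nonneg _)))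
  linarith [hm.bounded.nu_pos]

variable [IsProbabilityMeasure μ] [IsMarkovKernel P]

/-- The Fourier transform of the correlations at the wave number `k`. -/
def field (hm : IsModel hσ hP v₀ F h ψ₀ ν M C) (k : Fin d → ℂ) (t : ℝ) :
    EllTwoSum (Lattice d) (Lp ℂ 2 μ) :=
  ∑' p : Lattice d × Lattice d, transfer hσ k p (hm.corr p.1 p.2 t)

theorem norm_transfer_corr_le (hm : IsModel hσ hP v₀ F h ψ₀ ν M C) {k : Fin d → ℂ}
    (hk : (d + 1) * ‖k‖ ≤ ν / 2) {t τ : ℝ} (ht : 0 ≤ t) (htτ : t ≤ τ)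
    (p : Lattice d × Lattice d) : ‖transfer hσ k p (hm.corr p.1 p.2 t)‖
      ≤ ampBound h ν M C τ ^ 2 * (weight ν p.1 * weight (ν / 2) p.2) :=
  norm_transfer_le hσ hk p (sq_nonneg _) (hm.norm_corr_le p.1 p.2 ht htτ)

theorem summable_norm_field (hm : IsModel hσ hP v₀ F h ψ₀ ν M C) {k : Fin d → ℂ}
    (hk : (d + 1) * ‖k‖ ≤ ν / 2) {t : ℝ} (ht : 0 ≤ t) :
    Summable fun p : Lattice d × Lattice d => ‖transfer hσ k p (hm.corr p.1 p.2 t)‖ :=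
  Summable.of_nonneg_of_le (fun _ => norm_nonneg _) (hm.norm_transfer_corr_le hk ht le_rfl)
    ((summable_weight_mul hm.bounded.nu_pos).mul_left _)

theorem hasSum_field (hm : IsModel hσ hP v₀ F h ψ₀ ν M C) {k : Fin d → ℂ}
    (hk : (d + 1) * ‖k‖ ≤ ν / 2) {t : ℝ} (ht : 0 ≤ t) :
    HasSum (fun p : Lattice d × Lattice d => transfer hσ k p (hm.corr p.1 p.2 t))
      (hm.field k t) :=
  (hm.summable_norm_field hk ht).of_norm.hasSum

theorem norm_field_le (hm : IsModel hσ hP v₀ F h ψ₀ ν M C) {k : Fin d → ℂ}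
    (hk : (d + 1) * ‖k‖ ≤ ν / 2) {t : ℝ} (ht : 0 ≤ t) : ‖hm.field k t‖
      ≤ ampBound h ν M C t ^ 2
        * ∑' p : Lattice d × Lattice d, weight ν p.1 * weight (ν / 2) p.2 :=
  tsum_of_norm_bounded ((summable_weight_mul hm.bounded.nu_pos).hasSum.mul_left _)
    (hm.norm_transfer_corr_le hk ht le_rfl)

theorem continuous_field [BorelSpace Ω] {e : Lp ℂ 2 μ} {T : ℝ} (hS : IsGapped (semigroup hP) e T)
    (hm : IsModel hσ hP v₀ F h ψ₀ ν M C) {k : Fin d → ℂ} (hk : (d + 1) * ‖k‖ ≤ ν / 2) :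
    Continuous (hm.field k) := by
  have h1 : ∀ τ, ContinuousOn (hm.field k) (Set.Icc 0 τ) := by
    intro τ
    have hc : ∀ p : Lattice d × Lattice d,
        ContinuousOn (fun t => transfer hσ k p (hm.corr p.1 p.2 t)) (Set.Icc 0 τ) := by
      intro p
      refine (transfer hσ k p).continuous.comp_continuousOn ?_
      have hw1 := weight_pos ν p.1
      have hw2 := weight_pos ν p.2
      have hl := hm.lam_nonneg
      refine hS.continuousOn_of_norm_sub_le
        (K := 2 * ampBound h ν M C τ ^ 2 * (expMoment h ν + M) * (weight ν p.1 * weight ν p.2))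
        (by positivity) fun s t hs hst ht => ?_
      have := hm.norm_corr_sub_le p.1 p.2 hs (sub_nonneg.2 hst) (τ := τ) (by linarith)
      rwa [add_sub_cancel] at this
    have h0 := continuousOn_tsum hc ((summable_weight_mul hm.bounded.nu_pos).mul_left
      (ampBound h ν M C τ ^ 2)) fun p t ht => hm.norm_transfer_corr_le hk ht.1 ht.2 p
    exact h0
  have h2 : ContinuousOn (hm.field k) (Set.Ici 0) := by
    intro t ht
    refine (h1 (t + 1) t ⟨ht, by linarith⟩).mono_of_mem_nhdsWithin ?_
    rw [← Set.Ici_inter_Iic]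
    exact inter_mem self_mem_nhdsWithin
      (mem_nhdsWithin_of_mem_nhds (Iic_mem_nhds (by linarith)))
  have h3 : hm.field k = fun t => hm.field k (max t 0) := by
    funext t
    simp only [field, hm.corr_max]
  rw [h3]
  exact h2.comp_continuous (continuous_id.max continuous_const) fun t => Set.mem_Ici.2 (le_max_right _ _)

theorem hasSum_transfer_hop_left (hm : IsModel hσ hP v₀ F h ψ₀ ν M C) (hh : IsHoppingKernel h)
    {k : Fin d → ℂ} (hk : (d + 1) * ‖k‖ ≤ ν / 2) {t : ℝ} (ht : 0 ≤ t) :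
    HasSum (fun p : Lattice d × Lattice d =>
      transfer hσ k p (∑' z, h (p.1 - z) • hm.corr z p.2 t))
      (convOp (translate μ) h (hm.field k t)) := by
  let e : (Lattice d × Lattice d) × Lattice d ≃ Lattice d × (Lattice d × Lattice d) :=
    { toFun := fun q => (q.1.1 - q.2, (q.2, q.1.2))
      invFun := fun q => ((q.2.1 + q.1, q.2.2), q.2.1)
      left_inv := fun q => by simp
      right_inv := fun q => by simp }
  refine hasSum_convOp_rearrange norm_translate_le hh.summable_norm (hm.summable_norm_field hk ht) e
    fun p => ?_
  have h1 := (hm.summable_hop_corr p.1 p.2 ht).1.of_norm.hasSum.mapL (transfer hσ k p)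
  refine h1.congr_fun fun z => ?_
  show h (p.1 - z) • translate μ (p.1 - z) (transfer hσ k (z, p.2) (hm.corr z p.2 t)) = _
  rw [translate_transfer, add_sub_cancel, map_smul]

theorem hasSum_transfer_hop_right (hm : IsModel hσ hP v₀ F h ψ₀ ν M C) (hh : IsHoppingKernel h)
    {k : Fin d → ℂ} (hk : (d + 1) * ‖k‖ ≤ ν / 2) {t : ℝ} (ht : 0 ≤ t) :
    HasSum (fun p : Lattice d × Lattice d =>
      transfer hσ k p (∑' z, (starRingEnd ℂ) (h (p.2 - z)) • hm.corr p.1 z t))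
      (convOp (shiftTranslate hσ) (fun ζ => h ζ * Complex.exp (-(Complex.I * dot k ζ)))
        (hm.field k t)) := by
  let e : (Lattice d × Lattice d) × Lattice d ≃ Lattice d × (Lattice d × Lattice d) :=
    { toFun := fun q => (q.2 - q.1.2, (q.1.1, q.2))
      invFun := fun q => ((q.2.1, q.2.2 - q.1), q.2.2)
      left_inv := fun q => by simp
      right_inv := fun q => by simp }
  refine hasSum_convOp_rearrange (norm_shiftTranslate_le hσ) (hm.summable_phase hk)
    (hm.summable_norm_field hk ht) e fun p => ?_
  have h1 := (hm.summable_hop_corr p.1 p.2 ht).2.of_norm.hasSum.mapL (transfer hσ k p)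
  refine h1.congr_fun fun z => ?_
  show (h (z - p.2) * Complex.exp (-(Complex.I * dot k (z - p.2)))) •
    shiftTranslate hσ (z - p.2) (transfer hσ k (p.1, z) (hm.corr p.1 z t)) = _
  -- By self-adjointness `conj h(y - z) = h(z - y)`, so hopping of the second site is again a
  -- convolution with `h`.
  rw [mul_smul, shiftTranslate_transfer, sub_sub_cancel, map_smul, hh.selfAdjoint, neg_sub]
  rfl

/-- The Fourier transformed correlations solve an autonomous equation. -/
theorem tendsto_field [BorelSpace Ω] (hm : IsModel hσ hP v₀ F h ψ₀ ν M C) (hh : IsHoppingKernel h)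
    {k : Fin d → ℂ} (hk : (d + 1) * ‖k‖ ≤ ν / 2) {t : ℝ} (ht : 0 ≤ t) :
    Tendsto (fun δ : ℝ => δ⁻¹ • (hm.field k (t + δ)
        - diagOp (Lattice d) (semigroup hP δ) (hm.field k t))) (𝓝[>] 0)
      (𝓝 (-(Complex.I • (symmOp hσ hm.potential h (hm.field k t)
        + convOp (shiftTranslate hσ) (phaseCoeff h k) (hm.field k t))))) := by
  have hsum : HasSum (fun p : Lattice d × Lattice d =>
      transfer hσ k p (condL2 hP t.toNNReal (hm.pairVelL2 p.1 p.2 ht)))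
      (-(Complex.I • (symmOp hσ hm.potential h (hm.field k t)
        + convOp (shiftTranslate hσ) (phaseCoeff h k) (hm.field k t)))) := by
    have h1 := hm.hasSum_transfer_hop_left hh hk ht
    have h2 := hm.hasSum_transfer_hop_right hh hk ht
    have h3 := (hm.hasSum_field hk ht).mapL (potOp hσ hm.potential)
    have h4 := (((h1.sub h2).add h3).const_smul Complex.I).neg
    -- Adding the perturbation replaces the untwisted hopping inside `symmOp` by the one with
    -- phases.
    have h5 : phaseCoeff h k = fun ζ => h ζ - h ζ * Complex.exp (-(Complex.I * dot k ζ)) := by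
      funext ζ
      rw [phaseCoeff]; ring
    rw [h5, convOp_sub (norm_shiftTranslate_le hσ) hh.summable_norm (hm.summable_phase hk),
      sub_apply, symmOp_apply]
    have h6 : ∀ a b c w : EllTwoSum (Lattice d) (Lp ℂ 2 μ), a - b + c + (b - w) = a - w + c := by
      intros; abel
    rw [h6]
    refine h4.congr_fun fun p => ?_
    rw [hm.condL2_pairVelL2 p.1 p.2 ht, potOp_transfer, map_neg, map_smul, map_add, map_sub]
  rw [← hsum.tsum_eq]
  have hlim : Tendsto (fun δ : ℝ => ∑' p : Lattice d × Lattice d, transfer hσ k p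
      (δ⁻¹ • (hm.corr p.1 p.2 (t + δ) - semigroup hP δ (hm.corr p.1 p.2 t)))) (𝓝[>] 0)
      (𝓝 (∑' p : Lattice d × Lattice d,
        transfer hσ k p (condL2 hP t.toNNReal (hm.pairVelL2 p.1 p.2 ht)))) := by
    refine tendsto_tsum_of_dominated_convergence (bound := fun p =>
      2 * ampBound h ν M C (t + 1) ^ 2 * (expMoment h ν + M)
        * (weight ν p.1 * weight (ν / 2) p.2))
      ((summable_weight_mul hm.bounded.nu_pos).mul_left _) (fun p => ?_) ?_
    · exact ((transfer hσ k p).continuous.tendsto _).comp (hm.tendsto_corr p.1 p.2 ht)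
    · filter_upwards [Ioo_mem_nhdsGT (zero_lt_one (α := ℝ))] with δ hδ p
      have hl := hm.lam_nonneg
      refine norm_transfer_le hσ hk p (by positivity) ?_
      rw [norm_smul, Real.norm_of_nonneg (inv_nonneg.2 hδ.1.le), inv_mul_le_iff₀ hδ.1, mul_comm δ]
      exact hm.norm_corr_sub_le p.1 p.2 ht hδ.1.le (by linarith [hδ.2])
  refine hlim.congr' ?_
  filter_upwards [self_mem_nhdsWithin] with δ hδ
  have hδ0 : 0 < δ := hδ
  have h1 := (((hm.hasSum_field hk (add_nonneg ht hδ0.le)).sub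
    ((hm.hasSum_field hk ht).mapL (diagOp (Lattice d) (semigroup hP δ)))).const_smul δ⁻¹).tsum_eq
  rw [← h1]
  refine tsum_congr fun p => ?_
  rw [diagOp_transfer, ContinuousLinearMap.map_smul_of_tower, map_sub]

end IsModel

end Field

end MarkovAnderson

end

noncomputable section

namespace MarkovAnderson

/-! ### The characteristic function -/

section CharacteristicFunction

variable {d : ℕ} {Ω : Type*} [TopologicalSpace Ω] [MeasurableSpace Ω] {μ : Measure Ω}
  {σ : Lattice d → Ω → Ω} {P : Kernel Ω (RCPath Ω)}
  {hσ : IsShiftAction μ σ} {hP : IsMarkovFamily μ σ P} {v₀ : Ω → ℝ}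
  {F : Lattice d → ℝ × RCPath Ω → ℝ} {M : ℝ} {h : Lattice d → ℂ} {ψ₀ : EllTwo d} {ν C : ℝ}

namespace IsModel

variable [IsProbabilityMeasure μ] [IsMarkovKernel P]

theorem ae_existsUnique (hm : IsModel hσ hP v₀ F h ψ₀ ν M C) : ∀ᵐ ω ∂(jointLaw μ P),
    ∃! ψ : ℝ≥0 → EllTwo d, IsSolution h (pathPotential σ v₀ ω) ψ₀ ψ := by
  filter_upwards [hm.version.ae_solution hm.bounded] with ω hω
  exact ⟨_, hω.1, hω.2⟩

theorem ae_solution_eq (hm : IsModel hσ hP v₀ F h ψ₀ ν M C) : ∀ᵐ ω ∂(jointLaw μ P),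
    ∀ (t : ℝ≥0) x, solution h (pathPotential σ v₀ ω) ψ₀ t x = dysonSum h F ψ₀ x (t, ω) := by
  filter_upwards [hm.version.ae_solution hm.bounded] with ω hω t x
  rw [solution_eq hω.1 hω.2]
  rfl

theorem integrable_norm_solution_sq (hm : IsModel hσ hP v₀ F h ψ₀ ν M C) (t : ℝ≥0)
    (x : Lattice d) : Integrable (fun ω => ‖solution h (pathPotential σ v₀ ω) ψ₀ t x‖ ^ 2)
      (jointLaw μ P) := by
  have h1 : Integrable (fun ω => ‖dysonSum h F ψ₀ x (t, ω)‖ ^ 2) (jointLaw μ P) := by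
    refine Integrable.of_bound ((hm.stronglyMeasurable_amp t x).norm.pow 2).aestronglyMeasurable
      ((ampBound h ν M C t * weight ν x) ^ 2) (Eventually.of_forall fun ω => ?_)
    rw [Real.norm_of_nonneg (by positivity)]
    exact pow_le_pow_left₀ (norm_nonneg _) (hm.norm_amp_le t.coe_nonneg le_rfl ω x) 2
  refine h1.congr ?_
  filter_upwards [hm.ae_solution_eq] with ω hω
  rw [hω]

theorem inner_oneL2_corr (hm : IsModel hσ hP v₀ F h ψ₀ ν M C) (t : ℝ≥0) (x : Lattice d) :
    inner ℂ (oneL2 μ) (hm.corr x x t) = (meanSq μ σ P h v₀ ψ₀ t x : ℂ) := by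
  rw [hm.corr_eq x x t.coe_nonneg, inner_condL2, evalL2_oneL2, inner_oneL2, meanSq,
    ← integral_complex_ofReal]
  refine integral_congr_ae ?_
  filter_upwards [(hm.memLp_pairFn t.coe_nonneg x x).coeFn_toLp, hm.ae_solution_eq] with ω h1 h2
  rw [pairL2, h1, h2, pairFn, Complex.mul_conj, Complex.normSq_eq_norm_sq]

/-- The vector `δ₀ ⊗ 1` selects the pairs with `x = y`, and integrating against `1` removes the
shift because `μ` is invariant. -/
theorem hasSum_cfTerm (hm : IsModel hσ hP v₀ F h ψ₀ ν M C) {k : Fin d → ℂ}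
    (hk : (d + 1) * ‖k‖ ≤ ν / 2) (t : ℝ≥0) :
    HasSum (cfTerm μ σ P h v₀ ψ₀ t k) (inner ℂ (ground d μ) (hm.field k t)) := by
  have h1 := (hm.hasSum_field hk t.coe_nonneg).mapL (innerSL ℂ (ground d μ))
  have hinj : Function.Injective fun x : Lattice d => (x, x) := fun x y hxy => (Prod.mk.inj hxy).1
  have h2 := (hinj.hasSum_iff fun p hp => ?_).2 h1
  · refine h2.congr_fun fun x => ?_
    rw [Function.comp, innerSL_apply_apply, inner_ground_transfer, if_pos rfl, hm.inner_oneL2_corr]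
    rfl
  · rw [innerSL_apply_apply, inner_ground_transfer, if_neg]
    intro hp'
    exact hp ⟨p.1, Prod.ext rfl hp'⟩

theorem charFn_eq (hm : IsModel hσ hP v₀ F h ψ₀ ν M C) {k : Fin d → ℂ}
    (hk : (d + 1) * ‖k‖ ≤ ν / 2) (t : ℝ≥0) :
    charFn μ σ P h v₀ ψ₀ t k = inner ℂ (ground d μ) (hm.field k t) :=
  (hm.hasSum_cfTerm hk t).tsum_eq

theorem meanSq_zero (hm : IsModel hσ hP v₀ F h ψ₀ ν M C) (x : Lattice d) :
    meanSq μ σ P h v₀ ψ₀ 0 x = ‖ψ₀ x‖ ^ 2 := by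
  have h1 : ∀ᵐ ω ∂(jointLaw μ P), ‖solution h (pathPotential σ v₀ ω) ψ₀ 0 x‖ ^ 2
      = ‖ψ₀ x‖ ^ 2 := by
    filter_upwards [hm.version.ae_solution hm.bounded] with ω hω
    rw [solution_eq hω.1 hω.2, hω.1.integral_eq 0 x]
    simp
  rw [meanSq, integral_congr_ae h1, integral_const, probReal_univ, one_smul]

/-- At time zero the density is `|ψ₀|²` and `e^{ik·x} - 1` is of order `|k||x|e^{ν|x|/2}`. Of the
two weights in `|ψ₀(x)|²` one absorbs this growth in `x` and the other makes the sum converge. -/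
theorem norm_charFn_zero_sub_le (hm : IsModel hσ hP v₀ F h ψ₀ ν M C) {k : Fin d → ℂ}
    (hk : (d + 1) * ‖k‖ ≤ ν / 2) :
    ‖charFn μ σ P h v₀ ψ₀ 0 k - ((‖ψ₀‖ ^ 2 : ℝ) : ℂ)‖
      ≤ C ^ 2 * (2 / ν) * (∑' x : Lattice d, weight ν x) * ((d + 1) * ‖k‖) := by
  have hν := hm.bounded.nu_pos
  have h1 := (hm.hasSum_cfTerm hk 0).sub (Complex.hasSum_ofReal.2 (hasSum_norm_sq ψ₀))
  rw [← hm.charFn_eq hk 0] at h1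
  have hs : Summable fun x : Lattice d => weight ν x := summable_exp_neg_latticeNorm hν
  have h2 : HasSum (fun x : Lattice d => C ^ 2 * (2 / ν) * ((d + 1) * ‖k‖) * weight ν x)
      (C ^ 2 * (2 / ν) * (∑' x : Lattice d, weight ν x) * ((d + 1) * ‖k‖)) := by
    rw [mul_right_comm (C ^ 2 * (2 / ν))]
    exact hs.hasSum.mul_left _
  rw [← h1.tsum_eq]
  refine tsum_of_norm_bounded h2 fun x => ?_
  have hr := latticeNorm_nonneg x
  have hw := weight_pos ν x
  have e1 : cfTerm μ σ P h v₀ ψ₀ 0 k x - ((‖ψ₀ x‖ ^ 2 : ℝ) : ℂ)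
      = -(1 - Complex.exp (-(-(Complex.I * dot k x)))) * ((‖ψ₀ x‖ ^ 2 : ℝ) : ℂ) := by
    rw [cfTerm, hm.meanSq_zero, neg_neg, dot]; ring
  rw [e1, norm_mul, norm_neg, Complex.norm_real, Real.norm_of_nonneg (by positivity)]
  have h3 := norm_one_sub_exp_neg_le (-(Complex.I * dot k x))
  rw [norm_neg] at h3
  have h4 := norm_I_mul_dot_le k x
  have h5 : latticeNorm x ≤ 2 / ν * Real.exp (ν / 2 * latticeNorm x) := by
    rw [div_mul_eq_mul_div, le_div_iff₀ hν]
    linarith [Real.add_one_le_exp (ν / 2 * latticeNorm x)]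
  have h6 : Real.exp ‖Complex.I * dot k x‖ ≤ Real.exp (ν / 2 * latticeNorm x) :=
    Real.exp_le_exp.2 (h4.trans (by gcongr))
  have h7 : Real.exp (ν / 2 * latticeNorm x) * Real.exp (ν / 2 * latticeNorm x) * weight ν x
      = 1 := by
    rw [weight, ← Real.exp_add, ← Real.exp_add, ← Real.exp_zero]
    congr 1; ring
  have h8 : ‖ψ₀ x‖ ≤ C * weight ν x := hm.bounded.initial x
  calc ‖1 - Complex.exp (-(-(Complex.I * dot k x)))‖ * ‖ψ₀ x‖ ^ 2
      ≤ (((d + 1) * ‖k‖ * (2 / ν * Real.exp (ν / 2 * latticeNorm x)))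
          * Real.exp (ν / 2 * latticeNorm x)) * (C * weight ν x) ^ 2 := by
        gcongr
        refine h3.trans ?_
        gcongr
        exact h4.trans (by gcongr)
    _ = C ^ 2 * (2 / ν) * ((d + 1) * ‖k‖) * weight ν x
        * (Real.exp (ν / 2 * latticeNorm x) * Real.exp (ν / 2 * latticeNorm x) * weight ν x) := by
        ring
    _ = _ := by rw [h7, mul_one]

end IsModel

end CharacteristicFunction

/-! ### Diffusive scaling -/

section Scaling

variable {d : ℕ}

/-- For small wave numbers, `χ_t(k)` is approximated by `N e^{-t k·Lk}` on the diffusive scale. -/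
structure IsDiffusive (χ : ℝ≥0 → (Fin d → ℂ) → ℂ) (L : Matrix (Fin d) (Fin d) ℂ) (N : ℂ)
    (C κ₁ : ℝ) : Prop where
  C_nonneg : 0 ≤ C
  pos : 0 < κ₁
  amplitude : ∀ k, (d + 1) * ‖k‖ ≤ κ₁ → ∀ t : ℝ≥0,
    ‖χ t k - Complex.exp (-bilin L k * (t : ℝ)) * χ 0 k‖
      ≤ C * Real.exp (C * ((d + 1) * ‖k‖) ^ 2 * t)
        * ((d + 1) * ‖k‖ + ((d + 1) * ‖k‖) ^ 3 * t)
  initial : ∀ k, (d + 1) * ‖k‖ ≤ κ₁ → ‖χ 0 k - N‖ ≤ C * ((d + 1) * ‖k‖)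

theorem bilin_smul (L : Matrix (Fin d) (Fin d) ℂ) (c : ℂ) (z : Fin d → ℂ) :
    bilin L (c • z) = c ^ 2 * bilin L z := by
  unfold bilin
  rw [Finset.mul_sum]
  refine Finset.sum_congr rfl fun i _ => ?_
  rw [Finset.mul_sum]
  refine Finset.sum_congr rfl fun j _ => ?_
  simp only [Pi.smul_apply, smul_eq_mul]
  ring

theorem norm_bilin_le (L : Matrix (Fin d) (Fin d) ℂ) {z : Fin d → ℂ} {r : ℝ} (hz : ‖z‖ ≤ r) :
    ‖bilin L z‖ ≤ r ^ 2 * ∑ i, ∑ j, ‖L i j‖ := by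
  unfold bilin
  rw [Finset.mul_sum]
  refine norm_sum_le_of_le _ fun i _ => ?_
  rw [Finset.mul_sum]
  refine norm_sum_le_of_le _ fun j _ => ?_
  have hr := (norm_nonneg z).trans hz
  rw [norm_mul, norm_mul, sq]
  gcongr
  · exact (norm_le_pi_norm z i).trans hz
  · exact (norm_le_pi_norm z j).trans hz

theorem norm_sqrt_inv_smul {τ : ℝ≥0} (z : Fin d → ℂ) :
    ‖((Real.sqrt τ : ℝ) : ℂ)⁻¹ • z‖ = (Real.sqrt τ)⁻¹ * ‖z‖ := by
  rw [norm_smul, norm_inv, Complex.norm_real, Real.norm_of_nonneg (Real.sqrt_nonneg _)]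

theorem tendsto_div_sqrt (E : ℝ) : Tendsto (fun τ : ℝ≥0 => E * (Real.sqrt τ)⁻¹) atTop (𝓝 0) := by
  have h1 : Tendsto (fun τ : ℝ≥0 => Real.sqrt τ) atTop atTop :=
    Real.tendsto_sqrt_atTop.comp (NNReal.tendsto_coe_atTop.2 tendsto_id)
  simpa using h1.inv_tendsto_atTop.const_mul E

theorem eventually_small {K : Set (Fin d → ℂ)} (hK : IsCompact K) {κ : ℝ} (hκ : 0 < κ) :
    ∀ᶠ τ : ℝ≥0 in atTop, ∀ z ∈ K, (d + 1) * ‖((Real.sqrt τ : ℝ) : ℂ)⁻¹ • z‖ ≤ κ := by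
  obtain ⟨r, hr⟩ := hK.isBounded.exists_norm_le
  filter_upwards [(tendsto_div_sqrt ((d + 1) * r)).eventually (gt_mem_nhds hκ)] with τ hτ z hz
  rw [norm_sqrt_inv_smul]
  refine le_trans ?_ hτ.le
  rw [mul_assoc, mul_comm r]
  have := hr z hz
  gcongr

theorem IsDiffusive.tendstoUniformlyOn {χ : ℝ≥0 → (Fin d → ℂ) → ℂ}
    {L : Matrix (Fin d) (Fin d) ℂ} {N : ℂ} {C κ₁ : ℝ} (hχ : IsDiffusive χ L N C κ₁) (t : ℝ≥0)
    {K : Set (Fin d → ℂ)} (hK : IsCompact K) :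
    TendstoUniformlyOn
      (fun (τ : ℝ≥0) (z : Fin d → ℂ) => χ (τ * t) (((Real.sqrt τ : ℝ) : ℂ)⁻¹ • z))
      (fun z => N * Complex.exp (-((t : ℝ) : ℂ) * bilin L z)) atTop K := by
  obtain ⟨r', hr'⟩ := hK.isBounded.exists_norm_le
  set r := max r' 0 with hrdef
  have hr : ∀ z ∈ K, ‖z‖ ≤ r := fun z hz => (hr' z hz).trans (le_max_left _ _)
  have hr0 : 0 ≤ r := le_max_right _ _
  have hC := hχ.C_nonneg
  set ρ : ℝ := (d + 1) * r with hρ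
  have hρ0 : 0 ≤ ρ := by positivity
  set B : ℝ := r ^ 2 * ∑ i, ∑ j, ‖L i j‖ with hB
  -- With `κ ≤ ρτ^{-1/2}` the product `κ²τt` stays bounded by `ρ²t`, while `κ + κ³τt` is of order
  -- `τ^{-1/2}`. Hence all errors are at most `E τ^{-1/2}`, uniformly on the compact set.
  set E : ℝ := C * Real.exp (C * ρ ^ 2 * t) * (ρ + ρ ^ 3 * t) + Real.exp (t * B) * (C * ρ) with hE
  refine Metric.tendstoUniformlyOn_iff.2 fun ε hε => ?_
  filter_upwards [eventually_small hK hχ.pos, eventually_gt_atTop 0,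
    (tendsto_div_sqrt E).eventually (gt_mem_nhds hε)] with τ hτ hτ0 hτE z hz
  refine lt_of_le_of_lt ?_ hτE
  have hτ0' : (0 : ℝ) < τ := NNReal.coe_pos.2 hτ0
  have hs0 : 0 < Real.sqrt τ := Real.sqrt_pos.2 hτ0'
  set s := Real.sqrt τ with hs
  have hss : s ^ 2 = τ := Real.sq_sqrt hτ0'.le
  set k : Fin d → ℂ := ((s : ℝ) : ℂ)⁻¹ • z with hk
  set κ : ℝ := (d + 1) * ‖k‖ with hκ
  have hκ0 : 0 ≤ κ := by positivity
  have hκρ : κ ≤ ρ * s⁻¹ := by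
    rw [hκ, hk, hs, norm_sqrt_inv_smul, ← hs, hρ, mul_assoc, mul_comm r]
    have := hr z hz
    gcongr
  have h1 := hχ.amplitude k (hτ z hz) (τ * t)
  have h2 := hχ.initial k (hτ z hz)
  have e1 : -bilin L k * (((τ * t : ℝ≥0) : ℝ) : ℂ) = -((t : ℝ) : ℂ) * bilin L z := by
    rw [hk, bilin_smul, NNReal.coe_mul, ← hss]
    have : (s : ℂ) ≠ 0 := Complex.ofReal_ne_zero.2 hs0.ne'
    push_cast
    field_simp
  rw [e1] at h1
  have h3 : ‖Complex.exp (-((t : ℝ) : ℂ) * bilin L z)‖ ≤ Real.exp (t * B) := by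
    rw [Complex.norm_exp]
    apply Real.exp_le_exp.2
    refine (Complex.re_le_norm _).trans ?_
    rw [norm_mul, norm_neg, Complex.norm_real, Real.norm_of_nonneg t.coe_nonneg]
    exact mul_le_mul_of_nonneg_left (norm_bilin_le L (hr z hz)) t.coe_nonneg
  have h4 : κ ^ 2 * (τ * t) ≤ ρ ^ 2 * t := by
    calc κ ^ 2 * (τ * t) ≤ (ρ * s⁻¹) ^ 2 * (τ * t) := by gcongr
      _ = ρ ^ 2 * t := by rw [← hss]; field_simp
  have h5 : κ + κ ^ 3 * (τ * t) ≤ (ρ + ρ ^ 3 * t) * s⁻¹ := by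
    calc κ + κ ^ 3 * (τ * t) = κ + κ * (κ ^ 2 * (τ * t)) := by ring
      _ ≤ ρ * s⁻¹ + (ρ * s⁻¹) * (ρ ^ 2 * t) := by gcongr
      _ = _ := by ring
  have h6 : ‖χ (τ * t) k - Complex.exp (-((t : ℝ) : ℂ) * bilin L z) * χ 0 k‖
      ≤ C * Real.exp (C * ρ ^ 2 * t) * ((ρ + ρ ^ 3 * t) * s⁻¹) := by
    refine h1.trans ?_
    rw [NNReal.coe_mul]
    have h7 : C * κ ^ 2 * (τ * t) ≤ C * ρ ^ 2 * t := by
      rw [mul_assoc, mul_assoc]; gcongr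
    gcongr
  rw [dist_comm, dist_eq_norm]
  have e2 : χ (τ * t) k - N * Complex.exp (-((t : ℝ) : ℂ) * bilin L z)
      = (χ (τ * t) k - Complex.exp (-((t : ℝ) : ℂ) * bilin L z) * χ 0 k)
        + Complex.exp (-((t : ℝ) : ℂ) * bilin L z) * (χ 0 k - N) := by ring
  rw [e2]
  calc _ ≤ C * Real.exp (C * ρ ^ 2 * t) * ((ρ + ρ ^ 3 * t) * s⁻¹)
        + Real.exp (t * B) * (C * (ρ * s⁻¹)) := by
        refine (norm_add_le _ _).trans (add_le_add h6 ?_)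
        rw [norm_mul]
        gcongr
        exact h2.trans (by gcongr)
    _ = E * s⁻¹ := by rw [hE]; ring

end Scaling

end MarkovAnderson

end

/-! ### Reality and positivity of the diffusion matrix -/

noncomputable section

namespace MarkovAnderson

section RealForm

variable {d : ℕ}

theorem bilin_eq_dotProduct (L : Matrix (Fin d) (Fin d) ℂ) (z : Fin d → ℂ) :
    bilin L z = z ⬝ᵥ L.mulVec z := by
  simp only [bilin, dotProduct, Matrix.mulVec, Finset.mul_sum]
  exact Finset.sum_congr rfl fun i _ => Finset.sum_congr rfl fun j _ => by ring

/-- If `e^{-t w}` is real for all `t > 0`, then `w` is real. -/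
theorem im_eq_zero_of_exp {w : ℂ}
    (hw : ∀ t : ℝ≥0, 0 < t → (Complex.exp (-((t : ℝ) : ℂ) * w)).im = 0) : w.im = 0 := by
  by_contra hne
  have habs : 0 < |w.im| := abs_pos.2 hne
  -- At this time the phase of `e^{-tw}` is `±π/2`, so its imaginary part cannot vanish.
  set t : ℝ := Real.pi / 2 / |w.im| with ht
  have ht0 : 0 < t := by positivity
  have h1 := hw t.toNNReal (Real.toNNReal_pos.2 ht0)
  rw [Complex.exp_im, Real.coe_toNNReal t ht0.le] at h1
  have h2 := (mul_eq_zero.1 h1).resolve_left (Real.exp_pos _).ne'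
  have h3 : (-(t : ℂ) * w).im = -(t * w.im) := by
    rw [← Complex.ofReal_neg, Complex.im_ofReal_mul, neg_mul]
  rw [h3, Real.sin_neg, neg_eq_zero] at h2
  rcases lt_or_gt_of_ne hne with h4 | h4
  · have : t * w.im = -(Real.pi / 2) := by
      rw [ht, abs_of_neg h4]; field_simp
    rw [this, Real.sin_neg, Real.sin_pi_div_two] at h2
    norm_num at h2
  · have : t * w.im = Real.pi / 2 := by
      rw [ht, abs_of_pos h4]; field_simp
    rw [this, Real.sin_pi_div_two] at h2
    norm_num at h2

/-- For real `k` the symmetry makes the limit at `-k` the conjugate of the limit at `k`. The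
quadratic form is even, so both limits are the same `e^{-t k·Lk}`, which is therefore real for all
`t`. -/
theorem IsDiffusive.im_bilin_eq_zero {χ : ℝ≥0 → (Fin d → ℂ) → ℂ} {L : Matrix (Fin d) (Fin d) ℂ}
    {C κ₁ : ℝ} (hχ : IsDiffusive χ L 1 C κ₁)
    (hsymm : ∀ t z, χ t (fun i => -(starRingEnd ℂ) (z i)) = (starRingEnd ℂ) (χ t z))
    (k : Fin d → ℝ) : (bilin L fun i => (k i : ℂ)).im = 0 := by
  refine im_eq_zero_of_exp fun t _ => ?_
  set z : Fin d → ℂ := fun i => (k i : ℂ) with hz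
  have h1 := (hχ.tendstoUniformlyOn t (isCompact_singleton (x := z))).tendsto_at
    (Set.mem_singleton z)
  have h2 := (hχ.tendstoUniformlyOn t (isCompact_singleton (x := -z))).tendsto_at
    (Set.mem_singleton (-z))
  have h3 := (Complex.continuous_conj.tendsto _).comp h1
  have h4 : bilin L (-z) = bilin L z := by
    have := bilin_smul L (-1) z
    rwa [neg_one_smul, neg_one_sq, one_mul] at this
  rw [h4, one_mul] at h2
  rw [one_mul] at h3
  refine Complex.conj_eq_iff_im.1 (tendsto_nhds_unique (h3.congr fun τ => ?_) h2)
  simp only [Function.comp]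
  rw [← hsymm]
  congr 1
  funext i
  simp [hz]

/-- Polarization with the vectors `e_i`, `e_j` and `e_i + e_j`. The antisymmetric part of `L` does
not enter the form and need not be real. -/
theorem symm_part_im_eq_zero {L : Matrix (Fin d) (Fin d) ℂ}
    (hL : ∀ k : Fin d → ℝ, (bilin L fun i => (k i : ℂ)).im = 0) (i j : Fin d) :
    (L i j + L j i).im = 0 := by
  have hs : ∀ i : Fin d, (fun l => ((Pi.single i (1 : ℝ) : Fin d → ℝ) l : ℂ)) = Pi.single i 1 := by
    intro i
    funext l
    by_cases hl : l = i
    · subst hl; simp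
    · simp [hl]
  have h1 := hL (Pi.single i 1)
  have h2 := hL (Pi.single j 1)
  have h3 := hL (Pi.single i 1 + Pi.single j 1)
  have e : (fun l => (((Pi.single i 1 + Pi.single j 1 : Fin d → ℝ) l : ℝ) : ℂ))
      = Pi.single i 1 + Pi.single j 1 := by
    rw [← hs i, ← hs j]
    funext l
    simp only [Pi.add_apply, Complex.ofReal_add]
  rw [hs, bilin_eq_dotProduct] at h1 h2
  rw [e, bilin_eq_dotProduct, Matrix.mulVec_add, add_dotProduct, dotProduct_add, dotProduct_add] at h3
  simp only [Matrix.mulVec_single_one, single_one_dotProduct, Matrix.col_apply, Complex.add_im]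
    at h1 h2 h3 ⊢
  linarith

/-- The real symmetric matrix with the quadratic form `2 z·Lz`. -/
def diffusionMatrix (L : Matrix (Fin d) (Fin d) ℂ) : Matrix (Fin d) (Fin d) ℝ :=
  fun i j => (L i j + L j i).re

theorem sum_diffusionMatrix {L : Matrix (Fin d) (Fin d) ℂ}
    (hL : ∀ k : Fin d → ℝ, (bilin L fun i => (k i : ℂ)).im = 0) (z : Fin d → ℂ) :
    ∑ i, ∑ j, z i * (diffusionMatrix L i j : ℂ) * z j = 2 * bilin L z := by
  have h1 : ∀ i j, (diffusionMatrix L i j : ℂ) = L i j + L j i := fun i j =>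
    Complex.ext (by simp [diffusionMatrix]) (by
      rw [Complex.ofReal_im, symm_part_im_eq_zero hL])
  have h2 : ∑ i, ∑ j, z i * z j * L j i = bilin L z := by
    rw [Finset.sum_comm]
    exact Finset.sum_congr rfl fun i _ => Finset.sum_congr rfl fun j _ => by ring
  have h3 : ∑ i, ∑ j, z i * (diffusionMatrix L i j : ℂ) * z j
      = (∑ i, ∑ j, z i * z j * L i j) + ∑ i, ∑ j, z i * z j * L j i := by
    rw [← Finset.sum_add_distrib]
    refine Finset.sum_congr rfl fun i _ => ?_
    rw [← Finset.sum_add_distrib]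
    refine Finset.sum_congr rfl fun j _ => ?_
    rw [h1]; ring
  rw [h3, h2, bilin]; ring

theorem posDef_diffusionMatrix {L : Matrix (Fin d) (Fin d) ℂ}
    (hL : ∀ k : Fin d → ℝ, (bilin L fun i => (k i : ℂ)).im = 0)
    (hpos : ∀ k : Fin d → ℝ, k ≠ 0 → 0 < (bilin L fun i => (k i : ℂ)).re) :
    (diffusionMatrix L).PosDef := by
  refine Matrix.PosDef.of_dotProduct_mulVec_pos ?_ fun k hk => ?_
  · ext i j
    simp [diffusionMatrix, add_comm]
  · have h1 := sum_diffusionMatrix hL fun i => (k i : ℂ)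
    have h2 : star k ⬝ᵥ (diffusionMatrix L).mulVec k
        = ∑ i, ∑ j, k i * diffusionMatrix L i j * k j := by
      simp only [dotProduct, Matrix.mulVec, Finset.mul_sum, star_trivial, mul_assoc]
    have h3 : ((star k ⬝ᵥ (diffusionMatrix L).mulVec k : ℝ) : ℂ)
        = 2 * bilin L fun i => (k i : ℂ) := by
      rw [h2, ← h1]; push_cast; rfl
    have h4 := congrArg Complex.re h3
    rw [Complex.ofReal_re] at h4
    rw [h4]
    have := hpos k hk
    simp only [Complex.mul_re, Complex.re_ofNat, Complex.im_ofNat, zero_mul, sub_zero]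
    linarith

end RealForm

/-! ### Assembly of the diffusive limit -/

section Main

variable {d : ℕ} {Ω : Type*} [TopologicalSpace Ω] [MeasurableSpace Ω] {μ : Measure Ω}
  {σ : Lattice d → Ω → Ω} {P : Kernel Ω (RCPath Ω)} {v₀ : Ω → ℝ} {h : Lattice d → ℂ}

theorem charFn_neg_conj (ψ₀ : EllTwo d) (t : ℝ≥0) (z : Fin d → ℂ) :
    charFn μ σ P h v₀ ψ₀ t (fun i => -(starRingEnd ℂ) (z i))
      = (starRingEnd ℂ) (charFn μ σ P h v₀ ψ₀ t z) := by
  rw [charFn, charFn, Complex.conj_tsum]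
  refine tsum_congr fun x => ?_
  rw [cfTerm, cfTerm, map_mul, Complex.conj_ofReal, ← Complex.exp_conj, map_mul, Complex.conj_I,
    map_sum]
  congr 2
  simp [Finset.sum_neg_distrib]

theorem expDecay_single : ExpDecay (lp.single 2 (0 : Lattice d) (1 : ℂ) : EllTwo d) := by
  refine ⟨1, one_pos, 1, ?_⟩
  rintro _ ⟨x, rfl⟩
  rcases eq_or_ne x 0 with rfl | hx
  · simp [latticeNorm]
  · simp only [lp.single_apply_ne _ _ _ hx, norm_zero, mul_zero, zero_le_one]

variable [BorelSpace Ω] [IsProbabilityMeasure μ] [IsMarkovKernel P]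

/-- The generator does not involve the initial state, so `L` is fixed before `ψ₀`; only the error
constants and the admissible range of `k` depend on it. -/
theorem exists_isDiffusive {hσ : IsShiftAction μ σ} {hP : IsMarkovFamily μ σ P}
    (hB : GapAndSector hP) (hh : IsHoppingKernel h) (hv : IsPotential hP v₀) :
    ∃ L : Matrix (Fin d) (Fin d) ℂ,
      (∀ k : Fin d → ℝ, k ≠ 0 → 0 < (bilin L fun i => (k i : ℂ)).re) ∧
      ∀ {F : Lattice d → ℝ × RCPath Ω → ℝ} {M : ℝ} {ψ₀ : EllTwo d} {ν C : ℝ},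
        IsModel hσ hP v₀ F h ψ₀ ν M C →
        ∃ C₁ κ₁, IsDiffusive (charFn μ σ P h v₀ ψ₀) L ((‖ψ₀‖ ^ 2 : ℝ) : ℂ) C₁ κ₁ := by
  obtain ⟨T, hS⟩ := exists_isGapped hP hB
  obtain ⟨c, hyp⟩ := exists_isHypocoercive hS hσ hv hh
  obtain ⟨L, hL, C₀, κ₀, hC₀, hκ₀, hest⟩ := exists_effective_matrix hh hyp
  refine ⟨L, hL, fun {F M ψ₀ ν C} hm => ?_⟩
  have hν := hm.bounded.nu_pos
  set B := ampBound h ν M C 0 ^ 2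
    * ∑' p : Lattice d × Lattice d, weight ν p.1 * weight (ν / 2) p.2 with hBdef
  set C' := C ^ 2 * (2 / ν) * (∑' x : Lattice d, weight ν x) with hC'
  have hB0 : 0 ≤ B := mul_nonneg (sq_nonneg _)
    (tsum_nonneg fun p => mul_nonneg (weight_pos _ _).le (weight_pos _ _).le)
  have hC'0 : 0 ≤ C' := mul_nonneg (by positivity) (tsum_nonneg fun x => (weight_pos _ _).le)
  refine ⟨C₀ * (1 + B) + C', min κ₀ (ν / 2), by positivity, by positivity, fun k hk t => ?_,
    fun k hk => ?_⟩
  · have hk1 := hk.trans (min_le_left _ _)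
    have hk2 := hk.trans (min_le_right _ _)
    have h1 := hest k (hm.field k) hk1 (hm.continuous_field hS hk2)
      (fun s hs => hm.tendsto_field hh hk2 hs) t t.coe_nonneg
    have h0 := hm.charFn_eq hk2 0
    rw [NNReal.coe_zero] at h0
    rw [hm.charFn_eq hk2 t, h0]
    refine h1.trans ?_
    have h2 := hm.norm_field_le hk2 le_rfl
    rw [← hBdef] at h2
    have hcoef : C₀ ≤ C₀ * (1 + B) + C' := by nlinarith [mul_nonneg hC₀ hB0]
    calc _ ≤ C₀ * Real.exp ((C₀ * (1 + B) + C') * ((d + 1) * ‖k‖) ^ 2 * t)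
          * ((d + 1) * ‖k‖ + ((d + 1) * ‖k‖) ^ 3 * t) * B := by gcongr
      _ = (C₀ * B) * Real.exp ((C₀ * (1 + B) + C') * ((d + 1) * ‖k‖) ^ 2 * t)
          * ((d + 1) * ‖k‖ + ((d + 1) * ‖k‖) ^ 3 * t) := by ring
      _ ≤ _ := by
          have : C₀ * B ≤ C₀ * (1 + B) + C' := by nlinarith
          gcongr
  · refine (hm.norm_charFn_zero_sub_le (hk.trans (min_le_right _ _))).trans ?_
    rw [← hC']
    have : C' ≤ C₀ * (1 + B) + C' := by nlinarith [mul_nonneg hC₀ hB0]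
    gcongr

end Main

end MarkovAnderson

end

theorem mainTheorem1 {d : ℕ} {Ω : Type*} [TopologicalSpace Ω] [MeasurableSpace Ω] [BorelSpace Ω]
    (μ : Measure Ω) [IsProbabilityMeasure μ]
    (σ : MarkovAnderson.Lattice d → Ω → Ω) (hσ : MarkovAnderson.IsShiftAction μ σ)
    (P : Kernel Ω (MarkovAnderson.RCPath Ω)) [IsMarkovKernel P]
    (hP : MarkovAnderson.IsMarkovFamily μ σ P)
    (hB : MarkovAnderson.GapAndSector hP)
    (h : MarkovAnderson.Lattice d → ℂ) (hh : MarkovAnderson.IsHoppingKernel h)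
    (v₀ : Ω → ℝ) (hv : MarkovAnderson.IsPotential hP v₀) :
    ∃ D : Matrix (Fin d) (Fin d) ℝ, D.PosDef ∧
      ∀ ψ₀ : MarkovAnderson.EllTwo d, MarkovAnderson.ExpDecay ψ₀ →
        -- the objects in the claim are well defined
        (∀ᵐ ω ∂(MarkovAnderson.jointLaw μ P), ∃! ψ : ℝ≥0 → MarkovAnderson.EllTwo d,
          MarkovAnderson.IsSolution h (MarkovAnderson.pathPotential σ v₀ ω) ψ₀ ψ) ∧
        (∀ (t : ℝ≥0) (x : MarkovAnderson.Lattice d),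
          Integrable (fun ω => ‖MarkovAnderson.solution h
            (MarkovAnderson.pathPotential σ v₀ ω) ψ₀ t x‖ ^ 2) (MarkovAnderson.jointLaw μ P)) ∧
        -- the diffusive limit
        ∀ t : ℝ≥0, 0 < t → ∀ C : Set (Fin d → ℂ), IsCompact C →
          (∀ᶠ τ : ℝ≥0 in atTop, ∀ z ∈ C, Summable (MarkovAnderson.cfTerm μ σ P h v₀ ψ₀ (τ * t)
            (((Real.sqrt τ : ℝ) : ℂ)⁻¹ • z))) ∧
          TendstoUniformlyOn
            (fun (τ : ℝ≥0) (z : Fin d → ℂ) => MarkovAnderson.charFn μ σ P h v₀ ψ₀ (τ * t)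
              (((Real.sqrt τ : ℝ) : ℂ)⁻¹ • z))
            (fun z => ((‖ψ₀‖ ^ 2 : ℝ) : ℂ) *
              Complex.exp (-((t : ℝ) : ℂ) / 2 * ∑ i, ∑ j, z i * (D i j : ℂ) * z j))
            atTop C := by
  open MarkovAnderson in
  obtain ⟨L, hpos, hdiff⟩ := exists_isDiffusive (hσ := hσ) hB hh hv
  obtain ⟨F, M, hF⟩ := exists_isVersion hσ hP hv
  -- As `L` is the same for all initial states, its reality can be read off from a single one: the
  -- unit vector at the origin, for which the limit is the bare exponential.
  have him : ∀ k : Fin d → ℝ, (bilin L fun i => (k i : ℂ)).im = 0 := by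
    obtain ⟨ν, C, hb⟩ := exists_isExpBounded hh hF.bound (expDecay_single (d := d))
    obtain ⟨C₁, κ₁, hχ⟩ := hdiff (IsModel.mk (hσ := hσ) hv hF hb)
    rw [lp.norm_single (by norm_num), norm_one, one_pow, Complex.ofReal_one] at hχ
    exact hχ.im_bilin_eq_zero fun t z => charFn_neg_conj _ t z
  refine ⟨diffusionMatrix L, posDef_diffusionMatrix him hpos, fun ψ₀ hψ₀ => ?_⟩
  obtain ⟨ν, C, hb⟩ := exists_isExpBounded hh hF.bound hψ₀
  have hm : IsModel hσ hP v₀ F h ψ₀ ν M C := ⟨hv, hF, hb⟩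
  obtain ⟨C₁, κ₁, hχ⟩ := hdiff hm
  refine ⟨hm.ae_existsUnique, hm.integrable_norm_solution_sq, fun t _ K hK => ⟨?_, ?_⟩⟩
  · filter_upwards [eventually_small hK (half_pos hb.nu_pos)] with τ hτ z hz
    exact (hm.hasSum_cfTerm (hτ z hz) _).summable
  · have h1 := hχ.tendstoUniformlyOn t hK
    refine h1.congr_right fun z _ => ?_
    have e : -((t : ℝ) : ℂ) / 2 * (2 * bilin L z) = -((t : ℝ) : ℂ) * bilin L z := by ring
    rw [sum_diffusionMatrix him, e]
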